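/- **Setting.** Let $U\subseteq\mathbb R^{10}$ be open and let superfields be elements of $C^\infty(U,\mathbb C)\otimes\Lambda$, where $\Lambda$ is the Grassmann algebra on $\theta^\mu,\hat\theta^{\hat\mu}$ ($\mu,\hat\mu=1,\dots,16$) and $N\ge 0$ auxiliary odd parameters. Matter coordinates are $Z^M=(x^m,\theta^\mu,\hat\theta^{\hat\mu})$, flat labels are $A=(a,\alpha,\hat\alpha)$, and in exponents of signs a label stands for its parity (vector labels $0$, matter spinor labels $1$). The target space has coordinates $\mathbb Z^i=(Z^M,\lambda^\alpha,\hat\lambda^{\hat\alpha})$ with bosonic ghosts $\lambda,\hat\lambda\in\mathbb C^{16}$; target functions are polynomial in the ghosts, ghost directions have parity $0$, all derivatives are left derivatives. Fix two choices $\gamma,\hat\gamma$ of ten-dimensional chiral gamma matrices, i.e. symmetric $\gamma^a_{\alpha\beta}$, $\gamma^{a\,\alpha\beta}$ with $\gamma^a_{\alpha\beta}\gamma^{b\,\beta\delta}+\gamma^b_{\alpha\beta}\gamma^{a\,\beta\delta}=2\eta^{ab}\delta_\alpha^\delta$, and the same with the two kinds exchanged, $\eta=\mathrm{diag}(-1,1,\dots,1)$.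 A spinor $\lambda$ is pure if $\lambda\gamma^a\lambda=0$ for all $a$ (for $\hat\lambda$: $\hat\lambda\hat\gamma^a\hat\lambda=0$). The background consists of superfields $E_A{}^M$ (parity $A+M$) with two-sided inverse $E_M{}^A$, $B_{MN}=-(-)^{MN}B_{NM}$ (parity $M+N$), connections $\Omega_{M\alpha}{}^\beta,\hat\Omega_{M\hat\alpha}{}^{\hat\beta}$ (parity $M$), even $P^{\alpha\hat\alpha},S_{\alpha\hat\alpha}^{\beta\hat\beta}$ and odd $C_\alpha^{\beta\hat\beta},\hat C_{\hat\alpha}^{\hat\beta\beta}$, otherwise arbitrary. Write $(\lambda\Omega_M)^\beta=\lambda^\alpha\Omega_{M\alpha}{}^\beta$, $(\lambda C)^{\beta\hat\beta}=\lambda^\alpha C_\alpha^{\beta\hat\beta}$, $(\lambda\hat\lambda S)^{\beta\hat\beta}=\lambda^\alpha\hat\lambda^{\hat\alpha}S_{\alpha\hat\alpha}^{\beta\hat\beta}$, and similarly for hatted objects; $X_{(MN)}=X_{MN}+(-)^{MN}X_{NM}$. *Generalized metric.* Let $G_{MN}=E_M{}^aE_N{}^b\eta_{ab}$ and $A^{MN}=(-)^ME_a{}^ME_b{}^N\eta^{ab}+E_\alpha{}^ME_{\hat\alpha}{}^NP^{\alpha\hat\alpha}-E_{\hat\alpha}{}^ME_\alpha{}^NP^{\alpha\hat\alpha}$.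 The pure spinor generalized metric $\mathbb A$ has blocks - $\mathbb A^{MN}=A^{MN}$, $\mathbb A^{M\beta}=-A^{MN}(\lambda\Omega_N)^\beta-(-)^M(\lambda C)^{\beta\hat\beta}E_{\hat\beta}{}^M$, $\mathbb A^{M\hat\beta}=-A^{MN}(\hat\lambda\hat\Omega_N)^{\hat\beta}-(-)^M(\hat\lambda\hat C)^{\hat\beta\beta}E_\beta{}^M$, - $\mathbb A^{\alpha\beta}=(\lambda\Omega_M)^\alpha A^{MN}(\lambda\Omega_N)^\beta+(\lambda C)^{\alpha\hat\alpha}E_{\hat\alpha}{}^M(\lambda\Omega_M)^\beta+(\lambda C)^{\beta\hat\beta}E_{\hat\beta}{}^M(\lambda\Omega_M)^\alpha$, - $\mathbb A^{\alpha\hat\beta}=(\lambda\Omega_M)^\alpha A^{MN}(\hat\lambda\hat\Omega_N)^{\hat\beta}+(\lambda C)^{\alpha\hat\alpha}E_{\hat\alpha}{}^M(\hat\lambda\hat\Omega_M)^{\hat\beta}+(\hat\lambda\hat C)^{\hat\beta\beta}E_\beta{}^M(\lambda\Omega_M)^\alpha-(\lambda\hat\lambda S)^{\alpha\hat\beta}$,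 - $\mathbb A^{\hat\alpha\hat\beta}=(\hat\lambda\hat\Omega_M)^{\hat\alpha}A^{MN}(\hat\lambda\hat\Omega_N)^{\hat\beta}+(\hat\lambda\hat C)^{\hat\alpha\alpha}E_\alpha{}^M(\hat\lambda\hat\Omega_M)^{\hat\beta}+(\hat\lambda\hat C)^{\hat\beta\beta}E_\beta{}^M(\hat\lambda\hat\Omega_M)^{\hat\alpha}$, and $\mathbb A^{ij}=(-)^{ij+i+j}\mathbb A^{ji}$, - $\mathbb A_{MN}=G_{MN}-B_{ML}A^{LP}B_{PN}-E_{(M|}{}^{\hat\alpha}E_{\hat\alpha}{}^PB_{P|N)}+E_{(M|}{}^\alpha E_\alpha{}^PB_{P|N)}$, all other $\mathbb A_{ij}=0$, - $\mathbb A_M{}^N=-B_{MP}A^{PN}-E_M{}^{\hat\alpha}E_{\hat\alpha}{}^N+E_M{}^\alpha E_\alpha{}^N$, $\mathbb A_M{}^\beta=(\delta_M{}^N-\mathbb A_M{}^N)(\lambda\Omega_N)^\beta-(\lambda C)^{\beta\hat\beta}E_{\hat\beta}{}^NB_{NM}$, $\mathbb A_M{}^{\hat\beta}=-(\delta_M{}^N+\mathbb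 A_M{}^N)(\hat\lambda\hat\Omega_N)^{\hat\beta}-(\hat\lambda\hat C)^{\hat\beta\beta}E_\beta{}^NB_{NM}$, $\mathbb A_\alpha{}^\beta=\delta_\alpha{}^\beta$, $\mathbb A_{\hat\alpha}{}^{\hat\beta}=-\delta_{\hat\alpha}{}^{\hat\beta}$, other $\mathbb A_i{}^j=0$; $\mathbb A^i{}_j=(-)^{i+ij}\mathbb A_j{}^i$. *BRST sections.* The odd sections $(\mathbb Q,\mathbb F)$, $(\tilde{\mathbb Q},\tilde{\mathbb F})$ of $TM\oplus T^*M$ have $\mathbb Q=(Q^M,-Q^M(\lambda\Omega_M)^\alpha,-Q^M(\hat\lambda\hat\Omega_M)^{\hat\alpha})$ with $Q^M=\lambda^\alpha E_\alpha{}^M$, $\mathbb F_M=Q^NB_{NM}$, $\mathbb F_\alpha=\mathbb F_{\hat\alpha}=0$, and the same formulas for the tilded one with $\tilde Q^M=\hat\lambda^{\hat\alpha}E_{\hat\alpha}{}^M$. Let $H=dB$, $H_{MNP}=\partial_MB_{NP}-(-)^{MN}\partial_NB_{MP}+(-)^{P(M+N)}\partial_PB_{MN}$, and let $\mathbb H$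 be its extension by zero to the target. *Conventions.* For vector fields and forms on the target, with parities written as exponents: $[V,W]^i=V^j\partial_jW^i-(-)^{VW}W^j\partial_jV^i$, $(dF)_{ij}=(-)^{iF}\partial_iF_j-(-)^{ij+jF}\partial_jF_i$, $(\iota_VW)_{j\dots}=(-)^{Wi}V^iW_{ij\dots}$, $\mathcal L_V=\iota_Vd+d\iota_V$ on forms, and on $\mathbb A$ $(\mathcal L_V\mathbb A)_{ij}=V^k\partial_k\mathbb A_{ij}+(-)^{Vi}\partial_iV^k\mathbb A_{kj}+(-)^{ij+Vj}\partial_jV^k\mathbb A_{ki}$, $(\mathcal L_V\mathbb A)_i{}^j=V^k\partial_k\mathbb A_i{}^j-(-)^{Vi}\mathbb A_i{}^k\partial_kV^j+(-)^{Vi}\partial_iV^k\mathbb A_k{}^j$, $(\mathcal L_V\mathbb A)^{ij}=V^k\partial_k\mathbb A^{ij}-(-)^{Vi}\mathbb A^{ik}\partial_kV^j-(-)^{i+j+ij+Vj}\mathbb A^{jk}\partial_kV^i$. With connection $\Omega_{MA}{}^B$ block diagonal with blocks $0,\Omega_{M\alpha}{}^\beta,\hat\Omega_{M\hat\alpha}{}^{\hat\beta}$,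 $T_{AB}{}^C=(E_A{}^M\partial_ME_B{}^NE_N{}^C-E_A{}^M\Omega_{MB}{}^C)-(-)^{AB}(A\leftrightarrow B)$, $T_{ABc}=T_{AB}{}^d\eta_{dc}$, $R_{AB\alpha}{}^\beta=(-)^{NB}E_A{}^NE_B{}^M[(\partial_M\Omega_{N\alpha}{}^\beta-\Omega_{M\alpha}{}^\gamma\Omega_{N\gamma}{}^\beta)-(-)^{MN}(M\leftrightarrow N)]$, $\hat R$ likewise from $\hat\Omega$, $H_{ABC}=(-)^{MB+MC+NC}E_A{}^ME_B{}^NE_C{}^PH_{PNM}$. $\nabla_A=E_A{}^M\nabla_M$ acts on upper spinor indices by $\nabla_MX^\beta=\partial_MX^\beta+\Omega_{M\rho}{}^\beta X^\rho$ and on lower ones by $\nabla_MX_\alpha=\partial_MX_\alpha-\Omega_{M\alpha}{}^\rho X_\rho$, and with $\hat\Omega$ on hatted indices. *Conditions.* All conditions on target functions are imposed at all pure $\lambda,\hat\lambda$. The currents of odd sections $s,t$ *commute* if the coefficients of their Poisson bracket vanish: the Dorfman bracket $[\![(V_1,F_1),(V_2,F_2)]\!]=([V_1,V_2],\mathcal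 L_{V_1}F_2+\iota_{V_2}dF_1)$ and the pairing $\iota_{V_1}F_2-\iota_{V_2}F_1$ are zero. The current of an odd section $(V,F)$ is *conserved* if $(\mathcal L_V\mathbb A)_{ij}=-[(dF)_{ik}\mathbb A^k{}_j+(-)^{ij}(dF)_{jk}\mathbb A^k{}_i]$, $(\mathcal L_V\mathbb A)_i{}^j=-(dF)_{ik}\mathbb A^{kj}$, $(\mathcal L_V\mathbb A)^{ij}=0$; for $(\mathbb Q,\mathbb F)$ this is the holomorphicity condition, for $(\tilde{\mathbb Q},\tilde{\mathbb F})$ the antiholomorphicity condition. *Constraints* (equations with free indices hold for all values of these; equations with $\lambda$ or $\hat\lambda$ hold for all pure spinors): **(N1)** $\lambda^\alpha\lambda^\beta T_{\alpha\beta}{}^C=\lambda^\alpha\lambda^\beta\lambda^\gamma R_{\alpha\beta\gamma}{}^\sigma=\lambda^\alpha\lambda^\beta\hat R_{\alpha\beta\hat\gamma}{}^{\hat\sigma}=0$, $\lambda^\alpha\lambda^\beta H_{\alpha\beta C}=0$. **(N2)** $\hat\lambda^{\hat\alpha}\hat\lambda^{\hat\beta}T_{\hat\alpha\hat\beta}{}^C=\hat\lambda^{\hat\alpha}\hat\lambda^{\hat\beta}R_{\hat\alpha\hat\beta\gamma}{}^\sigma=\hat\lambda^{\hat\alpha}\hat\lambda^{\hat\beta}\hat\lambda^{\hat\gamma}\hat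 R_{\hat\alpha\hat\beta\hat\gamma}{}^{\hat\sigma}=0$, $\hat\lambda^{\hat\alpha}\hat\lambda^{\hat\beta}H_{\hat\alpha\hat\beta C}=0$. **(N3)** $T_{\alpha\hat\beta}{}^C=\lambda^\alpha\lambda^\gamma R_{\alpha\hat\beta\gamma}{}^\sigma=\hat\lambda^{\hat\alpha}\hat\lambda^{\hat\gamma}\hat R_{\hat\alpha\beta\hat\gamma}{}^{\hat\sigma}=0$, $H_{\alpha\hat\beta C}=0$. **(H1)** - $T_{\alpha bc}+T_{\alpha cb}=H_{\alpha bc}=H_{\alpha\hat\beta\gamma}=T_{\alpha\beta c}+H_{\alpha\beta c}=T_{\alpha\hat\beta c}-H_{\alpha\hat\beta c}=0$; - $T_{\alpha b}{}^\gamma-T_{\alpha\hat\gamma b}P^{\gamma\hat\gamma}=T_{\alpha b}{}^{\hat\gamma}+T_{\alpha\gamma b}P^{\gamma\hat\gamma}=T_{\alpha\beta}{}^{\hat\gamma}+\tfrac12H_{\alpha\beta\gamma}P^{\gamma\hat\gamma}=T_{\alpha\hat\beta}{}^\gamma=0$; - $\nabla_\alpha P^{\beta\hat\beta}+T_{\alpha\rho}{}^\beta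 P^{\rho\hat\beta}-C_\alpha^{\beta\hat\beta}=\hat R_{a\beta\hat\gamma}{}^{\hat\sigma}-T_{\beta\rho a}\hat C_{\hat\gamma}^{\hat\sigma\rho}=\hat R_{\alpha\beta\hat\gamma}{}^{\hat\sigma}+\tfrac12H_{\alpha\beta\rho}\hat C_{\hat\gamma}^{\hat\sigma\rho}=0$; - $-S_{\alpha\hat\alpha}^{\beta\hat\beta}+\hat R_{\alpha\hat\gamma\hat\alpha}{}^{\hat\beta}P^{\beta\hat\gamma}+\nabla_\alpha\hat C_{\hat\alpha}^{\hat\beta\beta}+T_{\alpha\gamma}{}^\beta\hat C_{\hat\alpha}^{\hat\beta\gamma}=0$; - $\lambda^\alpha\lambda^\beta(R_{a\alpha\beta}{}^\gamma-T_{\alpha\hat\rho a}C_\beta^{\gamma\hat\rho})=\lambda^\alpha\lambda^\beta R_{\hat\beta\alpha\beta}{}^\gamma=0$; - $\lambda^\alpha\lambda^\beta(\nabla_\alpha C_\beta^{\gamma\hat\gamma}-R_{\alpha\sigma\beta}{}^\gamma P^{\sigma\hat\gamma})=\lambda^\alpha\lambda^\beta(\nabla_\alpha S_{\beta\hat\beta}^{\gamma\hat\gamma}-\hat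 R_{\alpha\hat\rho\hat\beta}{}^{\hat\gamma}C_\beta^{\gamma\hat\rho}-R_{\alpha\rho\beta}{}^\gamma\hat C_{\hat\beta}^{\hat\gamma\rho})=0$. **(H2)** - $T_{\hat\alpha bc}+T_{\hat\alpha cb}=H_{\hat\alpha bc}=H_{\hat\alpha\beta\hat\gamma}=T_{\hat\alpha\hat\beta c}-H_{\hat\alpha\hat\beta c}=T_{\hat\alpha\beta c}+H_{\hat\alpha\beta c}=0$; - $T_{\hat\alpha b}{}^{\hat\gamma}+T_{\hat\alpha\gamma b}P^{\gamma\hat\gamma}=T_{\hat\alpha b}{}^\gamma-T_{\hat\alpha\hat\gamma b}P^{\gamma\hat\gamma}=T_{\hat\alpha\hat\beta}{}^\gamma+\tfrac12H_{\hat\alpha\hat\beta\hat\gamma}P^{\gamma\hat\gamma}=T_{\hat\alpha\beta}{}^{\hat\gamma}=0$; - $\nabla_{\hat\alpha}P^{\beta\hat\beta}+T_{\hat\alpha\hat\rho}{}^{\hat\beta}P^{\beta\hat\rho}+\hat C_{\hat\alpha}^{\hat\beta\beta}=R_{a\hat\beta\gamma}{}^\sigma-T_{\hat\beta\hat\rho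 a}C_\gamma^{\sigma\hat\rho}=R_{\hat\alpha\hat\beta\gamma}{}^\sigma-\tfrac12H_{\hat\alpha\hat\beta\hat\rho}C_\gamma^{\sigma\hat\rho}=0$; - $-S_{\alpha\hat\alpha}^{\beta\hat\beta}-R_{\hat\alpha\gamma\alpha}{}^\beta P^{\gamma\hat\beta}+\nabla_{\hat\alpha}C_\alpha^{\beta\hat\beta}+T_{\hat\alpha\hat\gamma}{}^{\hat\beta}C_\alpha^{\beta\hat\gamma}=0$; - $\hat\lambda^{\hat\alpha}\hat\lambda^{\hat\beta}(\hat R_{a\hat\alpha\hat\beta}{}^{\hat\gamma}-T_{\hat\alpha\rho a}\hat C_{\hat\beta}^{\hat\gamma\rho})=\hat\lambda^{\hat\alpha}\hat\lambda^{\hat\beta}\hat R_{\beta\hat\alpha\hat\beta}{}^{\hat\gamma}=0$; - $\hat\lambda^{\hat\alpha}\hat\lambda^{\hat\beta}(\nabla_{\hat\alpha}\hat C_{\hat\beta}^{\hat\gamma\gamma}+\hat R_{\hat\alpha\hat\sigma\hat\beta}{}^{\hat\gamma}P^{\gamma\hat\sigma})=\hat\lambda^{\hat\alpha}\hat\lambda^{\hat\beta}(\nabla_{\hat\alpha}S_{\beta\hat\beta}^{\gamma\hat\gamma}-R_{\hat\alpha\rho\beta}{}^\gamma\hat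 C_{\hat\beta}^{\hat\gamma\rho}-\hat R_{\hat\alpha\hat\rho\hat\beta}{}^{\hat\gamma}C_\beta^{\gamma\hat\rho})=0$. **Theorem (Type II supergravity constraints).** 1. The current of $(\mathbb Q,\mathbb F)$ commutes with itself if and only if $[\mathbb Q,\mathbb Q]=0$ and $\iota_{\mathbb Q}\iota_{\mathbb Q}\mathbb H=0$, and this holds if and only if (N1). The current of $(\tilde{\mathbb Q},\tilde{\mathbb F})$ commutes with itself if and only if $[\tilde{\mathbb Q},\tilde{\mathbb Q}]=0$ and $\iota_{\tilde{\mathbb Q}}\iota_{\tilde{\mathbb Q}}\mathbb H=0$, and this holds if and only if (N2). The two currents commute with each other if and only if $[\mathbb Q,\tilde{\mathbb Q}]=0$ and $\iota_{\mathbb Q}\iota_{\tilde{\mathbb Q}}\mathbb H=0$, and this holds if and only if (N3). 2. The holomorphicity condition for $(\mathbb Q,\mathbb F)$ and the antiholomorphicity condition for $(\tilde{\mathbb Q},\tilde{\mathbb F})$ both hold if and only if (H1) and (H2) both hold. Moreover, if (N3) holds, then the holomorphicity condition alone is equivalent to (H1), and the antiholomorphicity condition alone is equivalent to (H2). -/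

import Mathlib

open scoped TensorProduct ContDiff

noncomputable section

namespace PureSpinor

/-! ### Superfunctions on the matter superdomain and on the target space -/

/-- The coordinate space of the body: ten bosonic coordinates `x^m`. -/
abbrev Body : Type := EuclideanSpace ℝ (Fin 10)

/-- Extension by zero of a function on the open set `U`. -/
def extendZero (U : TopologicalSpace.Opens Body) (f : U → ℂ) : Body → ℂ :=
  open Classical in fun y => if h : y ∈ U then f ⟨y, h⟩ else 0

lemma extendZero_coe (U : TopologicalSpace.Opens Body) (f : U → ℂ) (x : U) :
    extendZero U f x = f x := by
  simp [extendZero]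

lemma extendZero_eventuallyEq (U : TopologicalSpace.Opens Body) (f : U → ℂ) (g : Body → ℂ)
    (h : ∀ y : U, f y = g y) (x : U) : extendZero U f =ᶠ[nhds (x : Body)] g := by
  filter_upwards [U.isOpen.mem_nhds x.2] with y hy
  rw [show y = ((⟨y, hy⟩ : U) : Body) from rfl, extendZero_coe, h]

/-- The algebra `C^∞(U, ℂ)` of smooth complex-valued functions on the open set `U ⊆ ℝ^10`. -/
def Smooth (U : TopologicalSpace.Opens Body) : Subalgebra ℂ (U → ℂ) where
  carrier := {f | ∀ x : U, ContDiffAt ℝ ∞ (extendZero U f) (x : Body)}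
  mul_mem' {f g} hf hg x := ((hf x).mul (hg x)).congr_of_eventuallyEq
    (extendZero_eventuallyEq U _ _ (fun y => by simp [extendZero_coe]) x)
  add_mem' {f g} hf hg x := ((hf x).add (hg x)).congr_of_eventuallyEq
    (extendZero_eventuallyEq U _ _ (fun y => by simp [extendZero_coe]) x)
  algebraMap_mem' c x := (contDiffAt_const (c := c)).congr_of_eventuallyEq
    (extendZero_eventuallyEq U _ _ (fun y => by simp) x)

/-- The partial derivative `∂/∂x^m` on `C^∞(U, ℂ)`. -/
def Smooth.partialDeriv (U : TopologicalSpace.Opens Body) (m : Fin 10) :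
    Smooth U →ₗ[ℂ] Smooth U where
  toFun f := ⟨fun x => fderiv ℝ (extendZero U f) (x : Body) (EuclideanSpace.single m 1), by
    intro x
    refine ContDiffAt.congr_of_eventuallyEq ?_ (extendZero_eventuallyEq U _
      (fun y => fderiv ℝ (extendZero U f) y (EuclideanSpace.single m 1)) (fun y => rfl) x)
    exact ((f.2 x).fderiv_right (m := ∞) (by simp)).clm_apply contDiffAt_const⟩
  map_add' f g := by
    ext x
    have hf : DifferentiableAt ℝ (extendZero U f) (x : Body) := (f.2 x).differentiableAt (by simp)
    have hg : DifferentiableAt ℝ (extendZero U g) (x : Body) := (g.2 x).differentiableAt (by simp)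
    have h := (extendZero_eventuallyEq U (f + g : Smooth U)
      (extendZero U f + extendZero U g) (fun y => by simp [extendZero_coe]) x).fderiv_eq (𝕜 := ℝ)
    simp only [AddMemClass.coe_add] at h
    simp [h, fderiv_add hf hg]
  map_smul' c f := by
    ext x
    have hf : DifferentiableAt ℝ (extendZero U f) (x : Body) := (f.2 x).differentiableAt (by simp)
    have h := (extendZero_eventuallyEq U (c • f : Smooth U)
      (c • extendZero U f) (fun y => by simp [extendZero_coe]) x).fderiv_eq (𝕜 := ℝ)
    simp only [SetLike.val_smul] at h
    simp [h, fderiv_const_smul hf c]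

/-- Labels of the odd generators: the coordinates `θ^μ`, the coordinates `θ̂^μ̂`, and `N`
auxiliary anticommuting parameters (so that superfields may have odd component fields). -/
abbrev OddLabel (N : ℕ) : Type := Fin 16 ⊕ Fin 16 ⊕ Fin N

/-- The Grassmann algebra on the odd generators. -/
abbrev Grassmann (N : ℕ) : Type := ExteriorAlgebra ℂ (OddLabel N → ℂ)

/-- Superfields: superfunctions `Λ[θ, θ̂, ζ_1, …, ζ_N] ⊗ C^∞(U)` of the matter coordinates
`Z^M = (x^m, θ^μ, θ̂^μ̂)`. -/
abbrev Matter (U : TopologicalSpace.Opens Body) (N : ℕ) : Type := Grassmann N ⊗[ℂ] Smooth U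

/-- Polynomials in the bosonic ghosts `λ^α` and `λ̂^α̂`. -/
abbrev Ghost : Type := MvPolynomial (Fin 16 ⊕ Fin 16) ℂ

/-- Superfunctions on the target space with coordinates `ℤ^i = (Z^M, λ^α, λ̂^α̂)`, polynomial
in the ghosts. -/
abbrev Target (U : TopologicalSpace.Opens Body) (N : ℕ) : Type := Matter U N ⊗[ℂ] Ghost

instance (U : TopologicalSpace.Opens Body) (N : ℕ) : Ring (Matter U N) := inferInstance
instance (U : TopologicalSpace.Opens Body) (N : ℕ) : Semiring (Matter U N) := inferInstance
instance (U : TopologicalSpace.Opens Body) (N : ℕ) : Algebra ℂ (Matter U N) := inferInstance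
instance (U : TopologicalSpace.Opens Body) (N : ℕ) : AddCommMonoid (Matter U N) := inferInstance
instance (U : TopologicalSpace.Opens Body) (N : ℕ) : AddCommGroup (Matter U N) := inferInstance
instance (U : TopologicalSpace.Opens Body) (N : ℕ) : Module ℂ (Matter U N) := inferInstance
instance (U : TopologicalSpace.Opens Body) (N : ℕ) : Mul (Matter U N) := inferInstance
instance (U : TopologicalSpace.Opens Body) (N : ℕ) : Ring (Target U N) := inferInstance
instance (U : TopologicalSpace.Opens Body) (N : ℕ) : Semiring (Target U N) := inferInstance
instance (U : TopologicalSpace.Opens Body) (N : ℕ) : Algebra ℂ (Target U N) := inferInstance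
instance (U : TopologicalSpace.Opens Body) (N : ℕ) : AddCommMonoid (Target U N) := inferInstance
instance (U : TopologicalSpace.Opens Body) (N : ℕ) : AddCommGroup (Target U N) := inferInstance
instance (U : TopologicalSpace.Opens Body) (N : ℕ) : Module ℂ (Target U N) := inferInstance
instance (U : TopologicalSpace.Opens Body) (N : ℕ) : Mul (Target U N) := inferInstance

/-- Index set of the matter directions, used both for curved labels
`M = (m, μ, μ̂)` and for flat labels `A = (a, α, α̂)`. -/
abbrev Idx : Type := Fin 10 ⊕ Fin 16 ⊕ Fin 16

/-- Index set of all target space directions `i = (M, α, α̂)`. -/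
abbrev Coord : Type := Idx ⊕ Fin 16 ⊕ Fin 16

/-- the vector label `a` -/
abbrev vec (a : Fin 10) : Idx := Sum.inl a

/-- the spinor label `α` -/
abbrev spi (α : Fin 16) : Idx := Sum.inr (Sum.inl α)

/-- the spinor label `α̂` -/
abbrev hat (α : Fin 16) : Idx := Sum.inr (Sum.inr α)

/-- the matter coordinate directions -/
abbrev mat (M : Idx) : Coord := Sum.inl M

/-- the direction of the ghost `λ^α` -/
abbrev gh (α : Fin 16) : Coord := Sum.inr (Sum.inl α)

/-- the direction of the ghost `λ̂^α̂` -/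
abbrev ghh (α : Fin 16) : Coord := Sum.inr (Sum.inr α)

/-- Parity of a matter label: `0` for vectors, `1` for spinors. -/
def par : Idx → ℕ
  | Sum.inl _ => 0
  | Sum.inr _ => 1

/-- Parity of a target space label; the ghosts are bosonic. -/
def cpar : Coord → ℕ
  | Sum.inl M => par M
  | Sum.inr _ => 0

/-- The sign `(-1)^k`. -/
abbrev sg (k : ℕ) : ℂ := (-1) ^ k

section

variable {U : TopologicalSpace.Opens Body} {N : ℕ}

/-- The superfields of parity `k` (mod 2). -/
def Matter.parity (U : TopologicalSpace.Opens Body) (N : ℕ) (k : ℕ) :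
    Submodule ℂ (Matter U N) :=
  LinearMap.range (LinearMap.rTensor (Smooth U)
    (CliffordAlgebra.evenOdd (0 : QuadraticForm ℂ (OddLabel N → ℂ)) (k : ZMod 2)).subtype)

/-- The left derivative with respect to an odd generator, on the Grassmann algebra. -/
def Grassmann.deriv (N : ℕ) (i : OddLabel N) : Grassmann N →ₗ[ℂ] Grassmann N :=
  CliffordAlgebra.contractLeft (Q := (0 : QuadraticForm ℂ (OddLabel N → ℂ)))
    (LinearMap.proj i : (OddLabel N → ℂ) →ₗ[ℂ] ℂ)

/-- The (left) partial derivatives `∂_M` of superfields. -/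
def Matter.pd : Idx → Matter U N →ₗ[ℂ] Matter U N
  | Sum.inl m => LinearMap.lTensor (Grassmann N) (Smooth.partialDeriv U m)
  | Sum.inr (Sum.inl μ) => LinearMap.rTensor (Smooth U) (Grassmann.deriv N (Sum.inl μ))
  | Sum.inr (Sum.inr μ) => LinearMap.rTensor (Smooth U) (Grassmann.deriv N (Sum.inr (Sum.inl μ)))

/-- The (left) partial derivatives `∂_i` of superfunctions on the target space. -/
def Target.pd : Coord → Target U N →ₗ[ℂ] Target U N
  | Sum.inl M => LinearMap.rTensor Ghost (Matter.pd M)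
  | Sum.inr α => LinearMap.lTensor (Matter U N) (MvPolynomial.pderiv (R := ℂ) α).toLinearMap

/-- A superfield regarded as a superfunction on the target space. -/
def up : Matter U N →ₐ[ℂ] Target U N := Algebra.TensorProduct.includeLeft

/-- The ghost coordinate `λ^α`. -/
def lam (α : Fin 16) : Target U N := 1 ⊗ₜ MvPolynomial.X (Sum.inl α)

/-- The ghost coordinate `λ̂^α̂`. -/
def lamh (α : Fin 16) : Target U N := 1 ⊗ₜ MvPolynomial.X (Sum.inr α)

/-- Restriction of a superfunction to given values of the ghosts. -/
def ev (l lh : Fin 16 → ℂ) : Target U N →ₐ[ℂ] Matter U N :=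
  (Algebra.TensorProduct.rid ℂ ℂ (Matter U N)).toAlgHom.comp
    (Algebra.TensorProduct.map (AlgHom.id ℂ (Matter U N)) (MvPolynomial.aeval (Sum.elim l lh)))

end

/-! ### Gamma matrices and pure spinors -/

/-- The flat metric `η^{ab} = η_{ab} = diag(-1, 1, …, 1)`. -/
def eta (a b : Fin 10) : ℂ := if a = b then (if a = 0 then -1 else 1) else 0

/-- Ten-dimensional chiral gamma matrices: symmetric `16 × 16` matrices `γ^a_{αβ}` and
`γ^{a αβ}` with `γ^a_{αβ} γ^{b βγ} + γ^b_{αβ} γ^{a βγ} = 2 η^{ab} δ_α^γ` and the same relation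
with the two kinds of matrices exchanged. -/
structure GammaMatrices where
  lower : Fin 10 → Matrix (Fin 16) (Fin 16) ℂ
  upper : Fin 10 → Matrix (Fin 16) (Fin 16) ℂ
  lower_symm : ∀ a, (lower a).transpose = lower a
  upper_symm : ∀ a, (upper a).transpose = upper a
  lower_upper : ∀ a b, lower a * upper b + lower b * upper a = (2 * eta a b) • 1
  upper_lower : ∀ a b, upper a * lower b + upper b * lower a = (2 * eta a b) • 1

/-- The pure spinor constraint `λ^α γ^a_{αβ} λ^β = 0`. -/
def GammaMatrices.IsPure (γ : GammaMatrices) (l : Fin 16 → ℂ) : Prop :=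
  ∀ a, ∑ α, ∑ β, l α * γ.lower a α β * l β = 0

/-! ### Supergeometry of the target space

A vector field `V` is given by its components `V^i` (acting as `V^i ∂_i`), a `1`-form by
`F_i = F(∂_i)`, a `2`-form by `W_{ij} = W(∂_i, ∂_j)`. The parities of the objects are passed
as natural numbers. -/

section

variable {U : TopologicalSpace.Opens Body} {N : ℕ}

/-- The Lie bracket `[V, W]^i` of vector fields of parities `v`, `w`. -/
def lieBracket (v w : ℕ) (V W : Coord → Target U N) (i : Coord) : Target U N :=
  ∑ j, (V j * Target.pd j (W i) - sg (v * w) • (W j * Target.pd j (V i)))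

/-- The exterior derivative of a `1`-form of parity `f`:
`(dF)_{ij} = (-)^{iF} ∂_i F_j - (-)^{ij + jF} ∂_j F_i`. -/
def extDeriv1 (f : ℕ) (F : Coord → Target U N) (i j : Coord) : Target U N :=
  sg (cpar i * f) • Target.pd i (F j) - sg (cpar i * cpar j + cpar j * f) • Target.pd j (F i)

/-- The contraction `ι_V F` of a `1`-form of parity `f`. -/
def contract1 (f : ℕ) (V F : Coord → Target U N) : Target U N :=
  ∑ i, sg (f * cpar i) • (V i * F i)

/-- The contraction `(ι_V W)_j` of a `2`-form of parity `w`. -/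
def contract2 (w : ℕ) (V : Coord → Target U N) (W : Coord → Coord → Target U N) (j : Coord) :
    Target U N :=
  ∑ i, sg (w * cpar i) • (V i * W i j)

/-- The contraction `(ι_V H)_{jk}` of a `3`-form of parity `h`. -/
def contract3 (h : ℕ) (V : Coord → Target U N) (H : Coord → Coord → Coord → Target U N)
    (j k : Coord) : Target U N :=
  ∑ i, sg (h * cpar i) • (V i * H i j k)

/-- The Lie derivative `(ℒ_V F)_i` of a `1`-form of parity `f` along a vector field of
parity `v`. -/
def lieForm (v f : ℕ) (V F : Coord → Target U N) (i : Coord) : Target U N :=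
  ∑ j, (V j * Target.pd j (F i)
    + sg (v * cpar i + f * (cpar i + cpar j)) • (Target.pd i (V j) * F j))

/-- A section `(V, F)` of `TM ⊕ T^*M`. -/
structure GenSection (U : TopologicalSpace.Opens Body) (N : ℕ) where
  V : Coord → Target U N
  F : Coord → Target U N

/-- The Dorfman bracket of sections of parities `p`, `q`:
`([V₁, V₂], ℒ_{V₁} F₂ - (-)^{pq} ι_{V₂} dF₁)`. -/
def dorfman (p q : ℕ) (s t : GenSection U N) : GenSection U N where
  V := lieBracket p q s.V t.V
  F i := lieForm p q s.V t.F i - sg (q * p) • contract2 p t.V (extDeriv1 p s.F) i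

/-- The canonical inner product `ι_{V₁} F₂ + (-)^{pq} ι_{V₂} F₁`. -/
def pairing (p q : ℕ) (s t : GenSection U N) : Target U N :=
  contract1 q s.V t.F + sg (q * p) • contract1 p t.V s.F

/-- The blocks `𝔸_{ij}`, `𝔸_i^j`, `𝔸^i_j`, `𝔸^{ij}` of a bilinear form on `TM ⊕ T^*M`. -/
structure GenMetric (U : TopologicalSpace.Opens Body) (N : ℕ) where
  dd : Coord → Coord → Target U N
  du : Coord → Coord → Target U N
  ud : Coord → Coord → Target U N
  uu : Coord → Coord → Target U N

/-- `(ℒ_V 𝔸)_{ij}` for an even `𝔸` and `V` of parity `v`. -/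
def lieDD (v : ℕ) (V : Coord → Target U N) (A : GenMetric U N) (i j : Coord) : Target U N :=
  ∑ k, (V k * Target.pd k (A.dd i j)
    + sg (v * cpar i) • (Target.pd i (V k) * A.dd k j)
    + sg (cpar i * cpar j + v * cpar j) • (Target.pd j (V k) * A.dd k i))

/-- `(ℒ_V 𝔸)_i^j`. -/
def lieDU (v : ℕ) (V : Coord → Target U N) (A : GenMetric U N) (i j : Coord) : Target U N :=
  ∑ k, (V k * Target.pd k (A.du i j)
    - sg (v * cpar i) • (A.du i k * Target.pd k (V j))
    + sg (v * cpar i) • (Target.pd i (V k) * A.du k j))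

/-- `(ℒ_V 𝔸)^{ij}`. -/
def lieUU (v : ℕ) (V : Coord → Target U N) (A : GenMetric U N) (i j : Coord) : Target U N :=
  ∑ k, (V k * Target.pd k (A.uu i j)
    - sg (v * cpar i) • (A.uu i k * Target.pd k (V j))
    - sg (cpar i + cpar j + cpar i * cpar j + v * cpar j) • (A.uu j k * Target.pd k (V i)))

end

/-! ### Background fields -/

/-- The background fields of the pure spinor string: the vielbein `E_A^M` with inverse `E_M^A`,
the two-form `B_{MN}`, the spin connections `Ω_{Mα}^β` and `Ω̂_{Mα̂}^β̂`, and `P^{αα̂}`,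
`C_α^{ββ̂}`, `Ĉ_α̂^{β̂β}`, `S_{αα̂}^{ββ̂}`, superfields of the indicated parities. -/
structure Background (U : TopologicalSpace.Opens Body) (N : ℕ) where
  /-- `E A M` is `E_A^M`. -/
  E : Idx → Idx → Matter U N
  /-- `Einv M A` is `E_M^A`. -/
  Einv : Idx → Idx → Matter U N
  /-- `B M N` is `B_{MN}`. -/
  B : Idx → Idx → Matter U N
  /-- `Om M α β` is `Ω_{Mα}^β`. -/
  Om : Idx → Fin 16 → Fin 16 → Matter U N
  /-- `Omh M α̂ β̂` is `Ω̂_{Mα̂}^β̂`. -/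
  Omh : Idx → Fin 16 → Fin 16 → Matter U N
  /-- `P α α̂` is `P^{αα̂}`. -/
  P : Fin 16 → Fin 16 → Matter U N
  /-- `C α β β̂` is `C_α^{ββ̂}`. -/
  C : Fin 16 → Fin 16 → Fin 16 → Matter U N
  /-- `Ch α̂ β̂ β` is `Ĉ_α̂^{β̂β}`. -/
  Ch : Fin 16 → Fin 16 → Fin 16 → Matter U N
  /-- `S α α̂ β β̂` is `S_{αα̂}^{ββ̂}`. -/
  S : Fin 16 → Fin 16 → Fin 16 → Fin 16 → Matter U N
  E_parity : ∀ A M, E A M ∈ Matter.parity U N (par A + par M)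
  Einv_parity : ∀ M A, Einv M A ∈ Matter.parity U N (par M + par A)
  E_mul_Einv : ∀ A B, ∑ M, E A M * Einv M B = if A = B then 1 else 0
  Einv_mul_E : ∀ M M', ∑ A, Einv M A * E A M' = if M = M' then 1 else 0
  B_parity : ∀ M M', B M M' ∈ Matter.parity U N (par M + par M')
  B_antisymm : ∀ M M', B M M' = -(sg (par M * par M') • B M' M)
  Om_parity : ∀ M α β, Om M α β ∈ Matter.parity U N (par M)
  Omh_parity : ∀ M α β, Omh M α β ∈ Matter.parity U N (par M)
  P_parity : ∀ α β, P α β ∈ Matter.parity U N 0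
  C_parity : ∀ α β γ, C α β γ ∈ Matter.parity U N 1
  Ch_parity : ∀ α β γ, Ch α β γ ∈ Matter.parity U N 1
  S_parity : ∀ α β γ δ, S α β γ δ ∈ Matter.parity U N 0

namespace Background

variable {U : TopologicalSpace.Opens Body} {N : ℕ} (bg : Background U N)

/-! #### The generalized metric and the BRST sections -/

/-- `(λΩ_M)^β = λ^α Ω_{Mα}^β` -/
def lOm (M : Idx) (β : Fin 16) : Target U N := ∑ α, lam α * up (bg.Om M α β)

/-- `(λ̂Ω̂_M)^β̂ = λ̂^α̂ Ω̂_{Mα̂}^β̂` -/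
def lOmh (M : Idx) (β : Fin 16) : Target U N := ∑ α, lamh α * up (bg.Omh M α β)

/-- `(λC)^{ββ̂} = λ^α C_α^{ββ̂}` -/
def lC (β βh : Fin 16) : Target U N := ∑ α, lam α * up (bg.C α β βh)

/-- `(λ̂Ĉ)^{β̂β} = λ̂^α̂ Ĉ_α̂^{β̂β}` -/
def lCh (βh β : Fin 16) : Target U N := ∑ α, lamh α * up (bg.Ch α βh β)

/-- `(λλ̂S)^{ββ̂} = λ^α λ̂^α̂ S_{αα̂}^{ββ̂}` -/
def llS (β βh : Fin 16) : Target U N := ∑ α, ∑ αh, lam α * lamh αh * up (bg.S α αh β βh)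

/-- the super-metric `G_{MN} = E_M^a E_N^b η_{ab}` -/
def G (M N' : Idx) : Matter U N :=
  ∑ a, ∑ b, eta a b • (bg.Einv M (vec a) * bg.Einv N' (vec b))

/-- `A^{MN} = (-)^M E_a^M E_b^N η^{ab} + E_α^M E_α̂^N P^{αα̂} - E_α̂^M E_α^N P^{αα̂}` -/
def Amat (M N' : Idx) : Matter U N :=
  (∑ a, ∑ b, (sg (par M) * eta a b) • (bg.E (vec a) M * bg.E (vec b) N'))
  + ∑ α, ∑ αh, (bg.E (spi α) M * bg.E (hat αh) N' * bg.P α αh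
      - bg.E (hat αh) M * bg.E (spi α) N' * bg.P α αh)

/-- `E_M^α E_α^P B_{PN}` -/
def projB (M N' : Idx) : Matter U N :=
  ∑ α, ∑ Q, bg.Einv M (spi α) * bg.E (spi α) Q * bg.B Q N'

/-- `E_M^α̂ E_α̂^P B_{PN}` -/
def projhB (M N' : Idx) : Matter U N :=
  ∑ α, ∑ Q, bg.Einv M (hat α) * bg.E (hat α) Q * bg.B Q N'

/-- `𝔸_{MN} = G_{MN} - B_{ML} A^{LP} B_{PN} - E_{(M|}^α̂ E_α̂^P B_{P|N)} + E_{(M|}^α E_α^P B_{P|N)}`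
with graded symmetrization `X_{(MN)} = X_{MN} + (-)^{MN} X_{NM}` -/
def Add (M N' : Idx) : Matter U N :=
  bg.G M N' - (∑ L, ∑ Q, bg.B M L * bg.Amat L Q * bg.B Q N')
    - (bg.projhB M N' + sg (par M * par N') • bg.projhB N' M)
    + (bg.projB M N' + sg (par M * par N') • bg.projB N' M)

/-- `𝔸_M^N = -B_{MP} A^{PN} - E_M^α̂ E_α̂^N + E_M^α E_α^N` -/
def Adu (M N' : Idx) : Matter U N :=
  -(∑ Q, bg.B M Q * bg.Amat Q N') - (∑ α, bg.Einv M (hat α) * bg.E (hat α) N')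
    + ∑ α, bg.Einv M (spi α) * bg.E (spi α) N'

/-- The block `𝔸^{Mβ}`. -/
def uuMgh (M : Idx) (β : Fin 16) : Target U N :=
  -(∑ N', up (bg.Amat M N') * bg.lOm N' β)
    - sg (par M) • ∑ βh, bg.lC β βh * up (bg.E (hat βh) M)

/-- The block `𝔸^{Mβ̂}`. -/
def uuMghh (M : Idx) (βh : Fin 16) : Target U N :=
  -(∑ N', up (bg.Amat M N') * bg.lOmh N' βh)
    - sg (par M) • ∑ β, bg.lCh βh β * up (bg.E (spi β) M)

/-- The block `𝔸^{αβ̂}`. -/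
def uuGhGhh (α βh : Fin 16) : Target U N :=
  (∑ M, ∑ N', bg.lOm M α * up (bg.Amat M N') * bg.lOmh N' βh)
    + (∑ αh, ∑ M, bg.lC α αh * up (bg.E (hat αh) M) * bg.lOmh M βh)
    + (∑ β, ∑ M, bg.lCh βh β * up (bg.E (spi β) M) * bg.lOm M α)
    - bg.llS α βh

/-- The block matrix `[𝔸^{ij}]`. -/
def uu : Coord → Coord → Target U N
  | Sum.inl M, Sum.inl N' => up (bg.Amat M N')
  | Sum.inl M, Sum.inr (Sum.inl β) => bg.uuMgh M β
  | Sum.inl M, Sum.inr (Sum.inr β) => bg.uuMghh M β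
  | Sum.inr (Sum.inl α), Sum.inl N' => sg (par N') • bg.uuMgh N' α
  | Sum.inr (Sum.inr α), Sum.inl N' => sg (par N') • bg.uuMghh N' α
  | Sum.inr (Sum.inl α), Sum.inr (Sum.inl β) =>
      (∑ M, ∑ N', bg.lOm M α * up (bg.Amat M N') * bg.lOm N' β)
        + (∑ αh, ∑ M, bg.lC α αh * up (bg.E (hat αh) M) * bg.lOm M β)
        + ∑ βh, ∑ M, bg.lC β βh * up (bg.E (hat βh) M) * bg.lOm M α
  | Sum.inr (Sum.inl α), Sum.inr (Sum.inr β) => bg.uuGhGhh α β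
  | Sum.inr (Sum.inr α), Sum.inr (Sum.inl β) => bg.uuGhGhh β α
  | Sum.inr (Sum.inr αh), Sum.inr (Sum.inr βh) =>
      (∑ M, ∑ N', bg.lOmh M αh * up (bg.Amat M N') * bg.lOmh N' βh)
        + (∑ α, ∑ M, bg.lCh αh α * up (bg.E (spi α) M) * bg.lOmh M βh)
        + ∑ β, ∑ M, bg.lCh βh β * up (bg.E (spi β) M) * bg.lOmh M αh

/-- The block matrix `[𝔸_{ij}]`. -/
def dd : Coord → Coord → Target U N
  | Sum.inl M, Sum.inl N' => up (bg.Add M N')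
  | Sum.inl _, Sum.inr _ => 0
  | Sum.inr _, _ => 0

/-- The block matrix `[𝔸_i^j]`. -/
def du : Coord → Coord → Target U N
  | Sum.inl M, Sum.inl N' => up (bg.Adu M N')
  | Sum.inl M, Sum.inr (Sum.inl β) =>
      (∑ N', ((if M = N' then 1 else 0) - up (bg.Adu M N')) * bg.lOm N' β)
        - ∑ βh, ∑ N', bg.lC β βh * up (bg.E (hat βh) N') * up (bg.B N' M)
  | Sum.inl M, Sum.inr (Sum.inr βh) =>
      -(∑ N', ((if M = N' then 1 else 0) + up (bg.Adu M N')) * bg.lOmh N' βh)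
        - ∑ β, ∑ N', bg.lCh βh β * up (bg.E (spi β) N') * up (bg.B N' M)
  | Sum.inr (Sum.inl α), Sum.inr (Sum.inl β) => if α = β then 1 else 0
  | Sum.inr (Sum.inr α), Sum.inr (Sum.inr β) => if α = β then -1 else 0
  | Sum.inr (Sum.inl _), Sum.inl _ => 0
  | Sum.inr (Sum.inl _), Sum.inr (Sum.inr _) => 0
  | Sum.inr (Sum.inr _), Sum.inl _ => 0
  | Sum.inr (Sum.inr _), Sum.inr (Sum.inl _) => 0

/-- The generalized metric `𝔸_PS` of the pure spinor string; `𝔸^i_j = (-)^{i+ij} 𝔸_j^i`. -/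
def genMetric : GenMetric U N where
  dd := bg.dd
  du := bg.du
  ud i j := sg (cpar i + cpar i * cpar j) • bg.du j i
  uu := bg.uu

/-- The two-form `𝔹_{ij}`, equal to `B_{MN}` on matter directions and zero otherwise. -/
def Btarget : Coord → Coord → Target U N
  | Sum.inl M, Sum.inl N' => up (bg.B M N')
  | Sum.inl _, Sum.inr _ => 0
  | Sum.inr _, _ => 0

/-- The vector field `V` lifted from `V^M` by the connections:
`(V^M, -V^M (λΩ_M)^α, -V^M (λ̂Ω̂_M)^α̂)`. -/
def horizontal (V : Idx → Target U N) : Coord → Target U N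
  | Sum.inl M => V M
  | Sum.inr (Sum.inl α) => -∑ M, V M * bg.lOm M α
  | Sum.inr (Sum.inr α) => -∑ M, V M * bg.lOmh M α

/-- The BRST section `(ℚ, 𝔽)` with `Q^M = λ^α E_α^M` and `𝔽 = ι_ℚ 𝔹`; it is odd. -/
def brst : GenSection U N where
  V := bg.horizontal fun M => ∑ α, lam α * up (bg.E (spi α) M)
  F := contract2 0 (bg.horizontal fun M => ∑ α, lam α * up (bg.E (spi α) M)) bg.Btarget

/-- The BRST section `(ℚ̃, 𝔽̃)` with `Q̃^M = λ̂^α̂ E_α̂^M` and `𝔽̃ = ι_ℚ̃ 𝔹`; it is odd. -/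
def brsth : GenSection U N where
  V := bg.horizontal fun M => ∑ α, lamh α * up (bg.E (hat α) M)
  F := contract2 0 (bg.horizontal fun M => ∑ α, lamh α * up (bg.E (hat α) M)) bg.Btarget

/-! #### Field strength, torsion, curvature -/

/-- The field strength `H = dB`:
`H_{MNP} = ∂_M B_{NP} - (-)^{MN} ∂_N B_{MP} + (-)^{P(M+N)} ∂_P B_{MN}`. -/
def H (M N' Q : Idx) : Matter U N :=
  Matter.pd M (bg.B N' Q) - sg (par M * par N') • Matter.pd N' (bg.B M Q)
    + sg (par Q * (par M + par N')) • Matter.pd Q (bg.B M N')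

/-- The three-form `ℍ_{ijk}`, equal to `H_{MNP}` on matter directions and zero otherwise. -/
def Htarget : Coord → Coord → Coord → Target U N
  | Sum.inl M, Sum.inl N', Sum.inl Q => up (bg.H M N' Q)
  | Sum.inl _, Sum.inl _, Sum.inr _ => 0
  | Sum.inl _, Sum.inr _, _ => 0
  | Sum.inr _, _, _ => 0

/-- `H_{ABC}` in flat indices, in the same (order-reversing) convention as the curvature below:
`H_{ABC} = (-)^{MB + MC + NC} E_A^M E_B^N E_C^P H_{PNM}`. -/
def Hf (A B' C' : Idx) : Matter U N :=
  ∑ M, ∑ N', ∑ Q, sg (par M * par B' + par M * par C' + par N' * par C') •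
    (bg.E A M * bg.E B' N' * bg.E C' Q * bg.H Q N' M)

/-- The connection `Ω_{MA}^B`, block diagonal with blocks `0`, `Ω_{Mα}^β`, `Ω̂_{Mα̂}^β̂`. -/
def Omfull (M : Idx) : Idx → Idx → Matter U N
  | Sum.inr (Sum.inl α), Sum.inr (Sum.inl β) => bg.Om M α β
  | Sum.inr (Sum.inr α), Sum.inr (Sum.inr β) => bg.Omh M α β
  | Sum.inl _, _ => 0
  | Sum.inr (Sum.inl _), Sum.inl _ => 0
  | Sum.inr (Sum.inl _), Sum.inr (Sum.inr _) => 0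
  | Sum.inr (Sum.inr _), Sum.inl _ => 0
  | Sum.inr (Sum.inr _), Sum.inr (Sum.inl _) => 0

/-- `E_A^M ∂_M E_B^N E_N^C - E_A^M Ω_{MB}^C` -/
def torsionAux (A B' C' : Idx) : Matter U N :=
  (∑ M, ∑ N', bg.E A M * Matter.pd M (bg.E B' N') * bg.Einv N' C')
    - ∑ M, bg.E A M * bg.Omfull M B' C'

/-- The torsion `T_{AB}^C = (E_A^M ∂_M E_B^N E_N^C - E_A^M Ω_{MB}^C) - (-)^{AB} (A ↔ B)`. -/
def T (A B' C' : Idx) : Matter U N :=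
  bg.torsionAux A B' C' - sg (par A * par B') • bg.torsionAux B' A C'

/-- `T_{ABc} = T_{AB}^d η_{dc}` -/
def Tl (A B' : Idx) (c : Fin 10) : Matter U N := ∑ d, eta d c • bg.T A B' (vec d)

/-- `∂_M Ω_{Nα}^β - Ω_{Mα}^γ Ω_{Nγ}^β` for a spinor connection `W`. -/
def curvAux (W : Idx → Fin 16 → Fin 16 → Matter U N) (M N' : Idx) (α β : Fin 16) : Matter U N :=
  Matter.pd M (W N' α β) - ∑ γ, W M α γ * W N' γ β

/-- The curvature in flat form indices: `(-)^{NB} E_A^N E_B^M`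
`[(∂_M Ω_{Nα}^β - Ω_{Mα}^γ Ω_{Nγ}^β) - (-)^{MN} (M ↔ N)]`. -/
def curv (W : Idx → Fin 16 → Fin 16 → Matter U N) (A B' : Idx) (α β : Fin 16) : Matter U N :=
  ∑ M, ∑ N', sg (par N' * par B') • (bg.E A N' * bg.E B' M *
    (curvAux W M N' α β - sg (par M * par N') • curvAux W N' M α β))

/-- `R_{ABα}^β` -/
def R (A B' : Idx) (α β : Fin 16) : Matter U N := bg.curv bg.Om A B' α β

/-- `R̂_{ABα̂}^β̂` -/
def Rh (A B' : Idx) (α β : Fin 16) : Matter U N := bg.curv bg.Omh A B' α β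

/-- `∇_A P^{ββ̂}` -/
def covP (A : Idx) (β βh : Fin 16) : Matter U N :=
  ∑ M, bg.E A M * (Matter.pd M (bg.P β βh)
    + (∑ ρ, bg.Om M ρ β * bg.P ρ βh) + ∑ ρ, bg.Omh M ρ βh * bg.P β ρ)

/-- `∇_A C_α^{ββ̂}` -/
def covC (A : Idx) (α β βh : Fin 16) : Matter U N :=
  ∑ M, bg.E A M * (Matter.pd M (bg.C α β βh)
    + (∑ ρ, bg.Om M ρ β * bg.C α ρ βh) + (∑ ρ, bg.Omh M ρ βh * bg.C α β ρ)
    - ∑ ρ, bg.Om M α ρ * bg.C ρ β βh)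

/-- `∇_A Ĉ_α̂^{β̂β}` -/
def covCh (A : Idx) (αh βh β : Fin 16) : Matter U N :=
  ∑ M, bg.E A M * (Matter.pd M (bg.Ch αh βh β)
    + (∑ ρ, bg.Omh M ρ βh * bg.Ch αh ρ β) + (∑ ρ, bg.Om M ρ β * bg.Ch αh βh ρ)
    - ∑ ρ, bg.Omh M αh ρ * bg.Ch ρ βh β)

/-- `∇_A S_{αα̂}^{ββ̂}` -/
def covS (A : Idx) (α αh β βh : Fin 16) : Matter U N :=
  ∑ M, bg.E A M * (Matter.pd M (bg.S α αh β βh)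
    + (∑ ρ, bg.Om M ρ β * bg.S α αh ρ βh) + (∑ ρ, bg.Omh M ρ βh * bg.S α αh β ρ)
    - (∑ ρ, bg.Om M α ρ * bg.S ρ αh β βh) - ∑ ρ, bg.Omh M αh ρ * bg.S α ρ β βh)

end Background

/-! ### Nilpotency and holomorphicity conditions

All conditions are imposed on the pure spinor locus. -/

section

variable {U : TopologicalSpace.Opens Body} {N : ℕ} (γ γh : GammaMatrices)

/-- A superfunction on the target space vanishes on the pure spinor locus
`λγ^aλ = λ̂γ̂^aλ̂ = 0`. -/
def VanishesOnPure (f : Target U N) : Prop :=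
  ∀ l lh : Fin 16 → ℂ, γ.IsPure l → γh.IsPure lh → ev l lh f = 0

/-- The Poisson bracket of the currents of two odd sections,
`{j_s(σ), j_t(σ')} = j_{⟦s,t⟧} δ(σ-σ') - ⟨s,t⟩ δ'(σ-σ')`, vanishes. -/
def CurrentsCommute (s t : GenSection U N) : Prop :=
  (∀ i, VanishesOnPure γ γh ((dorfman 1 1 s t).V i)) ∧
  (∀ i, VanishesOnPure γ γh ((dorfman 1 1 s t).F i)) ∧
  VanishesOnPure γ γh (pairing 1 1 s t)

/-- `[V, W] = 0` and `ι_V ι_W ℍ = 0`, for odd `V`, `W`. -/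
def BracketAndFluxVanish (bg : Background U N) (V W : Coord → Target U N) : Prop :=
  (∀ i, VanishesOnPure γ γh (lieBracket 1 1 V W i)) ∧
  (∀ k, VanishesOnPure γ γh (contract2 1 V (contract3 0 W bg.Htarget) k))

/-- The conditions for an odd section `(V, F)` to give a conserved current of the theory with
generalized metric `𝔸` (for a section in the `+1` or `-1` eigenbundle: a holomorphic or
antiholomorphic current):
`(ℒ_V 𝔸)_{ij} = -[(dF)_{ik} 𝔸^k_j + (-)^{ij} (dF)_{jk} 𝔸^k_i]`,
`(ℒ_V 𝔸)_i^j = -(dF)_{ik} 𝔸^{kj}`, `(ℒ_V 𝔸)^{ij} = 0`. -/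
def IsConserved (A : GenMetric U N) (s : GenSection U N) : Prop :=
  (∀ i j, VanishesOnPure γ γh (lieDD 1 s.V A i j
    + ∑ k, (extDeriv1 1 s.F i k * A.ud k j
      + sg (cpar i * cpar j) • (extDeriv1 1 s.F j k * A.ud k i)))) ∧
  (∀ i j, VanishesOnPure γ γh (lieDU 1 s.V A i j + ∑ k, extDeriv1 1 s.F i k * A.uu k j)) ∧
  (∀ i j, VanishesOnPure γ γh (lieUU 1 s.V A i j))

end

/-! ### Type II supergravity constraints -/

namespace Background

variable {U : TopologicalSpace.Opens Body} {N : ℕ} (bg : Background U N) (γ γh : GammaMatrices)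

/-- `λ^αλ^β T_{αβ}^C = λ^αλ^βλ^ρ R_{αβρ}^σ = λ^αλ^β R̂_{αβρ̂}^σ̂ = 0`, `λ^αλ^β H_{αβC} = 0`
for all pure spinors `λ`. -/
def SugraNil1 : Prop :=
  ∀ l, γ.IsPure l →
    (∀ D, ∑ α, ∑ β, (l α * l β) • bg.T (spi α) (spi β) D = 0) ∧
    (∀ σ, ∑ α, ∑ β, ∑ ρ, (l α * l β * l ρ) • bg.R (spi α) (spi β) ρ σ = 0) ∧
    (∀ ρ σ, ∑ α, ∑ β, (l α * l β) • bg.Rh (spi α) (spi β) ρ σ = 0) ∧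
    (∀ D, ∑ α, ∑ β, (l α * l β) • bg.Hf (spi α) (spi β) D = 0)

/-- `λ̂^α̂λ̂^β̂ T_{α̂β̂}^C = λ̂^α̂λ̂^β̂ R_{α̂β̂ρ}^σ = λ̂^α̂λ̂^β̂λ̂^ρ̂ R̂_{α̂β̂ρ̂}^σ̂ = 0`,
`λ̂^α̂λ̂^β̂ H_{α̂β̂C} = 0` for all pure spinors `λ̂`. -/
def SugraNil2 : Prop :=
  ∀ l, γh.IsPure l →
    (∀ D, ∑ α, ∑ β, (l α * l β) • bg.T (hat α) (hat β) D = 0) ∧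
    (∀ ρ σ, ∑ α, ∑ β, (l α * l β) • bg.R (hat α) (hat β) ρ σ = 0) ∧
    (∀ σ, ∑ α, ∑ β, ∑ ρ, (l α * l β * l ρ) • bg.Rh (hat α) (hat β) ρ σ = 0) ∧
    (∀ D, ∑ α, ∑ β, (l α * l β) • bg.Hf (hat α) (hat β) D = 0)

/-- `T_{αβ̂}^C = λ^αλ^ρ R_{αβ̂ρ}^σ = λ̂^α̂λ̂^ρ̂ R̂_{α̂βρ̂}^σ̂ = 0`, `H_{αβ̂C} = 0`. -/
def SugraNil3 : Prop :=
  (∀ α β D, bg.T (spi α) (hat β) D = 0) ∧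
  (∀ l, γ.IsPure l → ∀ β σ, ∑ α, ∑ ρ, (l α * l ρ) • bg.R (spi α) (hat β) ρ σ = 0) ∧
  (∀ l, γh.IsPure l → ∀ β σ, ∑ α, ∑ ρ, (l α * l ρ) • bg.Rh (hat α) (spi β) ρ σ = 0) ∧
  (∀ α β D, bg.Hf (spi α) (hat β) D = 0)

/-- The constraints equivalent to holomorphicity of the BRST current of `λ`. -/
structure SugraHol1 : Prop where
  /-- `T_{α(bc)} = 0` -/
  T_symm : ∀ α b c, bg.Tl (spi α) (vec b) c + bg.Tl (spi α) (vec c) b = 0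
  /-- `H_{αbc} = 0` -/
  H_vv : ∀ α b c, bg.Hf (spi α) (vec b) (vec c) = 0
  /-- `H_{αβ̂γ} = 0` -/
  H_hs : ∀ α β ρ, bg.Hf (spi α) (hat β) (spi ρ) = 0
  /-- `T_{αβc} + H_{αβc} = 0` -/
  T_add_H : ∀ α β c, bg.Tl (spi α) (spi β) c + bg.Hf (spi α) (spi β) (vec c) = 0
  /-- `T_{αβ̂c} - H_{αβ̂c} = 0` -/
  T_sub_H : ∀ α β c, bg.Tl (spi α) (hat β) c - bg.Hf (spi α) (hat β) (vec c) = 0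
  /-- `T_{αb}^γ - T_{αγ̂b} P^{γγ̂} = 0` -/
  T_vs : ∀ α b δ, bg.T (spi α) (vec b) (spi δ)
    - ∑ ρ, bg.Tl (spi α) (hat ρ) b * bg.P δ ρ = 0
  /-- `T_{αb}^γ̂ + T_{αγb} P^{γγ̂} = 0` -/
  T_vh : ∀ α b δ, bg.T (spi α) (vec b) (hat δ)
    + ∑ ρ, bg.Tl (spi α) (spi ρ) b * bg.P ρ δ = 0
  /-- `T_{αβ}^γ̂ + ½ H_{αβγ} P^{γγ̂} = 0` -/
  T_sh : ∀ α β δ, bg.T (spi α) (spi β) (hat δ)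
    + (1 / 2 : ℂ) • ∑ ρ, bg.Hf (spi α) (spi β) (spi ρ) * bg.P ρ δ = 0
  /-- `T_{αβ̂}^γ = 0` -/
  T_hs : ∀ α β δ, bg.T (spi α) (hat β) (spi δ) = 0
  /-- `∇_α P^{ββ̂} + T_{αρ}^β P^{ρβ̂} - C_α^{ββ̂} = 0` -/
  C_eq : ∀ α β βh, bg.covP (spi α) β βh
    + (∑ ρ, bg.T (spi α) (spi ρ) (spi β) * bg.P ρ βh) - bg.C α β βh = 0
  /-- `R̂_{aβγ̂}^σ̂ - T_{βρa} Ĉ_γ̂^{σ̂ρ} = 0` -/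
  Rh_v : ∀ a β δ σ, bg.Rh (vec a) (spi β) δ σ
    - ∑ ρ, bg.Tl (spi β) (spi ρ) a * bg.Ch δ σ ρ = 0
  /-- `R̂_{αβγ̂}^σ̂ + ½ H_{αβρ} Ĉ_γ̂^{σ̂ρ} = 0` -/
  Rh_s : ∀ α β δ σ, bg.Rh (spi α) (spi β) δ σ
    + (1 / 2 : ℂ) • ∑ ρ, bg.Hf (spi α) (spi β) (spi ρ) * bg.Ch δ σ ρ = 0
  /-- `-S_{αα̂}^{ββ̂} + R̂_{αγ̂α̂}^β̂ P^{βγ̂} + ∇_α Ĉ_α̂^{β̂β} + T_{αγ}^β Ĉ_α̂^{β̂γ} = 0` -/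
  S_eq : ∀ α αh β βh, -bg.S α αh β βh + (∑ ρ, bg.Rh (spi α) (hat ρ) αh βh * bg.P β ρ)
    + bg.covCh (spi α) αh βh β + (∑ ρ, bg.T (spi α) (spi ρ) (spi β) * bg.Ch αh βh ρ) = 0
  /-- `λ^αλ^β (R_{aαβ}^γ - T_{αρ̂a} C_β^{γρ̂}) = 0` -/
  R_v : ∀ l, γ.IsPure l → ∀ a δ, ∑ α, ∑ β, (l α * l β) • (bg.R (vec a) (spi α) β δ
    - ∑ ρ, bg.Tl (spi α) (hat ρ) a * bg.C β δ ρ) = 0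
  /-- `λ^αλ^β R_{β̂αβ}^γ = 0` -/
  R_h : ∀ l, γ.IsPure l → ∀ βh δ, ∑ α, ∑ β, (l α * l β) • bg.R (hat βh) (spi α) β δ = 0
  /-- `λ^αλ^β (∇_α C_β^{γγ̂} - R_{ασβ}^γ P^{σγ̂}) = 0` -/
  DC_eq : ∀ l, γ.IsPure l → ∀ δ δh, ∑ α, ∑ β, (l α * l β) • (bg.covC (spi α) β δ δh
    - ∑ σ, bg.R (spi α) (spi σ) β δ * bg.P σ δh) = 0
  /-- `λ^αλ^β (∇_α S_{ββ̂}^{γγ̂} - R̂_{αρ̂β̂}^γ̂ C_β^{γρ̂} - R_{αρβ}^γ Ĉ_β̂^{γ̂ρ}) = 0` -/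
  DS_eq : ∀ l, γ.IsPure l → ∀ βh δ δh, ∑ α, ∑ β, (l α * l β) • (bg.covS (spi α) β βh δ δh
    - (∑ ρ, bg.Rh (spi α) (hat ρ) βh δh * bg.C β δ ρ)
    - ∑ ρ, bg.R (spi α) (spi ρ) β δ * bg.Ch βh δh ρ) = 0

/-- The constraints equivalent to antiholomorphicity of the BRST current of `λ̂`. -/
structure SugraHol2 : Prop where
  /-- `T_{α̂(bc)} = 0` -/
  T_symm : ∀ α b c, bg.Tl (hat α) (vec b) c + bg.Tl (hat α) (vec c) b = 0
  /-- `H_{α̂bc} = 0` -/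
  H_vv : ∀ α b c, bg.Hf (hat α) (vec b) (vec c) = 0
  /-- `H_{α̂βγ̂} = 0` -/
  H_sh : ∀ α β ρ, bg.Hf (hat α) (spi β) (hat ρ) = 0
  /-- `T_{α̂β̂c} - H_{α̂β̂c} = 0` -/
  T_sub_H : ∀ α β c, bg.Tl (hat α) (hat β) c - bg.Hf (hat α) (hat β) (vec c) = 0
  /-- `T_{α̂βc} + H_{α̂βc} = 0` -/
  T_add_H : ∀ α β c, bg.Tl (hat α) (spi β) c + bg.Hf (hat α) (spi β) (vec c) = 0
  /-- `T_{α̂b}^γ̂ + T_{α̂γb} P^{γγ̂} = 0` -/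
  T_vh : ∀ α b δ, bg.T (hat α) (vec b) (hat δ)
    + ∑ ρ, bg.Tl (hat α) (spi ρ) b * bg.P ρ δ = 0
  /-- `T_{α̂b}^γ - T_{α̂γ̂b} P^{γγ̂} = 0` -/
  T_vs : ∀ α b δ, bg.T (hat α) (vec b) (spi δ)
    - ∑ ρ, bg.Tl (hat α) (hat ρ) b * bg.P δ ρ = 0
  /-- `T_{α̂β̂}^γ + ½ H_{α̂β̂γ̂} P^{γγ̂} = 0` -/
  T_hs : ∀ α β δ, bg.T (hat α) (hat β) (spi δ)
    + (1 / 2 : ℂ) • ∑ ρ, bg.Hf (hat α) (hat β) (hat ρ) * bg.P δ ρ = 0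
  /-- `T_{α̂β}^γ̂ = 0` -/
  T_sh : ∀ α β δ, bg.T (hat α) (spi β) (hat δ) = 0
  /-- `∇_α̂ P^{ββ̂} + T_{α̂ρ̂}^β̂ P^{βρ̂} + Ĉ_α̂^{β̂β} = 0` -/
  Ch_eq : ∀ αh β βh, bg.covP (hat αh) β βh
    + (∑ ρ, bg.T (hat αh) (hat ρ) (hat βh) * bg.P β ρ) + bg.Ch αh βh β = 0
  /-- `R_{aβ̂γ}^σ - T_{β̂ρ̂a} C_γ^{σρ̂} = 0` -/
  R_v : ∀ a β δ σ, bg.R (vec a) (hat β) δ σ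
    - ∑ ρ, bg.Tl (hat β) (hat ρ) a * bg.C δ σ ρ = 0
  /-- `R_{α̂β̂γ}^σ - ½ H_{α̂β̂ρ̂} C_γ^{σρ̂} = 0` -/
  R_h : ∀ α β δ σ, bg.R (hat α) (hat β) δ σ
    - (1 / 2 : ℂ) • ∑ ρ, bg.Hf (hat α) (hat β) (hat ρ) * bg.C δ σ ρ = 0
  /-- `-S_{αα̂}^{ββ̂} - R_{α̂γα}^β P^{γβ̂} + ∇_α̂ C_α^{ββ̂} + T_{α̂γ̂}^β̂ C_α^{βγ̂} = 0` -/
  S_eq : ∀ α αh β βh, -bg.S α αh β βh - (∑ ρ, bg.R (hat αh) (spi ρ) α β * bg.P ρ βh)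
    + bg.covC (hat αh) α β βh + (∑ ρ, bg.T (hat αh) (hat ρ) (hat βh) * bg.C α β ρ) = 0
  /-- `λ̂^α̂λ̂^β̂ (R̂_{aα̂β̂}^γ̂ - T_{α̂ρa} Ĉ_β̂^{γ̂ρ}) = 0` -/
  Rh_v : ∀ l, γh.IsPure l → ∀ a δ, ∑ α, ∑ β, (l α * l β) • (bg.Rh (vec a) (hat α) β δ
    - ∑ ρ, bg.Tl (hat α) (spi ρ) a * bg.Ch β δ ρ) = 0
  /-- `λ̂^α̂λ̂^β̂ R̂_{βα̂β̂}^γ̂ = 0` -/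
  Rh_s : ∀ l, γh.IsPure l → ∀ β' δ, ∑ α, ∑ β, (l α * l β) • bg.Rh (spi β') (hat α) β δ = 0
  /-- `λ̂^α̂λ̂^β̂ (∇_α̂ Ĉ_β̂^{γ̂γ} + R̂_{α̂σ̂β̂}^γ̂ P^{γσ̂}) = 0` -/
  DCh_eq : ∀ l, γh.IsPure l → ∀ δh δ, ∑ α, ∑ β, (l α * l β) • (bg.covCh (hat α) β δh δ
    + ∑ σ, bg.Rh (hat α) (hat σ) β δh * bg.P δ σ) = 0
  /-- `λ̂^α̂λ̂^β̂ (∇_α̂ S_{ββ̂}^{γγ̂} - R_{α̂ρβ}^γ Ĉ_β̂^{γ̂ρ} - R̂_{α̂ρ̂β̂}^γ̂ C_β^{γρ̂}) = 0` -/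
  DS_eq : ∀ l, γh.IsPure l → ∀ β' δ δh, ∑ α, ∑ β, (l α * l β) • (bg.covS (hat α) β' β δ δh
    - (∑ ρ, bg.R (hat α) (spi ρ) β' δ * bg.Ch β δh ρ)
    - ∑ ρ, bg.Rh (hat α) (hat ρ) β δh * bg.C β' δ ρ) = 0

end Background

end PureSpinor

end

set_option linter.unusedSectionVars false

noncomputable section

namespace PureSpinor

/-! ### Supercommutative algebras and supermatrices -/

/-! Each BRST section has the form $(V,\iota_V B)$ with $V=\chi_s\lambda^s e_s$. Here $s$ runs over
both kinds of spinor labels, $\chi$ is the indicator of one kind, and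
$e_A=E_A{}^M(\partial_M-(\lambda\Omega_M)\partial_\lambda)$, with both ghosts understood, is the
horizontal lift of the vielbein. Such a section is the image of $(V,0)$ under the $B$-field
transformation, so $B$ can be removed from every condition at the cost of contractions with $H=dB$.

For the brackets, the form part of the Dorfman bracket of $(V,\iota_VB)$ and $(W,\iota_WB)$ is
$\iota_{[V,W]}B$ plus a double contraction of $H$, and the pairing vanishes because the graph of a
two-form is isotropic (`dorfman_form`, `pairing_lower`). Hence currents commute exactly when bracket
and flux vanish. In the frame $e_A$ the bracket has torsion and curvature, contracted with ghosts,
as its components (`bracket_brstVec`).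

For conservation, the three conditions are written with supermatrices. Cartan's formula replaces
$dF$ by the Lie derivative of $B$ and a contraction with $H$ (`extDeriv_lower`). The Lie derivative
is absorbed by the $B$-twist of the generalized metric, and what remains is a triangular combination
of the conditions without $B$ (`consDU_twist`, `consDD_twist`). The untwisted metric is conjugate,
by the invertible frame, to a flat matrix with entries $\eta$, $\pm1$, $P$, $C$, $\hat C$, $S$. The
frame components of $[e_i,V]$ are torsion, curvature and a connection term (`frameDer_mul_frame`).
The connection terms either drop out or complete the derivatives of $P$, $C$, $\hat C$, $S$ to
covariant ones, so conservation becomes a list of flat equations (`cons_iff_flat`,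
`flatConserved_iff`).

It remains to strip the ghosts. Pure spinors span the spinor space: every choice of one null vector
from each of five null pairs of gamma matrices has only pure spinors in its kernel, and these
kernels together span (`spans_isPure`). An equation linear in a ghost therefore holds coefficient by
coefficient. Equations quadratic or cubic in one pure ghost stay contracted. The remaining flat
components are redundant by graded symmetry of the metric, antisymmetry of $P$ and symmetry of $H$.

Both currents are treated at once through an `Orientation`, which records the kind of spinor carried
by the BRST ghost. One current alone does not force $H_{\alpha\hat\beta\hat\gamma}$ and
$T_{\alpha\hat\beta}{}^{\hat\gamma}$ to vanish, although they enter its equations. They are supplied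
by the other current or by (N3), which is why each single equivalence is conditional and the joint
one is not. -/

theorem sg_congr {m n : ℕ} (h : Even m ↔ Even n := by
    (try simp only [Nat.even_add, Nat.even_mul, Nat.not_even_one, Even.zero, even_two]) <;> grind) :
    sg m = sg n := by
  by_cases hm : Even m
  · simp [sg, hm.neg_one_pow, (h.1 hm).neg_one_pow]
  · simp [sg, (Nat.not_even_iff_odd.1 hm).neg_one_pow,
      (Nat.not_even_iff_odd.1 (fun hn => hm (h.2 hn))).neg_one_pow]

theorem neg_sg (m : ℕ) : -sg m = sg (m + 1) := by
  simp [sg, pow_succ]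

theorem sg_mul (m n : ℕ) : sg m * sg n = sg (m + n) := by
  simp [sg, pow_add]

theorem sg_mul_self (m : ℕ) : sg m * sg m = 1 := by
  rw [sg_mul, sg_congr (n := 0)]; simp

theorem sg_smul_self {R : Type*} [AddCommGroup R] [Module ℂ R] (m : ℕ) (x : R) :
    sg m • sg m • x = x := by
  rw [smul_smul, sg_mul_self, one_smul]

/-- A supercommutative algebra; `deg k` is the space of elements of parity `k`. -/
class SuperCommAlgebra (R : Type*) [Ring R] [Algebra ℂ R] where
  deg : ℕ → Submodule ℂ R
  deg_le : ∀ {i j : ℕ}, (Even i ↔ Even j) → deg i ≤ deg j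
  one_mem : (1 : R) ∈ deg 0
  mul_mem : ∀ {i j : ℕ} {x y : R}, x ∈ deg i → y ∈ deg j → x * y ∈ deg (i + j)
  comm : ∀ {i j : ℕ} {x y : R}, x ∈ deg i → y ∈ deg j → x * y = sg (i * j) • (y * x)

open SuperCommAlgebra

section

variable {R : Type*} [Ring R] [Algebra ℂ R] [SuperCommAlgebra R]

/-- Degrees are natural numbers that matter only modulo two. The default argument compares the
parities, as in `sg_congr`, and so discharges most grading obligations silently. -/
theorem deg_of {i j : ℕ} {x : R} (hx : x ∈ deg i) (h : Even i ↔ Even j := by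
    (try simp only [Nat.even_add, Nat.even_mul, Nat.not_even_one, Even.zero, even_two]) <;> grind) :
    x ∈ deg j :=
  deg_le h hx

/-- An operator of parity `1` obeying the graded Leibniz rule. -/
structure IsOddDerivation (D : R →ₗ[ℂ] R) : Prop where
  leibniz : ∀ {k : ℕ} {x : R} (y : R), x ∈ deg k → D (x * y) = D x * y + sg k • (x * D y)
  map_deg : ∀ {k : ℕ} {x : R}, x ∈ deg k → D x ∈ deg (k + 1)

variable {ι : Type*} [Fintype ι] [DecidableEq ι] (p : ι → ℕ)

/-- A supermatrix of parity `k`. -/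
def IsHom (k : ℕ) (X : Matrix ι ι R) : Prop := ∀ i j, X i j ∈ deg (p i + p j + k)

/-- The derivation of even supermatrices induced by an odd derivation of the entries. -/
def matDer (D : R →ₗ[ℂ] R) (X : Matrix ι ι R) : Matrix ι ι R :=
  Matrix.of fun i j => sg (p i) • D (X i j)

/-- Supertranspose of an even matrix `X_i^j`. -/
def st0 (X : Matrix ι ι R) : Matrix ι ι R :=
  Matrix.of fun i j => sg (p i + p i * p j) • X j i

/-- Supertranspose of an odd matrix `X_i^j`. -/
def st1 (X : Matrix ι ι R) : Matrix ι ι R :=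
  Matrix.of fun i j => sg (p j + p i * p j) • X j i

/-- Graded transpose of a matrix `X_{ij}`. -/
def tdd (X : Matrix ι ι R) : Matrix ι ι R :=
  Matrix.of fun i j => sg (p i * p j) • X j i

/-- Graded transpose of a matrix `X^{ij}`. -/
def tuu (X : Matrix ι ι R) : Matrix ι ι R :=
  Matrix.of fun i j => sg (p i * p j + p i + p j) • X j i

variable {p}
variable {X Y : Matrix ι ι R}

theorem IsHom.congr {k l : ℕ} (hX : IsHom p k X) (h : Even k ↔ Even l) : IsHom p l X :=
  fun i j => deg_of (hX i j)

theorem IsHom.mul {k l : ℕ} (hX : IsHom p k X) (hY : IsHom p l Y) : IsHom p (k + l) (X * Y) := by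
  intro i j
  rw [Matrix.mul_apply]
  refine Submodule.sum_mem _ fun m _ => deg_of (mul_mem (hX i m) (hY m j)) ?_
  simp only [Nat.even_add]; tauto

theorem IsHom.add {k : ℕ} (hX : IsHom p k X) (hY : IsHom p k Y) : IsHom p k (X + Y) :=
  fun i j => Submodule.add_mem _ (hX i j) (hY i j)

theorem IsHom.sub {k : ℕ} (hX : IsHom p k X) (hY : IsHom p k Y) : IsHom p k (X - Y) :=
  fun i j => Submodule.sub_mem _ (hX i j) (hY i j)

theorem IsHom.one : IsHom p 0 (1 : Matrix ι ι R) := by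
  intro i j
  by_cases h : i = j
  · subst h
    rw [Matrix.one_apply_eq]
    exact deg_of one_mem (by simp)
  · rw [Matrix.one_apply_ne h]; exact Submodule.zero_mem _

theorem IsHom.st0 {k : ℕ} (hX : IsHom p k X) : IsHom p k (st0 p X) := fun i j =>
  Submodule.smul_mem _ _ (deg_of (hX j i))

theorem IsHom.matDer {k : ℕ} {D : R →ₗ[ℂ] R} (hD : IsOddDerivation D) (hX : IsHom p k X) :
    IsHom p (k + 1) (matDer p D X) := fun i j =>
  Submodule.smul_mem _ _ (deg_of (hD.map_deg (hX i j)))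

theorem st0_one : st0 p (1 : Matrix ι ι R) = 1 := by
  ext i j
  by_cases h : i = j
  · subst h
    simp only [st0, Matrix.of_apply, Matrix.one_apply_eq]
    rw [sg_congr (n := 0)]; simp
  · simp [st0, Matrix.one_apply_ne h, Matrix.one_apply_ne (Ne.symm h)]

theorem st1_st0 : st1 p (st0 p X) = X := by
  ext i j
  simp only [st0, st1, Matrix.of_apply, smul_smul, sg_mul]
  rw [sg_congr (n := 0)]; simp

theorem st1_add : st1 p (X + Y) = st1 p X + st1 p Y := by
  ext i j; simp [st1]

theorem st1_sub : st1 p (X - Y) = st1 p X - st1 p Y := by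
  ext i j; simp [st1, smul_sub]

theorem tdd_add : tdd p (X + Y) = tdd p X + tdd p Y := by
  ext i j; simp [tdd]

theorem tdd_sub : tdd p (X - Y) = tdd p X - tdd p Y := by
  ext i j; simp [tdd, smul_sub]

theorem matDer_add (D : R →ₗ[ℂ] R) : matDer p D (X + Y) = matDer p D X + matDer p D Y := by
  ext i j; simp [matDer]

theorem matDer_sub (D : R →ₗ[ℂ] R) : matDer p D (X - Y) = matDer p D X - matDer p D Y := by
  ext i j; simp [matDer, smul_sub]

/-- Moving $D$ past $X_{im}$ costs $(-)^{i+m}$. Together with the row sign $(-)^i$ this leaves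
$(-)^m$, the row sign of the second factor, so on even supermatrices an odd derivation obeys the
ungraded Leibniz rule. -/
theorem matDer_mul {D : R →ₗ[ℂ] R} (hD : IsOddDerivation D) (hX : IsHom p 0 X) :
    matDer p D (X * Y) = matDer p D X * Y + X * matDer p D Y := by
  ext i j
  simp only [matDer, Matrix.of_apply, Matrix.mul_apply, Matrix.add_apply, map_sum,
    Finset.smul_sum, ← Finset.sum_add_distrib]
  refine Finset.sum_congr rfl fun m _ => ?_
  rw [hD.leibniz _ (hX i m), smul_add, smul_mul_assoc, mul_smul_comm, smul_smul, sg_mul]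
  congr 2
  exact sg_congr

theorem matDer_one {D : R →ₗ[ℂ] R} (hD : IsOddDerivation D) :
    matDer p D (1 : Matrix ι ι R) = 0 := by
  have h := matDer_mul hD (IsHom.one (p := p) (R := R)) (Y := 1)
  simpa using h

/-- Differentiation makes an even matrix odd, so the transposition on the right has to be the odd
one. -/
theorem matDer_st0 (D : R →ₗ[ℂ] R) : matDer p D (st0 p X) = st1 p (matDer p D X) := by
  ext i j
  simp only [matDer, st0, st1, Matrix.of_apply, map_smul, smul_smul, sg_mul]
  congr 1
  exact sg_congr

/-- Reversing the factors costs $(-)^{(j+m)(m+i)}$. The index signs of the transpositions are chosen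
so that this factorizes into one sign for each matrix. The companion rules below differ only in the
index positions and parities of the factors. -/
theorem st0_mul (hX : IsHom p 0 X) (hY : IsHom p 0 Y) : st0 p (X * Y) = st0 p Y * st0 p X := by
  ext i j
  simp only [st0, Matrix.of_apply, Matrix.mul_apply, Finset.smul_sum, smul_mul_assoc,
    mul_smul_comm, smul_smul, sg_mul]
  refine Finset.sum_congr rfl fun m _ => ?_
  rw [comm (hX j m) (hY m i), smul_smul, sg_mul]
  congr 1
  exact sg_congr

theorem st1_mul_of_even_odd (hX : IsHom p 0 X) (hY : IsHom p 1 Y) :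
    st1 p (X * Y) = st1 p Y * st0 p X := by
  ext i j
  simp only [st0, st1, Matrix.of_apply, Matrix.mul_apply, Finset.smul_sum, smul_mul_assoc,
    mul_smul_comm, smul_smul, sg_mul]
  refine Finset.sum_congr rfl fun m _ => ?_
  rw [comm (hX j m) (hY m i), smul_smul, sg_mul]
  congr 1
  exact sg_congr

theorem st1_mul_of_odd_even (hX : IsHom p 1 X) (hY : IsHom p 0 Y) :
    st1 p (X * Y) = st0 p Y * st1 p X := by
  ext i j
  simp only [st0, st1, Matrix.of_apply, Matrix.mul_apply, Finset.smul_sum, smul_mul_assoc,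
    mul_smul_comm, smul_smul, sg_mul]
  refine Finset.sum_congr rfl fun m _ => ?_
  rw [comm (hX j m) (hY m i), smul_smul, sg_mul]
  congr 1
  exact sg_congr

/-- Supertranspose of a product `X_{ik} Y^{kj}`. -/
theorem st0_mul_dd_uu (hX : IsHom p 0 X) (hY : IsHom p 0 Y) :
    st0 p (X * Y) = tuu p Y * tdd p X := by
  ext i j
  simp only [st0, tuu, tdd, Matrix.of_apply, Matrix.mul_apply, Finset.smul_sum, smul_mul_assoc,
    mul_smul_comm, smul_smul, sg_mul]
  refine Finset.sum_congr rfl fun m _ => ?_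
  rw [comm (hX j m) (hY m i), smul_smul, sg_mul]
  congr 1
  exact sg_congr

/-- Supertranspose of a product `X_{ik} Y^{kj}` with `σ X` odd and graded antisymmetric. -/
theorem st1_mul_dd_uu (hX : IsHom p 1 X) (hY : IsHom p 0 Y) :
    st1 p (X * Y) = tuu p Y * tuu p X := by
  ext i j
  simp only [st1, tuu, Matrix.of_apply, Matrix.mul_apply, Finset.smul_sum, smul_mul_assoc,
    mul_smul_comm, smul_smul, sg_mul]
  refine Finset.sum_congr rfl fun m _ => ?_
  rw [comm (hX j m) (hY m i), smul_smul, sg_mul]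
  congr 1
  exact sg_congr

theorem tdd_mul_du_dd (hX : IsHom p 0 X) (hY : IsHom p 0 Y) :
    tdd p (X * Y) = tdd p Y * st0 p X := by
  ext i j
  simp only [st0, tdd, Matrix.of_apply, Matrix.mul_apply, Finset.smul_sum, smul_mul_assoc,
    mul_smul_comm, smul_smul, sg_mul]
  refine Finset.sum_congr rfl fun m _ => ?_
  rw [comm (hX j m) (hY m i), smul_smul, sg_mul]
  congr 1
  exact sg_congr

/-- The right factor has its upper index first, so although it is even its transposition carries the
signs of `st1`. -/
theorem tdd_mul_dd_ud (hX : IsHom p 0 X) (hY : IsHom p 0 Y) :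
    tdd p (X * Y) = st1 p Y * tdd p X := by
  ext i j
  simp only [st1, tdd, Matrix.of_apply, Matrix.mul_apply, Finset.smul_sum, smul_mul_assoc,
    mul_smul_comm, smul_smul, sg_mul]
  refine Finset.sum_congr rfl fun m _ => ?_
  rw [comm (hX j m) (hY m i), smul_smul, sg_mul]
  congr 1
  exact sg_congr

end

/-! ### Conservation conditions in matrix form and their gauge covariance -/

section

variable {R : Type*} [Ring R] [Algebra ℂ R] [SuperCommAlgebra R]
variable {ι : Type*} [Fintype ι] [DecidableEq ι] {p : ι → ℕ}

variable (p) in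
/-- Matrix form of the conservation condition with two lower indices. -/
def consDD (D : R →ₗ[ℂ] R) (L φ g a : Matrix ι ι R) : Matrix ι ι R :=
  matDer p D g + L * g + g * st1 p L + φ * st0 p a - a * φ

variable (p) in
/-- Matrix form of the conservation condition with a lower and an upper index. -/
def consDU (D : R →ₗ[ℂ] R) (L φ a u : Matrix ι ι R) : Matrix ι ι R :=
  matDer p D a + L * a - a * L + φ * u

variable (p) in
/-- Matrix form of the conservation condition with two upper indices. -/
def consUU (D : R →ₗ[ℂ] R) (L u : Matrix ι ι R) : Matrix ι ι R :=
  matDer p D u - u * L - st1 p L * u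

variable {D : R →ₗ[ℂ] R} {L φ w g a u b : Matrix ι ι R}

theorem tdd_tdd (X : Matrix ι ι R) : tdd p (tdd p X) = X := by
  ext i j
  simp only [tdd, Matrix.of_apply, smul_smul, sg_mul]
  rw [sg_congr (n := 0)]; simp

theorem tdd_mul_uu_du (hL : IsHom p 1 L) (hu : IsHom p 0 u) (hus : tuu p u = u) :
    tdd p (u * L) = st1 p L * u := by
  nth_rewrite 2 [← hus]
  ext i j
  simp only [st1, tdd, tuu, Matrix.of_apply, Matrix.mul_apply, Finset.smul_sum, smul_mul_assoc,
    mul_smul_comm, smul_smul, sg_mul]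
  refine Finset.sum_congr rfl fun m _ => ?_
  rw [comm (hu j m) (hL m i), smul_smul, sg_mul]
  congr 1
  exact sg_congr

/-- The conservation condition on `A^{ij}` is graded symmetric. -/
theorem tdd_consUU (hL : IsHom p 1 L) (hu : IsHom p 0 u) (hus : tuu p u = u) :
    tdd p (consUU p D L u) = consUU p D L u := by
  have h1 : tdd p (matDer p D u) = matDer p D u := by
    nth_rewrite 2 [← hus]
    ext i j
    simp only [matDer, tdd, tuu, Matrix.of_apply, map_smul, smul_smul, sg_mul]
    congr 1
    exact sg_congr
  have h2 := tdd_mul_uu_du hL hu hus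
  have h3 : tdd p (st1 p L * u) = u * L := by rw [← h2, tdd_tdd]
  rw [consUU, tdd_sub, tdd_sub, h1, h2, h3]
  abel

theorem tuu_tuu (X : Matrix ι ι R) : tuu p (tuu p X) = X := by
  ext i j
  simp only [tuu, Matrix.of_apply, smul_smul, sg_mul]
  rw [sg_congr (n := 0)]; simp

/-- The sign flips because `b` is graded antisymmetric while `u` is graded symmetric. -/
theorem st0_sub_mul (hb : IsHom p 0 b) (hu : IsHom p 0 u)
    (hbs : tdd p b = -b) (hus : tuu p u = u) : st0 p (a - b * u) = st0 p a + u * b := by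
  have h1 : st0 p (a - b * u) = st0 p a - st0 p (b * u) := by
    ext i j; simp [st0, smul_sub]
  rw [h1, st0_mul_dd_uu hb hu, hbs, hus]
  noncomm_ring

/-- Supertransposition of the mixed conservation condition. -/
theorem st1_consDU (hL : IsHom p 1 L) (hw : IsHom p 1 w)
    (hws : tuu p w = -w) (ha : IsHom p 0 a) (hu : IsHom p 0 u) (hus : tuu p u = u) :
    st1 p (consDU p D L w a u)
      = matDer p D (st0 p a) + st0 p a * st1 p L - st1 p L * st0 p a - u * w := by
  unfold consDU
  rw [st1_add, st1_sub, st1_add, st1_mul_of_odd_even hL ha, st1_mul_of_even_odd ha hL,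
    st1_mul_dd_uu hw hu, hws, hus, matDer_st0]
  noncomm_ring

/-- The Lie derivative of `b` contained in `φ` cancels the derivative of the twist. Only `b` times
the upper-index condition is left over, so the mixed condition is covariant up to a condition
imposed anyway. -/
theorem consDU_twist (hD : IsOddDerivation D) (hb : IsHom p 0 b)
    (hφ : φ = matDer p D b + L * b + b * st1 p L + w) :
    consDU p D L φ (a - b * u) u = consDU p D L w a u - b * consUU p D L u := by
  unfold consDU consUU
  rw [matDer_sub, matDer_mul hD hb, hφ]
  noncomm_ring

/-- Same mechanism one level down: the twisted lower condition is the untwisted one plus multiples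
of the mixed condition, of its supertranspose and of the upper condition. The triangular shape is
what makes the twist harmless. -/
theorem consDD_twist (hD : IsOddDerivation D) (hL : IsHom p 1 L) (hw : IsHom p 1 w)
    (hws : tuu p w = -w) (ha : IsHom p 0 a) (hu : IsHom p 0 u) (hus : tuu p u = u)
    (hb : IsHom p 0 b) (hbs : tdd p b = -b)
    (hφ : φ = matDer p D b + L * b + b * st1 p L + w) :
    consDD p D L φ (g - b * u * b + a * b - b * st0 p a) (a - b * u)
      = consDD p D L w g a + consDU p D L w a u * b - b * st1 p (consDU p D L w a u)
        - b * consUU p D L u * b := by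
  rw [st1_consDU hL hw hws ha hu hus]
  unfold consDD consDU consUU
  rw [st0_sub_mul hb hu hbs hus, matDer_sub, matDer_add, matDer_sub, matDer_mul hD (hb.mul hu),
    matDer_mul hD hb, matDer_mul hD ha, matDer_mul hD hb, hφ]
  noncomm_ring

/-- The twisted `A_{ij}` is graded symmetric. -/
theorem tdd_twist (ha : IsHom p 0 a) (hu : IsHom p 0 u) (hus : tuu p u = u)
    (hb : IsHom p 0 b) (hbs : tdd p b = -b) (hgs : tdd p g = g) :
    tdd p (g - b * u * b + a * b - b * st0 p a) = g - b * u * b + a * b - b * st0 p a := by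
  rw [tdd_sub, tdd_add, tdd_sub, tdd_mul_du_dd ha hb, tdd_mul_dd_ud hb ha.st0, st1_st0,
    tdd_mul_du_dd (hb.mul hu) hb, st0_mul_dd_uu hb hu, hgs, hbs, hus]
  noncomm_ring

variable {e f ℓ : Matrix ι ι R}

theorem matDer_inv (hD : IsOddDerivation D) (he : IsHom p 0 e)
    (hef : e * f = 1) (hfe : f * e = 1) : matDer p D f = -(f * matDer p D e * f) := by
  have h := matDer_mul hD he (Y := f)
  rw [hef, matDer_one hD] at h
  have h2 : f * (matDer p D e * f + e * matDer p D f) = 0 := by rw [← h, mul_zero]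
  rw [mul_add, ← mul_assoc f e, hfe, one_mul, ← mul_assoc] at h2
  exact eq_neg_of_add_eq_zero_right h2

/-- The hypothesis on `ℓ` is the transformation law of a connection, $\ell=eLe^{-1}-(De)e^{-1}$.
With it the inhomogeneous terms produced by differentiating the frame cancel and the condition
transforms as a tensor. The next two lemmas use the same law for the other index positions. -/
theorem consUU_frame (hD : IsOddDerivation D) (hL : IsHom p 1 L) (hu : IsHom p 0 u)
    (he : IsHom p 0 e) (hℓ : ℓ * e = e * L - matDer p D e) (hℓ1 : IsHom p 1 ℓ) :
    consUU p D L (st0 p e * u * e) = st0 p e * consUU p D ℓ u * e := by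
  have h1 : st0 p e * st1 p ℓ = st1 p L * st0 p e - matDer p D (st0 p e) := by
    rw [← st1_mul_of_odd_even hℓ1 he, hℓ, st1_sub, st1_mul_of_even_odd he hL, matDer_st0]
  unfold consUU
  rw [matDer_mul hD (he.st0.mul hu), matDer_mul hD he.st0]
  have h2 : st0 p e * (matDer p D u - u * ℓ - st1 p ℓ * u) * e
      = st0 p e * matDer p D u * e - st0 p e * u * (ℓ * e) - (st0 p e * st1 p ℓ) * u * e := by
    noncomm_ring
  rw [h2, h1, hℓ]
  noncomm_ring

theorem consDU_frame (hD : IsOddDerivation D) (ha : IsHom p 0 a)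
    (he : IsHom p 0 e) (hf : IsHom p 0 f) (hef : e * f = 1) (hfe : f * e = 1)
    (hℓ : ℓ * e = e * L - matDer p D e) :
    consDU p D L (f * w * st0 p f) (f * a * e) (st0 p e * u * e)
      = f * consDU p D ℓ w a u * e := by
  have h1 : st0 p f * st0 p e = 1 := by rw [← st0_mul he hf, hef, st0_one]
  -- The transformation law of `ℓ`, solved for the inverse frame.
  have h2 : f * ℓ = L * f - f * matDer p D e * f := by
    have : f * (ℓ * e) * f = f * (e * L - matDer p D e) * f := by rw [hℓ]
    calc f * ℓ = f * (ℓ * e) * f := by rw [mul_assoc, mul_assoc, hef, mul_one]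
      _ = f * e * L * f - f * matDer p D e * f := by rw [this]; noncomm_ring
      _ = _ := by rw [hfe, one_mul]
  unfold consDU
  rw [matDer_mul hD (hf.mul ha), matDer_mul hD hf, matDer_inv hD he hef hfe]
  have h3 : f * w * st0 p f * (st0 p e * u * e) = f * w * (st0 p f * st0 p e) * u * e := by
    noncomm_ring
  have h4 : f * (matDer p D a + ℓ * a - a * ℓ + w * u) * e
      = f * matDer p D a * e + (f * ℓ) * a * e - f * a * (ℓ * e) + f * w * u * e := by
    noncomm_ring
  rw [h3, h4, h1, h2, hℓ]
  noncomm_ring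

theorem consDD_frame (hD : IsOddDerivation D) (hL : IsHom p 1 L) (ha : IsHom p 0 a)
    (hg : IsHom p 0 g)
    (he : IsHom p 0 e) (hf : IsHom p 0 f) (hef : e * f = 1) (hfe : f * e = 1)
    (hℓ : ℓ * e = e * L - matDer p D e) (hℓ1 : IsHom p 1 ℓ) :
    consDD p D L (f * w * st0 p f) (f * g * st0 p f) (f * a * e)
      = f * consDD p D ℓ w g a * st0 p f := by
  have h1 : st0 p f * st0 p e = 1 := by rw [← st0_mul he hf, hef, st0_one]
  have h2 : f * ℓ = L * f - f * matDer p D e * f := by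
    have : f * (ℓ * e) * f = f * (e * L - matDer p D e) * f := by rw [hℓ]
    calc f * ℓ = f * (ℓ * e) * f := by rw [mul_assoc, mul_assoc, hef, mul_one]
      _ = f * e * L * f - f * matDer p D e * f := by rw [this]; noncomm_ring
      _ = _ := by rw [hfe, one_mul]
  have h2' : f * ℓ = L * f + matDer p D f := by
    rw [h2, matDer_inv hD he hef hfe, sub_eq_add_neg]
  have h3 : st1 p ℓ * st0 p f = st0 p f * st1 p L + matDer p D (st0 p f) := by
    rw [← st1_mul_of_even_odd hf hℓ1, h2', st1_add, st1_mul_of_odd_even hL hf, matDer_st0]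
  unfold consDD
  rw [matDer_mul hD (hf.mul hg), matDer_mul hD hf, st0_mul (hf.mul ha) he, st0_mul hf ha]
  have h4 : f * w * st0 p f * (st0 p e * (st0 p a * st0 p f))
      = f * w * (st0 p f * st0 p e) * st0 p a * st0 p f := by noncomm_ring
  have h5 : f * a * e * (f * w * st0 p f) = f * a * (e * f) * w * st0 p f := by noncomm_ring
  have h6 : f * (matDer p D g + ℓ * g + g * st1 p ℓ + w * st0 p a - a * w) * st0 p f
      = f * matDer p D g * st0 p f + (f * ℓ) * g * st0 p f + f * g * (st1 p ℓ * st0 p f)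
        + f * w * st0 p a * st0 p f - f * a * w * st0 p f := by noncomm_ring
  rw [h4, h5, h6, h1, h2', h3, hef]
  noncomm_ring

end

/-! ### Vector fields in coordinates -/

section

variable {R : Type*} [Ring R] [Algebra ℂ R] [SuperCommAlgebra R]
variable {ι : Type*} [Fintype ι] [DecidableEq ι] {p : ι → ℕ}

variable (p) in
/-- Partial derivatives of parities `p`, obeying the graded Leibniz rule. -/
structure IsPartialDerivs (pd : ι → R →ₗ[ℂ] R) : Prop where
  leibniz : ∀ (i : ι) {k : ℕ} {x : R} (y : R), x ∈ deg k →
    pd i (x * y) = pd i x * y + sg (p i * k) • (x * pd i y)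
  map_deg : ∀ (i : ι) {k : ℕ} {x : R}, x ∈ deg k → pd i x ∈ deg (k + p i)

/-- The action `V^i ∂_i` of a vector field. -/
def act (pd : ι → R →ₗ[ℂ] R) (V : ι → R) : R →ₗ[ℂ] R :=
  ∑ j, LinearMap.mulLeft ℂ (V j) ∘ₗ pd j

theorem act_apply (pd : ι → R →ₗ[ℂ] R) (V : ι → R) (x : R) :
    act pd V x = ∑ j, V j * pd j x := by
  simp [act]

/-- The matrix `∂_i V^j`. -/
def jac (pd : ι → R →ₗ[ℂ] R) (V : ι → R) : Matrix ι ι R := Matrix.of fun i j => pd i (V j)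

variable {pd : ι → R →ₗ[ℂ] R} {V W : ι → R}

theorem act_leibniz (hpd : IsPartialDerivs p pd) {v : ℕ} (hV : ∀ i, V i ∈ deg (p i + v))
    {k : ℕ} {x : R} (y : R) (hx : x ∈ deg k) :
    act pd V (x * y) = act pd V x * y + sg (v * k) • (x * act pd V y) := by
  simp only [act_apply, Finset.sum_mul, Finset.mul_sum, Finset.smul_sum,
    ← Finset.sum_add_distrib]
  refine Finset.sum_congr rfl fun j _ => ?_
  rw [hpd.leibniz j y hx, mul_add, mul_smul_comm, ← mul_assoc, ← mul_assoc, ← mul_assoc,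
    comm (hV j) hx, smul_mul_assoc, smul_smul, sg_mul]
  congr 2
  exact sg_congr

theorem act_deg (hpd : IsPartialDerivs p pd) {v : ℕ} (hV : ∀ i, V i ∈ deg (p i + v))
    {k : ℕ} {x : R} (hx : x ∈ deg k) : act pd V x ∈ deg (k + v) := by
  rw [act_apply]
  refine Submodule.sum_mem _ fun j _ => deg_of (mul_mem (hV j) (hpd.map_deg j hx)) ?_
  simp only [Nat.even_add]; tauto

theorem act_isOddDerivation (hpd : IsPartialDerivs p pd) (hV : ∀ i, V i ∈ deg (p i + 1)) :
    IsOddDerivation (act pd V) where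
  leibniz y hx := by rw [act_leibniz hpd hV y hx, one_mul]
  map_deg hx := act_deg hpd hV hx

theorem jac_isHom (hpd : IsPartialDerivs p pd) (hV : ∀ i, V i ∈ deg (p i + 1)) :
    IsHom p 1 (jac pd V) := fun i j =>
  deg_of (hpd.map_deg i (hV j))

variable {g a u b Φ : Matrix ι ι R}

/-- Graded symmetry of `g` and graded antisymmetry of `Φ` let the terms acting on the second index
be reordered into right multiplications. The price is the overall row sign, which is invertible. The
factor $(-)^i$ put on `Φ` is what makes it behave as an odd supermatrix. -/
theorem consDD_coord (hpd : IsPartialDerivs p pd) (hV : ∀ i, V i ∈ deg (p i + 1))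
    (hg : IsHom p 0 g) (hgs : tdd p g = g) (ha : IsHom p 0 a) (hΦ : IsHom p 1 Φ)
    (hΦs : tdd p Φ = -Φ) (i j : ι) :
    (∑ k, (V k * pd k (g i j) + sg (1 * p i) • (pd i (V k) * g k j)
        + sg (p i * p j + 1 * p j) • (pd j (V k) * g k i)))
      + ∑ k, (Φ i k * sg (p k + p k * p j) • a j k
        + sg (p i * p j) • (Φ j k * sg (p k + p k * p i) • a i k))
      = sg (p i) • consDD p (act pd V) (jac pd V)
        (Matrix.of fun i k => sg (p i) • Φ i k) g a i j := by
  -- Symmetry of `g` moves the index `i` to the left, and supercommutativity then puts the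
  -- derivative of the vector field on the right, as in `g * st1 L`.
  have h1 : ∀ k, sg (p i * p j + 1 * p j) • (pd j (V k) * g k i)
      = sg (p i) • (g i k * (sg (p j + p k * p j) • pd j (V k))) := by
    intro k
    have : g i k = sg (p i * p k) • g k i := by
      nth_rewrite 1 [← hgs]; simp [tdd]
    rw [this, comm (deg_of (hpd.map_deg j (hV k)) Iff.rfl) (hg k i), smul_mul_assoc,
      mul_smul_comm, smul_smul, smul_smul, smul_smul, sg_mul, sg_mul, sg_mul]
    congr 1
    exact sg_congr
  have h2 : ∀ k, sg (p i * p j) • (Φ j k * sg (p k + p k * p i) • a i k)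
      = -(sg (p i) • (a i k * sg (p k) • Φ k j)) := by
    intro k
    have : Φ k j = -(sg (p k * p j) • Φ j k) := by
      have := congrFun (congrFun hΦs k) j
      simp only [tdd, Matrix.of_apply, Matrix.neg_apply] at this
      rw [this, neg_neg]
    rw [this, mul_smul_comm, comm (hΦ j k) (ha i k), smul_neg, mul_neg, smul_neg, neg_neg,
      mul_smul_comm, mul_smul_comm, smul_smul, smul_smul, smul_smul, smul_smul, sg_mul, sg_mul,
      sg_mul, sg_mul]
    congr 1
    exact sg_congr
  simp only [one_mul] at h1
  simp only [consDD, matDer, jac, st0, st1, Matrix.add_apply, Matrix.sub_apply, Matrix.mul_apply,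
    Matrix.of_apply, h1, h2, smul_add, smul_sub, act_apply, Finset.smul_sum, sg_smul_self,
    Finset.sum_add_distrib, Finset.sum_neg_distrib, one_mul, smul_mul_assoc]
  abel

theorem consDU_coord (i j : ι) :
    (∑ k, (V k * pd k (a i j) - sg (1 * p i) • (a i k * pd k (V j))
        + sg (1 * p i) • (pd i (V k) * a k j))) + ∑ k, Φ i k * u k j
      = sg (p i) • consDU p (act pd V) (jac pd V)
        (Matrix.of fun i k => sg (p i) • Φ i k) a u i j := by
  simp only [consDU, matDer, jac, Matrix.add_apply, Matrix.sub_apply, Matrix.mul_apply,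
    Matrix.of_apply, smul_add, smul_sub, act_apply, Finset.smul_sum, sg_smul_self,
    Finset.sum_add_distrib, Finset.sum_sub_distrib, one_mul, smul_mul_assoc]
  abel

theorem consUU_coord (hpd : IsPartialDerivs p pd) (hV : ∀ i, V i ∈ deg (p i + 1))
    (hu : IsHom p 0 u) (hus : tuu p u = u) (i j : ι) :
    (∑ k, (V k * pd k (u i j) - sg (1 * p i) • (u i k * pd k (V j))
        - sg (p i + p j + p i * p j + 1 * p j) • (u j k * pd k (V i))))
      = sg (p i) • consUU p (act pd V) (jac pd V) u i j := by
  have h1 : ∀ k, sg (p i + p j + p i * p j + 1 * p j) • (u j k * pd k (V i))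
      = sg (p i) • ((sg (p k + p i * p k) • pd k (V i)) * u k j) := by
    intro k
    have : u k j = sg (p k * p j + p k + p j) • u j k := by
      nth_rewrite 1 [← hus]; simp [tuu]
    rw [this, comm (hu j k) (deg_of (hpd.map_deg k (hV i)) Iff.rfl), smul_mul_assoc,
      mul_smul_comm, smul_smul, smul_smul, smul_smul, sg_mul, sg_mul, sg_mul]
    congr 1
    exact sg_congr
  simp only [one_mul] at h1
  simp only [consUU, matDer, jac, st1, Matrix.sub_apply, Matrix.mul_apply,
    Matrix.of_apply, h1, smul_sub, act_apply, Finset.smul_sum, sg_smul_self,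
    Finset.sum_sub_distrib, one_mul]

/-- The exterior derivative of the two-form `b`, in components. -/
def fieldStrength (p : ι → ℕ) (pd : ι → R →ₗ[ℂ] R) (b : Matrix ι ι R) (i j k : ι) : R :=
  pd i (b j k) - sg (p i * p j) • pd j (b i k) + sg (p k * (p i + p j)) • pd k (b i j)

/-- The contraction of the field strength with `V`, up to sign. -/
def fluxMat (p : ι → ℕ) (H : ι → ι → ι → R) (V : ι → R) : Matrix ι ι R :=
  Matrix.of fun i j => -(sg (p i) • ∑ k, V k * H k i j)

/-- `F = ι_V b` -/
def lower (b : Matrix ι ι R) (V : ι → R) (j : ι) : R := ∑ i, V i * b i j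

variable (p pd) in
/-- The exterior derivative of an odd one-form. -/
def extDeriv (F : ι → R) : Matrix ι ι R :=
  Matrix.of fun i j => sg (p i * 1) • pd i (F j) - sg (p i * p j + p j * 1) • pd j (F i)

theorem lower_deg (hV : ∀ i, V i ∈ deg (p i + 1)) (hb : IsHom p 0 b) (j : ι) :
    lower b V j ∈ deg (p j + 1) :=
  Submodule.sum_mem _ fun i _ => deg_of (mul_mem (hV i) (hb i j))

theorem extDeriv_isHom (hpd : IsPartialDerivs p pd) {F : ι → R} (hF : ∀ i, F i ∈ deg (p i + 1)) :
    IsHom p 1 (extDeriv p pd F) := fun i j => Submodule.sub_mem _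
  (Submodule.smul_mem _ _ (deg_of (hpd.map_deg i (hF j))))
  (Submodule.smul_mem _ _ (deg_of (hpd.map_deg j (hF i))))

theorem tdd_extDeriv (F : ι → R) : tdd p (extDeriv p pd F) = -extDeriv p pd F := by
  ext i j
  simp only [tdd, extDeriv, Matrix.of_apply, Matrix.neg_apply, smul_sub, smul_smul, sg_mul,
    neg_sub]
  congr 2; exact sg_congr

/-- Cartan's formula: $d\iota_V b$ is $\mathcal L_V b$ minus $\iota_V db$. The first three terms on
the right are the Lie derivative in matrix form, and `fluxMat` is the remaining contraction with its
sign. -/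
theorem extDeriv_lower (hpd : IsPartialDerivs p pd) (hV : ∀ i, V i ∈ deg (p i + 1))
    (hb : IsHom p 0 b) (hbs : tdd p b = -b) :
    (Matrix.of fun i k => sg (p i) • extDeriv p pd (lower b V) i k)
      = matDer p (act pd V) b + jac pd V * b + b * st1 p (jac pd V)
        + fluxMat p (fieldStrength p pd b) V := by
  ext i j
  have hb' : ∀ i j, b i j = -(sg (p i * p j) • b j i) := fun i j => by
    have := congrFun (congrFun hbs i) j
    simp only [tdd, Matrix.of_apply, Matrix.neg_apply] at this
    rw [this, neg_neg]
  have h1 : ∀ k, pd i (V k * b k j) = pd i (V k) * b k j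
      + sg (p i + p i * p k) • (V k * pd i (b k j)) := fun k => by
    rw [hpd.leibniz i _ (hV k)]
    congr 2
    exact sg_congr
  have h2 : ∀ k, sg (p i + p i * p j + p j) • pd j (V k * b k i)
      = -(b i k * (sg (p j + p k * p j) • pd j (V k)))
        + sg (p i + p j * (p k + p i)) • (V k * pd j (b k i)) := fun k => by
    rw [hpd.leibniz j _ (hV k), smul_add]
    congr 1
    · rw [hb' i k, neg_mul, neg_neg, smul_mul_assoc, mul_smul_comm, comm (hpd.map_deg j (hV k))
        (hb k i), smul_smul, smul_smul, sg_mul, sg_mul]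
      congr 1
      exact sg_congr
    · rw [smul_smul, sg_mul]
      congr 1
      exact sg_congr
  have h3 : sg (p i) • extDeriv p pd (lower b V) i j
      = ∑ k, pd i (V k * b k j) - ∑ k, sg (p i + p i * p j + p j) • pd j (V k * b k i) := by
    simp only [extDeriv, lower, Matrix.of_apply, map_sum, Finset.smul_sum, smul_sub, smul_smul,
      sg_mul]
    congr 1
    · refine Finset.sum_congr rfl fun k _ => ?_
      rw [sg_congr (n := 0)]
      simp
    · refine Finset.sum_congr rfl fun k _ => ?_
      rw [mul_one, add_assoc]
  rw [Matrix.of_apply, h3]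
  simp only [h1, h2, matDer, jac, st1, fluxMat, fieldStrength, Matrix.add_apply, Matrix.mul_apply,
    Matrix.of_apply, act_apply, Finset.smul_sum, mul_add, mul_sub, smul_add, smul_sub,
    Finset.sum_add_distrib, Finset.sum_sub_distrib, Finset.sum_neg_distrib, mul_smul_comm,
    smul_smul, sg_mul]
  simp only [fun k => sg_congr (m := p i + p k * p i) (n := p i + p i * p k)]
  abel

/-- The action of the Dorfman bracket on the form part, for sections `(V, ι_V b)`,
`(W, ι_W b)`. -/
theorem dorfman_form (hpd : IsPartialDerivs p pd) (hV : ∀ i, V i ∈ deg (p i + 1))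
    (hW : ∀ i, W i ∈ deg (p i + 1)) (hb : IsHom p 0 b) (hbs : tdd p b = -b) (i : ι) :
    (∑ j, (V j * pd j (lower b W i)
        + sg (1 * p i + 1 * (p i + p j)) • (pd i (V j) * lower b W j)))
      + ∑ k, sg (1 * p k) • (W k * extDeriv p pd (lower b V) k i)
      = ∑ k, (act pd V (W k) + act pd W (V k)) * b k i
        + ∑ k, W k * fluxMat p (fieldStrength p pd b) V k i := by
  have hD := act_isOddDerivation hpd hV
  have h1 : ∑ k, sg (1 * p k) • (W k * extDeriv p pd (lower b V) k i)
      = ∑ k, W k * (sg (p k) • extDeriv p pd (lower b V) k i) := by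
    refine Finset.sum_congr rfl fun k _ => ?_
    rw [one_mul, mul_smul_comm]
  have h2 : ∀ k, sg (p k) • extDeriv p pd (lower b V) k i
      = (matDer p (act pd V) b + jac pd V * b + b * st1 p (jac pd V)
        + fluxMat p (fieldStrength p pd b) V) k i := fun k => by
    rw [← extDeriv_lower hpd hV hb hbs, Matrix.of_apply]
  have h3 : ∑ j, V j * pd j (lower b W i) = ∑ k, (act pd V (W k) * b k i
      - W k * (sg (p k) • act pd V (b k i))) := by
    rw [← act_apply, lower, map_sum]
    refine Finset.sum_congr rfl fun k _ => ?_
    rw [hD.leibniz _ (hW k), mul_smul_comm, sub_eq_add_neg, ← neg_smul, neg_sg]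
  -- This part of the Cartan formula cancels the index-rotation term of the Lie derivative of
  -- $\iota_W b$.
  have h4 : ∑ k, W k * ∑ j, b k j * (sg (p i + p j * p i) • pd i (V j))
      = -∑ j, sg (1 * p i + 1 * (p i + p j)) • (pd i (V j) * lower b W j) := by
    simp only [Finset.mul_sum]
    rw [Finset.sum_comm, ← Finset.sum_neg_distrib]
    refine Finset.sum_congr rfl fun j _ => ?_
    have h5 := lower_deg hW hb j
    rw [comm (hpd.map_deg i (hV j)) h5, lower, smul_smul, sg_mul, ← neg_smul, neg_sg,
      Finset.sum_mul, Finset.smul_sum]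
    refine Finset.sum_congr rfl fun k _ => ?_
    rw [← mul_assoc, mul_smul_comm]
    congr 1
    exact sg_congr
  -- The other index term supplies the half of $\iota_{[V,W]}b$ in which `W` acts on `V`.
  have h6 : ∑ k, W k * ∑ j, pd k (V j) * b j i = ∑ k, act pd W (V k) * b k i := by
    simp only [Finset.mul_sum, act_apply, Finset.sum_mul, mul_assoc]
    rw [Finset.sum_comm]
  rw [h1, Finset.sum_add_distrib, h3]
  simp only [h2, matDer, jac, st1, Matrix.add_apply, Matrix.mul_apply, Matrix.of_apply, mul_add,
    add_mul, Finset.sum_add_distrib, h4, h6, Finset.sum_sub_distrib]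
  abel

/-- The graph of a graded antisymmetric two-form is isotropic: both pairings contain the same double
sum up to exchanging the summation indices. -/
theorem pairing_lower (hV : ∀ i, V i ∈ deg (p i + 1)) (hW : ∀ i, W i ∈ deg (p i + 1))
    (hbs : tdd p b = -b) :
    ∑ i, sg (1 * p i) • (V i * lower b W i) - ∑ i, sg (1 * p i) • (W i * lower b V i) = 0 := by
  have hb' : ∀ i j, b i j = -(sg (p i * p j) • b j i) := fun i j => by
    have := congrFun (congrFun hbs i) j
    simp only [tdd, Matrix.of_apply, Matrix.neg_apply] at this
    rw [this, neg_neg]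
  rw [sub_eq_zero]
  simp only [lower, Finset.mul_sum, Finset.smul_sum]
  rw [Finset.sum_comm]
  refine Finset.sum_congr rfl fun i _ => Finset.sum_congr rfl fun j _ => ?_
  rw [hb' i j, ← mul_assoc, comm (hV j) (hW i), mul_neg, mul_smul_comm, smul_neg,
    smul_mul_assoc, mul_assoc, smul_smul, smul_smul, sg_mul, sg_mul, ← neg_smul, neg_sg]
  congr 1
  exact sg_congr

theorem fieldStrength_swap_right (hbs : tdd p b = -b) (i j k : ι) :
    fieldStrength p pd b i j k = -(sg (p j * p k) • fieldStrength p pd b i k j) := by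
  have hb' : ∀ i j, b i j = -(sg (p i * p j) • b j i) := fun i j => by
    have := congrFun (congrFun hbs i) j
    simp only [tdd, Matrix.of_apply, Matrix.neg_apply] at this
    rw [this, neg_neg]
  simp only [fieldStrength]
  rw [hb' j k]
  simp only [map_neg, map_smul, smul_sub, smul_add, smul_smul, sg_mul]
  rw [sg_congr (m := p j * p k + p i * p k) (n := p k * (p i + p j)),
    sg_congr (m := p j * p k + p j * (p i + p k)) (n := p i * p j)]
  abel

theorem fieldStrength_swap_left (hbs : tdd p b = -b) (i j k : ι) :
    fieldStrength p pd b i j k = -(sg (p i * p j) • fieldStrength p pd b j i k) := by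
  have hb' : ∀ i j, b i j = -(sg (p i * p j) • b j i) := fun i j => by
    have := congrFun (congrFun hbs i) j
    simp only [tdd, Matrix.of_apply, Matrix.neg_apply] at this
    rw [this, neg_neg]
  simp only [fieldStrength]
  rw [hb' i j]
  simp only [map_neg, map_smul, smul_sub, smul_add, smul_smul, sg_mul, smul_neg]
  rw [sg_congr (m := p i * p j + p j * p i) (n := 0),
    sg_congr (m := p i * p j + p k * (p j + p i)) (n := p k * (p i + p j) + p i * p j)]
  simp only [pow_zero, one_smul]
  abel

theorem fieldStrength_deg (hpd : IsPartialDerivs p pd) (hb : IsHom p 0 b) (i j k : ι) :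
    fieldStrength p pd b i j k ∈ deg (p i + p j + p k) := by
  refine Submodule.add_mem _ (Submodule.sub_mem _ ?_ (Submodule.smul_mem _ _ ?_))
    (Submodule.smul_mem _ _ ?_)
  · exact deg_of (hpd.map_deg i (hb j k))
  · exact deg_of (hpd.map_deg j (hb i k))
  · exact deg_of (hpd.map_deg k (hb i j))

theorem fluxMat_isHom (hV : ∀ i, V i ∈ deg (p i + 1)) {H : ι → ι → ι → R}
    (hH : ∀ i j k, H i j k ∈ deg (p i + p j + p k)) : IsHom p 1 (fluxMat p H V) := fun i j =>
  Submodule.neg_mem _ (Submodule.smul_mem _ _ (Submodule.sum_mem _ fun k _ =>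
    deg_of (mul_mem (hV k) (hH k i j))))

/-- The row sign in `fluxMat` converts graded antisymmetry in two lower indices into antisymmetry
under `tuu`, the form required in the twist lemmas. -/
theorem tuu_fluxMat {H : ι → ι → ι → R}
    (hH : ∀ i j k, H i j k = -(sg (p j * p k) • H i k j)) :
    tuu p (fluxMat p H V) = -fluxMat p H V := by
  ext i j
  simp only [tuu, fluxMat, Matrix.of_apply, Matrix.neg_apply, smul_neg, neg_neg, smul_smul, sg_mul,
    Finset.smul_sum, ← Finset.sum_neg_distrib]
  refine Finset.sum_congr rfl fun k _ => ?_
  rw [hH k i j, mul_neg, mul_smul_comm, smul_neg, smul_smul, sg_mul]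
  congr 2
  exact sg_congr

/-- The double contraction of a three-form with odd vector fields is symmetric. -/
theorem contract_contract (hV : ∀ i, V i ∈ deg (p i + 1)) (hW : ∀ i, W i ∈ deg (p i + 1))
    {H : ι → ι → ι → R} (hH : ∀ i j k, H i j k = -(sg (p i * p j) • H j i k)) (k : ι) :
    ∑ i, V i * fluxMat p H W i k = ∑ i, W i * fluxMat p H V i k := by
  simp only [fluxMat, Matrix.of_apply, mul_neg, mul_smul_comm, Finset.mul_sum, Finset.smul_sum,
    Finset.sum_neg_distrib]
  rw [Finset.sum_comm]
  congr 1
  refine Finset.sum_congr rfl fun i _ => Finset.sum_congr rfl fun j _ => ?_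
  rw [hH i j k, ← mul_assoc, comm (hV j) (hW i), mul_neg, mul_smul_comm, ← neg_smul, neg_sg,
    smul_mul_assoc, smul_smul, smul_smul, sg_mul, sg_mul, mul_assoc]
  congr 1
  exact sg_congr

end

/-! ### The algebras of superfunctions -/

section TensorProduct

variable {A S : Type*} [Ring A] [Algebra ℂ A] [SuperCommAlgebra A] [CommRing S] [Algebra ℂ S]

theorem tensor_deg_induction {k : ℕ} {P : A ⊗[ℂ] S → Prop}
    (tmul : ∀ a ∈ (deg k : Submodule ℂ A), ∀ s : S, P (a ⊗ₜ s))
    (add : ∀ x y, P x → P y → P (x + y)) {x : A ⊗[ℂ] S}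
    (hx : x ∈ LinearMap.range (LinearMap.rTensor S (deg k : Submodule ℂ A).subtype)) : P x := by
  obtain ⟨t, rfl⟩ := hx
  induction t using TensorProduct.induction_on with
  | zero => simpa using tmul 0 (Submodule.zero_mem _) 0
  | tmul a s => exact tmul _ a.2 s
  | add x y hx hy => rw [map_add]; exact add _ _ hx hy

theorem tmul_mem_deg {k : ℕ} {a : A} (ha : a ∈ (deg k : Submodule ℂ A)) (s : S) :
    a ⊗ₜ[ℂ] s ∈ LinearMap.range (LinearMap.rTensor S (deg k : Submodule ℂ A).subtype) :=
  ⟨⟨a, ha⟩ ⊗ₜ s, rfl⟩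

/-- The commutative factor is purely even, so the grading and all signs come from `A`. The
construction is used twice: for the smooth functions over the Grassmann algebra, and then for the
ghosts over the superfields. -/
instance : SuperCommAlgebra (A ⊗[ℂ] S) where
  deg k := LinearMap.range (LinearMap.rTensor S (deg k : Submodule ℂ A).subtype)
  deg_le h x hx := by
    refine tensor_deg_induction (fun a ha s => tmul_mem_deg (deg_le h ha) s)
      (fun x y hx hy => Submodule.add_mem _ hx hy) hx
  one_mem := tmul_mem_deg one_mem 1
  mul_mem {i j x y} hx hy := by
    refine tensor_deg_induction (P := fun x => x * y ∈ LinearMap.range (LinearMap.rTensor S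
      (deg (i + j) : Submodule ℂ A).subtype)) (fun a ha s => ?_) (fun x y hx hy => ?_) hx
    · refine tensor_deg_induction (P := fun y => a ⊗ₜ[ℂ] s * y ∈ LinearMap.range
        (LinearMap.rTensor S (deg (i + j) : Submodule ℂ A).subtype)) (fun b hb t => ?_)
        (fun x y hx hy => ?_) hy
      · rw [Algebra.TensorProduct.tmul_mul_tmul]
        exact tmul_mem_deg (mul_mem ha hb) _
      · rw [mul_add]; exact Submodule.add_mem _ hx hy
    · rw [add_mul]; exact Submodule.add_mem _ hx hy
  comm {i j x y} hx hy := by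
    refine tensor_deg_induction (P := fun x => x * y = sg (i * j) • (y * x)) (fun a ha s => ?_) (fun x y hx hy => ?_) hx
    · refine tensor_deg_induction (P := fun y => a ⊗ₜ[ℂ] s * y = sg (i * j) • (y * a ⊗ₜ[ℂ] s))
        (fun b hb t => ?_) (fun x y hx hy => ?_) hy
      · rw [Algebra.TensorProduct.tmul_mul_tmul, Algebra.TensorProduct.tmul_mul_tmul, comm ha hb,
          TensorProduct.smul_tmul', mul_comm s t]
      · rw [mul_add, add_mul, smul_add, hx, hy]
    · rw [mul_add, add_mul, smul_add, hx, hy]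

theorem rTensor_leibniz {d : A →ₗ[ℂ] A} {i k : ℕ}
    (hd : ∀ {x : A} (y : A), x ∈ (deg k : Submodule ℂ A) →
      d (x * y) = d x * y + sg (i * k) • (x * d y))
    {x : A ⊗[ℂ] S} (y : A ⊗[ℂ] S) (hx : x ∈ (deg k : Submodule ℂ (A ⊗[ℂ] S))) :
    LinearMap.rTensor S d (x * y) = LinearMap.rTensor S d x * y
      + sg (i * k) • (x * LinearMap.rTensor S d y) := by
  refine tensor_deg_induction (P := fun x => LinearMap.rTensor S d (x * y)
    = LinearMap.rTensor S d x * y + sg (i * k) • (x * LinearMap.rTensor S d y)) (fun a ha s => ?_) (fun x y hx hy => ?_) hx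
  · induction y using TensorProduct.induction_on with
    | zero => simp
    | tmul b t =>
      simp only [Algebra.TensorProduct.tmul_mul_tmul, LinearMap.rTensor_tmul, hd b ha,
        TensorProduct.add_tmul, TensorProduct.smul_tmul']
    | add x y hx hy => rw [mul_add, map_add, map_add, hx, hy, mul_add, mul_add, smul_add]; abel
  · rw [add_mul, map_add, map_add, hx, hy, add_mul, add_mul, smul_add]; abel

theorem rTensor_deg {d : A →ₗ[ℂ] A} {k l : ℕ}
    (hd : ∀ {x : A}, x ∈ (deg k : Submodule ℂ A) → d x ∈ (deg l : Submodule ℂ A))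
    {x : A ⊗[ℂ] S} (hx : x ∈ (deg k : Submodule ℂ (A ⊗[ℂ] S))) :
    LinearMap.rTensor S d x ∈ (deg l : Submodule ℂ (A ⊗[ℂ] S)) := by
  refine tensor_deg_induction (P := fun x => LinearMap.rTensor S d x ∈
    (deg l : Submodule ℂ (A ⊗[ℂ] S))) (fun a ha s => ?_) (fun x y hx hy => ?_) hx
  · rw [LinearMap.rTensor_tmul]; exact tmul_mem_deg (hd ha) s
  · rw [map_add]; exact Submodule.add_mem _ hx hy

theorem lTensor_leibniz {d : S →ₗ[ℂ] S} (hd : ∀ x y : S, d (x * y) = d x * y + x * d y)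
    (x y : A ⊗[ℂ] S) :
    LinearMap.lTensor A d (x * y) = LinearMap.lTensor A d x * y + x * LinearMap.lTensor A d y := by
  induction x using TensorProduct.induction_on with
  | zero => simp
  | tmul a s =>
    induction y using TensorProduct.induction_on with
    | zero => simp
    | tmul b t =>
      simp only [Algebra.TensorProduct.tmul_mul_tmul, LinearMap.lTensor_tmul, hd,
        TensorProduct.tmul_add]
    | add x y hx hy => rw [mul_add, map_add, map_add, hx, hy, mul_add, mul_add]; abel
  | add x y hx hy => rw [add_mul, map_add, map_add, hx, hy, add_mul, add_mul]; abel

theorem lTensor_deg (d : S →ₗ[ℂ] S) {k : ℕ} {x : A ⊗[ℂ] S}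
    (hx : x ∈ (deg k : Submodule ℂ (A ⊗[ℂ] S))) :
    LinearMap.lTensor A d x ∈ (deg k : Submodule ℂ (A ⊗[ℂ] S)) := by
  refine tensor_deg_induction (P := fun x => LinearMap.lTensor A d x ∈
    (deg k : Submodule ℂ (A ⊗[ℂ] S))) (fun a ha s => ?_) (fun x y hx hy => ?_) hx
  · rw [LinearMap.lTensor_tmul]; exact tmul_mem_deg ha _
  · rw [map_add]; exact Submodule.add_mem _ hx hy

end TensorProduct

theorem natCast_zmod_two_congr {i j : ℕ} (h : Even i ↔ Even j) : (i : ZMod 2) = (j : ZMod 2) := by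
  rw [ZMod.natCast_eq_natCast_iff]
  unfold Nat.ModEq
  grind

/-- For the zero quadratic form any two vectors are orthogonal, and homogeneous elements generated
by mutually orthogonal vectors supercommute in a Clifford algebra. -/
theorem grassmann_comm {N : ℕ} {i j : ℕ} {x y : Grassmann N}
    (hx : x ∈ CliffordAlgebra.evenOdd (0 : QuadraticForm ℂ (OddLabel N → ℂ)) (i : ZMod 2))
    (hy : y ∈ CliffordAlgebra.evenOdd (0 : QuadraticForm ℂ (OddLabel N → ℂ)) (j : ZMod 2)) :
    x * y = sg (i * j) • (y * x) := by
  have h := CliffordAlgebra.map_mul_map_of_isOrtho_of_mem_evenOdd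
    (QuadraticMap.Isometry.id (0 : QuadraticForm ℂ (OddLabel N → ℂ)))
    (QuadraticMap.Isometry.id (0 : QuadraticForm ℂ (OddLabel N → ℂ)))
    (fun a b => by simp [QuadraticMap.isOrtho_def]) x y hx hy
  simp only [CliffordAlgebra.map_id, AlgHom.id_apply] at h
  rw [h]
  have h2 : ((j : ZMod 2) * (i : ZMod 2)) = ((i * j : ℕ) : ZMod 2) := by push_cast; ring
  rw [h2, uzpow_natCast, Units.smul_def]
  rcases Nat.even_or_odd (i * j) with h3 | h3 <;> simp [sg, h3.neg_one_pow]

instance (N : ℕ) : SuperCommAlgebra (Grassmann N) where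
  deg k := CliffordAlgebra.evenOdd (0 : QuadraticForm ℂ (OddLabel N → ℂ)) (k : ZMod 2)
  deg_le h := by rw [natCast_zmod_two_congr h]
  one_mem := by simpa using CliffordAlgebra.one_le_evenOdd_zero (0 : QuadraticForm ℂ (OddLabel N → ℂ)) 
  mul_mem hx hy := by
    rw [Nat.cast_add]
    exact CliffordAlgebra.evenOdd_mul_le _ _ _ (Submodule.mul_mem_mul hx hy)
  comm hx hy := grassmann_comm hx hy

theorem involute_of_mem {N k : ℕ} {x : Grassmann N}
    (hx : x ∈ (deg k : Submodule ℂ (Grassmann N))) :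
    CliffordAlgebra.involute x = sg k • x := by
  rcases Nat.even_or_odd k with h | h
  · rw [CliffordAlgebra.involute_eq_of_mem_even, sg, h.neg_one_pow, one_smul]
    have := deg_le (show Even k ↔ Even 0 by simp [h]) hx
    exact_mod_cast this
  · rw [CliffordAlgebra.involute_eq_of_mem_odd, sg, h.neg_one_pow, neg_smul, one_smul]
    have := deg_le (show Even k ↔ Even 1 by simpa using h) hx
    exact_mod_cast this

/-- Phrased with the grade involution instead of a sign, the Leibniz rule needs no homogeneity and
can be proved by induction on left multiplication by generators. -/
theorem grassmann_deriv_mul {N : ℕ} (i : OddLabel N) (x y : Grassmann N) :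
    Grassmann.deriv N i (x * y) = Grassmann.deriv N i x * y
      + CliffordAlgebra.involute x * Grassmann.deriv N i y := by
  induction x using CliffordAlgebra.left_induction with
  | algebraMap r => simp [Grassmann.deriv, ← Algebra.smul_def]
  | add x y hx hy => simp only [add_mul, map_add, hx, hy]; abel
  | ι_mul x m hx =>
    simp only [Grassmann.deriv] at hx ⊢
    rw [mul_assoc, CliffordAlgebra.contractLeft_ι_mul, hx, CliffordAlgebra.contractLeft_ι_mul,
      map_mul, CliffordAlgebra.involute_ι]
    noncomm_ring

theorem grassmann_deriv_deg {N : ℕ} (i : OddLabel N) {k : ℕ} {x : Grassmann N}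
    (hx : x ∈ (deg k : Submodule ℂ (Grassmann N))) :
    Grassmann.deriv N i x ∈ (deg (k + 1) : Submodule ℂ (Grassmann N)) := by
  -- The derivative lowers word length by one. Its parity is recorded as `n + 1`, which agrees with
  -- `n - 1` modulo two and makes sense for the empty word too.
  have key : ∀ (n : ℕ) (y : Grassmann N), y ∈ LinearMap.range (CliffordAlgebra.ι
      (0 : QuadraticForm ℂ (OddLabel N → ℂ))) ^ n →
      Grassmann.deriv N i y ∈ (deg (n + 1) : Submodule ℂ (Grassmann N)) := by
    intro n y hy
    induction hy using Submodule.pow_induction_on_left' with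
    | algebraMap r => simp [Grassmann.deriv]
    | add x y i hx hy ihx ihy => rw [map_add]; exact Submodule.add_mem _ ihx ihy
    | mem_mul m hm n x hx ih =>
      obtain ⟨v, rfl⟩ := hm
      simp only [Grassmann.deriv] at ih ⊢
      rw [CliffordAlgebra.contractLeft_ι_mul]
      have hv : CliffordAlgebra.ι (0 : QuadraticForm ℂ (OddLabel N → ℂ)) v
          ∈ (deg 1 : Submodule ℂ (Grassmann N)) := by
        have := CliffordAlgebra.ι_mem_evenOdd_one (0 : QuadraticForm ℂ (OddLabel N → ℂ)) v
        exact_mod_cast this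
      refine Submodule.sub_mem _ (Submodule.smul_mem _ _ ?_) (deg_of (mul_mem hv ih))
      have hx' : x ∈ (deg n : Submodule ℂ (Grassmann N)) :=
        Submodule.mem_iSup_of_mem (⟨n, rfl⟩ : {n' : ℕ // (n' : ZMod 2) = (n : ZMod 2)}) hx
      exact deg_of hx'
  change x ∈ CliffordAlgebra.evenOdd _ _ at hx
  unfold CliffordAlgebra.evenOdd at hx
  induction hx using Submodule.iSup_induction' with
  | zero => simp
  | add x y _ _ ihx ihy => rw [map_add]; exact Submodule.add_mem _ ihx ihy
  | mem n y hy =>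
    have h := key _ y hy
    have hn : ((n.1 + 1 : ℕ) : ZMod 2) = ((k + 1 : ℕ) : ZMod 2) := by
      push_cast; rw [n.2]
    change _ ∈ CliffordAlgebra.evenOdd _ _ at h
    change _ ∈ CliffordAlgebra.evenOdd _ _
    rwa [hn] at h

theorem smooth_deriv_mul {U : TopologicalSpace.Opens Body} (m : Fin 10) (f g : Smooth U) :
    Smooth.partialDeriv U m (f * g)
      = Smooth.partialDeriv U m f * g + f * Smooth.partialDeriv U m g := by
  ext x
  have hf : DifferentiableAt ℝ (extendZero U f) (x : Body) := (f.2 x).differentiableAt (by simp)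
  have hg : DifferentiableAt ℝ (extendZero U g) (x : Body) := (g.2 x).differentiableAt (by simp)
  have h := (extendZero_eventuallyEq U (f * g : Smooth U)
    (extendZero U f * extendZero U g) (fun y => by simp [extendZero_coe]) x).fderiv_eq (𝕜 := ℝ)
  rw [fderiv_mul hf hg] at h
  have h2 := congrArg (fun L => L (EuclideanSpace.single m 1)) h
  simp only [add_apply, smul_apply, extendZero_coe,
    smul_eq_mul] at h2
  change fderiv ℝ (extendZero U ((f * g : Smooth U) : U → ℂ)) (x : Body)
      (EuclideanSpace.single m 1)
    = fderiv ℝ (extendZero U f) (x : Body) (EuclideanSpace.single m 1) * (g : U → ℂ) x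
      + (f : U → ℂ) x * fderiv ℝ (extendZero U g) (x : Body) (EuclideanSpace.single m 1)
  rw [h2]
  ring

variable {U : TopologicalSpace.Opens Body} {N : ℕ}

instance : SuperCommAlgebra (Matter U N) := inferInstance
instance : SuperCommAlgebra (Target U N) := inferInstance

set_option maxHeartbeats 1000000 in
theorem matter_pd_leibniz (i : Idx) {k : ℕ} {x : Matter U N} (y : Matter U N)
    (hx : x ∈ (deg k : Submodule ℂ (Matter U N))) :
    Matter.pd i (x * y) = Matter.pd i x * y + sg (par i * k) • (x * Matter.pd i y) := by
  rcases i with m | μ | μ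
  · simp only [par, zero_mul, pow_zero, one_smul]
    exact lTensor_leibniz (smooth_deriv_mul m) x y
  · exact rTensor_leibniz (i := 1) (fun y hx => by
      rw [grassmann_deriv_mul, involute_of_mem hx, smul_mul_assoc, one_mul]) y hx
  · exact rTensor_leibniz (i := 1) (fun y hx => by
      rw [grassmann_deriv_mul, involute_of_mem hx, smul_mul_assoc, one_mul]) y hx

set_option maxHeartbeats 1000000 in
theorem matter_pd_deg (i : Idx) {k : ℕ} {x : Matter U N}
    (hx : x ∈ (deg k : Submodule ℂ (Matter U N))) :
    Matter.pd i x ∈ (deg (k + par i) : Submodule ℂ (Matter U N)) := by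
  rcases i with m | μ | μ
  · exact lTensor_deg _ hx
  · exact rTensor_deg (grassmann_deriv_deg _) hx
  · exact rTensor_deg (grassmann_deriv_deg _) hx

theorem matter_isPartialDerivs : IsPartialDerivs par (Matter.pd (U := U) (N := N)) where
  leibniz i _ _ y hx := matter_pd_leibniz i y hx
  map_deg i _ _ hx := matter_pd_deg i hx

theorem pderiv_leibniz (α : Fin 16 ⊕ Fin 16) (x y : Ghost) :
    (MvPolynomial.pderiv (R := ℂ) α).toLinearMap (x * y)
      = (MvPolynomial.pderiv (R := ℂ) α).toLinearMap x * y
        + x * (MvPolynomial.pderiv (R := ℂ) α).toLinearMap y := by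
  change MvPolynomial.pderiv α (x * y) = MvPolynomial.pderiv α x * y + x * MvPolynomial.pderiv α y
  rw [Derivation.leibniz, smul_eq_mul, smul_eq_mul]
  ring

set_option maxHeartbeats 1000000 in
theorem target_pd_leibniz (i : Coord) {k : ℕ} {x : Target U N} (y : Target U N)
    (hx : x ∈ (deg k : Submodule ℂ (Target U N))) :
    Target.pd i (x * y) = Target.pd i x * y + sg (cpar i * k) • (x * Target.pd i y) := by
  rcases i with M | α
  · exact rTensor_leibniz (i := par M) (fun y hx => matter_pd_leibniz M y hx) y hx
  · simp only [cpar, zero_mul, pow_zero, one_smul]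
    exact lTensor_leibniz (pderiv_leibniz α) x y

set_option maxHeartbeats 1000000 in
theorem target_pd_deg (i : Coord) {k : ℕ} {x : Target U N}
    (hx : x ∈ (deg k : Submodule ℂ (Target U N))) :
    Target.pd i x ∈ (deg (k + cpar i) : Submodule ℂ (Target U N)) := by
  rcases i with M | α
  · exact rTensor_deg (fun hx => matter_pd_deg M hx) hx
  · exact lTensor_deg _ hx

theorem target_isPartialDerivs : IsPartialDerivs cpar (Target.pd (U := U) (N := N)) where
  leibniz i _ _ y hx := target_pd_leibniz i y hx
  map_deg i _ _ hx := target_pd_deg i hx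

theorem up_mem_deg {k : ℕ} {x : Matter U N} (hx : x ∈ (deg k : Submodule ℂ (Matter U N))) :
    up x ∈ (deg k : Submodule ℂ (Target U N)) := tmul_mem_deg hx _

theorem lam_mem_deg (α : Fin 16) : lam α ∈ (deg 0 : Submodule ℂ (Target U N)) :=
  tmul_mem_deg one_mem _

theorem lamh_mem_deg (α : Fin 16) : lamh α ∈ (deg 0 : Submodule ℂ (Target U N)) :=
  tmul_mem_deg one_mem _

theorem pd_mat_up (M : Idx) (x : Matter U N) :
    Target.pd (mat M) (up x) = up (Matter.pd M x) := rfl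

theorem pd_gh_up (α : Fin 16 ⊕ Fin 16) (x : Matter U N) :
    Target.pd (Sum.inr α) (up x) = 0 := by
  change x ⊗ₜ (MvPolynomial.pderiv α (1 : Ghost)) = 0
  simp

theorem matter_pd_one (M : Idx) : Matter.pd M (1 : Matter U N) = 0 := by
  have h := matter_pd_leibniz M (1 : Matter U N) one_mem
  simpa using h

theorem pd_mat_lam (M : Idx) (α : Fin 16) : Target.pd (mat M) (lam α : Target U N) = 0 := by
  change Matter.pd M (1 : Matter U N) ⊗ₜ _ = 0
  rw [matter_pd_one, TensorProduct.zero_tmul]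

theorem pd_mat_lamh (M : Idx) (α : Fin 16) : Target.pd (mat M) (lamh α : Target U N) = 0 := by
  change Matter.pd M (1 : Matter U N) ⊗ₜ _ = 0
  rw [matter_pd_one, TensorProduct.zero_tmul]

theorem pd_gh_lam (α β : Fin 16) :
    Target.pd (gh α) (lam β : Target U N) = if α = β then 1 else 0 := by
  change (1 : Matter U N) ⊗ₜ (MvPolynomial.pderiv _ _) = _
  rw [MvPolynomial.pderiv_X]
  by_cases h : α = β
  · subst h; simp [Algebra.TensorProduct.one_def]
  · simp [h, Ne.symm h]

theorem pd_ghh_lamh (α β : Fin 16) :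
    Target.pd (ghh α) (lamh β : Target U N) = if α = β then 1 else 0 := by
  change (1 : Matter U N) ⊗ₜ (MvPolynomial.pderiv _ _) = _
  rw [MvPolynomial.pderiv_X]
  by_cases h : α = β
  · subst h; simp [Algebra.TensorProduct.one_def]
  · simp [h, Ne.symm h]

theorem pd_ghh_lam (α β : Fin 16) : Target.pd (ghh α) (lam β : Target U N) = 0 := by
  change (1 : Matter U N) ⊗ₜ (MvPolynomial.pderiv _ _) = _
  rw [MvPolynomial.pderiv_X]
  simp

theorem pd_gh_lamh (α β : Fin 16) : Target.pd (gh α) (lamh β : Target U N) = 0 := by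
  change (1 : Matter U N) ⊗ₜ (MvPolynomial.pderiv _ _) = _
  rw [MvPolynomial.pderiv_X]
  simp

theorem ev_up (l lh : Fin 16 → ℂ) (x : Matter U N) : ev l lh (up x : Target U N) = x := by
  simp [ev, up]

theorem ev_lam (l lh : Fin 16 → ℂ) (α : Fin 16) :
    ev l lh (lam α : Target U N) = algebraMap ℂ _ (l α) := by
  simp [ev, lam, Algebra.algebraMap_eq_smul_one]

theorem ev_lamh (l lh : Fin 16 → ℂ) (α : Fin 16) :
    ev l lh (lamh α : Target U N) = algebraMap ℂ _ (lh α) := by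
  simp [ev, lamh, Algebra.algebraMap_eq_smul_one]

section
variable {R : Type*} [Ring R] [Algebra ℂ R] [SuperCommAlgebra R]

theorem commute_of_even {k : ℕ} {x y : R} (hx : x ∈ deg 0) (hy : y ∈ deg k) : x * y = y * x := by
  rw [comm hx hy, zero_mul]; simp

theorem algebraMap_mem_deg (c : ℂ) : algebraMap ℂ R c ∈ deg 0 := by
  rw [Algebra.algebraMap_eq_smul_one]
  exact Submodule.smul_mem _ _ one_mem

theorem smul_one_comm (c : ℂ) (x : R) : x * algebraMap ℂ R c = c • x := by
  rw [← Algebra.commutes, Algebra.smul_def]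

end

theorem sum_coord {M : Type*} [AddCommMonoid M] (F : Coord → M) :
    ∑ i, F i = ∑ M, F (mat M) + ∑ s, F (Sum.inr s) :=
  Fintype.sum_sum_type F

theorem sum_idx {M : Type*} [AddCommMonoid M] (F : Idx → M) :
    ∑ i, F i = ∑ a, F (vec a) + ∑ s, F (Sum.inr s) :=
  Fintype.sum_sum_type F

@[simp] theorem cpar_mat (M : Idx) : cpar (mat M) = par M := rfl
@[simp] theorem cpar_inr (s : Fin 16 ⊕ Fin 16) : cpar (Sum.inr s) = 0 := rfl
@[simp] theorem par_vec (a : Fin 10) : par (vec a) = 0 := rfl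
@[simp] theorem par_inr (s : Fin 16 ⊕ Fin 16) : par (Sum.inr s) = 1 := rfl

theorem eta_symm (a b : Fin 10) : eta a b = eta b a := by
  by_cases h : a = b
  · rw [h]
  · simp [eta, h, Ne.symm h]

/-! ### Backgrounds over a general superspace -/

/-- Labels of all spinor directions: `s = (α, α̂)`. -/
abbrev Spin : Type := Fin 16 ⊕ Fin 16

/-- The eigenvalue of the generalized metric on spinors of each kind. -/
def chir : Spin → ℂ
  | Sum.inl _ => 1
  | Sum.inr _ => -1

/-- A superalgebra `T` of functions on the target space over the superalgebra `R` of functions on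
the matter superspace. -/
structure GhostExtension (R T : Type*) [Ring R] [Algebra ℂ R] [SuperCommAlgebra R]
    [Ring T] [Algebra ℂ T] [SuperCommAlgebra T] where
  mpd : Idx → R →ₗ[ℂ] R
  pd : Coord → T →ₗ[ℂ] T
  up : R →ₐ[ℂ] T
  lam : Spin → T
  ev : (Spin → ℂ) → T →ₐ[ℂ] R
  mpd_derivs : IsPartialDerivs par mpd
  pd_derivs : IsPartialDerivs cpar pd
  up_deg : ∀ {k : ℕ} {x : R}, x ∈ deg k → up x ∈ deg k
  lam_deg : ∀ s, lam s ∈ deg 0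
  lam_comm : ∀ s x, lam s * x = x * lam s
  pd_mat_up : ∀ M x, pd (mat M) (up x) = up (mpd M x)
  pd_gh_up : ∀ s x, pd (Sum.inr s) (up x) = 0
  pd_mat_lam : ∀ M s, pd (mat M) (lam s) = 0
  pd_gh_lam : ∀ s t, pd (Sum.inr s) (lam t) = if s = t then 1 else 0
  ev_up : ∀ l x, ev l (up x) = x
  ev_lam : ∀ l s, ev l (lam s) = algebraMap ℂ R (l s)

/-- The background fields with the two kinds of spinor labels combined. -/
structure Fields (R : Type*) [Ring R] [Algebra ℂ R] [SuperCommAlgebra R] where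
  E : Idx → Idx → R
  Einv : Idx → Idx → R
  B : Idx → Idx → R
  Om : Idx → Idx → Idx → R
  P : Spin → Spin → R
  K : Spin → Spin → Spin → R
  S : Spin → Spin → Spin → Spin → R
  E_deg : ∀ A M, E A M ∈ deg (par A + par M)
  Einv_deg : ∀ M A, Einv M A ∈ deg (par M + par A)
  E_mul_Einv : ∀ A B, ∑ M, E A M * Einv M B = if A = B then 1 else 0
  Einv_mul_E : ∀ M M', ∑ A, Einv M A * E A M' = if M = M' then 1 else 0
  B_deg : ∀ M M', B M M' ∈ deg (par M + par M')
  B_antisymm : ∀ M M', B M M' = -(sg (par M * par M') • B M' M)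
  Om_deg : ∀ M A B, Om M A B ∈ deg (par M + par A + par B)
  Om_vec_left : ∀ M a B, Om M (vec a) B = 0
  Om_vec_right : ∀ M A b, Om M A (vec b) = 0
  Om_chir : ∀ M s t, chir s ≠ chir t → Om M (Sum.inr s) (Sum.inr t) = 0
  P_deg : ∀ s t, P s t ∈ deg 0
  P_antisymm : ∀ s t, P s t = -P t s
  P_chir : ∀ s t, chir s = chir t → P s t = 0
  K_deg : ∀ t s g, K t s g ∈ deg 1
  K_chir : ∀ t s g, chir s = chir g → K t s g = 0
  K_chir' : ∀ t s g, chir t ≠ chir g → K t s g = 0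
  S_deg : ∀ t t' g g', S t t' g g' ∈ deg 0
  S_symm : ∀ t t' g g', S t t' g g' = S t t' g' g
  S_chir : ∀ t t' g g', chir g = chir g' → S t t' g g' = 0
  S_chir' : ∀ t t' g g', chir t = chir t' → S t t' g g' = 0

section

variable {R T : Type*} [Ring R] [Algebra ℂ R] [SuperCommAlgebra R]
    [Ring T] [Algebra ℂ T] [SuperCommAlgebra T]

namespace Fields

variable (X : GhostExtension R T) (F : Fields R)

/-- The vielbein, extended by the identity to the ghost directions. -/
def vielbein : Matrix Coord Coord T := Matrix.of fun
  | Sum.inl A, Sum.inl M => X.up (F.E A M)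
  | Sum.inl _, Sum.inr _ => 0
  | Sum.inr _, Sum.inl _ => 0
  | Sum.inr α, Sum.inr β => if α = β then 1 else 0

/-- The inverse vielbein, extended by the identity to the ghost directions. -/
def vielbeinInv : Matrix Coord Coord T := Matrix.of fun
  | Sum.inl A, Sum.inl M => X.up (F.Einv A M)
  | Sum.inl _, Sum.inr _ => 0
  | Sum.inr _, Sum.inl _ => 0
  | Sum.inr α, Sum.inr β => if α = β then 1 else 0

/-- The ghost components `λ^s Ω_{Ms}^g` of the connection. -/
def conn (M : Idx) (g : Spin) : T := ∑ t, X.lam t * X.up (F.Om M (Sum.inr t) (Sum.inr g))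

/-- The coefficients linear in the ghosts, `λ^t K_t^{sg}`. -/
def lamK (s g : Spin) : T := ∑ t, X.lam t * X.up (F.K t s g)

/-- The coefficients quadratic in the ghosts, `λ^t λ^t' S_{tt'}^{gg'}`. -/
def lamS (g g' : Spin) : T := ∑ t, ∑ t', X.lam t * X.lam t' * X.up (F.S t t' g g')

/-- The connection as a nilpotent matrix. -/
def connMat : Matrix Coord Coord T := Matrix.of fun
  | Sum.inl M, Sum.inr g => F.conn X M g
  | Sum.inl _, Sum.inl _ => 0
  | Sum.inr _, _ => 0

/-- The two-form as a matrix. -/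
def Bmat : Matrix Coord Coord T := Matrix.of fun
  | Sum.inl M, Sum.inl M' => X.up (F.B M M')
  | Sum.inl _, Sum.inr _ => 0
  | Sum.inr _, _ => 0

@[simp] theorem vielbein_mat_mat (A M : Idx) : F.vielbein X (mat A) (mat M) = X.up (F.E A M) := rfl
@[simp] theorem vielbein_mat_gh (A : Idx) (g : Spin) :
    F.vielbein X (mat A) (Sum.inr g) = 0 := rfl
@[simp] theorem vielbein_gh_mat (g : Spin) (M : Idx) :
    F.vielbein X (Sum.inr g) (mat M) = 0 := rfl
@[simp] theorem vielbein_gh_gh (g g' : Spin) :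
    F.vielbein X (Sum.inr g) (Sum.inr g') = if g = g' then 1 else 0 := rfl
@[simp] theorem vielbeinInv_mat_mat (M A : Idx) :
    F.vielbeinInv X (mat M) (mat A) = X.up (F.Einv M A) := rfl
@[simp] theorem vielbeinInv_mat_gh (M : Idx) (g : Spin) :
    F.vielbeinInv X (mat M) (Sum.inr g) = 0 := rfl
@[simp] theorem vielbeinInv_gh_mat (g : Spin) (M : Idx) :
    F.vielbeinInv X (Sum.inr g) (mat M) = 0 := rfl
@[simp] theorem vielbeinInv_gh_gh (g g' : Spin) :
    F.vielbeinInv X (Sum.inr g) (Sum.inr g') = if g = g' then 1 else 0 := rfl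
@[simp] theorem connMat_mat_mat (M M' : Idx) : F.connMat X (mat M) (mat M') = 0 := rfl
@[simp] theorem connMat_mat_gh (M : Idx) (g : Spin) :
    F.connMat X (mat M) (Sum.inr g) = F.conn X M g := rfl
@[simp] theorem connMat_gh (g : Spin) (j : Coord) : F.connMat X (Sum.inr g) j = 0 := rfl
@[simp] theorem Bmat_mat_mat (M M' : Idx) : F.Bmat X (mat M) (mat M') = X.up (F.B M M') := rfl
@[simp] theorem Bmat_mat_gh (M : Idx) (g : Spin) : F.Bmat X (mat M) (Sum.inr g) = 0 := rfl
@[simp] theorem Bmat_gh (g : Spin) (j : Coord) : F.Bmat X (Sum.inr g) j = 0 := rfl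

/-- The connection matrix sends matter rows to ghost columns and has no ghost rows, so two
applications give zero. Hence $1\pm N$ are mutually inverse, which gives the dual coframe in closed
form. -/
theorem connMat_mul_self : F.connMat X * F.connMat X = 0 := by
  ext i j
  rw [Matrix.mul_apply, Matrix.zero_apply]
  refine Finset.sum_eq_zero fun k _ => ?_
  rcases i with i | i <;> rcases k with k | k <;> rcases j with j | j <;> simp [connMat]

theorem vielbein_mul_inv : F.vielbein X * F.vielbeinInv X = 1 := by
  ext i j
  rw [Matrix.mul_apply, Fintype.sum_sum_type]
  rcases i with i | i <;> rcases j with j | j <;>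
    simp [vielbein, vielbeinInv, Matrix.one_apply, ← map_mul, ← map_sum, F.E_mul_Einv]

theorem vielbeinInv_mul : F.vielbeinInv X * F.vielbein X = 1 := by
  ext i j
  rw [Matrix.mul_apply, Fintype.sum_sum_type]
  rcases i with i | i <;> rcases j with j | j <;>
    simp [vielbein, vielbeinInv, Matrix.one_apply, ← map_mul, ← map_sum, F.Einv_mul_E]

/-- The frame of horizontal lifts of `E_A` and of the ghost directions. -/
def frame : Matrix Coord Coord T := F.vielbein X * (1 - F.connMat X)

/-- The coframe dual to `frame`. -/
def coframe : Matrix Coord Coord T := (1 + F.connMat X) * F.vielbeinInv X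

theorem frame_mul_coframe : F.frame X * F.coframe X = 1 := by
  have h : (1 - F.connMat X) * (1 + F.connMat X) = 1 := by
    have := F.connMat_mul_self X
    noncomm_ring
    simp [this]
  calc F.frame X * F.coframe X
      = F.vielbein X * ((1 - F.connMat X) * (1 + F.connMat X)) * F.vielbeinInv X := by
        simp only [frame, coframe, mul_assoc]
    _ = 1 := by rw [h, mul_one, vielbein_mul_inv]

theorem coframe_mul_frame : F.coframe X * F.frame X = 1 := by
  have h : (1 + F.connMat X) * (1 - F.connMat X) = 1 := by
    have := F.connMat_mul_self X
    noncomm_ring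
    simp [this]
  calc F.coframe X * F.frame X
      = (1 + F.connMat X) * (F.vielbeinInv X * F.vielbein X) * (1 - F.connMat X) := by
        simp only [frame, coframe, mul_assoc]
    _ = 1 := by rw [vielbeinInv_mul, mul_one, h]

theorem conn_deg (M : Idx) (g : Spin) : F.conn X M g ∈ deg (par M) :=
  Submodule.sum_mem _ fun _ _ => deg_of (mul_mem (X.lam_deg _) (X.up_deg (F.Om_deg M _ _)))
    (by simp [Nat.even_add])

theorem lamK_deg (s g : Spin) : F.lamK X s g ∈ deg 1 :=
  Submodule.sum_mem _ fun _ _ => deg_of (mul_mem (X.lam_deg _) (X.up_deg (F.K_deg _ s g)))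

theorem lamS_deg (g g' : Spin) : F.lamS X g g' ∈ deg 0 :=
  Submodule.sum_mem _ fun _ _ => Submodule.sum_mem _ fun _ _ => deg_of (mul_mem
    (mul_mem (X.lam_deg _) (X.lam_deg _)) (X.up_deg (F.S_deg _ _ g g')))

theorem connMat_isHom : IsHom cpar 0 (F.connMat X) := by
  intro i j
  rcases i with i | i <;> rcases j with j | j
  · exact Submodule.zero_mem _
  · exact F.conn_deg X i j
  all_goals exact Submodule.zero_mem _

theorem vielbein_isHom : IsHom cpar 0 (F.vielbein X) := by
  intro i j
  rcases i with i | i <;> rcases j with j | j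
  · exact X.up_deg (F.E_deg i j)
  · exact Submodule.zero_mem _
  · exact Submodule.zero_mem _
  · simp only [vielbein, Matrix.of_apply]
    split_ifs
    · exact one_mem
    · exact Submodule.zero_mem _

theorem vielbeinInv_isHom : IsHom cpar 0 (F.vielbeinInv X) := by
  intro i j
  rcases i with i | i <;> rcases j with j | j
  · exact X.up_deg (F.Einv_deg i j)
  · exact Submodule.zero_mem _
  · exact Submodule.zero_mem _
  · simp only [vielbeinInv, Matrix.of_apply]
    split_ifs
    · exact one_mem
    · exact Submodule.zero_mem _

theorem frame_isHom : IsHom cpar 0 (F.frame X) :=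
  (F.vielbein_isHom X).mul (IsHom.one.sub (F.connMat_isHom X))

theorem coframe_isHom : IsHom cpar 0 (F.coframe X) :=
  (IsHom.one.add (F.connMat_isHom X)).mul (F.vielbeinInv_isHom X)

theorem Bmat_isHom : IsHom cpar 0 (F.Bmat X) := by
  intro i j
  rcases i with i | i <;> rcases j with j | j
  · exact X.up_deg (F.B_deg i j)
  all_goals exact Submodule.zero_mem _

theorem tdd_Bmat : tdd cpar (F.Bmat X) = -F.Bmat X := by
  ext i j
  rcases i with i | i <;> rcases j with j | j
  · simp only [tdd, Bmat, Matrix.of_apply, Matrix.neg_apply]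
    rw [F.B_antisymm i j, map_neg, map_smul, neg_neg]
    rfl
  all_goals simp [tdd, Bmat]

theorem frame_mat_mat (A M : Idx) : F.frame X (mat A) (mat M) = X.up (F.E A M) := by
  simp [frame, Matrix.mul_apply, mul_sub, Matrix.one_apply]

theorem frame_mat_gh (A : Idx) (g : Spin) :
    F.frame X (mat A) (Sum.inr g) = -∑ M, X.up (F.E A M) * F.conn X M g := by
  simp [frame, Matrix.mul_apply, sum_coord, Matrix.one_apply, -Fintype.sum_sum_type]

theorem frame_gh_mat (s : Spin) (M : Idx) : F.frame X (Sum.inr s) (mat M) = 0 := by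
  simp [frame, Matrix.mul_apply, sum_coord, Matrix.one_apply, -Fintype.sum_sum_type]

theorem frame_gh_gh (s g : Spin) :
    F.frame X (Sum.inr s) (Sum.inr g) = if s = g then 1 else 0 := by
  simp [frame, Matrix.mul_apply, sum_coord, Matrix.one_apply, -Fintype.sum_sum_type]

theorem coframe_mat_mat (M A : Idx) : F.coframe X (mat M) (mat A) = X.up (F.Einv M A) := by
  simp [coframe, Matrix.mul_apply, sum_coord, Matrix.one_apply, -Fintype.sum_sum_type]

theorem coframe_mat_gh (M : Idx) (g : Spin) :
    F.coframe X (mat M) (Sum.inr g) = F.conn X M g := by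
  simp [coframe, Matrix.mul_apply, sum_coord, Matrix.one_apply, -Fintype.sum_sum_type]

theorem coframe_gh_mat (s : Spin) (M : Idx) : F.coframe X (Sum.inr s) (mat M) = 0 := by
  simp [coframe, Matrix.mul_apply, Matrix.one_apply, -Fintype.sum_sum_type]

theorem coframe_gh_gh (s g : Spin) :
    F.coframe X (Sum.inr s) (Sum.inr g) = if s = g then 1 else 0 := by
  simp [coframe, Matrix.mul_apply, Matrix.one_apply, -Fintype.sum_sum_type]

/-! ### The generalized metric in the flat frame -/

/-- The eigenvalue of the generalized metric on each flat direction. -/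
def flatSign : Coord → ℂ
  | Sum.inl (Sum.inl _) => 0
  | Sum.inl (Sum.inr s) => chir s
  | Sum.inr s => chir s

@[simp] theorem flatSign_vec (a : Fin 10) : flatSign (mat (vec a)) = 0 := rfl
@[simp] theorem flatSign_spin (s : Spin) : flatSign (mat (Sum.inr s)) = chir s := rfl
@[simp] theorem flatSign_gh (s : Spin) : flatSign (Sum.inr s) = chir s := rfl

variable (T) in
/-- The flat components of `𝔸_i^j`. -/
def flatDU : Matrix Coord Coord T := Matrix.diagonal fun i => algebraMap ℂ T (flatSign i)

variable (T) in
/-- The flat components of `𝔸_{ij}`. -/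
def flatDD : Matrix Coord Coord T := Matrix.of fun
  | Sum.inl (Sum.inl a), Sum.inl (Sum.inl b) => algebraMap ℂ T (eta a b)
  | Sum.inl (Sum.inl _), Sum.inl (Sum.inr _) => 0
  | Sum.inl (Sum.inl _), Sum.inr _ => 0
  | Sum.inl (Sum.inr _), _ => 0
  | Sum.inr _, _ => 0

/-- The flat components of `𝔸^{ij}`. -/
def flatUU : Matrix Coord Coord T := Matrix.of fun
  | Sum.inl (Sum.inl a), Sum.inl (Sum.inl b) => algebraMap ℂ T (eta a b)
  | Sum.inl (Sum.inl _), Sum.inl (Sum.inr _) => 0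
  | Sum.inl (Sum.inl _), Sum.inr _ => 0
  | Sum.inl (Sum.inr _), Sum.inl (Sum.inl _) => 0
  | Sum.inl (Sum.inr s), Sum.inl (Sum.inr t) => X.up (F.P s t)
  | Sum.inl (Sum.inr s), Sum.inr g => F.lamK X s g
  | Sum.inr _, Sum.inl (Sum.inl _) => 0
  | Sum.inr g, Sum.inl (Sum.inr s) => -F.lamK X s g
  | Sum.inr g, Sum.inr g' => F.lamS X g g'

@[simp] theorem flatUU_vec_vec (a b : Fin 10) :
    F.flatUU X (mat (vec a)) (mat (vec b)) = algebraMap ℂ T (eta a b) := rfl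
@[simp] theorem flatUU_vec_spin (a : Fin 10) (t : Spin) :
    F.flatUU X (mat (vec a)) (mat (Sum.inr t)) = 0 := rfl
@[simp] theorem flatUU_vec_gh (a : Fin 10) (g : Spin) :
    F.flatUU X (mat (vec a)) (Sum.inr g) = 0 := rfl
@[simp] theorem flatUU_spin_vec (s : Spin) (b : Fin 10) :
    F.flatUU X (mat (Sum.inr s)) (mat (vec b)) = 0 := rfl
@[simp] theorem flatUU_spin_spin (s t : Spin) :
    F.flatUU X (mat (Sum.inr s)) (mat (Sum.inr t)) = X.up (F.P s t) := rfl
@[simp] theorem flatUU_spin_gh (s g : Spin) :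
    F.flatUU X (mat (Sum.inr s)) (Sum.inr g) = F.lamK X s g := rfl
@[simp] theorem flatUU_gh_vec (g : Spin) (b : Fin 10) :
    F.flatUU X (Sum.inr g) (mat (vec b)) = 0 := rfl
@[simp] theorem flatUU_gh_spin (g s : Spin) :
    F.flatUU X (Sum.inr g) (mat (Sum.inr s)) = -F.lamK X s g := rfl
@[simp] theorem flatUU_gh_gh (g g' : Spin) :
    F.flatUU X (Sum.inr g) (Sum.inr g') = F.lamS X g g' := rfl
@[simp] theorem flatDD_vec_vec (a b : Fin 10) :
    flatDD T (mat (vec a)) (mat (vec b)) = algebraMap ℂ T (eta a b) := rfl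
@[simp] theorem flatDD_vec_spin (a : Fin 10) (t : Spin) :
    flatDD T (mat (vec a)) (mat (Sum.inr t)) = 0 := rfl
@[simp] theorem flatDD_mat_gh (A : Idx) (g : Spin) :
    flatDD T (mat A) (Sum.inr g) = 0 := by rcases A with a | s <;> rfl
@[simp] theorem flatDD_spin (s : Spin) (j : Coord) :
    flatDD T (mat (Sum.inr s)) j = 0 := rfl
@[simp] theorem flatDD_gh (g : Spin) (j : Coord) : flatDD T (Sum.inr g) j = 0 := rfl

theorem flatDU_isHom : IsHom cpar 0 (flatDU T) := by
  intro i j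
  by_cases h : i = j
  · subst h
    rw [flatDU, Matrix.diagonal_apply_eq]
    exact deg_of (algebraMap_mem_deg _)
  · rw [flatDU, Matrix.diagonal_apply_ne _ h]; exact Submodule.zero_mem _

theorem flatDD_isHom : IsHom cpar 0 (flatDD T) := by
  rintro ((i | i) | i) ((j | j) | j)
  · exact algebraMap_mem_deg _
  all_goals exact Submodule.zero_mem _

theorem tdd_flatDD : tdd cpar (flatDD T) = flatDD T := by
  ext i j
  rcases i with (i | i) | i <;> rcases j with (j | j) | j <;>
    simp [tdd, flatDD, cpar, par, eta_symm]

theorem flatUU_isHom : IsHom cpar 0 (F.flatUU X) := by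
  rintro ((i | i) | i) ((j | j) | j)
  · exact algebraMap_mem_deg _
  iterate 3 exact Submodule.zero_mem _
  · exact deg_of (X.up_deg (F.P_deg i j)) (by simp [cpar, par])
  · exact F.lamK_deg X i j
  · exact Submodule.zero_mem _
  · exact Submodule.neg_mem _ (F.lamK_deg X j i)
  · exact F.lamS_deg X i j

theorem lamS_symm (g g' : Spin) : F.lamS X g g' = F.lamS X g' g := by
  simp only [lamS]
  refine Finset.sum_congr rfl fun t _ => Finset.sum_congr rfl fun t' _ => ?_
  rw [F.S_symm]

theorem tuu_flatUU : tuu cpar (F.flatUU X) = F.flatUU X := by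
  -- For two spinor labels the exponent in `tuu` is `1 * 1 + 1 + 1`. This sign is what matches the
  -- antisymmetry of `P`.
  have h3 : sg 3 = -1 := by norm_num [sg]
  ext i j
  rcases i with (i | i) | i <;> rcases j with (j | j) | j
  all_goals simp [tuu, flatUU, cpar, par, eta_symm, h3]
  · rw [F.P_antisymm i j, map_neg]
  · rw [F.lamS_symm]

end Fields
end

/-! ### Block form of the generalized metric without the two-form -/

section

variable {R T : Type*} [Ring R] [Algebra ℂ R] [SuperCommAlgebra R]
    [Ring T] [Algebra ℂ T] [SuperCommAlgebra T]

theorem tuu_mul_uu_du {ι : Type*} [Fintype ι] {p : ι → ℕ} {u e : Matrix ι ι R}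
    (hu : IsHom p 0 u) (he : IsHom p 0 e) : tuu p (u * e) = st0 p e * tuu p u := by
  ext i j
  simp only [st0, tuu, Matrix.of_apply, Matrix.mul_apply, Finset.smul_sum, smul_mul_assoc,
    mul_smul_comm, smul_smul, sg_mul]
  refine Finset.sum_congr rfl fun m _ => ?_
  rw [comm (hu j m) (he m i), smul_smul, sg_mul]
  congr 1
  exact sg_congr

theorem IsHom.tuu {ι : Type*} {p : ι → ℕ} {k : ℕ} {u : Matrix ι ι R}
    (hu : IsHom p k u) : IsHom p k (tuu p u) := fun i j =>
  Submodule.smul_mem _ _ (deg_of (hu j i))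

/-- Conjugation by an even frame commutes with graded transposition, so graded symmetry need only be
checked in the flat frame. -/
theorem tuu_conj {ι : Type*} [Fintype ι] [DecidableEq ι] {p : ι → ℕ} {u e : Matrix ι ι R}
    (hu : IsHom p 0 u) (he : IsHom p 0 e) :
    tuu p (st0 p e * u * e) = st0 p e * tuu p u * e := by
  rw [tuu_mul_uu_du (he.st0.mul hu) he, mul_assoc]
  congr 1
  have h := tuu_mul_uu_du hu.tuu he
  rw [tuu_tuu] at h
  rw [← h, tuu_tuu]

namespace Fields

variable (X : GhostExtension R T) (F : Fields R)

/-- The matrix `𝔸^{ij}` in the case of vanishing connections. -/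
def baseUU : Matrix Coord Coord T := st0 cpar (F.vielbein X) * F.flatUU X * F.vielbein X

/-- The matrix `𝔸^{ij}`. -/
def metricUU : Matrix Coord Coord T := st0 cpar (F.frame X) * F.flatUU X * F.frame X

/-- The `B`-independent part of the matrix `𝔸_i^j`. -/
def metricDU : Matrix Coord Coord T := F.coframe X * flatDU T * F.frame X

/-- The matrix `𝔸^{MN}`. -/
def metricUp (M M' : Idx) : R :=
  (∑ a, ∑ b, (sg (par M) * eta a b) • (F.E (vec a) M * F.E (vec b) M'))
    + ∑ s, ∑ t, F.E (Sum.inr s) M * F.E (Sum.inr t) M' * F.P s t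

theorem baseUU_mat_mat (M M' : Idx) : F.baseUU X (mat M) (mat M') = X.up (F.metricUp M M') := by
  have h1 : sg (par M + par M) = 1 := by rw [sg_congr (n := 0)]; simp
  have hv : ∀ b, (st0 cpar (F.vielbein X) * F.flatUU X) (mat M) (mat (vec b))
      = ∑ a, (sg (par M) * eta a b) • X.up (F.E (vec a) M) := fun b => by
    simp [Matrix.mul_apply, sum_coord, sum_idx, st0, -Fintype.sum_sum_type, smul_one_comm, smul_smul]
  have hs : ∀ t, (st0 cpar (F.vielbein X) * F.flatUU X) (mat M) (mat (Sum.inr t))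
      = ∑ s, X.up (F.E (Sum.inr s) M) * X.up (F.P s t) := fun t => by
    simp [Matrix.mul_apply, sum_coord, sum_idx, st0, -Fintype.sum_sum_type, h1]
  rw [baseUU, Matrix.mul_apply, sum_coord, sum_idx]
  simp only [hv, hs, vielbein_mat_mat, vielbein_gh_mat, mul_zero, Finset.sum_const_zero, add_zero]
  simp only [metricUp, map_add, map_sum, map_mul, map_smul, Finset.sum_mul, smul_mul_assoc]
  rw [Finset.sum_comm, Finset.sum_comm (γ := Spin)]
  congr 1
  refine Finset.sum_congr rfl fun s _ => Finset.sum_congr rfl fun t _ => ?_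
  rw [mul_assoc, mul_assoc, commute_of_even (X.up_deg (F.P_deg s t)) (X.up_deg (F.E_deg _ M'))]

theorem baseUU_mat_gh (M : Idx) (g : Spin) :
    F.baseUU X (mat M) (Sum.inr g)
      = -(sg (par M) • ∑ s, F.lamK X s g * X.up (F.E (Sum.inr s) M)) := by
  have h1 : sg (par M + par M) = 1 := by rw [sg_congr (n := 0)]; simp
  simp [baseUU, Matrix.mul_apply, sum_coord, sum_idx, st0, -Fintype.sum_sum_type, h1, Finset.smul_sum,
    ← Finset.sum_neg_distrib]
  refine Finset.sum_congr rfl fun s _ => ?_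
  rw [comm (X.up_deg (F.E_deg (Sum.inr s) M)) (F.lamK_deg X s g), ← neg_smul, neg_sg, par_inr]
  congr 1
  exact sg_congr

theorem tuu_baseUU : tuu cpar (F.baseUU X) = F.baseUU X := by
  rw [baseUU, tuu_conj (F.flatUU_isHom X) (F.vielbein_isHom X), tuu_flatUU]

theorem baseUU_gh_gh (g g' : Spin) :
    F.baseUU X (Sum.inr g) (Sum.inr g') = F.lamS X g g' := by
  simp [baseUU, Matrix.mul_apply, sum_coord, st0, -Fintype.sum_sum_type]

/-- The frame factors into vielbein and $1-N$, so the dependence on the connection is at most linear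
on each side. The four terms yield the connection terms of the prescribed blocks. -/
theorem metricUU_eq : F.metricUU X
    = F.baseUU X - st0 cpar (F.connMat X) * F.baseUU X - F.baseUU X * F.connMat X
      + st0 cpar (F.connMat X) * F.baseUU X * F.connMat X := by
  have h : st0 cpar (1 - F.connMat X) = 1 - st0 cpar (F.connMat X) := by
    nth_rewrite 2 [← st0_one (p := cpar)]
    ext i j; simp [st0, smul_sub]
  rw [metricUU, frame, st0_mul (F.vielbein_isHom X) (IsHom.one.sub (F.connMat_isHom X)), h, baseUU]
  noncomm_ring

theorem tuu_metricUU : tuu cpar (F.metricUU X) = F.metricUU X := by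
  rw [metricUU, tuu_conj (F.flatUU_isHom X) (F.frame_isHom X), tuu_flatUU]

theorem metricUU_isHom : IsHom cpar 0 (F.metricUU X) :=
  ((F.frame_isHom X).st0.mul (F.flatUU_isHom X)).mul (F.frame_isHom X)

theorem metricUU_mat_mat (M M' : Idx) :
    F.metricUU X (mat M) (mat M') = X.up (F.metricUp M M') := by
  rw [metricUU_eq]
  simp [-Fintype.sum_sum_type, Matrix.mul_apply, st0, sum_coord, baseUU_mat_mat]

theorem metricUU_mat_gh (M : Idx) (g : Spin) : F.metricUU X (mat M) (Sum.inr g)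
    = -(∑ M', X.up (F.metricUp M M') * F.conn X M' g)
      - sg (par M) • ∑ s, F.lamK X s g * X.up (F.E (Sum.inr s) M) := by
  rw [metricUU_eq]
  simp [-Fintype.sum_sum_type, Matrix.mul_apply, st0, sum_coord, baseUU_mat_mat, baseUU_mat_gh]
  abel

theorem metricUU_gh_gh (g g' : Spin) : F.metricUU X (Sum.inr g) (Sum.inr g')
    = (∑ M, ∑ M', F.conn X M g * X.up (F.metricUp M M') * F.conn X M' g')
      + (∑ s, ∑ M, F.lamK X s g * X.up (F.E (Sum.inr s) M) * F.conn X M g')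
      + (∑ s, ∑ M, F.lamK X s g' * X.up (F.E (Sum.inr s) M) * F.conn X M g)
      + F.lamS X g g' := by
  have hs := congrFun (congrFun (F.tuu_baseUU X) (Sum.inr g))
  -- Ghost rows are obtained from ghost columns through graded symmetry.
  have h1 : ∀ M, F.baseUU X (Sum.inr g) (mat M)
      = -∑ s, F.lamK X s g * X.up (F.E (Sum.inr s) M) := fun M => by
    rw [← hs, tuu, Matrix.of_apply, baseUU_mat_gh, smul_neg, smul_smul, sg_mul,
      sg_congr (n := 0) (by simp)]
    simp
  have h2 : ∀ M s, F.conn X M g * (sg (par M) • (F.lamK X s g' * X.up (F.E (Sum.inr s) M)))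
      = F.lamK X s g' * X.up (F.E (Sum.inr s) M) * F.conn X M g := fun M s => by
    rw [mul_smul_comm, comm (F.conn_deg X M g) (mul_mem (F.lamK_deg X s g')
      (X.up_deg (F.E_deg (Sum.inr s) M))), smul_smul, sg_mul, par_inr, sg_congr (n := 0)]
    simp
  rw [metricUU_eq]
  simp only [Matrix.mul_apply, Matrix.add_apply, Matrix.sub_apply, sum_coord, st0, Matrix.of_apply,
    connMat_mat_gh, connMat_gh, cpar_inr, baseUU_mat_mat, baseUU_mat_gh, baseUU_gh_gh, h1,
    mul_zero, zero_mul, Finset.sum_const_zero, add_zero, pow_zero, one_smul, neg_mul,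
    mul_neg, Finset.sum_neg_distrib, sub_neg_eq_add, Finset.sum_mul, Finset.mul_sum,
    Finset.smul_sum, h2]
  rw [Finset.sum_comm (γ := Spin), Finset.sum_comm (γ := Spin),
    Finset.sum_comm (γ := Idx) (f := fun x i => F.conn X i g * _ * F.conn X x g')]
  abel

/-- The part `E_M^s E_s^N` of the identity with signs. -/
def metricProj (M M' : Idx) : R := ∑ s, chir s • (F.Einv M (Sum.inr s) * F.E (Sum.inr s) M')

theorem metricDU_apply (i j : Coord) :
    F.metricDU X i j = ∑ k, flatSign k • (F.coframe X i k * F.frame X k j) := by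
  rw [metricDU, flatDU, Matrix.mul_apply]
  refine Finset.sum_congr rfl fun k _ => ?_
  rw [Matrix.mul_diagonal, smul_one_comm, smul_mul_assoc]

theorem metricDU_mat_mat (M M' : Idx) :
    F.metricDU X (mat M) (mat M') = X.up (F.metricProj M M') := by
  simp [-Fintype.sum_sum_type, metricDU_apply, sum_coord,
    sum_idx, frame_mat_mat, frame_gh_mat, coframe_mat_mat, metricProj]

theorem metricDU_mat_gh (M : Idx) (g : Spin) : F.metricDU X (mat M) (Sum.inr g)
    = chir g • F.conn X M g - ∑ M', X.up (F.metricProj M M') * F.conn X M' g := by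
  simp only [metricDU_apply, sum_coord,
    frame_mat_gh, frame_gh_gh, coframe_mat_mat, coframe_mat_gh,
    flatSign_gh, mul_ite, mul_one, mul_zero, smul_ite,
    smul_zero, Finset.sum_ite_eq', Finset.mem_univ, if_true, mul_neg, smul_neg,
    Finset.sum_neg_distrib, metricProj, map_sum, map_smul, map_mul, Finset.mul_sum, Finset.sum_mul,
    Finset.smul_sum, smul_mul_assoc, mul_assoc]
  rw [Finset.sum_comm, add_comm, sub_eq_add_neg]
  congr 2
  refine Finset.sum_congr rfl fun M' _ => ?_
  rw [sum_idx]
  simp [-Fintype.sum_sum_type]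

theorem metricDU_gh_mat (g : Spin) (M : Idx) : F.metricDU X (Sum.inr g) (mat M) = 0 := by
  simp [-Fintype.sum_sum_type, metricDU_apply, sum_coord, frame_gh_mat, coframe_gh_mat]

theorem metricDU_gh_gh (g g' : Spin) :
    F.metricDU X (Sum.inr g) (Sum.inr g') = if g = g' then algebraMap ℂ T (chir g) else 0 := by
  by_cases h : g = g'
  · subst h
    simp [-Fintype.sum_sum_type, metricDU_apply, sum_coord, frame_gh_gh, coframe_gh_mat,
      coframe_gh_gh, Algebra.algebraMap_eq_smul_one]
  · simp [-Fintype.sum_sum_type, metricDU_apply, sum_coord, frame_gh_gh, coframe_gh_mat,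
      coframe_gh_gh, h]

theorem metricDU_isHom : IsHom cpar 0 (F.metricDU X) :=
  ((F.coframe_isHom X).mul flatDU_isHom).mul (F.frame_isHom X)

/-- The `B`-independent part of the matrix `𝔸_{ij}`. -/
def metricDD : Matrix Coord Coord T := F.coframe X * flatDD T * st0 cpar (F.coframe X)

theorem metricDD_isHom : IsHom cpar 0 (F.metricDD X) :=
  ((F.coframe_isHom X).mul flatDD_isHom).mul (F.coframe_isHom X).st0

/-- The matrix `G_{MN}`. -/
def metricG (M M' : Idx) : R :=
  ∑ a, ∑ b, eta a b • (F.Einv M (vec a) * F.Einv M' (vec b))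

theorem metricDD_mat_mat (M M' : Idx) :
    F.metricDD X (mat M) (mat M') = X.up (F.metricG M M') := by
  simp [-Fintype.sum_sum_type, metricDD, Matrix.mul_apply, sum_coord,
    sum_idx, coframe_mat_mat, smul_one_comm, metricG, st0, Finset.sum_mul]
  rw [Finset.sum_comm]

theorem metricDD_gh (g : Spin) (j : Coord) : F.metricDD X (Sum.inr g) j = 0 := by
  simp [-Fintype.sum_sum_type, metricDD, Matrix.mul_apply, sum_coord,
    coframe_gh_mat, coframe_gh_gh]

theorem metricDD_mat_gh (M : Idx) (g : Spin) : F.metricDD X (mat M) (Sum.inr g) = 0 := by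
  simp [-Fintype.sum_sum_type, metricDD, Matrix.mul_apply, sum_coord,
    sum_idx, coframe_mat_mat, coframe_gh_mat, coframe_gh_gh, st0]

end Fields
end

section

variable {R T : Type*} [Ring R] [Algebra ℂ R] [SuperCommAlgebra R]
    [Ring T] [Algebra ℂ T] [SuperCommAlgebra T]

namespace Fields

variable (X : GhostExtension R T) (F : Fields R)

/-! ### Torsion and curvature -/

/-- `E_A^M ∂_M E_B^N E_N^C - E_A^M Ω_{MB}^C` -/
def torsionAux (A B C : Idx) : R :=
  (∑ M, ∑ M', F.E A M * X.mpd M (F.E B M') * F.Einv M' C) - ∑ M, F.E A M * F.Om M B C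

/-- The torsion `T_{AB}^C`. -/
def tors (A B C : Idx) : R :=
  F.torsionAux X A B C - sg (par A * par B) • F.torsionAux X B A C

/-- `∂_M Ω_{Ns}^t - Ω_{Ms}^r Ω_{Nr}^t` -/
def curvAux (M M' : Idx) (s t : Spin) : R :=
  X.mpd M (F.Om M' (Sum.inr s) (Sum.inr t))
    - ∑ r : Spin, F.Om M (Sum.inr s) (Sum.inr r) * F.Om M' (Sum.inr r) (Sum.inr t)

/-- The curvature `R_{ABs}^t`. -/
def curv (A B : Idx) (s t : Spin) : R :=
  ∑ M, ∑ M', sg (par M' * par B) • (F.E A M' * F.E B M *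
    (F.curvAux X M M' s t - sg (par M * par M') • F.curvAux X M' M s t))

/-- The derivative `E_A^M ∂_M x`. -/
def dirDeriv (A : Idx) (x : R) : R := ∑ M, F.E A M * X.mpd M x

/-- The connection `E_A^M Ω_{MB}^C`. -/
def flatOm (A B C : Idx) : R := ∑ M, F.E A M * F.Om M B C

/-- Returning the upper label to a curved one cancels the inverse vielbein. The added connection
term removes one of the two connections in the torsion. What is left is the bracket of vielbein
vectors together with the rotation of the ghost label. -/
theorem tors_mul_vielbein (s : Spin) (A M : Idx) :
    ∑ C, (F.tors X (Sum.inr s) A C + F.flatOm (Sum.inr s) A C) * F.E C M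
      = F.dirDeriv X (Sum.inr s) (F.E A M) - sg (par A) • (F.dirDeriv X A (F.E (Sum.inr s) M)
        - ∑ t, F.flatOm A (Sum.inr s) (Sum.inr t) * F.E (Sum.inr t) M) := by
  have h1 : ∀ A B, ∑ C, (∑ M', ∑ M'', F.E A M' * X.mpd M' (F.E B M'') * F.Einv M'' C) * F.E C M
      = F.dirDeriv X A (F.E B M) := fun A B => by
    simp only [Finset.sum_mul, mul_assoc]
    rw [Finset.sum_comm]
    simp only [dirDeriv]
    refine Finset.sum_congr rfl fun M' _ => ?_
    rw [Finset.sum_comm]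
    simp only [← Finset.mul_sum, F.Einv_mul_E]
    simp [-Fintype.sum_sum_type]
  have h2 : ∑ C, F.flatOm A (Sum.inr s) C * F.E C M
      = ∑ t, F.flatOm A (Sum.inr s) (Sum.inr t) * F.E (Sum.inr t) M := by
    rw [sum_idx]
    simp [-Fintype.sum_sum_type, flatOm, F.Om_vec_right]
  have h3 : ∀ C, (F.tors X (Sum.inr s) A C + F.flatOm (Sum.inr s) A C) * F.E C M
      = (∑ M', ∑ M'', F.E (Sum.inr s) M' * X.mpd M' (F.E A M'') * F.Einv M'' C) * F.E C M
        - sg (par A) • ((∑ M', ∑ M'', F.E A M' * X.mpd M' (F.E (Sum.inr s) M'') * F.Einv M'' C)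
          * F.E C M - F.flatOm A (Sum.inr s) C * F.E C M) := fun C => by
    simp only [tors, torsionAux, flatOm, par_inr, one_mul, add_mul, sub_mul, smul_mul_assoc]
    abel
  simp only [h3, Finset.sum_sub_distrib, ← Finset.smul_sum, h1, h2]

/-! ### The vector fields `χ_s λ^s e_s` -/

variable (χ : Spin → ℂ)

/-- The vector field `χ_s λ^s e_s`. -/
def brstVec (j : Coord) : T := ∑ s, χ s • (X.lam s * F.frame X (mat (Sum.inr s)) j)

theorem brstVec_deg (j : Coord) : F.brstVec X χ j ∈ deg (cpar j + 1) :=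
  Submodule.sum_mem _ fun s _ => Submodule.smul_mem _ _
    (deg_of (mul_mem (X.lam_deg s) (F.frame_isHom X (mat (Sum.inr s)) j))
      (by simp [Nat.even_add, parity_simps]))

theorem brstVec_gh (g : Spin) :
    F.brstVec X χ (Sum.inr g) = -∑ M, F.brstVec X χ (mat M) * F.conn X M g := by
  simp only [brstVec, frame_mat_gh, frame_mat_mat, Finset.sum_mul, mul_neg, smul_neg,
    Finset.sum_neg_distrib, Finset.mul_sum, Finset.smul_sum, smul_mul_assoc, mul_assoc]
  rw [Finset.sum_comm]

theorem act_frame_up (A : Idx) (x : R) :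
    act X.pd (F.frame X (mat A)) (X.up x) = X.up (F.dirDeriv X A x) := by
  simp [-Fintype.sum_sum_type, act_apply, sum_coord, X.pd_mat_up, X.pd_gh_up, dirDeriv,
    frame_mat_mat]

/-- A horizontal lift annihilates no ghost: its ghost components rotate $\lambda$ by the connection.
This is the source of all connection terms on contracted lower labels. -/
theorem act_frame_lam (A : Idx) (s : Spin) : act X.pd (F.frame X (mat A)) (X.lam s)
    = -∑ t, X.lam t * X.up (F.flatOm A (Sum.inr t) (Sum.inr s)) := by
  simp only [act_apply, sum_coord, X.pd_mat_lam, X.pd_gh_lam, mul_zero, Finset.sum_const_zero,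
    zero_add, mul_ite, mul_one, Finset.sum_ite_eq', Finset.mem_univ, if_true, frame_mat_gh, conn,
    flatOm, Finset.mul_sum, map_sum, map_mul]
  rw [Finset.sum_comm]
  congr 1
  refine Finset.sum_congr rfl fun t _ => Finset.sum_congr rfl fun M _ => ?_
  rw [← mul_assoc, ← mul_assoc, X.lam_comm]

theorem act_frame_gh (s : Spin) (x : T) :
    act X.pd (F.frame X (Sum.inr s)) x = X.pd (Sum.inr s) x := by
  simp [-Fintype.sum_sum_type, act_apply, sum_coord, frame_gh_mat, frame_gh_gh]

theorem act_brstVec (x : T) : act X.pd (F.brstVec X χ) x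
    = ∑ s, χ s • (X.lam s * act X.pd (F.frame X (mat (Sum.inr s))) x) := by
  simp only [act_apply, brstVec, Finset.sum_mul, Finset.mul_sum, Finset.smul_sum, smul_mul_assoc,
    mul_assoc]
  rw [Finset.sum_comm]

theorem act_frame_lam_mul (A : Idx) (s : Spin) (x : T) :
    act X.pd (F.frame X (mat A)) (X.lam s * x) = act X.pd (F.frame X (mat A)) (X.lam s) * x
      + X.lam s * act X.pd (F.frame X (mat A)) x := by
  rw [act_leibniz X.pd_derivs (v := par A) (fun i => deg_of (F.frame_isHom X (mat A) i)
    (by simp [Nat.even_add]; tauto)) x (X.lam_deg s)]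
  simp

/-- Differentiating $\lambda^t\Omega_{Mt}{}^g$ hits the connection and, through the rotation of
$\lambda$, produces a product of two connections. The two contributions are the two terms of
`curvAux`. -/
theorem act_frame_conn (A M : Idx) (g : Spin) :
    act X.pd (F.frame X (mat A)) (F.conn X M g)
      = ∑ t, X.lam t * X.up (∑ M', F.E A M' * F.curvAux X M' M t g) := by
  have h : ∀ t, X.up (∑ M', F.E A M' * F.curvAux X M' M t g)
      = X.up (F.dirDeriv X A (F.Om M (Sum.inr t) (Sum.inr g)))
        - ∑ r, X.up (F.flatOm A (Sum.inr t) (Sum.inr r)) * X.up (F.Om M (Sum.inr r) (Sum.inr g)) := by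
    intro t
    simp only [curvAux, mul_sub, Finset.sum_sub_distrib, dirDeriv, map_sub, ← map_mul, ← map_sum,
      flatOm]
    congr 2
    simp only [Finset.mul_sum, Finset.sum_mul, mul_assoc]
    rw [Finset.sum_comm]
  simp only [conn, map_sum, act_frame_lam_mul, act_frame_up, act_frame_lam, h, mul_sub,
    Finset.sum_sub_distrib, Finset.sum_add_distrib, neg_mul, Finset.sum_neg_distrib,
    Finset.sum_mul, Finset.mul_sum, mul_assoc]
  rw [Finset.sum_comm, sub_eq_add_neg, add_comm]

theorem pd_gh_lam_mul_up (r s : Spin) (x : R) :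
    X.pd (Sum.inr r) (X.lam s * X.up x) = if r = s then X.up x else 0 := by
  rw [X.pd_derivs.leibniz _ _ (X.lam_deg s), X.pd_gh_up, X.pd_gh_lam]
  simp

theorem pd_gh_conn (r g : Spin) (M : Idx) :
    X.pd (Sum.inr r) (F.conn X M g) = X.up (F.Om M (Sum.inr r) (Sum.inr g)) := by
  simp [-Fintype.sum_sum_type, conn, pd_gh_lam_mul_up]

/-- The derivative of the frame along `χ_s λ^s e_s`. -/
def frameDer : Matrix Coord Coord T := Matrix.of fun
  | Sum.inl A, Sum.inl C => -(sg (par A) •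
      ∑ s, χ s • (X.lam s * X.up (F.tors X (Sum.inr s) A C + F.flatOm (Sum.inr s) A C)))
  | Sum.inl A, Sum.inr g => -(sg (par A) •
      ∑ s, χ s • (X.lam s * ∑ t, X.lam t * X.up (F.curv X (Sum.inr s) A t g)))
  | Sum.inr _, Sum.inl (Sum.inl _) => 0
  | Sum.inr r, Sum.inl (Sum.inr s) => if r = s then algebraMap ℂ T (χ r) else 0
  | Sum.inr r, Sum.inr g =>
      -∑ s, χ s • (X.lam s * X.up (F.flatOm (Sum.inr s) (Sum.inr r) (Sum.inr g)))

theorem frameDer_mat_mat (A C : Idx) : F.frameDer X χ (mat A) (mat C) = -(sg (par A) •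
    ∑ s, χ s • (X.lam s * X.up (F.tors X (Sum.inr s) A C + F.flatOm (Sum.inr s) A C))) := rfl
theorem frameDer_mat_gh (A : Idx) (g : Spin) : F.frameDer X χ (mat A) (Sum.inr g)
    = -(sg (par A) • ∑ s, χ s • (X.lam s * ∑ t, X.lam t * X.up (F.curv X (Sum.inr s) A t g))) := rfl
theorem frameDer_gh_vec (r : Spin) (a : Fin 10) :
    F.frameDer X χ (Sum.inr r) (mat (vec a)) = 0 := rfl
theorem frameDer_gh_spin (r s : Spin) : F.frameDer X χ (Sum.inr r) (mat (Sum.inr s))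
    = if r = s then algebraMap ℂ T (χ r) else 0 := rfl
theorem frameDer_gh_gh (r g : Spin) : F.frameDer X χ (Sum.inr r) (Sum.inr g)
    = -∑ s, χ s • (X.lam s * X.up (F.flatOm (Sum.inr s) (Sum.inr r) (Sum.inr g))) := rfl

/-- The curvature is split into two halves in the order in which they arise: the derivative along
$e_A$ of the connection contracted with $E_s$, and the same with the roles exchanged. -/
theorem curv_eq (s : Spin) (A : Idx) (t g : Spin) :
    sg (par A) • F.curv X (Sum.inr s) A t g
      = ∑ M, (sg (par A * par M + par A) • (F.E (Sum.inr s) M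
            * ∑ M', F.E A M' * F.curvAux X M' M t g)
          - sg (par M) • (F.E A M * ∑ M', F.E (Sum.inr s) M' * F.curvAux X M' M t g)) := by
  simp only [curv, Finset.smul_sum, Finset.mul_sum, mul_sub, smul_sub, Finset.sum_sub_distrib,
    mul_smul_comm, smul_smul, sg_mul]
  congr 1
  · rw [Finset.sum_comm]
    refine Finset.sum_congr rfl fun M _ => Finset.sum_congr rfl fun M' _ => ?_
    rw [mul_assoc]
    congr 1
    exact sg_congr
  · refine Finset.sum_congr rfl fun M _ => Finset.sum_congr rfl fun M' _ => ?_
    rw [comm (F.E_deg (Sum.inr s) M') (F.E_deg A M), smul_mul_assoc, smul_smul, sg_mul, mul_assoc,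
      par_inr]
    congr 1
    exact sg_congr

end Fields
end

/-! ### Structure equations: the bracket of the frame with the BRST vector field -/

section

variable {R T : Type*} [Ring R] [Algebra ℂ R] [SuperCommAlgebra R]
    [Ring T] [Algebra ℂ T] [SuperCommAlgebra T]

namespace Fields

variable (X : GhostExtension R T) (F : Fields R) (χ : Spin → ℂ)

theorem frame_mul_jac_apply (i j : Coord) : (F.frame X * jac X.pd (F.brstVec X χ)) i j
    = act X.pd (F.frame X i) (F.brstVec X χ j) := by
  rw [act_apply, Matrix.mul_apply]; rfl

theorem act_brstVec_up (x : R) : act X.pd (F.brstVec X χ) (X.up x)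
    = ∑ s, χ s • (X.lam s * X.up (F.dirDeriv X (Sum.inr s) x)) := by
  simp only [act_brstVec, act_frame_up]

/-- The matter components of `[e_A, V]`. -/
theorem frameDer_mul_mat_mat (hχ : ∀ M s t,
      χ s • F.Om M (Sum.inr s) (Sum.inr t) = χ t • F.Om M (Sum.inr s) (Sum.inr t)) (A M : Idx) :
    ∑ C, F.frameDer X χ (mat A) (mat C) * X.up (F.E C M)
      = act X.pd (F.frame X (mat A)) (F.brstVec X χ (mat M))
        - sg (par A) • act X.pd (F.brstVec X χ) (X.up (F.E A M)) := by
  have h1 : ∑ C, F.frameDer X χ (mat A) (mat C) * X.up (F.E C M)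
      = -(sg (par A) • ∑ s, χ s • (X.lam s * X.up (∑ C, (F.tors X (Sum.inr s) A C
        + F.flatOm (Sum.inr s) A C) * F.E C M))) := by
    simp only [frameDer_mat_mat, map_sum, map_mul, Finset.mul_sum, Finset.smul_sum, Finset.sum_mul,
      neg_mul, smul_mul_assoc, mul_assoc, Finset.sum_neg_distrib]
    rw [Finset.sum_comm]
  have h2 : ∑ s, χ s • (act X.pd (F.frame X (mat A)) (X.lam s) * X.up (F.E (Sum.inr s) M))
      = -∑ s, χ s • (X.lam s * X.up (∑ t, F.flatOm A (Sum.inr s) (Sum.inr t)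
          * F.E (Sum.inr t) M)) := by
    simp only [act_frame_lam, map_sum, map_mul, Finset.mul_sum, Finset.smul_sum, Finset.sum_mul,
      neg_mul, smul_neg, mul_assoc, Finset.sum_neg_distrib]
    rw [Finset.sum_comm]
    congr 1
    refine Finset.sum_congr rfl fun s _ => Finset.sum_congr rfl fun t _ => ?_
    -- Rotating $\lambda^t$ puts the weight of the new label on the old one. The two weights agree
    -- wherever the connection is nonzero, because `χ` is constant along its blocks.
    have : χ s • X.up (F.flatOm A (Sum.inr s) (Sum.inr t))
        = χ t • X.up (F.flatOm A (Sum.inr s) (Sum.inr t)) := by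
      simp only [← map_smul, flatOm, Finset.smul_sum, ← mul_smul_comm]
      simp only [mul_smul_comm, ← Finset.smul_sum, ← hχ]
    calc χ t • (X.lam s * (X.up (F.flatOm A (Sum.inr s) (Sum.inr t)) * X.up (F.E (Sum.inr t) M)))
        = X.lam s * (χ t • X.up (F.flatOm A (Sum.inr s) (Sum.inr t)) * X.up (F.E (Sum.inr t) M)) := by
          rw [smul_mul_assoc, mul_smul_comm]
      _ = _ := by rw [← this, smul_mul_assoc, mul_smul_comm]
  have h3 : ∀ (s : Spin) (x : R), χ s • (X.lam s * X.up (sg (par A) • x))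
      = sg (par A) • χ s • (X.lam s * X.up x) := fun s x => by
    rw [map_smul, mul_smul_comm, smul_comm]
  rw [h1]
  simp only [tors_mul_vielbein, act_brstVec_up]
  rw [brstVec]
  simp only [frame_mat_mat, map_sum (act _ _), map_smul (act _ _), act_frame_lam_mul, act_frame_up, smul_add,
    Finset.sum_add_distrib, h2, map_sub X.up, mul_sub, smul_sub, Finset.sum_sub_distrib, h3,
    ← Finset.smul_sum, neg_sub, sg_smul_self]
  abel

theorem frame_mat_isDerivation (A : Idx) (i : Coord) : F.frame X (mat A) i ∈ deg (cpar i + par A) :=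
  deg_of (F.frame_isHom X (mat A) i) (by simp [Nat.even_add]; tauto)

/-- In the ghost components of $[e_A,V]$, derivatives of the vielbein reproduce the matter
components multiplied by the connection, which is the horizontal part. Derivatives of the connection
along $e_A$ and along $V$ combine into the curvature, which is the vertical part. -/
theorem frameDer_mul_mat_gh (hχ : ∀ M s t,
      χ s • F.Om M (Sum.inr s) (Sum.inr t) = χ t • F.Om M (Sum.inr s) (Sum.inr t))
    (A : Idx) (g : Spin) :
    F.frameDer X χ (mat A) (Sum.inr g)
        - ∑ C, F.frameDer X χ (mat A) (mat C) * ∑ M, X.up (F.E C M) * F.conn X M g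
      = act X.pd (F.frame X (mat A)) (F.brstVec X χ (Sum.inr g))
        - sg (par A) • act X.pd (F.brstVec X χ) (F.frame X (mat A) (Sum.inr g)) := by
  have hD := act_isOddDerivation X.pd_derivs (F.brstVec_deg X χ)
  have h1 : act X.pd (F.frame X (mat A)) (F.brstVec X χ (Sum.inr g))
      = -∑ M, (act X.pd (F.frame X (mat A)) (F.brstVec X χ (mat M)) * F.conn X M g
        + sg (par A * (par M + 1)) • (F.brstVec X χ (mat M)
          * act X.pd (F.frame X (mat A)) (F.conn X M g))) := by
    rw [brstVec_gh, map_neg, map_sum]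
    congr 1
    refine Finset.sum_congr rfl fun M _ => ?_
    rw [act_leibniz X.pd_derivs (F.frame_mat_isDerivation X A) _ (F.brstVec_deg X χ (mat M))]
    rfl
  have h2 : act X.pd (F.brstVec X χ) (F.frame X (mat A) (Sum.inr g))
      = -∑ M, (act X.pd (F.brstVec X χ) (X.up (F.E A M)) * F.conn X M g
        + sg (par A + par M) • (X.up (F.E A M) * act X.pd (F.brstVec X χ) (F.conn X M g))) := by
    rw [frame_mat_gh, map_neg, map_sum]
    congr 1
    refine Finset.sum_congr rfl fun M _ => ?_
    rw [hD.leibniz _ (X.up_deg (F.E_deg A M))]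
  have h3 : ∑ C, F.frameDer X χ (mat A) (mat C) * ∑ M, X.up (F.E C M) * F.conn X M g
      = ∑ M, (act X.pd (F.frame X (mat A)) (F.brstVec X χ (mat M))
        - sg (par A) • act X.pd (F.brstVec X χ) (X.up (F.E A M))) * F.conn X M g := by
    simp only [← F.frameDer_mul_mat_mat X χ hχ, Finset.mul_sum, Finset.sum_mul, mul_assoc]
    rw [Finset.sum_comm]
  have h4 : F.frameDer X χ (mat A) (Sum.inr g)
      = ∑ M, (sg (par M) • (X.up (F.E A M) * act X.pd (F.brstVec X χ) (F.conn X M g))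
        - sg (par A * (par M + 1)) • (F.brstVec X χ (mat M)
          * act X.pd (F.frame X (mat A)) (F.conn X M g))) := by
    -- For a single label `s` the curvature is the graded difference of the two derivatives of the
    -- connection.
    have h5 : ∀ s, sg (par A) • ∑ t, X.lam t * X.up (F.curv X (Sum.inr s) A t g)
        = ∑ M, (sg (par A * (par M + 1)) • (X.up (F.E (Sum.inr s) M)
              * act X.pd (F.frame X (mat A)) (F.conn X M g))
          - sg (par M) • (X.up (F.E A M)
              * act X.pd (F.frame X (mat (Sum.inr s))) (F.conn X M g))) := by
      intro s
      simp only [act_frame_conn, Finset.smul_sum, Finset.mul_sum]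
      simp only [← mul_smul_comm, ← map_smul, curv_eq]
      simp only [map_sum, map_sub, map_smul, map_mul, Finset.mul_sum, mul_sub, mul_smul_comm,
        Finset.sum_sub_distrib, Finset.smul_sum, mul_add, mul_one]
      congr 1
      · rw [Finset.sum_comm]
        refine Finset.sum_congr rfl fun M _ => Finset.sum_congr rfl fun t _ => ?_
        refine Finset.sum_congr rfl fun M' _ => ?_
        rw [← mul_assoc, X.lam_comm, mul_assoc]
      · rw [Finset.sum_comm]
        refine Finset.sum_congr rfl fun M _ => Finset.sum_congr rfl fun t _ => ?_
        refine Finset.sum_congr rfl fun M' _ => ?_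
        rw [← mul_assoc, X.lam_comm, mul_assoc]
    rw [frameDer_mat_gh]
    simp only [Finset.smul_sum (r := sg (par A)), smul_comm (sg (par A)) (χ _)]
    simp only [← mul_smul_comm (sg (par A)), h5, act_brstVec]
    simp only [brstVec, frame_mat_mat, Finset.sum_mul, Finset.mul_sum, Finset.smul_sum,
      ← Finset.sum_neg_distrib, mul_smul_comm, smul_mul_assoc, mul_sub, smul_sub, neg_sub,
      ← Finset.sum_sub_distrib]
    rw [Finset.sum_comm]
    refine Finset.sum_congr rfl fun M _ => Finset.sum_congr rfl fun s _ => ?_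
    rw [smul_comm (χ s) (sg (par M)), smul_comm (χ s) (sg (par A * (par M + 1)))]
    rw [← mul_assoc (X.lam s), X.lam_comm s (X.up (F.E A M)), mul_assoc, mul_assoc]
  rw [h1, h2, h3, h4]
  simp only [← Finset.sum_sub_distrib, ← Finset.sum_neg_distrib, smul_neg, Finset.smul_sum]
  refine Finset.sum_congr rfl fun M _ => ?_
  simp only [smul_add, smul_smul, sg_mul, sub_mul, smul_mul_assoc, neg_add]
  rw [sg_congr (m := par A + (par A + par M)) (n := par M)]
  abel

/-- The frame components of `[e_i, V]`. -/
theorem frameDer_mul_frame (hχ : ∀ M s t,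
      χ s • F.Om M (Sum.inr s) (Sum.inr t) = χ t • F.Om M (Sum.inr s) (Sum.inr t)) :
    F.frameDer X χ * F.frame X = F.frame X * jac X.pd (F.brstVec X χ)
      - matDer cpar (act X.pd (F.brstVec X χ)) (F.frame X) := by
  have hD := act_isOddDerivation X.pd_derivs (F.brstVec_deg X χ)
  have hD1 : act X.pd (F.brstVec X χ) 1 = 0 := by
    have := hD.leibniz (1 : T) one_mem
    simpa using this
  ext i j
  rw [Matrix.sub_apply, frame_mul_jac_apply, matDer, Matrix.of_apply, Matrix.mul_apply, sum_coord]
  rcases i with A | r <;> rcases j with M | g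
  · simp only [frame_gh_mat, mul_zero, Finset.sum_const_zero, add_zero, frame_mat_mat,
      F.frameDer_mul_mat_mat X χ hχ, cpar_mat]
  · have := F.frameDer_mul_mat_gh X χ hχ A g
    simp only [frame_gh_gh, frame_mat_gh, mul_ite, mul_one, mul_zero, Finset.sum_ite_eq',
      Finset.mem_univ, if_true, mul_neg, Finset.sum_neg_distrib, cpar_mat] at this ⊢
    rw [← this]
    abel
  · simp only [frame_gh_mat, frame_mat_mat, sum_idx, frameDer_gh_vec, frameDer_gh_spin, mul_zero,
      zero_mul, ite_mul, Finset.sum_ite_eq, Finset.mem_univ, if_true, Finset.sum_const_zero,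
      zero_add, add_zero, map_zero, smul_zero, sub_zero, act_frame_gh, brstVec, map_sum, map_smul,
      pd_gh_lam_mul_up, smul_ite, ← Algebra.smul_def]
  -- A ghost derivative of the ghost components of $V$ sees both the explicit ghost and the ghost
  -- inside the connection. The first gives the horizontal lift of $e_r$, the second the entry of
  -- `frameDer`.
  · have h1 : ∀ s M, X.pd (Sum.inr r) (X.lam s * (X.up (F.E (Sum.inr s) M) * F.conn X M g))
        = (if r = s then X.up (F.E (Sum.inr s) M) * F.conn X M g else 0)
          + X.lam s * (X.up (F.E (Sum.inr s) M) * X.up (F.Om M (Sum.inr r) (Sum.inr g))) := by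
      intro s M
      rw [X.pd_derivs.leibniz _ _ (X.lam_deg s), X.pd_gh_lam, X.pd_derivs.leibniz _ _
        (X.up_deg (F.E_deg _ _)), X.pd_gh_up, pd_gh_conn]
      simp
    have h2 : act X.pd (F.brstVec X χ) (F.frame X (Sum.inr r) (Sum.inr g)) = 0 := by
      rw [frame_gh_gh]; split_ifs
      · exact hD1
      · exact map_zero _
    rw [h2, smul_zero, sub_zero, act_frame_gh]
    simp only [frame_mat_gh,
      frame_gh_gh, frameDer_gh_gh,
      Finset.mem_univ, if_true,
      mul_ite, mul_one, mul_zero, Finset.sum_ite_eq', brstVec, map_sum, map_smul, map_neg, mul_neg,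
      Finset.mul_sum, h1, flatOm, map_mul, Finset.sum_add_distrib, smul_add, smul_neg, smul_ite,
      smul_zero, Finset.sum_neg_distrib, Finset.smul_sum, neg_add]
    congr 2
    rw [Finset.sum_comm]
    conv_rhs => rw [Finset.sum_comm]
    refine Finset.sum_congr rfl fun M _ => ?_
    rw [sum_idx]
    simp [-Fintype.sum_sum_type, frameDer_gh_vec, frameDer_gh_spin, Algebra.smul_def]

end Fields
end

section

variable {R T : Type*} [Ring R] [Algebra ℂ R] [SuperCommAlgebra R]
    [Ring T] [Algebra ℂ T] [SuperCommAlgebra T]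

namespace Fields

variable (X : GhostExtension R T) (F : Fields R) (χ : Spin → ℂ)

/-! ### The three-form in the flat frame -/

/-- The field strength `H = dB`. -/
def curl (M M' Q : Idx) : R := fieldStrength par X.mpd (Matrix.of F.B) M M' Q

/-- The field strength in flat indices. -/
def flatH (A B C : Idx) : R :=
  ∑ M, ∑ M', ∑ Q, sg (par M * par B + par M * par C + par M' * par C) •
    (F.E A M * F.E B M' * F.E C Q * F.curl X Q M' M)

/-- The field strength on the target space. -/
def targetH : Coord → Coord → Coord → T := fieldStrength cpar X.pd (F.Bmat X)

theorem targetH_mat (M M' Q : Idx) :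
    F.targetH X (mat M) (mat M') (mat Q) = X.up (F.curl X M M' Q) := by
  simp [targetH, fieldStrength, curl, X.pd_mat_up]

/-- The two-form has no ghost legs and does not depend on the ghosts, so its exterior derivative is
the extension of $H$ by zero. The next two lemmas treat the other slots. -/
theorem targetH_gh_left (g : Spin) (j k : Coord) : F.targetH X (Sum.inr g) j k = 0 := by
  rcases j with j | j <;> rcases k with k | k <;> simp [targetH, fieldStrength, X.pd_gh_up]

theorem targetH_gh_mid (i : Coord) (g : Spin) (k : Coord) : F.targetH X i (Sum.inr g) k = 0 := by
  rcases i with i | i <;> rcases k with k | k <;> simp [targetH, fieldStrength, X.pd_gh_up]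

theorem targetH_gh_right (i j : Coord) (g : Spin) : F.targetH X i j (Sum.inr g) = 0 := by
  rcases i with i | i <;> rcases j with j | j <;> simp [targetH, fieldStrength, X.pd_gh_up]

theorem of_B_antisymm : tdd par (Matrix.of F.B) = -Matrix.of F.B := by
  ext i j
  simp only [tdd, Matrix.of_apply, Matrix.neg_apply]
  rw [F.B_antisymm i j, neg_neg]

theorem curl_deg (M M' Q : Idx) : F.curl X M M' Q ∈ deg (par M + par M' + par Q) :=
  fieldStrength_deg X.mpd_derivs (fun i j => F.B_deg i j) M M' Q

/-- Reversing three indices is a product of three adjacent transpositions, hence an odd permutation.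
It reconciles the index order of `curl` with the reversed convention of `flatH`. -/
theorem curl_reverse (M M' Q : Idx) : F.curl X M M' Q
    = -(sg (par M * par M' + par M * par Q + par M' * par Q) • F.curl X Q M' M) := by
  rw [curl, fieldStrength_swap_right F.of_B_antisymm, fieldStrength_swap_left F.of_B_antisymm,
    fieldStrength_swap_right F.of_B_antisymm, curl]
  simp only [smul_neg, neg_neg, smul_smul, sg_mul]
  congr 2
  exact sg_congr

theorem targetH_swap_right (i j k : Coord) :
    F.targetH X i j k = -(sg (cpar j * cpar k) • F.targetH X i k j) :=
  fieldStrength_swap_right (F.tdd_Bmat X) i j k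

theorem targetH_swap_left (i j k : Coord) :
    F.targetH X i j k = -(sg (cpar i * cpar j) • F.targetH X j i k) :=
  fieldStrength_swap_left (F.tdd_Bmat X) i j k

theorem targetH_deg (i j k : Coord) : F.targetH X i j k ∈ deg (cpar i + cpar j + cpar k) :=
  fieldStrength_deg X.pd_derivs (F.Bmat_isHom X) i j k

/-- The contraction of the field strength with `χ_s λ^s e_s`. -/
def flux : Matrix Coord Coord T := fluxMat cpar (F.targetH X) (F.brstVec X χ)

/-- The flat components of `flux`. -/
def flatFlux : Matrix Coord Coord T := Matrix.of fun
  | Sum.inl A, Sum.inl B => sg (par A) • ∑ s, χ s • (X.lam s * X.up (F.flatH X (Sum.inr s) A B))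
  | Sum.inl _, Sum.inr _ => 0
  | Sum.inr _, _ => 0

@[simp] theorem flatFlux_mat_mat (A B : Idx) : F.flatFlux X χ (mat A) (mat B)
    = sg (par A) • ∑ s, χ s • (X.lam s * X.up (F.flatH X (Sum.inr s) A B)) := rfl
@[simp] theorem flatFlux_mat_gh (A : Idx) (g : Spin) :
    F.flatFlux X χ (mat A) (Sum.inr g) = 0 := rfl
@[simp] theorem flatFlux_gh (g : Spin) (j : Coord) : F.flatFlux X χ (Sum.inr g) j = 0 := rfl

theorem flux_gh_left (g : Spin) (j : Coord) : F.flux X χ (Sum.inr g) j = 0 := by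
  simp [flux, fluxMat, targetH_gh_mid]

theorem flux_gh_right (i : Coord) (g : Spin) : F.flux X χ i (Sum.inr g) = 0 := by
  simp [flux, fluxMat, targetH_gh_right]

theorem flux_isHom : IsHom cpar 1 (F.flux X χ) :=
  fluxMat_isHom (F.brstVec_deg X χ) (F.targetH_deg X)

theorem tuu_flux : tuu cpar (F.flux X χ) = -F.flux X χ := tuu_fluxMat (F.targetH_swap_right X)

theorem flux_mat_mat (M M' : Idx) : F.flux X χ (mat M) (mat M')
    = -(sg (par M) • ∑ s, χ s • (X.lam s
      * X.up (∑ P, F.E (Sum.inr s) P * F.curl X P M M'))) := by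
  simp only [flux, fluxMat, Matrix.of_apply, sum_coord, targetH_gh_left, mul_zero,
    brstVec, targetH_mat, map_sum, map_mul, Finset.mul_sum,
    Finset.sum_mul, Finset.smul_sum, frame_mat_mat, cpar_mat, smul_mul_assoc, mul_assoc]
  rw [Finset.sum_comm]
  simp [-Fintype.sum_sum_type, Finset.smul_sum]

/-- The flat component is rewritten with the ghost leg contracted first and the other two vielbeins
on the outside, which is the shape of the matrix product of frame, flux and transposed frame. -/
theorem flatH_eq (s : Spin) (A B : Idx) : sg (par A) • F.flatH X (Sum.inr s) A B
    = -∑ M', ∑ M, sg (par M + par M' + par M' * par B) • (F.E A M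
      * (∑ P, F.E (Sum.inr s) P * F.curl X P M M') * F.E B M') := by
  simp only [flatH, Finset.smul_sum, Finset.mul_sum, Finset.sum_mul, ← Finset.sum_neg_distrib]
  rw [Finset.sum_comm]
  conv_lhs => enter [2, M]; rw [Finset.sum_comm]
  rw [Finset.sum_comm]
  refine Finset.sum_congr rfl fun M' _ => Finset.sum_congr rfl fun M _ =>
    Finset.sum_congr rfl fun P _ => ?_
  rw [F.curl_reverse X P M M', mul_assoc, mul_assoc, mul_assoc, mul_neg, neg_mul, mul_neg,
    smul_neg, neg_neg, mul_smul_comm, smul_mul_assoc, mul_smul_comm,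
    mul_assoc (F.E (Sum.inr s) P), comm (F.curl_deg X M' M P) (F.E_deg B M'), mul_smul_comm,
    mul_smul_comm, ← mul_assoc (F.E A M) (F.E (Sum.inr s) P), comm (F.E_deg A M) (F.E_deg (Sum.inr s) P),
    smul_mul_assoc, mul_assoc]
  simp only [smul_smul, sg_mul, par_inr]
  congr 1
  -- The exponents agree modulo two as polynomials in five parities, checked on all values.
  refine sg_congr ?_
  simp only [Nat.even_add, Nat.even_mul, Nat.not_even_one]
  by_cases hA : Even (par A) <;> by_cases hB : Even (par B) <;> by_cases hP : Even (par P) <;>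
    by_cases hM : Even (par M) <;> by_cases hM' : Even (par M') <;>
      simp [hA, hB, hP, hM, hM', -Nat.not_even_iff_odd]

/-- Since the flux has no ghost legs, only the vielbein part of the frame contributes, and
conjugation merely converts curved labels to flat ones. -/
theorem frame_flux : F.frame X * F.flux X χ * st0 cpar (F.frame X) = F.flatFlux X χ := by
  ext i j
  rw [Matrix.mul_apply, sum_coord]
  simp only [Matrix.mul_apply, sum_coord, flux_gh_right, flux_gh_left, mul_zero, zero_mul, add_zero,
    Finset.sum_const_zero]
  rcases i with A | g
  · rcases j with B | g
    · rw [flatFlux_mat_mat]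
      simp only [Finset.smul_sum, smul_comm (sg (par A)) (χ _)]
      simp only [← mul_smul_comm (sg (par A)), ← map_smul, flatH_eq]
      simp only [frame_mat_mat, flux_mat_mat, st0, Matrix.of_apply, Finset.mul_sum, Finset.sum_mul,
        cpar_mat, map_neg, map_sum X.up, map_smul, mul_neg, neg_mul, Finset.sum_neg_distrib,
        Finset.smul_sum, mul_smul_comm, smul_mul_assoc, smul_smul, map_mul]
      have hcomm : ∀ f : Idx → Spin → T, ∑ M, ∑ s, f M s = ∑ s, ∑ M, f M s :=
        fun f => Finset.sum_comm
      simp only [hcomm]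
      simp only [smul_neg, Finset.sum_neg_distrib, Finset.smul_sum, hcomm]
      refine congrArg Neg.neg (Finset.sum_congr rfl fun s _ => Finset.sum_congr rfl fun M' _ =>
        Finset.sum_congr rfl fun M _ => Finset.sum_congr rfl fun P _ => ?_)
      have hs : sg (par M + par M' + par M' * par B)
          = sg (par M' + par M' * par B) * sg (par M) := by
        rw [sg_mul]; congr 1; ring
      rw [hs, ← mul_assoc (X.up (F.E A M)) (X.lam s), ← X.lam_comm]
      simp only [smul_smul, mul_assoc]
      congr 1
      ring
    · simp [frame_gh_mat, st0]
  · simp [frame_gh_mat]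

variable {S : Type*} [Ring S]

/-- Evaluation is a ring homomorphism and the outer factors have one-sided inverses before
evaluation. Vanishing at given ghost values is therefore independent of the frame. -/
theorem map_conj_eq_zero (φ : T →+* S) {e f e' f' Y : Matrix Coord Coord T}
    (h : e * f = 1) (h' : f' * e' = 1) : (f * Y * f').map φ = 0 ↔ Y.map φ = 0 := by
  constructor
  · intro h0
    have : Y = e * (f * Y * f') * e' := by
      calc Y = (e * f) * Y * (f' * e') := by rw [h, h', one_mul, mul_one]
        _ = _ := by simp only [mul_assoc]
    rw [this, Matrix.map_mul, Matrix.map_mul, h0]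
    simp
  · intro h0
    rw [Matrix.map_mul, Matrix.map_mul, h0]
    simp

theorem map_st1_eq_zero {ι R' : Type*} [Ring R'] [Algebra ℂ R'] {p : ι → ℕ} (φ : T →ₐ[ℂ] R')
    {Y : Matrix ι ι T} (h : Y.map φ = 0) : (st1 p Y).map φ = 0 := by
  ext i j
  have := congrFun (congrFun h j) i
  simp only [Matrix.map_apply, Matrix.zero_apply] at this
  simp [st1, this]

/-- The conservation conditions may be evaluated in the flat frame. -/
theorem cons_iff_flat (hχ : ∀ M s t,
      χ s • F.Om M (Sum.inr s) (Sum.inr t) = χ t • F.Om M (Sum.inr s) (Sum.inr t))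
    (φ : T →ₐ[ℂ] R) {D : T →ₗ[ℂ] T} (hDV : D = act X.pd (F.brstVec X χ)) {L Φ b u g a : Matrix Coord Coord T}
    (hLV : L = jac X.pd (F.brstVec X χ))
    (hΦ : Φ = matDer cpar D b + L * b + b * st1 cpar L + F.flux X χ)
    (hb : b = F.Bmat X) (hu : u = F.metricUU X) (ha : a = F.metricDU X - b * u)
    (hg : g = F.metricDD X - b * u * b + F.metricDU X * b - b * st0 cpar (F.metricDU X)) :
    ((consDD cpar D L Φ g a).map φ = 0 ∧ (consDU cpar D L Φ a u).map φ = 0 ∧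
        (consUU cpar D L u).map φ = 0) ↔
      ((consDD cpar D (F.frameDer X χ) (F.flatFlux X χ) (flatDD T) (flatDU T)).map φ = 0 ∧
        (consDU cpar D (F.frameDer X χ) (F.flatFlux X χ) (flatDU T) (F.flatUU X)).map φ = 0 ∧
        (consUU cpar D (F.frameDer X χ) (F.flatUU X)).map φ = 0) := by
  have hD : IsOddDerivation D := hDV ▸ act_isOddDerivation X.pd_derivs (F.brstVec_deg X χ)
  have hL : IsHom cpar 1 L := hLV ▸ jac_isHom X.pd_derivs (F.brstVec_deg X χ)
  have he := F.frame_isHom X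
  have hf := F.coframe_isHom X
  have hef := F.frame_mul_coframe X
  have hfe := F.coframe_mul_frame X
  have hℓ : F.frameDer X χ * F.frame X = F.frame X * L - matDer cpar D (F.frame X) := by
    rw [hLV, hDV, F.frameDer_mul_frame X χ hχ]
  have hℓ1 : IsHom cpar 1 (F.frameDer X χ) := by
    -- Oddness is read off from the transformation law solved for `frameDer`, avoiding an inspection
    -- of torsion and curvature entries.
    have h : F.frameDer X χ = (F.frame X * L - matDer cpar D (F.frame X)) * F.coframe X := by
      rw [← hℓ, mul_assoc, hef, mul_one]
    rw [h]
    exact (((he.mul hL).congr (by simp)).sub (he.matDer hD)).mul hf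
  have hst : st0 cpar (F.coframe X) * st0 cpar (F.frame X) = 1 := by
    rw [← st0_mul he hf, hef, st0_one]
  have hts : st0 cpar (F.frame X) * st0 cpar (F.coframe X) = 1 := by
    rw [← st0_mul hf he, hfe, st0_one]
  have hw : F.flux X χ = F.coframe X * F.flatFlux X χ * st0 cpar (F.coframe X) := by
    rw [← frame_flux]
    calc F.flux X χ = (F.coframe X * F.frame X) * F.flux X χ
          * (st0 cpar (F.frame X) * st0 cpar (F.coframe X)) := by rw [hfe, hts, one_mul, mul_one]
      _ = _ := by simp only [mul_assoc]
  have hbs : tdd cpar b = -b := hb ▸ F.tdd_Bmat X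
  have hb0 : IsHom cpar 0 b := hb ▸ F.Bmat_isHom X
  have hu0 : IsHom cpar 0 u := hu ▸ F.metricUU_isHom X
  have hus : tuu cpar u = u := hu ▸ F.tuu_metricUU X
  have ha0 := F.metricDU_isHom X
  have kuu : consUU cpar D L u
      = st0 cpar (F.frame X) * consUU cpar D (F.frameDer X χ) (F.flatUU X) * F.frame X := by
    rw [hu]
    exact consUU_frame hD hL (F.flatUU_isHom X) he hℓ hℓ1
  have kdu : consDU cpar D L (F.flux X χ) (F.metricDU X) u
      = F.coframe X * consDU cpar D (F.frameDer X χ) (F.flatFlux X χ) (flatDU T) (F.flatUU X)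
        * F.frame X := by
    rw [hu, hw]
    exact consDU_frame hD flatDU_isHom he hf hef hfe hℓ
  have kdd : consDD cpar D L (F.flux X χ) (F.metricDD X) (F.metricDU X)
      = F.coframe X * consDD cpar D (F.frameDer X χ) (F.flatFlux X χ) (flatDD T) (flatDU T)
        * st0 cpar (F.coframe X) := by
    rw [hw]
    exact consDD_frame hD hL flatDU_isHom flatDD_isHom he hf hef hfe hℓ hℓ1
  have tdu := consDU_twist (a := F.metricDU X) (u := u) hD hb0 hΦ
  have tdd' := consDD_twist (g := F.metricDD X) hD hL (F.flux_isHom X χ) (F.tuu_flux X χ) ha0 hu0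
    hus hb0 hbs hΦ
  rw [← ha] at tdu tdd'
  rw [← hg] at tdd'
  have euu := map_conj_eq_zero (φ : T →+* R) (Y := consUU cpar D (F.frameDer X χ) (F.flatUU X)) hst hef
  have edu := map_conj_eq_zero (φ : T →+* R) (Y := consDU cpar D (F.frameDer X χ) (F.flatFlux X χ)
    (flatDU T) (F.flatUU X)) hef hef
  have edd := map_conj_eq_zero (φ : T →+* R) (Y := consDD cpar D (F.frameDer X χ) (F.flatFlux X χ)
    (flatDD T) (flatDU T)) hef hst
  rw [← kuu] at euu
  rw [← kdu] at edu
  rw [← kdd] at edd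
  have mmul : ∀ Y Z : Matrix Coord Coord T, (Y * Z).map φ = Y.map φ * Z.map φ :=
    fun Y Z => Matrix.map_mul (f := (φ : T →+* R))
  have msub : ∀ Y Z : Matrix Coord Coord T, (Y - Z).map φ = Y.map φ - Z.map φ :=
    fun Y Z => Matrix.map_sub φ (map_sub φ) Y Z
  have madd : ∀ Y Z : Matrix Coord Coord T, (Y + Z).map φ = Y.map φ + Z.map φ :=
    fun Y Z => Matrix.map_add φ (map_add φ) Y Z
  simp only [RingHom.coe_coe] at euu edu edd
  rw [tdd', tdu, ← euu, ← edu, ← edd]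
  simp only [msub, madd, mmul]
  -- The twisted conditions are triangular in the untwisted ones. The upper condition is common to
  -- both, it reduces the mixed ones to each other, and both together reduce the lower ones.
  constructor
  · rintro ⟨h1, h2, h3⟩
    rw [h3] at h1 h2
    have h2' : (consDU cpar D L (F.flux X χ) (F.metricDU X) u).map φ = 0 := by simpa using h2
    have h4 := map_st1_eq_zero (p := cpar) φ h2'
    rw [h2', h4] at h1
    exact ⟨by simpa using h1, h2', h3⟩
  · rintro ⟨h1, h2, h3⟩
    have h4 := map_st1_eq_zero (p := cpar) φ h2
    rw [h1, h2, h3, h4]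
    simp

end Fields
end

/-! ### Covariant derivatives and evaluation at fixed ghosts -/

section

variable {R T : Type*} [Ring R] [Algebra ℂ R] [SuperCommAlgebra R]
    [Ring T] [Algebra ℂ T] [SuperCommAlgebra T]

theorem derivation_algebraMap {D : R →ₗ[ℂ] R} (hD : IsOddDerivation D) (c : ℂ) :
    D (algebraMap ℂ R c) = 0 := by
  have h := hD.leibniz (1 : R) one_mem
  have h1 : D 1 = 0 := by simpa using h
  rw [Algebra.algebraMap_eq_smul_one, map_smul, h1, smul_zero]

theorem sum_eta_smul {M : Type*} [AddCommGroup M] [Module ℂ M] (a : Fin 10) (f : Fin 10 → M) :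
    ∑ c, eta a c • f c = eta a a • f a := by
  rw [Finset.sum_eq_single a]
  · intro b _ hb
    rw [eta, if_neg (Ne.symm hb), zero_smul]
  · simp

theorem sum_eta_smul' {M : Type*} [AddCommGroup M] [Module ℂ M] (a : Fin 10) (f : Fin 10 → M) :
    ∑ c, eta c a • f c = eta a a • f a := by
  simp only [eta_symm _ a, sum_eta_smul]

theorem eta_mul_self (a : Fin 10) : eta a a * eta a a = 1 := by
  by_cases h : a = 0 <;> simp [eta, h]

namespace Fields

variable (X : GhostExtension R T) (F : Fields R) (χ l : Spin → ℂ)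

/-- `∇_A P^{rq}` -/
def covP (A : Idx) (r q : Spin) : R :=
  ∑ M, F.E A M * (X.mpd M (F.P r q) + (∑ ρ, F.Om M (Sum.inr ρ) (Sum.inr r) * F.P ρ q)
    + ∑ ρ, F.Om M (Sum.inr ρ) (Sum.inr q) * F.P r ρ)

/-- `∇_A K_t^{sg}` -/
def covK (A : Idx) (t s g : Spin) : R :=
  ∑ M, F.E A M * (X.mpd M (F.K t s g) + (∑ ρ, F.Om M (Sum.inr ρ) (Sum.inr s) * F.K t ρ g)
    + (∑ ρ, F.Om M (Sum.inr ρ) (Sum.inr g) * F.K t s ρ)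
    - ∑ ρ, F.Om M (Sum.inr t) (Sum.inr ρ) * F.K ρ s g)

/-- `∇_A S_{tt'}^{gg'}` -/
def covS (A : Idx) (t t' g g' : Spin) : R :=
  ∑ M, F.E A M * (X.mpd M (F.S t t' g g')
    + (∑ ρ, F.Om M (Sum.inr ρ) (Sum.inr g) * F.S t t' ρ g')
    + (∑ ρ, F.Om M (Sum.inr ρ) (Sum.inr g') * F.S t t' g ρ)
    - (∑ ρ, F.Om M (Sum.inr t) (Sum.inr ρ) * F.S ρ t' g g')
    - ∑ ρ, F.Om M (Sum.inr t') (Sum.inr ρ) * F.S t ρ g g')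

/-! ### Contractions with ghosts -/

/-- `χ_s l^s T_{sA}^C` -/
def conT (A C : Idx) : R := ∑ s, (χ s * l s) • F.tors X (Sum.inr s) A C

/-- `χ_s l^s H_{sAB}` -/
def conH (A B : Idx) : R := ∑ s, (χ s * l s) • F.flatH X (Sum.inr s) A B

/-- `χ_s l^s l^t R_{sAt}^g` -/
def conR (A : Idx) (g : Spin) : R :=
  ∑ s, ∑ t, (χ s * l s * l t) • F.curv X (Sum.inr s) A t g

/-- `χ_s l^s Ω_{sA}^C` -/
def conOm (A C : Idx) : R := ∑ s, (χ s * l s) • F.flatOm (Sum.inr s) A C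

/-- `l^t K_t^{sg}` -/
def conK (s g : Spin) : R := ∑ t, l t • F.K t s g

/-- `l^t l^t' S_{tt'}^{gg'}` -/
def conS (g g' : Spin) : R := ∑ t, ∑ t', (l t * l t') • F.S t t' g g'

/-- `χ_s l^s ∇_s P^{rq}` -/
def conDP (r q : Spin) : R := ∑ s, (χ s * l s) • F.covP X (Sum.inr s) r q

/-- `χ_s l^s l^t ∇_s K_t^{rg}` -/
def conDK (r g : Spin) : R := ∑ s, ∑ t, (χ s * l s * l t) • F.covK X (Sum.inr s) t r g

/-- `χ_s l^s l^t l^t' ∇_s S_{tt'}^{gg'}` -/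
def conDS (g g' : Spin) : R :=
  ∑ s, ∑ t, ∑ t', (χ s * l s * l t * l t') • F.covS X (Sum.inr s) t t' g g'

theorem ev_lam_mul (s : Spin) (x : T) : X.ev l (X.lam s * x) = l s • X.ev l x := by
  rw [map_mul, X.ev_lam, Algebra.smul_def]

theorem ev_conn_sum (f : Spin → R) :
    X.ev l (∑ s, χ s • (X.lam s * X.up (f s))) = ∑ s, (χ s * l s) • f s := by
  simp only [map_sum, map_smul, ev_lam_mul, X.ev_up, smul_smul]

theorem ev_frameDer_mat_mat (A C : Idx) : X.ev l (F.frameDer X χ (mat A) (mat C))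
    = -(sg (par A) • (F.conT X χ l A C + F.conOm χ l A C)) := by
  rw [frameDer_mat_mat, map_neg, map_smul, ev_conn_sum]
  simp only [smul_add, Finset.sum_add_distrib, conT, conOm]

theorem ev_frameDer_mat_gh (A : Idx) (g : Spin) : X.ev l (F.frameDer X χ (mat A) (Sum.inr g))
    = -(sg (par A) • F.conR X χ l A g) := by
  simp only [frameDer_mat_gh, map_neg, map_smul, map_sum, ev_lam_mul, X.ev_up, conR, Finset.smul_sum,
    smul_smul, mul_assoc]

theorem ev_frameDer_gh_spin (r s : Spin) :
    X.ev l (F.frameDer X χ (Sum.inr r) (mat (Sum.inr s)))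
      = if r = s then algebraMap ℂ R (χ r) else 0 := by
  rw [frameDer_gh_spin]; split_ifs <;> simp

theorem ev_frameDer_gh_gh (r g : Spin) : X.ev l (F.frameDer X χ (Sum.inr r) (Sum.inr g))
    = -F.conOm χ l (Sum.inr r) (Sum.inr g) := by
  rw [frameDer_gh_gh, map_neg, ev_conn_sum, conOm]

theorem ev_flatFlux (A B : Idx) : X.ev l (F.flatFlux X χ (mat A) (mat B))
    = sg (par A) • F.conH X χ l A B := by
  rw [flatFlux_mat_mat, map_smul, ev_conn_sum, conH]

theorem ev_lamK (s g : Spin) : X.ev l (F.lamK X s g) = F.conK l s g := by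
  simp only [lamK, conK, map_sum, ev_lam_mul, X.ev_up]

theorem ev_lamS (g g' : Spin) : X.ev l (F.lamS X g g') = F.conS l g g' := by
  simp only [lamS, conS, map_sum, ev_lam_mul, X.ev_up, mul_assoc, smul_smul]

theorem ev_act_up (x : R) : X.ev l (act X.pd (F.brstVec X χ) (X.up x))
    = ∑ s, (χ s * l s) • F.dirDeriv X (Sum.inr s) x := by
  rw [act_brstVec_up, ev_conn_sum]

theorem ev_act_lam (t : Spin) : X.ev l (act X.pd (F.brstVec X χ) (X.lam t))
    = -∑ u, l u • F.conOm χ l (Sum.inr u) (Sum.inr t) := by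
  simp only [act_brstVec, act_frame_lam, map_sum, map_smul, map_neg, ev_lam_mul, X.ev_up, conOm,
    smul_neg, Finset.sum_neg_distrib, Finset.smul_sum, smul_smul]
  rw [Finset.sum_comm]
  simp only [mul_comm, mul_left_comm]

theorem conOm_vec_left (a : Fin 10) (C : Idx) : F.conOm χ l (vec a) C = 0 := by
  simp [conOm, flatOm, F.Om_vec_left]

theorem conOm_vec_right (A : Idx) (b : Fin 10) : F.conOm χ l A (vec b) = 0 := by
  simp [conOm, flatOm, F.Om_vec_right]

theorem conOm_chir (s t : Spin) (h : chir s ≠ chir t) :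
    F.conOm χ l (Sum.inr s) (Sum.inr t) = 0 := by
  simp [conOm, flatOm, F.Om_chir _ s t h]

theorem flatOm_deg (A B C : Idx) : F.flatOm A B C ∈ deg (par A + par B + par C) :=
  Submodule.sum_mem _ fun M _ => deg_of (mul_mem (F.E_deg A M) (F.Om_deg M B C))

theorem conOm_deg (s t : Spin) : F.conOm χ l (Sum.inr s) (Sum.inr t) ∈ deg 1 :=
  Submodule.sum_mem _ fun _ _ => Submodule.smul_mem _ _ (deg_of (F.flatOm_deg _ _ _)
    (by simp only [par_inr]; decide))

theorem conK_deg (s g : Spin) : F.conK l s g ∈ deg 1 :=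
  Submodule.sum_mem _ fun _ _ => Submodule.smul_mem _ _ (F.K_deg _ _ _)

theorem conS_deg (g g' : Spin) : F.conS l g g' ∈ deg 0 :=
  Submodule.sum_mem _ fun _ _ => Submodule.sum_mem _ fun _ _ =>
    Submodule.smul_mem _ _ (F.S_deg _ _ _ _)

theorem covP_eq (A : Idx) (r q : Spin) : F.covP X A r q = F.dirDeriv X A (F.P r q)
    + (∑ ρ, F.flatOm A (Sum.inr ρ) (Sum.inr r) * F.P ρ q)
    + ∑ ρ, F.flatOm A (Sum.inr ρ) (Sum.inr q) * F.P r ρ := by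
  simp only [covP, dirDeriv, flatOm, mul_add, Finset.sum_add_distrib, Finset.mul_sum,
    Finset.sum_mul, mul_assoc]
  congr 1
  · congr 1
    rw [Finset.sum_comm]
  · rw [Finset.sum_comm]

theorem covK_eq (A : Idx) (t s g : Spin) : F.covK X A t s g = F.dirDeriv X A (F.K t s g)
    + (∑ ρ, F.flatOm A (Sum.inr ρ) (Sum.inr s) * F.K t ρ g)
    + (∑ ρ, F.flatOm A (Sum.inr ρ) (Sum.inr g) * F.K t s ρ)
    - ∑ ρ, F.flatOm A (Sum.inr t) (Sum.inr ρ) * F.K ρ s g := by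
  simp only [covK, dirDeriv, flatOm, mul_add, mul_sub, Finset.sum_add_distrib,
    Finset.sum_sub_distrib, Finset.mul_sum, Finset.sum_mul, mul_assoc]
  rw [Finset.sum_comm (γ := Idx) (α := Spin), Finset.sum_comm (γ := Idx) (α := Spin),
    Finset.sum_comm (γ := Idx) (α := Spin)]

theorem covS_eq (A : Idx) (t t' g g' : Spin) : F.covS X A t t' g g' = F.dirDeriv X A (F.S t t' g g')
    + (∑ ρ, F.flatOm A (Sum.inr ρ) (Sum.inr g) * F.S t t' ρ g')
    + (∑ ρ, F.flatOm A (Sum.inr ρ) (Sum.inr g') * F.S t t' g ρ)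
    - (∑ ρ, F.flatOm A (Sum.inr t) (Sum.inr ρ) * F.S ρ t' g g')
    - ∑ ρ, F.flatOm A (Sum.inr t') (Sum.inr ρ) * F.S t ρ g g' := by
  simp only [covS, dirDeriv, flatOm, mul_add, mul_sub, Finset.sum_add_distrib,
    Finset.sum_sub_distrib, Finset.mul_sum, Finset.sum_mul, mul_assoc]
  rw [Finset.sum_comm (γ := Idx) (α := Spin), Finset.sum_comm (γ := Idx) (α := Spin),
    Finset.sum_comm (γ := Idx) (α := Spin), Finset.sum_comm (γ := Idx) (α := Spin)]

/-- Both labels of `P` are free upper labels, so the connection acts on each of them explicitly and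
no ghost rotation is involved. -/
theorem conDP_eq (r q : Spin) : F.conDP X χ l r q
    = X.ev l (act X.pd (F.brstVec X χ) (X.up (F.P r q)))
      + (∑ ρ, F.conOm χ l (Sum.inr ρ) (Sum.inr r) * F.P ρ q)
      + ∑ ρ, F.conOm χ l (Sum.inr ρ) (Sum.inr q) * F.P r ρ := by
  simp only [conDP, covP_eq, ev_act_up, conOm, smul_add, Finset.sum_add_distrib, Finset.sum_mul,
    Finset.smul_sum, smul_mul_assoc]
  congr 1
  · congr 1
    rw [Finset.sum_comm]
  · rw [Finset.sum_comm]

theorem ev_act_lam_mul_up (t : Spin) (x : R) :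
    X.ev l (act X.pd (F.brstVec X χ) (X.lam t * X.up x))
      = l t • (∑ s, (χ s * l s) • F.dirDeriv X (Sum.inr s) x)
        - (∑ u, l u • F.conOm χ l (Sum.inr u) (Sum.inr t)) * x := by
  have hD := act_isOddDerivation X.pd_derivs (F.brstVec_deg X χ)
  rw [hD.leibniz _ (X.lam_deg t), show sg 0 = 1 from pow_zero _, one_smul, map_add, ev_lam_mul, map_mul, ev_act_lam,
    X.ev_up, ev_act_up, neg_mul]
  abel

theorem sum_reverse {ι κ μ : Type*} [Fintype ι] [Fintype κ] [Fintype μ] (f : ι → κ → μ → R) :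
    ∑ a, ∑ b, ∑ c, f a b c = ∑ c, ∑ b, ∑ a, f a b c := by
  conv_rhs =>
    rw [Finset.sum_comm]
    enter [2, s]
    rw [Finset.sum_comm]
  exact Finset.sum_comm

theorem sum_smul_sum_mul {ι κ μ : Type*} [Fintype ι] [Fintype κ] [Fintype μ] (a : ι → ℂ)
    (b : κ → ℂ) (f : ι → μ → R) (k : κ → μ → R) :
    ∑ s, a s • ∑ i, b i • ∑ ρ, f s ρ * k i ρ = ∑ ρ, (∑ s, a s • f s ρ) * ∑ i, b i • k i ρ := by
  simp only [Finset.sum_mul_sum, smul_mul_smul_comm, Finset.smul_sum, smul_smul]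
  conv_rhs =>
    rw [Finset.sum_comm]
    enter [2, s]
    rw [Finset.sum_comm]

theorem sum_smul_sum_mul' {ι κ μ : Type*} [Fintype ι] [Fintype κ] [Fintype μ] (a : ι → ℂ)
    (b : κ → ℂ) (f : ι → κ → μ → R) (k : μ → R) :
    ∑ s, a s • ∑ i, b i • ∑ ρ, f s i ρ * k ρ = ∑ ρ, (∑ i, b i • ∑ s, a s • f s i ρ) * k ρ := by
  simp only [Finset.sum_mul, smul_mul_assoc, Finset.smul_sum, smul_smul]
  conv_rhs =>
    rw [Finset.sum_comm]
    enter [2, s]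
    rw [Finset.sum_comm]
  rw [Finset.sum_comm]
  simp only [mul_comm]

/-- The lower label is contracted with a ghost, and its connection term comes from the vector field
acting on that ghost. Only the upper labels need explicit connection terms. -/
theorem conDK_eq (r g : Spin) : F.conDK X χ l r g
    = X.ev l (act X.pd (F.brstVec X χ) (F.lamK X r g))
      + (∑ ρ, F.conOm χ l (Sum.inr ρ) (Sum.inr r) * F.conK l ρ g)
      + ∑ ρ, F.conOm χ l (Sum.inr ρ) (Sum.inr g) * F.conK l r ρ := by
  have h : F.conDK X χ l r g = ∑ s, (χ s * l s) • ∑ t, l t • F.covK X (Sum.inr s) t r g := by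
    simp only [conDK, Finset.smul_sum, smul_smul]
  rw [h]
  simp only [covK_eq, lamK, map_sum, ev_act_lam_mul_up, smul_add, smul_sub, Finset.sum_add_distrib,
    Finset.sum_sub_distrib, sum_smul_sum_mul (R := R), sum_smul_sum_mul' (R := R)]
  have h2 : ∑ s, (χ s * l s) • ∑ t, l t • F.dirDeriv X (Sum.inr s) (F.K t r g)
      = ∑ t, l t • ∑ s, (χ s * l s) • F.dirDeriv X (Sum.inr s) (F.K t r g) := by
    simp only [Finset.smul_sum, smul_smul]
    rw [Finset.sum_comm]
    simp only [mul_comm]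
  rw [h2]
  simp only [conOm, conK]
  abel

theorem conDS_eq (g g' : Spin) : F.conDS X χ l g g'
    = X.ev l (act X.pd (F.brstVec X χ) (F.lamS X g g'))
      + (∑ ρ, F.conOm χ l (Sum.inr ρ) (Sum.inr g) * F.conS l ρ g')
      + ∑ ρ, F.conOm χ l (Sum.inr ρ) (Sum.inr g') * F.conS l g ρ := by
  -- Bundling the two ghost labels into one index reduces the resummation to the pattern with a
  -- single contracted label.
  have h : F.conDS X χ l g g'
      = ∑ s, (χ s * l s) • ∑ i : Spin × Spin, (l i.1 * l i.2) • F.covS X (Sum.inr s) i.1 i.2 g g' := by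
    simp only [conDS, Finset.smul_sum, smul_smul, Fintype.sum_prod_type, mul_assoc]
  have hS : ∀ g g', F.conS l g g' = ∑ i : Spin × Spin, (l i.1 * l i.2) • F.S i.1 i.2 g g' := by
    intro g g'
    simp only [conS, Fintype.sum_prod_type]
  have hL : F.lamS X g g' = ∑ i : Spin × Spin, X.lam i.1 * (X.lam i.2 * X.up (F.S i.1 i.2 g g')) := by
    simp only [lamS, Fintype.sum_prod_type, mul_assoc]
  have hD := act_isOddDerivation X.pd_derivs (F.brstVec_deg X χ)
  have hact : ∀ i : Spin × Spin, X.ev l (act X.pd (F.brstVec X χ)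
      (X.lam i.1 * (X.lam i.2 * X.up (F.S i.1 i.2 g g'))))
      = (l i.1 * l i.2) • (∑ s, (χ s * l s) • F.dirDeriv X (Sum.inr s) (F.S i.1 i.2 g g'))
        - l i.1 • ((∑ u, l u • F.conOm χ l (Sum.inr u) (Sum.inr i.2)) * F.S i.1 i.2 g g')
        - l i.2 • ((∑ u, l u • F.conOm χ l (Sum.inr u) (Sum.inr i.1)) * F.S i.1 i.2 g g') := by
    intro i
    rw [hD.leibniz _ (X.lam_deg i.1), show sg 0 = 1 from pow_zero _, one_smul, map_add, ev_lam_mul,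
      ev_act_lam_mul_up, map_mul, ev_lam_mul, ev_act_lam, X.ev_up, smul_sub, smul_smul,
      mul_smul_comm, neg_mul, smul_neg]
    abel
  rw [h, hL]
  simp only [covS_eq, map_sum, hact, smul_add, smul_sub, Finset.sum_add_distrib,
    Finset.sum_sub_distrib, sum_smul_sum_mul (R := R)]
  have h2 : ∑ s, (χ s * l s) • ∑ i : Spin × Spin,
        (l i.1 * l i.2) • F.dirDeriv X (Sum.inr s) (F.S i.1 i.2 g g')
      = ∑ i : Spin × Spin, (l i.1 * l i.2) • ∑ s, (χ s * l s) •
        F.dirDeriv X (Sum.inr s) (F.S i.1 i.2 g g') := by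
    simp only [Finset.smul_sum, smul_smul]
    rw [Finset.sum_comm]
    simp only [mul_comm]
  -- The label on which the connection acts exchanges its role with the dummy label. Each side is
  -- then the same sum over four labels.
  have h3 : ∑ s, (χ s * l s) • ∑ i : Spin × Spin,
        (l i.1 * l i.2) • ∑ ρ, F.flatOm (Sum.inr s) (Sum.inr i.1) (Sum.inr ρ) * F.S ρ i.2 g g'
      = ∑ i : Spin × Spin,
        l i.2 • ((∑ u, l u • F.conOm χ l (Sum.inr u) (Sum.inr i.1)) * F.S i.1 i.2 g g') := by
    simp only [conOm, Fintype.sum_prod_type, Finset.smul_sum, Finset.sum_mul, smul_smul,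
      smul_mul_assoc]
    have hp : ∀ f : Spin → Spin → Spin → Spin → R, ∑ s, ∑ u, ∑ t, ∑ ρ, f s u t ρ
        = ∑ ρ, ∑ t, ∑ u, ∑ s, f s u t ρ := by
      intro f
      simp only [sum_reverse (f _)]
      rw [Finset.sum_comm]
      refine Finset.sum_congr rfl fun ρ _ => ?_
      rw [Finset.sum_comm]
      exact Finset.sum_congr rfl fun t _ => Finset.sum_comm
    rw [hp]
    refine Finset.sum_congr rfl fun _ _ => Finset.sum_congr rfl fun _ _ =>
      Finset.sum_congr rfl fun _ _ => Finset.sum_congr rfl fun _ _ => ?_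
    congr 1
    ring
  have h4 : ∑ s, (χ s * l s) • ∑ i : Spin × Spin,
        (l i.1 * l i.2) • ∑ ρ, F.flatOm (Sum.inr s) (Sum.inr i.2) (Sum.inr ρ) * F.S i.1 ρ g g'
      = ∑ i : Spin × Spin,
        l i.1 • ((∑ u, l u • F.conOm χ l (Sum.inr u) (Sum.inr i.2)) * F.S i.1 i.2 g g') := by
    simp only [conOm, Fintype.sum_prod_type, Finset.smul_sum, Finset.sum_mul, smul_smul,
      smul_mul_assoc]
    have hp : ∀ f : Spin → Spin → Spin → Spin → R, ∑ s, ∑ t, ∑ u, ∑ ρ, f s t u ρ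
        = ∑ t, ∑ ρ, ∑ u, ∑ s, f s t u ρ := by
      intro f
      rw [Finset.sum_comm]
      refine Finset.sum_congr rfl fun t _ => ?_
      exact sum_reverse _
    rw [hp]
    refine Finset.sum_congr rfl fun _ _ => Finset.sum_congr rfl fun _ _ =>
      Finset.sum_congr rfl fun _ _ => Finset.sum_congr rfl fun _ _ => ?_
    congr 1
    ring
  rw [h2, h3, h4]
  simp only [← hS, conOm]
  abel

end Fields
end

/-! ### Flat components of the conservation conditions -/

section

variable {R T : Type*} [Ring R] [Algebra ℂ R] [SuperCommAlgebra R]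
    [Ring T] [Algebra ℂ T] [SuperCommAlgebra T]

namespace Fields

variable (X : GhostExtension R T) (F : Fields R) (χ l : Spin → ℂ)

theorem flatDU_apply_mul (Y : Matrix Coord Coord T) (i j : Coord) :
    (Y * flatDU T) i j = flatSign j • Y i j := by
  rw [flatDU, Matrix.mul_diagonal, smul_one_comm]

theorem mul_flatDU_apply (Y : Matrix Coord Coord T) (i j : Coord) :
    (flatDU T * Y) i j = flatSign i • Y i j := by
  rw [flatDU, Matrix.diagonal_mul, Algebra.smul_def]

theorem st0_flatDU : st0 cpar (flatDU T) = flatDU T := by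
  ext i j
  simp only [st0, flatDU, Matrix.of_apply]
  by_cases h : i = j
  · subst h
    rw [sg_congr (n := 0)]
    simp
  · rw [Matrix.diagonal_apply_ne _ h, Matrix.diagonal_apply_ne _ (Ne.symm h), smul_zero]

/-- The derivation `V^i ∂_i` along `χ_s λ^s e_s`. -/
def brstDer : T →ₗ[ℂ] T := act X.pd (F.brstVec X χ)

theorem brstDer_isOddDerivation : IsOddDerivation (F.brstDer X χ) :=
  act_isOddDerivation X.pd_derivs (F.brstVec_deg X χ)

theorem brstDer_algebraMap (c : ℂ) : F.brstDer X χ (algebraMap ℂ T c) = 0 :=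
  derivation_algebraMap (F.brstDer_isOddDerivation X χ) c

/-- The flat components of the conservation condition on `𝔸_{ij}`. -/
def flatConsDD (i j : Coord) : R := X.ev l (consDD cpar (F.brstDer X χ) (F.frameDer X χ)
  (F.flatFlux X χ) (flatDD T) (flatDU T) i j)

/-- The flat components of the conservation condition on `𝔸_i^j`. -/
def flatConsDU (i j : Coord) : R := X.ev l (consDU cpar (F.brstDer X χ) (F.frameDer X χ)
  (F.flatFlux X χ) (flatDU T) (F.flatUU X) i j)

/-- The flat components of the conservation condition on `𝔸^{ij}`. -/
def flatConsUU (i j : Coord) : R := X.ev l (consUU cpar (F.brstDer X χ) (F.frameDer X χ)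
  (F.flatUU X) i j)

/-- The flat lower metric is constant, so its derivative drops out. The mixed metric is diagonal, so
the flux terms collapse to a difference of eigenvalues. -/
theorem flatConsDD_eq (i j : Coord) : F.flatConsDD X χ l i j
    = ∑ k, X.ev l (F.frameDer X χ i k) * X.ev l (flatDD T k j)
      + ∑ k, X.ev l (flatDD T i k) * sg (cpar j + cpar k * cpar j) • X.ev l (F.frameDer X χ j k)
      + (flatSign j - flatSign i) • X.ev l (F.flatFlux X χ i j) := by
  have h : F.brstDer X χ (flatDD T i j) = 0 := by
    rcases i with (i | i) | i <;> rcases j with (j | j) | j <;>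
      simp [brstDer_algebraMap, -algebraMap_smul]
  rw [flatConsDD, consDD, Matrix.sub_apply, Matrix.add_apply, Matrix.add_apply, Matrix.add_apply,
    st0_flatDU, flatDU_apply_mul, mul_flatDU_apply, add_sub_assoc, ← sub_smul]
  simp only [matDer, Matrix.of_apply, h, smul_zero, zero_add, Matrix.mul_apply, map_add, map_smul,
    map_sum, map_mul, st1]

/-- The commutator with a diagonal matrix multiplies each entry by a difference of eigenvalues.
Torsion and curvature are thus seen here only between different eigenspaces. -/
theorem flatConsDU_eq (i j : Coord) : F.flatConsDU X χ l i j
    = (flatSign j - flatSign i) • X.ev l (F.frameDer X χ i j)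
      + ∑ k, X.ev l (F.flatFlux X χ i k) * X.ev l (F.flatUU X k j) := by
  have h : F.brstDer X χ (flatDU T i j) = 0 := by
    by_cases h : i = j
    · rw [h, flatDU, Matrix.diagonal_apply_eq, brstDer_algebraMap]
    · rw [flatDU, Matrix.diagonal_apply_ne _ h, map_zero]
  rw [flatConsDU, consDU, Matrix.add_apply, Matrix.sub_apply, Matrix.add_apply,
    flatDU_apply_mul, mul_flatDU_apply, add_sub_assoc, ← sub_smul]
  simp only [matDer, Matrix.of_apply, h, smul_zero, zero_add, Matrix.mul_apply, map_add, map_smul,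
    map_sum, map_mul]

theorem flatConsUU_eq (i j : Coord) : F.flatConsUU X χ l i j
    = sg (cpar i) • X.ev l (F.brstDer X χ (F.flatUU X i j))
      - ∑ k, X.ev l (F.flatUU X i k) * X.ev l (F.frameDer X χ k j)
      - ∑ k, sg (cpar k + cpar i * cpar k) • X.ev l (F.frameDer X χ k i) * X.ev l (F.flatUU X k j)
      := by
  rw [flatConsUU, consUU, Matrix.sub_apply, Matrix.sub_apply]
  simp only [matDer, Matrix.of_apply, Matrix.mul_apply, map_sub, map_smul,
    map_sum, map_mul, st1]

/-- `χ_s l^s T_{sAb}` -/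
def conTl (A : Idx) (b : Fin 10) : R := eta b b • F.conT X χ l A (vec b)

theorem conTl_smul (A : Idx) (b : Fin 10) :
    eta b b • F.conTl X χ l A b = F.conT X χ l A (vec b) := by
  rw [conTl, smul_smul, eta_mul_self, one_smul]

theorem flatConsDD_vec_vec (a b : Fin 10) : F.flatConsDD X χ l (mat (vec a)) (mat (vec b))
    = -(F.conTl X χ l (vec a) b + F.conTl X χ l (vec b) a) := by
  rw [flatConsDD_eq]
  simp [sum_coord, sum_idx, -Fintype.sum_sum_type, -flatFlux_mat_mat, ev_frameDer_mat_mat, conOm_vec_left,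
    smul_one_comm, ← Algebra.smul_def, sum_eta_smul, sum_eta_smul', conTl]
  abel

theorem flatConsDD_spin_vec (r : Spin) (b : Fin 10) :
    F.flatConsDD X χ l (mat (Sum.inr r)) (mat (vec b))
    = F.conTl X χ l (Sum.inr r) b + chir r • F.conH X χ l (Sum.inr r) (vec b) := by
  rw [flatConsDD_eq]
  simp [sum_coord, sum_idx, -Fintype.sum_sum_type, -flatFlux_mat_mat, ev_frameDer_mat_mat, conOm_vec_right,
    smul_one_comm, sum_eta_smul', conTl, ev_flatFlux]

theorem flatConsDD_vec_spin (r : Spin) (b : Fin 10) :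
    F.flatConsDD X χ l (mat (vec b)) (mat (Sum.inr r))
    = -F.conTl X χ l (Sum.inr r) b + chir r • F.conH X χ l (vec b) (Sum.inr r) := by
  rw [flatConsDD_eq]
  simp [sum_coord, sum_idx, -Fintype.sum_sum_type, -flatFlux_mat_mat, ev_frameDer_mat_mat, conOm_vec_right,
    ← Algebra.smul_def, sum_eta_smul, conTl, ev_flatFlux]

theorem flatConsDD_spin_spin (r r' : Spin) :
    F.flatConsDD X χ l (mat (Sum.inr r)) (mat (Sum.inr r'))
    = -((chir r' - chir r) • F.conH X χ l (Sum.inr r) (Sum.inr r')) := by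
  rw [flatConsDD_eq]
  simp [sum_coord, sum_idx, -Fintype.sum_sum_type, -flatFlux_mat_mat, ev_flatFlux]

theorem flatConsDD_gh (g : Spin) (j : Coord) : F.flatConsDD X χ l (Sum.inr g) j = 0 := by
  rw [flatConsDD_eq]
  rcases j with (j | j) | j <;>
  simp [sum_coord, sum_idx, -Fintype.sum_sum_type, -flatFlux_mat_mat, frameDer_gh_vec]

theorem flatConsDD_mat_gh (A : Idx) (g : Spin) : F.flatConsDD X χ l (mat A) (Sum.inr g) = 0 := by
  rw [flatConsDD_eq]
  rcases A with j | j <;>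
  simp [sum_coord, sum_idx, -Fintype.sum_sum_type, -flatFlux_mat_mat, frameDer_gh_vec]

theorem flatConsDU_vec_vec (a b : Fin 10) : F.flatConsDU X χ l (mat (vec a)) (mat (vec b))
    = eta b b • F.conH X χ l (vec a) (vec b) := by
  rw [flatConsDU_eq]
  simp [sum_coord, sum_idx, -Fintype.sum_sum_type, -flatFlux_mat_mat, smul_one_comm, sum_eta_smul', ev_flatFlux]

theorem flatConsDU_vec_spin (a : Fin 10) (s : Spin) :
    F.flatConsDU X χ l (mat (vec a)) (mat (Sum.inr s))
    = -(chir s • F.conT X χ l (vec a) (Sum.inr s))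
      + ∑ r, F.conH X χ l (vec a) (Sum.inr r) * F.P r s := by
  rw [flatConsDU_eq]
  simp [sum_coord, sum_idx, -Fintype.sum_sum_type, -flatFlux_mat_mat, ev_frameDer_mat_mat, conOm_vec_left,
    ev_flatFlux, X.ev_up]

theorem flatConsDU_vec_gh (a : Fin 10) (g : Spin) :
    F.flatConsDU X χ l (mat (vec a)) (Sum.inr g)
    = -(chir g • F.conR X χ l (vec a) g)
      + ∑ r, F.conH X χ l (vec a) (Sum.inr r) * F.conK l r g := by
  rw [flatConsDU_eq]
  simp [sum_coord, sum_idx, -Fintype.sum_sum_type, -flatFlux_mat_mat, ev_frameDer_mat_gh,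
    ev_flatFlux, ev_lamK]

theorem flatConsDU_spin_vec (r : Spin) (b : Fin 10) :
    F.flatConsDU X χ l (mat (Sum.inr r)) (mat (vec b))
    = -(chir r • F.conT X χ l (Sum.inr r) (vec b)) - eta b b • F.conH X χ l (Sum.inr r) (vec b) := by
  rw [flatConsDU_eq]
  simp [sum_coord, sum_idx, -Fintype.sum_sum_type, -flatFlux_mat_mat, ev_frameDer_mat_mat, conOm_vec_right,
    smul_one_comm, sum_eta_smul', ev_flatFlux]
  abel

theorem flatConsDU_spin_spin (r s : Spin) :
    F.flatConsDU X χ l (mat (Sum.inr r)) (mat (Sum.inr s))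
    = (chir s - chir r) • F.conT X χ l (Sum.inr r) (Sum.inr s)
      - ∑ q, F.conH X χ l (Sum.inr r) (Sum.inr q) * F.P q s := by
  -- The connection preserves the kind of spinor, so its entries survive only where the eigenvalue
  -- difference is zero.
  have h : (chir s - chir r) • F.conOm χ l (Sum.inr r) (Sum.inr s) = 0 := by
    by_cases h : chir r = chir s
    · simp [h]
    · simp [F.conOm_chir χ l r s h]
  rw [flatConsDU_eq]
  simp [sum_coord, sum_idx, -Fintype.sum_sum_type, -flatFlux_mat_mat, ev_frameDer_mat_mat, h,
    ev_flatFlux, X.ev_up]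
  abel

theorem flatConsDU_spin_gh (r g : Spin) :
    F.flatConsDU X χ l (mat (Sum.inr r)) (Sum.inr g)
    = (chir g - chir r) • F.conR X χ l (Sum.inr r) g
      - ∑ q, F.conH X χ l (Sum.inr r) (Sum.inr q) * F.conK l q g := by
  rw [flatConsDU_eq]
  simp [sum_coord, sum_idx, -Fintype.sum_sum_type, -flatFlux_mat_mat, ev_frameDer_mat_gh,
    ev_flatFlux, ev_lamK]
  abel

/-- Ghost rows carry no information. The flux has no ghost legs, and the nonzero entries of
`frameDer` in these rows connect labels of equal eigenvalue. -/
theorem flatConsDU_gh (g : Spin) (j : Coord) : F.flatConsDU X χ l (Sum.inr g) j = 0 := by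
  rw [flatConsDU_eq]
  have h : ∀ k, F.flatFlux X χ (Sum.inr g) k = 0 := fun k => by rcases k with k | k <;> rfl
  simp only [h, map_zero, zero_mul, Finset.sum_const_zero, add_zero]
  rcases j with (j | j) | j
  · simp [frameDer_gh_vec]
  · rw [ev_frameDer_gh_spin]
    split_ifs with h
    · simp [h]
    · simp
  · rw [ev_frameDer_gh_gh]
    by_cases h : chir g = chir j
    · simp [h]
    · simp [F.conOm_chir χ l g j h]

theorem flatConsUU_vec_vec (a b : Fin 10) : F.flatConsUU X χ l (mat (vec a)) (mat (vec b))
    = eta a a • F.conT X χ l (vec a) (vec b) + eta b b • F.conT X χ l (vec b) (vec a) := by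
  rw [flatConsUU_eq]
  simp [sum_coord, sum_idx, -Fintype.sum_sum_type, -flatFlux_mat_mat, smul_one_comm, ← Algebra.smul_def,
    sum_eta_smul, sum_eta_smul', ev_frameDer_mat_mat, conOm_vec_left, brstDer_algebraMap]

theorem flatConsUU_vec_spin (a : Fin 10) (s : Spin) :
    F.flatConsUU X χ l (mat (vec a)) (mat (Sum.inr s))
    = eta a a • F.conT X χ l (vec a) (Sum.inr s)
      + ∑ q, F.conT X χ l (Sum.inr q) (vec a) * F.P q s := by
  rw [flatConsUU_eq]
  simp [sum_coord, sum_idx, -Fintype.sum_sum_type, -flatFlux_mat_mat, ← Algebra.smul_def,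
    sum_eta_smul, ev_frameDer_mat_mat, conOm_vec_left, conOm_vec_right,
    X.ev_up, frameDer_gh_vec]

theorem flatConsUU_vec_gh (a : Fin 10) (g : Spin) :
    F.flatConsUU X χ l (mat (vec a)) (Sum.inr g)
    = eta a a • F.conR X χ l (vec a) g
      + ∑ q, F.conT X χ l (Sum.inr q) (vec a) * F.conK l q g := by
  rw [flatConsUU_eq]
  simp [sum_coord, sum_idx, -Fintype.sum_sum_type, -flatFlux_mat_mat, ← Algebra.smul_def,
    sum_eta_smul, ev_frameDer_mat_mat, ev_frameDer_mat_gh,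
    conOm_vec_right, frameDer_gh_vec, ev_lamK]

theorem flatConsUU_spin_spin (r s : Spin) :
    F.flatConsUU X χ l (mat (Sum.inr r)) (mat (Sum.inr s))
    = -(F.conDP X χ l r s + ∑ q, F.P r q * F.conT X χ l (Sum.inr q) (Sum.inr s)
      + ∑ q, F.conT X χ l (Sum.inr q) (Sum.inr r) * F.P q s
      + χ s • F.conK l r s - χ r • F.conK l s r) := by
  have hP : ∀ ρ, F.P r ρ * F.conOm χ l (Sum.inr ρ) (Sum.inr s)
      = F.conOm χ l (Sum.inr ρ) (Sum.inr s) * F.P r ρ :=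
    fun ρ => commute_of_even (F.P_deg r ρ) (F.conOm_deg χ l ρ s)
  rw [flatConsUU_eq, conDP_eq]
  simp [sum_coord, sum_idx, -Fintype.sum_sum_type, -flatFlux_mat_mat, ev_frameDer_mat_mat,
    X.ev_up, ev_frameDer_gh_spin, ev_lamK, brstDer, smul_one_comm, ← Algebra.smul_def, add_mul,
    mul_add, Finset.sum_add_distrib, hP]
  abel

theorem flatConsUU_spin_gh (r g : Spin) :
    F.flatConsUU X χ l (mat (Sum.inr r)) (Sum.inr g)
    = -(F.conDK X χ l r g + ∑ q, F.P r q * F.conR X χ l (Sum.inr q) g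
      + ∑ q, F.conT X χ l (Sum.inr q) (Sum.inr r) * F.conK l q g + χ r • F.conS l r g) := by
  -- Both factors are odd. The resulting sign makes this term part of the covariant derivative.
  have hK : ∀ ρ, F.conK l r ρ * F.conOm χ l (Sum.inr ρ) (Sum.inr g)
      = -(F.conOm χ l (Sum.inr ρ) (Sum.inr g) * F.conK l r ρ) := fun ρ => by
    rw [comm (F.conK_deg l r ρ) (F.conOm_deg χ l ρ g)]
    simp
  rw [flatConsUU_eq, conDK_eq]
  simp [sum_coord, sum_idx, -Fintype.sum_sum_type, -flatFlux_mat_mat, ev_frameDer_mat_mat, ev_frameDer_mat_gh,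
    X.ev_up, ev_frameDer_gh_spin, ev_frameDer_gh_gh, ev_lamK, ev_lamS, brstDer,
    ← Algebra.smul_def, add_mul, Finset.sum_add_distrib, hK]
  abel

theorem flatConsUU_gh_gh (g g' : Spin) : F.flatConsUU X χ l (Sum.inr g) (Sum.inr g')
    = F.conDS X χ l g g' + ∑ q, F.conK l q g * F.conR X χ l (Sum.inr q) g'
      + ∑ q, F.conR X χ l (Sum.inr q) g * F.conK l q g' := by
  have hS : ∀ ρ, F.conS l g ρ * F.conOm χ l (Sum.inr ρ) (Sum.inr g')
      = F.conOm χ l (Sum.inr ρ) (Sum.inr g') * F.conS l g ρ :=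
    fun ρ => commute_of_even (F.conS_deg l g ρ) (F.conOm_deg χ l ρ g')
  rw [flatConsUU_eq, conDS_eq]
  simp [sum_coord, sum_idx, -Fintype.sum_sum_type, -flatFlux_mat_mat, ev_frameDer_mat_gh,
    ev_frameDer_gh_gh, ev_lamK, ev_lamS, brstDer,
    hS]
  abel

end Fields
end

section

variable {R T : Type*} [Ring R] [Algebra ℂ R] [SuperCommAlgebra R]
    [Ring T] [Algebra ℂ T] [SuperCommAlgebra T]

namespace Fields

variable (X : GhostExtension R T) (F : Fields R) (χ l : Spin → ℂ)

/-! ### Symmetries of torsion, curvature and field strength -/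

theorem curl_swap_left (M M' Q : Idx) :
    F.curl X M M' Q = -(sg (par M * par M') • F.curl X M' M Q) :=
  fieldStrength_swap_left F.of_B_antisymm M M' Q

theorem curl_swap_right (M M' Q : Idx) :
    F.curl X M M' Q = -(sg (par M' * par Q) • F.curl X M Q M') :=
  fieldStrength_swap_right F.of_B_antisymm M M' Q

/-- In the reversed convention the last two flat labels are attached to the first two curved ones,
so antisymmetry in the left pair of `curl` is used. -/
theorem flatH_swap_right (A B C : Idx) :
    F.flatH X A B C = -(sg (par B * par C) • F.flatH X A C B) := by
  have hc : ∀ f : Idx → Idx → R, ∑ M, ∑ M', f M M' = ∑ M', ∑ M, f M M' := fun f => Finset.sum_comm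
  simp only [flatH, Finset.smul_sum, ← Finset.sum_neg_distrib]
  refine Finset.sum_congr rfl fun M _ => ?_
  rw [Finset.sum_comm]
  refine Finset.sum_congr rfl fun M' _ => Finset.sum_congr rfl fun Q _ => ?_
  rw [F.curl_swap_left X M' Q M, mul_assoc (F.E A M), comm (F.E_deg B Q) (F.E_deg C M')]
  simp only [mul_neg, smul_neg, mul_smul_comm, smul_mul_assoc, smul_smul, sg_mul, mul_assoc]
  congr 2
  refine sg_congr ?_
  simp only [Nat.even_add, Nat.even_mul]
  by_cases hA : Even (par C) <;> by_cases hB : Even (par B) <;> by_cases hP : Even (par Q) <;>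
    by_cases hM : Even (par M) <;> by_cases hM' : Even (par M') <;>
      simp [hA, hB, hP, hM, hM', -Nat.not_even_iff_odd]

theorem flatH_swap_left (A B C : Idx) :
    F.flatH X A B C = -(sg (par A * par B) • F.flatH X B A C) := by
  simp only [flatH, Finset.smul_sum, ← Finset.sum_neg_distrib]
  rw [Finset.sum_comm]
  refine Finset.sum_congr rfl fun M _ => Finset.sum_congr rfl fun M' _ =>
    Finset.sum_congr rfl fun Q _ => ?_
  rw [F.curl_swap_right X Q M M', comm (F.E_deg A M') (F.E_deg B M)]
  simp only [mul_neg, smul_neg, mul_smul_comm, smul_mul_assoc, smul_smul, sg_mul, mul_assoc]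
  congr 2
  refine sg_congr ?_
  simp only [Nat.even_add, Nat.even_mul]
  by_cases hA : Even (par A) <;> by_cases hB : Even (par B) <;> by_cases hP : Even (par C) <;>
    by_cases hM : Even (par M) <;> by_cases hM' : Even (par M') <;>
      simp [hA, hB, hP, hM, hM', -Nat.not_even_iff_odd]

theorem flatH_deg (A B C : Idx) : F.flatH X A B C ∈ deg (par A + par B + par C) := by
  refine Submodule.sum_mem _ fun M _ => Submodule.sum_mem _ fun M' _ => Submodule.sum_mem _
    fun Q _ => Submodule.smul_mem _ _ (deg_of (mul_mem (mul_mem (mul_mem (F.E_deg A M)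
    (F.E_deg B M')) (F.E_deg C Q)) (F.curl_deg X Q M' M)) ?_)
  simp only [Nat.even_add]
  by_cases hA : Even (par A) <;> by_cases hB : Even (par B) <;> by_cases hP : Even (par C) <;>
    by_cases hM : Even (par M) <;> by_cases hM' : Even (par M') <;> by_cases hQ : Even (par Q) <;>
      simp [hA, hB, hP, hM, hM', hQ, -Nat.not_even_iff_odd]

theorem tors_swap (A B C : Idx) :
    F.tors X A B C = -(sg (par A * par B) • F.tors X B A C) := by
  have h : sg (par A * par B) * sg (par B * par A) = 1 := by
    rw [sg_mul, sg_congr (n := 0)]; simp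
  simp only [tors, smul_sub, smul_smul, h, one_smul]
  abel

theorem curv_swap (A B : Idx) (s t : Spin) :
    F.curv X A B s t = -(sg (par A * par B) • F.curv X B A s t) := by
  simp only [curv, Finset.smul_sum, ← Finset.sum_neg_distrib]
  rw [Finset.sum_comm]
  refine Finset.sum_congr rfl fun M _ => Finset.sum_congr rfl fun M' _ => ?_
  rw [comm (F.E_deg A M) (F.E_deg B M')]
  simp only [mul_sub, smul_sub, mul_smul_comm, smul_mul_assoc, smul_smul, sg_mul]
  rw [neg_sub]
  congr 1
  · congr 1
    refine sg_congr ?_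
    simp only [Nat.even_add, Nat.even_mul]
    by_cases hA : Even (par A) <;> by_cases hB : Even (par B) <;>
      by_cases hM : Even (par M) <;> by_cases hM' : Even (par M') <;>
        simp [hA, hB, hM, hM', -Nat.not_even_iff_odd]
  · congr 1
    refine sg_congr ?_
    simp only [Nat.even_add, Nat.even_mul]
    by_cases hA : Even (par A) <;> by_cases hB : Even (par B) <;>
      by_cases hM : Even (par M) <;> by_cases hM' : Even (par M') <;>
        simp [hA, hB, hM, hM', -Nat.not_even_iff_odd]

theorem curvAux_chir (M M' : Idx) (s t : Spin) (h : chir s ≠ chir t) :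
    F.curvAux X M M' s t = 0 := by
  have hr : ∀ r, F.Om M (Sum.inr s) (Sum.inr r) * F.Om M' (Sum.inr r) (Sum.inr t) = 0 := by
    intro r
    by_cases hs : chir s = chir r
    · rw [F.Om_chir M' r t (hs ▸ h), mul_zero]
    · rw [F.Om_chir M s r hs, zero_mul]
  simp only [curvAux, F.Om_chir M' s t h, map_zero, hr, Finset.sum_const_zero, sub_zero]

theorem curv_chir (A B : Idx) (s t : Spin) (h : chir s ≠ chir t) : F.curv X A B s t = 0 := by
  simp only [curv, F.curvAux_chir X _ _ s t h, smul_zero, sub_zero, mul_zero,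
    Finset.sum_const_zero]

theorem curvAux_deg (M M' : Idx) (s t : Spin) : F.curvAux X M M' s t ∈ deg (par M + par M') := by
  refine Submodule.sub_mem _ (deg_of (X.mpd_derivs.map_deg M (F.Om_deg M' _ _)) ?_)
    (Submodule.sum_mem _ fun r _ => deg_of (mul_mem (F.Om_deg M _ _) (F.Om_deg M' _ _)) ?_)
  all_goals
    simp only [par_inr, Nat.even_add, Nat.not_even_one]
    by_cases hM : Even (par M) <;> by_cases hM' : Even (par M') <;>
      simp [hM, hM', -Nat.not_even_iff_odd]

theorem curv_deg (A B : Idx) (s t : Spin) : F.curv X A B s t ∈ deg (par A + par B) := by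
  refine Submodule.sum_mem _ fun M _ => Submodule.sum_mem _ fun M' _ => Submodule.smul_mem _ _
    (deg_of (mul_mem (mul_mem (F.E_deg A M') (F.E_deg B M)) (Submodule.sub_mem _
      (F.curvAux_deg X M M' s t) (Submodule.smul_mem _ _ (deg_of (F.curvAux_deg X M' M s t)
        (by rw [add_comm]))))) ?_)
  simp only [Nat.even_add]
  by_cases hA : Even (par A) <;> by_cases hB : Even (par B) <;>
    by_cases hM : Even (par M) <;> by_cases hM' : Even (par M') <;>
      simp [hA, hB, hM, hM', -Nat.not_even_iff_odd]

theorem conH_swap (A B : Idx) : F.conH X χ l A B = -(sg (par A * par B) • F.conH X χ l B A) := by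
  simp only [conH, Finset.smul_sum, ← Finset.sum_neg_distrib]
  refine Finset.sum_congr rfl fun s _ => ?_
  rw [F.flatH_swap_right X _ A B, smul_neg, smul_comm]

theorem conH_vec (A : Idx) (b : Fin 10) : F.conH X χ l A (vec b) = -F.conH X χ l (vec b) A := by
  rw [conH_swap]; simp

theorem conH_spin (r s : Spin) :
    F.conH X χ l (Sum.inr r) (Sum.inr s) = F.conH X χ l (Sum.inr s) (Sum.inr r) := by
  rw [conH_swap]; simp

/-! ### The independent flat components of the conservation conditions -/

/-- The conservation conditions in the flat frame at given values of the ghosts. -/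
structure FlatConserved : Prop where
  dd_vv : ∀ a b, F.conTl X χ l (vec a) b + F.conTl X χ l (vec b) a = 0
  dd_sv : ∀ r b, F.conTl X χ l (Sum.inr r) b + chir r • F.conH X χ l (Sum.inr r) (vec b) = 0
  dd_ss : ∀ r s, (chir s - chir r) • F.conH X χ l (Sum.inr r) (Sum.inr s) = 0
  du_vv : ∀ a b, F.conH X χ l (vec a) (vec b) = 0
  du_vs : ∀ a s, -(chir s • F.conT X χ l (vec a) (Sum.inr s))
    + ∑ r, F.conH X χ l (vec a) (Sum.inr r) * F.P r s = 0
  du_vg : ∀ a g, -(chir g • F.conR X χ l (vec a) g)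
    + ∑ r, F.conH X χ l (vec a) (Sum.inr r) * F.conK l r g = 0
  du_ss : ∀ r s, (chir s - chir r) • F.conT X χ l (Sum.inr r) (Sum.inr s)
    - ∑ q, F.conH X χ l (Sum.inr r) (Sum.inr q) * F.P q s = 0
  du_sg : ∀ r g, (chir g - chir r) • F.conR X χ l (Sum.inr r) g
    - ∑ q, F.conH X χ l (Sum.inr r) (Sum.inr q) * F.conK l q g = 0
  uu_vs : ∀ a s, F.conT X χ l (vec a) (Sum.inr s)
    + ∑ q, F.conTl X χ l (Sum.inr q) a * F.P q s = 0
  uu_vg : ∀ a g, F.conR X χ l (vec a) g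
    + ∑ q, F.conTl X χ l (Sum.inr q) a * F.conK l q g = 0
  uu_ss : ∀ r s, F.conDP X χ l r s + ∑ q, F.P r q * F.conT X χ l (Sum.inr q) (Sum.inr s)
    + ∑ q, F.conT X χ l (Sum.inr q) (Sum.inr r) * F.P q s
    + χ s • F.conK l r s - χ r • F.conK l s r = 0
  uu_sg : ∀ r g, F.conDK X χ l r g + ∑ q, F.P r q * F.conR X χ l (Sum.inr q) g
    + ∑ q, F.conT X χ l (Sum.inr q) (Sum.inr r) * F.conK l q g + χ r • F.conS l r g = 0
  uu_gg : ∀ g g', F.conDS X χ l g g' + ∑ q, F.conK l q g * F.conR X χ l (Sum.inr q) g'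
    + ∑ q, F.conR X χ l (Sum.inr q) g * F.conK l q g' = 0

theorem eta_smul_eq_zero {M : Type*} [AddCommGroup M] [Module ℂ M] {a : Fin 10} {x : M} :
    eta a a • x = 0 ↔ x = 0 := by
  refine smul_eq_zero_iff_right fun h => ?_
  have := eta_mul_self a
  simp [h] at this

theorem conTl_mul_eta (A : Idx) (b : Fin 10) :
    F.conT X χ l A (vec b) = eta b b • F.conTl X χ l A b := (F.conTl_smul X χ l A b).symm

/-- The upper condition inherits graded symmetry from the metric, so one order of each off-diagonal
pair of blocks suffices. -/
theorem flatConsUU_swap (hχ : ∀ M s t,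
      χ s • F.Om M (Sum.inr s) (Sum.inr t) = χ t • F.Om M (Sum.inr s) (Sum.inr t)) (i j : Coord)
    (h : F.flatConsUU X χ l i j = 0) : F.flatConsUU X χ l j i = 0 := by
  have hℓ : IsHom cpar 1 (F.frameDer X χ) := by
    have hh : F.frameDer X χ = (F.frame X * jac X.pd (F.brstVec X χ)
        - matDer cpar (F.brstDer X χ) (F.frame X)) * F.coframe X := by
      rw [brstDer, ← F.frameDer_mul_frame X χ hχ, mul_assoc, frame_mul_coframe, mul_one]
    rw [hh]
    exact ((((F.frame_isHom X).mul (jac_isHom X.pd_derivs (F.brstVec_deg X χ))).congr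
      (by simp)).sub ((F.frame_isHom X).matDer (F.brstDer_isOddDerivation X χ))).mul
      (F.coframe_isHom X)
  have hs := tdd_consUU (D := F.brstDer X χ) hℓ (F.flatUU_isHom X) (F.tuu_flatUU X)
  have hs' := congrFun (congrFun hs j) i
  simp only [tdd, Matrix.of_apply] at hs'
  rw [flatConsUU, ← hs', map_smul]
  rw [flatConsUU] at h
  rw [h, smul_zero]

theorem flatConserved_iff (hχ : ∀ M s t,
      χ s • F.Om M (Sum.inr s) (Sum.inr t) = χ t • F.Om M (Sum.inr s) (Sum.inr t)) :
    ((consDD cpar (F.brstDer X χ) (F.frameDer X χ) (F.flatFlux X χ) (flatDD T)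
        (flatDU T)).map (X.ev l) = 0 ∧
      (consDU cpar (F.brstDer X χ) (F.frameDer X χ) (F.flatFlux X χ) (flatDU T)
        (F.flatUU X)).map (X.ev l) = 0 ∧
      (consUU cpar (F.brstDer X χ) (F.frameDer X χ) (F.flatUU X)).map (X.ev l) = 0) ↔
    F.FlatConserved X χ l := by
  constructor
  · rintro ⟨hdd, hdu, huu⟩
    replace hdd : ∀ i j, F.flatConsDD X χ l i j = 0 := fun i j => congrFun (congrFun hdd i) j
    replace hdu : ∀ i j, F.flatConsDU X χ l i j = 0 := fun i j => congrFun (congrFun hdu i) j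
    replace huu : ∀ i j, F.flatConsUU X χ l i j = 0 := fun i j => congrFun (congrFun huu i) j
    constructor
    · intro a b
      exact neg_eq_zero.1 ((F.flatConsDD_vec_vec X χ l a b).symm.trans (hdd _ _))
    · intro r b
      exact (F.flatConsDD_spin_vec X χ l r b).symm.trans (hdd _ _)
    · intro r s
      exact neg_eq_zero.1 ((F.flatConsDD_spin_spin X χ l r s).symm.trans (hdd _ _))
    · intro a b
      exact eta_smul_eq_zero.1 ((F.flatConsDU_vec_vec X χ l a b).symm.trans (hdu _ _))
    · intro a s
      exact (F.flatConsDU_vec_spin X χ l a s).symm.trans (hdu _ _)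
    · intro a s
      exact (F.flatConsDU_vec_gh X χ l a s).symm.trans (hdu _ _)
    · intro a s
      exact (F.flatConsDU_spin_spin X χ l a s).symm.trans (hdu _ _)
    · intro a s
      exact (F.flatConsDU_spin_gh X χ l a s).symm.trans (hdu _ _)
    · intro a s
      -- Lowering the vector label multiplies the equation by a diagonal entry of $\eta$, which is
      -- $\pm1$.
      refine (eta_smul_eq_zero (a := a)).1 (Eq.trans ?_
        ((F.flatConsUU_vec_spin X χ l a s).symm.trans (huu _ _)))
      simp only [smul_add, Finset.smul_sum, ← smul_mul_assoc, conTl_smul]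
    · intro a s
      refine (eta_smul_eq_zero (a := a)).1 (Eq.trans ?_
        ((F.flatConsUU_vec_gh X χ l a s).symm.trans (huu _ _)))
      simp only [smul_add, Finset.smul_sum, ← smul_mul_assoc, conTl_smul]
    · intro a s
      exact neg_eq_zero.1 ((F.flatConsUU_spin_spin X χ l a s).symm.trans (huu _ _))
    · intro a s
      exact neg_eq_zero.1 ((F.flatConsUU_spin_gh X χ l a s).symm.trans (huu _ _))
    · intro a s
      exact (F.flatConsUU_gh_gh X χ l a s).symm.trans (huu _ _)
  · intro h
    have hdd : ∀ i j, F.flatConsDD X χ l i j = 0 := by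
      rintro ((a | r) | g) ((b | s) | g')
      · rw [flatConsDD_vec_vec, h.dd_vv, neg_zero]
      · rw [flatConsDD_vec_spin, ← neg_eq_zero, neg_add, neg_neg, ← smul_neg, ← conH_vec]
        exact h.dd_sv s a
      · exact F.flatConsDD_mat_gh X χ l _ _
      · rw [flatConsDD_spin_vec, h.dd_sv]
      · rw [flatConsDD_spin_spin, h.dd_ss, neg_zero]
      · exact F.flatConsDD_mat_gh X χ l _ _
      all_goals exact F.flatConsDD_gh X χ l _ _
    have hdu : ∀ i j, F.flatConsDU X χ l i j = 0 := by
      rintro ((a | r) | g) ((b | s) | g')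
      · rw [flatConsDU_vec_vec, h.du_vv, smul_zero]
      · rw [flatConsDU_vec_spin, h.du_vs]
      · rw [flatConsDU_vec_gh, h.du_vg]
      -- This mixed component is the spinor-vector part of the lower condition multiplied by
      -- $-\chi_r\eta_{bb}$, hence not independent.
      · have hc : chir r * chir r = 1 := by rcases r with r | r <;> simp [chir]
        rw [flatConsDU_spin_vec]
        have h1 := congrArg (fun x => -((chir r * eta b b) • x)) (h.dd_sv r b)
        simp only [smul_zero, neg_zero, smul_add, smul_smul, neg_add] at h1
        rw [← h1, conTl_mul_eta, smul_smul, mul_right_comm, hc, one_mul]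
        abel
      · rw [flatConsDU_spin_spin, h.du_ss]
      · rw [flatConsDU_spin_gh, h.du_sg]
      all_goals exact F.flatConsDU_gh X χ l _ _
    have hvs : ∀ a s, F.flatConsUU X χ l (mat (vec a)) (mat (Sum.inr s)) = 0 := fun a s => by
      rw [flatConsUU_vec_spin]
      simp only [conTl_mul_eta, smul_mul_assoc]
      rw [← Finset.smul_sum, ← smul_add, h.uu_vs, smul_zero]
    have hvg : ∀ a g, F.flatConsUU X χ l (mat (vec a)) (Sum.inr g) = 0 := fun a g => by
      rw [flatConsUU_vec_gh]
      simp only [conTl_mul_eta, smul_mul_assoc]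
      rw [← Finset.smul_sum, ← smul_add, h.uu_vg, smul_zero]
    have hsg : ∀ s g, F.flatConsUU X χ l (mat (Sum.inr s)) (Sum.inr g) = 0 := fun s g => by
      rw [flatConsUU_spin_gh, h.uu_sg, neg_zero]
    have huu : ∀ i j, F.flatConsUU X χ l i j = 0 := by
      rintro ((a | r) | g) ((b | s) | g')
      · rw [flatConsUU_vec_vec]
        -- The vector-vector part of the upper condition is that of the lower condition with both
        -- labels raised.
        have h1 := congrArg (fun x => (eta a a * eta b b) • x) (h.dd_vv a b)
        simp only [smul_zero, smul_add] at h1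
        rw [← h1, conTl_mul_eta, conTl_mul_eta, smul_smul, smul_smul, mul_comm (eta b b)]
      · exact hvs a s
      · exact hvg a g'
      · exact F.flatConsUU_swap X χ l hχ _ _ (hvs b r)
      · rw [flatConsUU_spin_spin, h.uu_ss, neg_zero]
      · exact hsg r g'
      · exact F.flatConsUU_swap X χ l hχ _ _ (hvg b g)
      · exact F.flatConsUU_swap X χ l hχ _ _ (hsg s g)
      · rw [flatConsUU_gh_gh, h.uu_gg]
    exact ⟨Matrix.ext hdd, Matrix.ext hdu, Matrix.ext huu⟩

end Fields
end

/-- A choice of which of the two kinds of spinor labels is the one of the BRST ghost. -/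
structure Orientation where
  perm : Equiv.Perm Spin
  sgn : ℂ
  sgn_sq : sgn * sgn = 1
  chir_inl : ∀ α, chir (perm (Sum.inl α)) = sgn
  chir_inr : ∀ α, chir (perm (Sum.inr α)) = -sgn

namespace Orientation

variable (o : Orientation)

/-- The spinor labels of the same kind as the BRST ghost. -/
def own (α : Fin 16) : Spin := o.perm (Sum.inl α)

/-- The spinor labels of the other kind. -/
def opp (α : Fin 16) : Spin := o.perm (Sum.inr α)

@[simp] theorem chir_own (α : Fin 16) : chir (o.own α) = o.sgn := o.chir_inl α
@[simp] theorem chir_opp (α : Fin 16) : chir (o.opp α) = -o.sgn := o.chir_inr α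

theorem sgn_ne_zero : o.sgn ≠ 0 := fun h => by simpa [h] using o.sgn_sq

theorem sgn_ne_neg : o.sgn ≠ -o.sgn := fun h => o.sgn_ne_zero (self_eq_neg.1 h)

theorem neg_sgn_ne : -o.sgn ≠ o.sgn := o.sgn_ne_neg.symm

theorem sum_spin {M : Type*} [AddCommMonoid M] (f : Spin → M) :
    ∑ s, f s = ∑ α, f (o.own α) + ∑ α, f (o.opp α) := by
  rw [← Equiv.sum_comp o.perm f]
  exact Fintype.sum_sum_type _

theorem cases (s : Spin) : (∃ α, s = o.own α) ∨ ∃ α, s = o.opp α := by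
  rcases h : o.perm.symm s with α | α
  · exact Or.inl ⟨α, by rw [own, ← h, Equiv.apply_symm_apply]⟩
  · exact Or.inr ⟨α, by rw [opp, ← h, Equiv.apply_symm_apply]⟩

/-- The indicator of the kind of the BRST ghost. -/
def ind (s : Spin) : ℂ := if chir s = o.sgn then 1 else 0

@[simp] theorem ind_own (α : Fin 16) : o.ind (o.own α) = 1 := by simp [ind]
@[simp] theorem ind_opp (α : Fin 16) : o.ind (o.opp α) = 0 := by simp [ind, o.neg_sgn_ne]

/-- Values of all ghosts from the values of the ghosts of the two kinds. -/
def glue (x y : Fin 16 → ℂ) (s : Spin) : ℂ := Sum.elim x y (o.perm.symm s)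

@[simp] theorem glue_own (x y : Fin 16 → ℂ) (α : Fin 16) : o.glue x y (o.own α) = x α := by
  simp [glue, own]
@[simp] theorem glue_opp (x y : Fin 16 → ℂ) (α : Fin 16) : o.glue x y (o.opp α) = y α := by
  simp [glue, opp]

end Orientation

/-! ### Chirality blocks for a chosen orientation -/

section

variable {R T : Type*} [Ring R] [Algebra ℂ R] [SuperCommAlgebra R]
    [Ring T] [Algebra ℂ T] [SuperCommAlgebra T]

theorem sum_sum_smul_mul {ι κ : Type*} [Fintype ι] [Fintype κ] (a : ι → ℂ) (f : ι → κ → R)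
    (P : κ → R) : ∑ q, (∑ i, a i • f i q) * P q = ∑ i, a i • ∑ q, f i q * P q := by
  simp only [Finset.sum_mul, smul_mul_assoc, Finset.smul_sum]
  exact Finset.sum_comm

theorem sum_mul_sum_smul {ι κ : Type*} [Fintype ι] [Fintype κ] (a : ι → ℂ) (f : ι → κ → R)
    (P : κ → R) : ∑ q, P q * (∑ i, a i • f i q) = ∑ i, a i • ∑ q, P q * f i q := by
  simp only [Finset.mul_sum, mul_smul_comm, Finset.smul_sum]
  exact Finset.sum_comm

namespace Fields

variable (X : GhostExtension R T) (F : Fields R) (o : Orientation)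

/-- The indicator of one kind of spinor is constant along the blocks of the connection, which is the
compatibility demanded of the weights `χ` above. -/
theorem ind_smul_Om (M : Idx) (s t : Spin) :
    o.ind s • F.Om M (Sum.inr s) (Sum.inr t) = o.ind t • F.Om M (Sum.inr s) (Sum.inr t) := by
  by_cases h : chir s = chir t
  · rw [Orientation.ind, Orientation.ind, h]
  · rw [F.Om_chir M s t h, smul_zero, smul_zero]

/-- `T_{ABc}` -/
def torsl (A B : Idx) (c : Fin 10) : R := eta c c • F.tors X A B (vec c)

section blocks

@[simp] theorem P_own_own (α β : Fin 16) : F.P (o.own α) (o.own β) = 0 := F.P_chir _ _ (by simp)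
@[simp] theorem P_opp_opp (α β : Fin 16) : F.P (o.opp α) (o.opp β) = 0 := F.P_chir _ _ (by simp)
theorem P_opp_own (α β : Fin 16) : F.P (o.opp α) (o.own β) = -F.P (o.own β) (o.opp α) :=
  F.P_antisymm _ _
@[simp] theorem K_own_own (t : Spin) (α β : Fin 16) : F.K t (o.own α) (o.own β) = 0 :=
  F.K_chir _ _ _ (by simp)
@[simp] theorem K_opp_opp (t : Spin) (α β : Fin 16) : F.K t (o.opp α) (o.opp β) = 0 :=
  F.K_chir _ _ _ (by simp)
@[simp] theorem K_own_opp (s : Spin) (α β : Fin 16) : F.K (o.own α) s (o.opp β) = 0 :=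
  F.K_chir' _ _ _ (by simp [o.sgn_ne_neg])
@[simp] theorem K_opp_own (s : Spin) (α β : Fin 16) : F.K (o.opp α) s (o.own β) = 0 :=
  F.K_chir' _ _ _ (by simp [o.neg_sgn_ne])
@[simp] theorem S_own_own (t t' : Spin) (α β : Fin 16) : F.S t t' (o.own α) (o.own β) = 0 :=
  F.S_chir _ _ _ _ (by simp)
@[simp] theorem S_opp_opp (t t' : Spin) (α β : Fin 16) : F.S t t' (o.opp α) (o.opp β) = 0 :=
  F.S_chir _ _ _ _ (by simp)
@[simp] theorem S_own_own' (t t' : Spin) (α β : Fin 16) : F.S (o.own α) (o.own β) t t' = 0 :=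
  F.S_chir' _ _ _ _ (by simp)
@[simp] theorem S_opp_opp' (t t' : Spin) (α β : Fin 16) : F.S (o.opp α) (o.opp β) t t' = 0 :=
  F.S_chir' _ _ _ _ (by simp)
@[simp] theorem Om_own_opp (M : Idx) (α β : Fin 16) :
    F.Om M (Sum.inr (o.own α)) (Sum.inr (o.opp β)) = 0 := F.Om_chir _ _ _ (by simp [o.sgn_ne_neg])
@[simp] theorem Om_opp_own (M : Idx) (α β : Fin 16) :
    F.Om M (Sum.inr (o.opp α)) (Sum.inr (o.own β)) = 0 := F.Om_chir _ _ _ (by simp [o.neg_sgn_ne])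
@[simp] theorem curv_own_opp (A B : Idx) (α β : Fin 16) :
    F.curv X A B (o.own α) (o.opp β) = 0 := F.curv_chir _ _ _ _ _ (by simp [o.sgn_ne_neg])
@[simp] theorem curv_opp_own (A B : Idx) (α β : Fin 16) :
    F.curv X A B (o.opp α) (o.own β) = 0 := F.curv_chir _ _ _ _ _ (by simp [o.neg_sgn_ne])

@[simp] theorem covP_own_own (A : Idx) (α β : Fin 16) : F.covP X A (o.own α) (o.own β) = 0 := by
  simp [covP, o.sum_spin, -Fintype.sum_sum_type]
@[simp] theorem covP_opp_opp (A : Idx) (α β : Fin 16) : F.covP X A (o.opp α) (o.opp β) = 0 := by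
  simp [covP, o.sum_spin, -Fintype.sum_sum_type]
@[simp] theorem covK_own_own (A : Idx) (t : Spin) (α β : Fin 16) :
    F.covK X A t (o.own α) (o.own β) = 0 := by
  simp [covK, o.sum_spin, -Fintype.sum_sum_type]
@[simp] theorem covK_opp_opp (A : Idx) (t : Spin) (α β : Fin 16) :
    F.covK X A t (o.opp α) (o.opp β) = 0 := by
  simp [covK, o.sum_spin, -Fintype.sum_sum_type]
@[simp] theorem covK_own_opp (A : Idx) (s : Spin) (α β : Fin 16) :
    F.covK X A (o.own α) s (o.opp β) = 0 := by
  simp [covK, o.sum_spin, -Fintype.sum_sum_type]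
@[simp] theorem covK_opp_own (A : Idx) (s : Spin) (α β : Fin 16) :
    F.covK X A (o.opp α) s (o.own β) = 0 := by
  simp [covK, o.sum_spin, -Fintype.sum_sum_type]
@[simp] theorem covS_own_own (A : Idx) (t t' : Spin) (α β : Fin 16) :
    F.covS X A t t' (o.own α) (o.own β) = 0 := by
  simp [covS, o.sum_spin, -Fintype.sum_sum_type]
@[simp] theorem covS_opp_opp (A : Idx) (t t' : Spin) (α β : Fin 16) :
    F.covS X A t t' (o.opp α) (o.opp β) = 0 := by
  simp [covS, o.sum_spin, -Fintype.sum_sum_type]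
@[simp] theorem covS_own_own' (A : Idx) (t t' : Spin) (α β : Fin 16) :
    F.covS X A (o.own α) (o.own β) t t' = 0 := by
  simp [covS, o.sum_spin, -Fintype.sum_sum_type]
@[simp] theorem covS_opp_opp' (A : Idx) (t t' : Spin) (α β : Fin 16) :
    F.covS X A (o.opp α) (o.opp β) t t' = 0 := by
  simp [covS, o.sum_spin, -Fintype.sum_sum_type]

end blocks

section glue

variable (x y : Fin 16 → ℂ)

theorem conT_glue (A C : Idx) : F.conT X o.ind (o.glue x y) A C
    = ∑ α, x α • F.tors X (Sum.inr (o.own α)) A C := by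
  simp [conT, o.sum_spin, -Fintype.sum_sum_type]

theorem conTl_glue (A : Idx) (b : Fin 10) : F.conTl X o.ind (o.glue x y) A b
    = ∑ α, x α • F.torsl X (Sum.inr (o.own α)) A b := by
  simp only [conTl, conT_glue, torsl, Finset.smul_sum, smul_comm (eta b b)]

theorem conH_glue (A B : Idx) : F.conH X o.ind (o.glue x y) A B
    = ∑ α, x α • F.flatH X (Sum.inr (o.own α)) A B := by
  simp [conH, o.sum_spin, -Fintype.sum_sum_type]

theorem conR_own (A : Idx) (δ : Fin 16) : F.conR X o.ind (o.glue x y) A (o.own δ)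
    = ∑ α, x α • ∑ β, x β • F.curv X (Sum.inr (o.own α)) A (o.own β) (o.own δ) := by
  simp [conR, o.sum_spin, -Fintype.sum_sum_type, Finset.smul_sum, smul_smul]

theorem conR_opp (A : Idx) (δ : Fin 16) : F.conR X o.ind (o.glue x y) A (o.opp δ)
    = ∑ α, x α • ∑ β, y β • F.curv X (Sum.inr (o.own α)) A (o.opp β) (o.opp δ) := by
  simp [conR, o.sum_spin, -Fintype.sum_sum_type, Finset.smul_sum, smul_smul]

@[simp] theorem conK_own_own (α β : Fin 16) : F.conK (o.glue x y) (o.own α) (o.own β) = 0 := by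
  simp [conK, o.sum_spin, -Fintype.sum_sum_type]
@[simp] theorem conK_opp_opp (α β : Fin 16) : F.conK (o.glue x y) (o.opp α) (o.opp β) = 0 := by
  simp [conK, o.sum_spin, -Fintype.sum_sum_type]
theorem conK_opp_own (ρ δ : Fin 16) : F.conK (o.glue x y) (o.opp ρ) (o.own δ)
    = ∑ β, x β • F.K (o.own β) (o.opp ρ) (o.own δ) := by
  simp [conK, o.sum_spin, -Fintype.sum_sum_type]
theorem conK_own_opp (ρ δ : Fin 16) : F.conK (o.glue x y) (o.own ρ) (o.opp δ)
    = ∑ β, y β • F.K (o.opp β) (o.own ρ) (o.opp δ) := by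
  simp [conK, o.sum_spin, -Fintype.sum_sum_type]

/-- The coefficients `S` symmetrized in the ghosts. -/
def symS (t t' g g' : Spin) : R := F.S t t' g g' + F.S t' t g g'

/-- The covariant derivative of `symS`. -/
def covSymS (A : Idx) (t t' g g' : Spin) : R := F.covS X A t t' g g' + F.covS X A t' t g g'

@[simp] theorem conS_own_own (α β : Fin 16) : F.conS (o.glue x y) (o.own α) (o.own β) = 0 := by
  simp [conS, o.sum_spin, -Fintype.sum_sum_type]
theorem conS_own_opp (δ δ' : Fin 16) : F.conS (o.glue x y) (o.own δ) (o.opp δ')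
    = ∑ α, x α • ∑ β, y β • F.symS (o.own α) (o.opp β) (o.own δ) (o.opp δ') := by
  simp only [conS, o.sum_spin, Orientation.glue_own, Orientation.glue_opp, S_own_own', S_opp_opp',
    smul_zero, Finset.sum_const_zero, zero_add, add_zero, symS, smul_add, Finset.sum_add_distrib,
    Finset.smul_sum, smul_smul]
  congr 1
  rw [Finset.sum_comm]
  simp only [mul_comm]

theorem conDP_glue (r q : Spin) : F.conDP X o.ind (o.glue x y) r q
    = ∑ α, x α • F.covP X (Sum.inr (o.own α)) r q := by
  simp [conDP, o.sum_spin, -Fintype.sum_sum_type]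

@[simp] theorem conDK_own_own (α β : Fin 16) :
    F.conDK X o.ind (o.glue x y) (o.own α) (o.own β) = 0 := by
  simp [conDK, o.sum_spin, -Fintype.sum_sum_type]
@[simp] theorem conDK_opp_opp (α β : Fin 16) :
    F.conDK X o.ind (o.glue x y) (o.opp α) (o.opp β) = 0 := by
  simp [conDK, o.sum_spin, -Fintype.sum_sum_type]
theorem conDK_opp_own (ρ δ : Fin 16) : F.conDK X o.ind (o.glue x y) (o.opp ρ) (o.own δ)
    = ∑ α, x α • ∑ β, x β • F.covK X (Sum.inr (o.own α)) (o.own β) (o.opp ρ) (o.own δ) := by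
  simp [conDK, o.sum_spin, -Fintype.sum_sum_type, Finset.smul_sum, smul_smul]
theorem conDK_own_opp (ρ δ : Fin 16) : F.conDK X o.ind (o.glue x y) (o.own ρ) (o.opp δ)
    = ∑ α, x α • ∑ β, y β • F.covK X (Sum.inr (o.own α)) (o.opp β) (o.own ρ) (o.opp δ) := by
  simp [conDK, o.sum_spin, -Fintype.sum_sum_type, Finset.smul_sum, smul_smul]

@[simp] theorem conDS_own_own (α β : Fin 16) :
    F.conDS X o.ind (o.glue x y) (o.own α) (o.own β) = 0 := by
  simp [conDS, o.sum_spin, -Fintype.sum_sum_type]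
@[simp] theorem conDS_opp_opp (α β : Fin 16) :
    F.conDS X o.ind (o.glue x y) (o.opp α) (o.opp β) = 0 := by
  simp [conDS, o.sum_spin, -Fintype.sum_sum_type]
theorem conDS_symm (l : Spin → ℂ) (g g' : Spin) : F.conDS X o.ind l g g' = F.conDS X o.ind l g' g := by
  have h : ∀ A t t', F.covS X A t t' g g' = F.covS X A t t' g' g := fun A t t' => by
    simp only [covS, F.S_symm _ _ g g', F.S_symm _ _ _ g', F.S_symm _ _ g _]
    refine Finset.sum_congr rfl fun M _ => ?_
    congr 3
    abel
  simp only [conDS, h]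
theorem conDS_own_opp (δ δ' : Fin 16) : F.conDS X o.ind (o.glue x y) (o.own δ) (o.opp δ')
    = ∑ α, x α • ∑ β, x β • ∑ γ, y γ •
      F.covSymS X (Sum.inr (o.own α)) (o.own β) (o.opp γ) (o.own δ) (o.opp δ') := by
  simp only [conDS, o.sum_spin, Orientation.glue_own, Orientation.glue_opp, covS_own_own',
    covS_opp_opp', Orientation.ind_own, Orientation.ind_opp, zero_mul, zero_smul, one_mul,
    smul_zero, Finset.sum_const_zero, zero_add, add_zero, covSymS, smul_add, Finset.sum_add_distrib,
    Finset.smul_sum, smul_smul, mul_assoc]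
  congr 1
  refine Finset.sum_congr rfl fun α _ => ?_
  rw [Finset.sum_comm]
  refine Finset.sum_congr rfl fun β _ => Finset.sum_congr rfl fun γ _ => ?_
  congr 1
  ring

end glue

end Fields
end

/-! ### The constraints attached to one orientation -/

section

variable {R T : Type*} [Ring R] [Algebra ℂ R] [SuperCommAlgebra R]
    [Ring T] [Algebra ℂ T] [SuperCommAlgebra T]

/-- A symmetric matrix may act on either vector. The scalar `c` records whether the left vector
commutes or anticommutes with its entries. This cancels the components with two labels of the
opposite kind. -/
theorem sum_mul_symm_mul {ι : Type*} [Fintype ι] (h : ι → ι → R) (p q : ι → R) (c : ℂ)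
    (hs : ∀ i j, h i j = h j i) (hp : ∀ i j k, p i * h j k = c • (h j k * p i)) :
    ∑ i, p i * ∑ j, h i j * q j = c • ∑ i, (∑ j, h i j * p j) * q i := by
  simp only [Finset.mul_sum, Finset.sum_mul, Finset.smul_sum, ← mul_assoc, hp, smul_mul_assoc]
  rw [Finset.sum_comm]
  refine Finset.sum_congr rfl fun i _ => Finset.sum_congr rfl fun j _ => ?_
  rw [hs]

/-- A set of spinors is spanning if linear expressions in a spinor that vanish on the set vanish
identically. -/
def Spans (p : (Fin 16 → ℂ) → Prop) : Prop := Submodule.span ℂ {l | p l} = ⊤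

/-- The kernel of $l\mapsto\sum_\alpha l^\alpha z_\alpha$ contains the span of the set, hence
everything, and evaluation on basis vectors isolates the coefficients. -/
theorem Spans.eq_zero {p : (Fin 16 → ℂ) → Prop} (hp : Spans p) {M : Type*} [AddCommGroup M]
    [Module ℂ M] (z : Fin 16 → M) (h : ∀ l, p l → ∑ α, l α • z α = 0) (α : Fin 16) : z α = 0 := by
  have hle : Submodule.span ℂ {l | p l} ≤ LinearMap.ker (Fintype.linearCombination ℂ z) := by
    rw [Submodule.span_le]
    intro l hl
    simpa [Fintype.linearCombination_apply] using h l hl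
  have hα : Pi.single α 1 ∈ LinearMap.ker (Fintype.linearCombination ℂ z) :=
    hle (hp ▸ Submodule.mem_top)
  simpa [Fintype.linearCombination_apply_single] using hα

namespace Fields

variable (X : GhostExtension R T) (F : Fields R) (o : Orientation)

/-- The constraints equivalent to conservation of the BRST current of the ghosts of one kind. -/
structure HolConstraints (pure : (Fin 16 → ℂ) → Prop) : Prop where
  T_symm : ∀ α b c, F.torsl X (Sum.inr (o.own α)) (vec b) c
    + F.torsl X (Sum.inr (o.own α)) (vec c) b = 0
  H_vv : ∀ α b c, F.flatH X (Sum.inr (o.own α)) (vec b) (vec c) = 0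
  H_po : ∀ α β ρ, F.flatH X (Sum.inr (o.own α)) (Sum.inr (o.opp β)) (Sum.inr (o.own ρ)) = 0
  T_add_H : ∀ α β c, F.torsl X (Sum.inr (o.own α)) (Sum.inr (o.own β)) c
    + o.sgn • F.flatH X (Sum.inr (o.own α)) (Sum.inr (o.own β)) (vec c) = 0
  T_sub_H : ∀ α β c, F.torsl X (Sum.inr (o.own α)) (Sum.inr (o.opp β)) c
    - o.sgn • F.flatH X (Sum.inr (o.own α)) (Sum.inr (o.opp β)) (vec c) = 0
  T_vo : ∀ α b δ, F.tors X (Sum.inr (o.own α)) (vec b) (Sum.inr (o.own δ))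
    - ∑ ρ, F.torsl X (Sum.inr (o.own α)) (Sum.inr (o.opp ρ)) b * F.P (o.own δ) (o.opp ρ) = 0
  T_vp : ∀ α b δ, F.tors X (Sum.inr (o.own α)) (vec b) (Sum.inr (o.opp δ))
    + ∑ ρ, F.torsl X (Sum.inr (o.own α)) (Sum.inr (o.own ρ)) b * F.P (o.own ρ) (o.opp δ) = 0
  T_op : ∀ α β δ, F.tors X (Sum.inr (o.own α)) (Sum.inr (o.own β)) (Sum.inr (o.opp δ))
    + (1 / 2 * o.sgn) • ∑ ρ, F.flatH X (Sum.inr (o.own α)) (Sum.inr (o.own β)) (Sum.inr (o.own ρ))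
      * F.P (o.own ρ) (o.opp δ) = 0
  T_po : ∀ α β δ, F.tors X (Sum.inr (o.own α)) (Sum.inr (o.opp β)) (Sum.inr (o.own δ)) = 0
  C_eq : ∀ α β β', F.covP X (Sum.inr (o.own α)) (o.own β) (o.opp β')
    + (∑ ρ, F.tors X (Sum.inr (o.own α)) (Sum.inr (o.own ρ)) (Sum.inr (o.own β))
      * F.P (o.own ρ) (o.opp β')) - F.K (o.own α) (o.opp β') (o.own β) = 0
  Rp_v : ∀ a β δ σ, F.curv X (vec a) (Sum.inr (o.own β)) (o.opp δ) (o.opp σ)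
    - ∑ ρ, F.torsl X (Sum.inr (o.own β)) (Sum.inr (o.own ρ)) a
      * F.K (o.opp δ) (o.own ρ) (o.opp σ) = 0
  Rp_s : ∀ α β δ σ, F.curv X (Sum.inr (o.own α)) (Sum.inr (o.own β)) (o.opp δ) (o.opp σ)
    + (1 / 2 * o.sgn) • ∑ ρ, F.flatH X (Sum.inr (o.own α)) (Sum.inr (o.own β)) (Sum.inr (o.own ρ))
      * F.K (o.opp δ) (o.own ρ) (o.opp σ) = 0
  S_eq : ∀ α α' β β', F.symS (o.own α) (o.opp α') (o.own β) (o.opp β')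
    + (∑ ρ, F.curv X (Sum.inr (o.own α)) (Sum.inr (o.opp ρ)) (o.opp α') (o.opp β')
      * F.P (o.own β) (o.opp ρ))
    + F.covK X (Sum.inr (o.own α)) (o.opp α') (o.own β) (o.opp β')
    + (∑ ρ, F.tors X (Sum.inr (o.own α)) (Sum.inr (o.own ρ)) (Sum.inr (o.own β))
      * F.K (o.opp α') (o.own ρ) (o.opp β')) = 0
  Ro_v : ∀ l, pure l → ∀ a δ, ∑ α, l α • ∑ β, l β • (F.curv X (vec a) (Sum.inr (o.own α))
    (o.own β) (o.own δ) - ∑ ρ, F.torsl X (Sum.inr (o.own α)) (Sum.inr (o.opp ρ)) a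
      * F.K (o.own β) (o.opp ρ) (o.own δ)) = 0
  Ro_p : ∀ l, pure l → ∀ ρ δ, ∑ α, l α • ∑ β, l β • F.curv X (Sum.inr (o.opp ρ))
    (Sum.inr (o.own α)) (o.own β) (o.own δ) = 0
  DC_eq : ∀ l, pure l → ∀ δ δ', ∑ α, l α • ∑ β, l β •
    (F.covK X (Sum.inr (o.own α)) (o.own β) (o.opp δ') (o.own δ)
    - ∑ σ, F.curv X (Sum.inr (o.own α)) (Sum.inr (o.own σ)) (o.own β) (o.own δ)
      * F.P (o.own σ) (o.opp δ')) = 0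
  DS_eq : ∀ l, pure l → ∀ β' δ δ', ∑ α, l α • ∑ β, l β •
    (F.covSymS X (Sum.inr (o.own α)) (o.own β) (o.opp β') (o.own δ) (o.opp δ')
    + (∑ ρ, F.curv X (Sum.inr (o.own α)) (Sum.inr (o.opp ρ)) (o.opp β') (o.opp δ')
      * F.K (o.own β) (o.opp ρ) (o.own δ))
    + ∑ ρ, F.curv X (Sum.inr (o.own α)) (Sum.inr (o.own ρ)) (o.own β) (o.own δ)
      * F.K (o.opp β') (o.own ρ) (o.opp δ')) = 0

section components

variable (x y : Fin 16 → ℂ)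

local notation "T'" => F.conT X o.ind (o.glue x y)
local notation "Tl'" => F.conTl X o.ind (o.glue x y)
local notation "H'" => F.conH X o.ind (o.glue x y)
local notation "R'" => F.conR X o.ind (o.glue x y)
local notation "K'" => F.conK (o.glue x y)

/-- This and the following lemmas expose each flat component as a ghost contraction of a single
constraint. The vanishing chirality blocks of `P`, `K` and the curvature discard all other terms,
and linear contractions can then be removed by spanning. -/
theorem component_T_vo (a : Fin 10) (δ : Fin 16) : T' (vec a) (Sum.inr (o.own δ))
      + ∑ q, Tl' (Sum.inr q) a * F.P q (o.own δ)
    = ∑ α, x α • (F.tors X (Sum.inr (o.own α)) (vec a) (Sum.inr (o.own δ))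
      - ∑ ρ, F.torsl X (Sum.inr (o.own α)) (Sum.inr (o.opp ρ)) a * F.P (o.own δ) (o.opp ρ)) := by
  simp only [o.sum_spin, P_own_own, mul_zero, Finset.sum_const_zero, zero_add, P_opp_own, mul_neg,
    conT_glue, conTl_glue, sum_sum_smul_mul, Finset.sum_neg_distrib, smul_sub,
    Finset.sum_sub_distrib]
  abel

theorem component_T_vp (a : Fin 10) (δ : Fin 16) : T' (vec a) (Sum.inr (o.opp δ))
      + ∑ q, Tl' (Sum.inr q) a * F.P q (o.opp δ)
    = ∑ α, x α • (F.tors X (Sum.inr (o.own α)) (vec a) (Sum.inr (o.opp δ))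
      + ∑ ρ, F.torsl X (Sum.inr (o.own α)) (Sum.inr (o.own ρ)) a * F.P (o.own ρ) (o.opp δ)) := by
  simp only [o.sum_spin, P_opp_opp, mul_zero, Finset.sum_const_zero, add_zero,
    conT_glue, conTl_glue, sum_sum_smul_mul, smul_add, Finset.sum_add_distrib]

theorem component_Ro_v (a : Fin 10) (δ : Fin 16) : R' (vec a) (o.own δ)
      + ∑ q, Tl' (Sum.inr q) a * K' q (o.own δ)
    = -∑ α, x α • ∑ β, x β • (F.curv X (vec a) (Sum.inr (o.own α))
    (o.own β) (o.own δ) - ∑ ρ, F.torsl X (Sum.inr (o.own α)) (Sum.inr (o.opp ρ)) a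
      * F.K (o.own β) (o.opp ρ) (o.own δ)) := by
  simp only [o.sum_spin, conK_own_own, mul_zero, Finset.sum_const_zero, zero_add, conR_own,
    conTl_glue, conK_opp_own, sum_sum_smul_mul, sum_mul_sum_smul, smul_sub,
    Finset.sum_sub_distrib, F.curv_swap X (vec a), par_vec, zero_mul, pow_zero, one_smul, smul_neg,
    Finset.sum_neg_distrib]
  abel

theorem component_Rp_v (a : Fin 10) (δ : Fin 16) : R' (vec a) (o.opp δ)
      + ∑ q, Tl' (Sum.inr q) a * K' q (o.opp δ)
    = -∑ α, x α • ∑ β, y β • (F.curv X (vec a) (Sum.inr (o.own α))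
    (o.opp β) (o.opp δ) - ∑ ρ, F.torsl X (Sum.inr (o.own α)) (Sum.inr (o.own ρ)) a
      * F.K (o.opp β) (o.own ρ) (o.opp δ)) := by
  simp only [o.sum_spin, conK_opp_opp, mul_zero, Finset.sum_const_zero, add_zero, conR_opp,
    conTl_glue, conK_own_opp, sum_sum_smul_mul, sum_mul_sum_smul, smul_sub,
    Finset.sum_sub_distrib, F.curv_swap X (vec a), par_vec, zero_mul, pow_zero, one_smul, smul_neg,
    Finset.sum_neg_distrib]
  abel

/-- The eigenvalue difference from own to opposite labels is $-2\sigma$ with $\sigma=\pm1$ the sign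
of the orientation. As $\sigma^2=1$, factoring it out leaves the coefficient $\sigma/2$ in front of
the flux. -/
theorem component_T_op (β δ : Fin 16) :
    (-o.sgn - o.sgn) • T' (Sum.inr (o.own β)) (Sum.inr (o.opp δ))
      - ∑ q, H' (Sum.inr (o.own β)) (Sum.inr q) * F.P q (o.opp δ)
    = (-2 * o.sgn) • ∑ α, x α •
      (F.tors X (Sum.inr (o.own α)) (Sum.inr (o.own β)) (Sum.inr (o.opp δ))
    + (1 / 2 * o.sgn) • ∑ ρ, F.flatH X (Sum.inr (o.own α)) (Sum.inr (o.own β)) (Sum.inr (o.own ρ))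
      * F.P (o.own ρ) (o.opp δ)) := by
  have h : -2 * o.sgn * (1 / 2 * o.sgn) = -1 := by linear_combination (-1 : ℂ) * o.sgn_sq
  simp only [o.sum_spin, P_opp_opp, mul_zero, Finset.sum_const_zero, add_zero,
    conT_glue, conH_glue, sum_sum_smul_mul, smul_add, Finset.sum_add_distrib]
  rw [show -o.sgn - o.sgn = -2 * o.sgn by ring]
  simp only [smul_comm (x _) (1 / 2 * o.sgn), ← Finset.smul_sum]
  rw [smul_smul, h, neg_one_smul]
  abel

/-- With an own upper label, `P` pairs only with flux components having two opposite labels. These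
must be known to vanish before the torsion stands alone. -/
theorem component_T_po (β δ : Fin 16)
    (hH : ∀ α β ρ, F.flatH X (Sum.inr (o.own α)) (Sum.inr (o.opp β)) (Sum.inr (o.opp ρ)) = 0) :
    (o.sgn - -o.sgn) • T' (Sum.inr (o.opp β)) (Sum.inr (o.own δ))
      - ∑ q, H' (Sum.inr (o.opp β)) (Sum.inr q) * F.P q (o.own δ)
    = (2 * o.sgn) • ∑ α, x α •
      F.tors X (Sum.inr (o.own α)) (Sum.inr (o.opp β)) (Sum.inr (o.own δ)) := by
  simp only [o.sum_spin, P_own_own, mul_zero, Finset.sum_const_zero, zero_add,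
    conT_glue, conH_glue, hH, smul_zero, zero_mul, sub_zero]
  congr 1
  ring

theorem component_Rp_s (β δ : Fin 16) :
    (-o.sgn - o.sgn) • R' (Sum.inr (o.own β)) (o.opp δ)
      - ∑ q, H' (Sum.inr (o.own β)) (Sum.inr q) * K' q (o.opp δ)
    = (-2 * o.sgn) • ∑ α, x α • ∑ γ, y γ •
      (F.curv X (Sum.inr (o.own α)) (Sum.inr (o.own β)) (o.opp γ) (o.opp δ)
    + (1 / 2 * o.sgn) • ∑ ρ, F.flatH X (Sum.inr (o.own α)) (Sum.inr (o.own β)) (Sum.inr (o.own ρ))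
      * F.K (o.opp γ) (o.own ρ) (o.opp δ)) := by
  have h : -2 * o.sgn * (1 / 2 * o.sgn) = -1 := by linear_combination (-1 : ℂ) * o.sgn_sq
  simp only [o.sum_spin, conK_opp_opp, mul_zero, Finset.sum_const_zero, add_zero,
    conR_opp, conH_glue, conK_own_opp, sum_sum_smul_mul, sum_mul_sum_smul, smul_add,
    Finset.sum_add_distrib]
  rw [show -o.sgn - o.sgn = -2 * o.sgn by ring]
  simp only [smul_comm (x _) (1 / 2 * o.sgn), smul_comm (y _) (1 / 2 * o.sgn), ← Finset.smul_sum]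
  rw [smul_smul, h, neg_one_smul]
  abel

theorem component_Ro_p (β δ : Fin 16)
    (hH : ∀ α β ρ, F.flatH X (Sum.inr (o.own α)) (Sum.inr (o.opp β)) (Sum.inr (o.opp ρ)) = 0) :
    (o.sgn - -o.sgn) • R' (Sum.inr (o.opp β)) (o.own δ)
      - ∑ q, H' (Sum.inr (o.opp β)) (Sum.inr q) * K' q (o.own δ)
    = (2 * o.sgn) • ∑ α, x α • ∑ γ, x γ • F.curv X (Sum.inr (o.opp β)) (Sum.inr (o.own α))
      (o.own γ) (o.own δ) := by
  simp only [o.sum_spin, conK_own_own, mul_zero, Finset.sum_const_zero, zero_add,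
    conR_own, conH_glue, hH, smul_zero, zero_mul, sub_zero, F.curv_swap X (Sum.inr (o.opp β))]
  simp
  congr 1
  ring

/-- The torsion with two opposite labels would enter through `P` on the left and is excluded by
`hT`. The indicator keeps only the coefficient belonging to the active ghost. -/
theorem component_C_eq (β β' : Fin 16)
    (hT : ∀ α β ρ, F.tors X (Sum.inr (o.own α)) (Sum.inr (o.opp β)) (Sum.inr (o.opp ρ)) = 0) :
    F.conDP X o.ind (o.glue x y) (o.own β) (o.opp β')
      + ∑ q, F.P (o.own β) q * T' (Sum.inr q) (Sum.inr (o.opp β'))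
      + ∑ q, T' (Sum.inr q) (Sum.inr (o.own β)) * F.P q (o.opp β')
      + o.ind (o.opp β') • K' (o.own β) (o.opp β') - o.ind (o.own β) • K' (o.opp β') (o.own β)
    = ∑ α, x α • (F.covP X (Sum.inr (o.own α)) (o.own β) (o.opp β')
    + (∑ ρ, F.tors X (Sum.inr (o.own α)) (Sum.inr (o.own ρ)) (Sum.inr (o.own β))
      * F.P (o.own ρ) (o.opp β')) - F.K (o.own α) (o.opp β') (o.own β)) := by
  simp only [o.sum_spin, P_own_own, P_opp_opp, mul_zero, zero_mul, Finset.sum_const_zero,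
    conT_glue, hT, smul_zero, add_zero, conDP_glue, conK_opp_own, Orientation.ind_own,
    Orientation.ind_opp, zero_smul, one_smul, sum_sum_smul_mul, smul_add, smul_sub,
    Finset.sum_add_distrib, Finset.sum_sub_distrib]

theorem component_S_eq (β δ : Fin 16) :
    F.conDK X o.ind (o.glue x y) (o.own β) (o.opp δ)
      + ∑ q, F.P (o.own β) q * R' (Sum.inr q) (o.opp δ)
      + ∑ q, T' (Sum.inr q) (Sum.inr (o.own β)) * K' q (o.opp δ)
      + o.ind (o.own β) • F.conS (o.glue x y) (o.own β) (o.opp δ)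
    = ∑ α, x α • ∑ α', y α' • (F.symS (o.own α) (o.opp α') (o.own β) (o.opp δ)
    + (∑ ρ, F.curv X (Sum.inr (o.own α)) (Sum.inr (o.opp ρ)) (o.opp α') (o.opp δ)
      * F.P (o.own β) (o.opp ρ))
    + F.covK X (Sum.inr (o.own α)) (o.opp α') (o.own β) (o.opp δ)
    + (∑ ρ, F.tors X (Sum.inr (o.own α)) (Sum.inr (o.own ρ)) (Sum.inr (o.own β))
      * F.K (o.opp α') (o.own ρ) (o.opp δ))) := by
  have hP : ∀ α ρ α', F.curv X (Sum.inr (o.own α)) (Sum.inr (o.opp ρ)) (o.opp α') (o.opp δ)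
      * F.P (o.own β) (o.opp ρ) = F.P (o.own β) (o.opp ρ)
        * F.curv X (Sum.inr (o.own α)) (Sum.inr (o.opp ρ)) (o.opp α') (o.opp δ) := fun α ρ α' =>
    (commute_of_even (F.P_deg _ _) (F.curv_deg X _ _ _ _)).symm
  simp only [o.sum_spin, P_own_own, conK_opp_opp, mul_zero, zero_mul, Finset.sum_const_zero,
    zero_add, conT_glue, conR_opp, conK_own_opp, conDK_own_opp, conS_own_opp, add_zero, hP,
    Orientation.ind_own, one_smul, sum_sum_smul_mul, sum_mul_sum_smul, smul_add,
    Finset.sum_add_distrib]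
  abel

theorem component_DC_eq (δ' δ : Fin 16)
    (hT : ∀ α β ρ, F.tors X (Sum.inr (o.own α)) (Sum.inr (o.opp β)) (Sum.inr (o.opp ρ)) = 0) :
    F.conDK X o.ind (o.glue x y) (o.opp δ') (o.own δ)
      + ∑ q, F.P (o.opp δ') q * R' (Sum.inr q) (o.own δ)
      + ∑ q, T' (Sum.inr q) (Sum.inr (o.opp δ')) * K' q (o.own δ)
      + o.ind (o.opp δ') • F.conS (o.glue x y) (o.opp δ') (o.own δ)
    = ∑ α, x α • ∑ β, x β •
    (F.covK X (Sum.inr (o.own α)) (o.own β) (o.opp δ') (o.own δ)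
    - ∑ σ, F.curv X (Sum.inr (o.own α)) (Sum.inr (o.own σ)) (o.own β) (o.own δ)
      * F.P (o.own σ) (o.opp δ')) := by
  have hP : ∀ α σ β, F.curv X (Sum.inr (o.own α)) (Sum.inr (o.own σ)) (o.own β) (o.own δ)
      * F.P (o.own σ) (o.opp δ') = F.P (o.own σ) (o.opp δ')
        * F.curv X (Sum.inr (o.own α)) (Sum.inr (o.own σ)) (o.own β) (o.own δ) := fun α ρ α' =>
    (commute_of_even (F.P_deg _ _) (F.curv_deg X _ _ _ _)).symm
  simp only [o.sum_spin, P_opp_opp, conK_own_own, mul_zero, zero_mul, Finset.sum_const_zero,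
    conT_glue, conR_own, conK_opp_own, conDK_opp_own, add_zero, hP, hT, smul_zero,
    P_opp_own, neg_mul, Finset.sum_neg_distrib,
    Orientation.ind_opp, zero_smul, sum_mul_sum_smul, smul_sub, Finset.sum_sub_distrib]
  abel

theorem component_DS_eq (δ δ' : Fin 16) :
    F.conDS X o.ind (o.glue x y) (o.own δ) (o.opp δ')
      + ∑ q, K' q (o.own δ) * R' (Sum.inr q) (o.opp δ')
      + ∑ q, R' (Sum.inr q) (o.own δ) * K' q (o.opp δ')
    = ∑ α, x α • ∑ β, x β • ∑ β', y β' •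
    (F.covSymS X (Sum.inr (o.own α)) (o.own β) (o.opp β') (o.own δ) (o.opp δ')
    + (∑ ρ, F.curv X (Sum.inr (o.own α)) (Sum.inr (o.opp ρ)) (o.opp β') (o.opp δ')
      * F.K (o.own β) (o.opp ρ) (o.own δ))
    + ∑ ρ, F.curv X (Sum.inr (o.own α)) (Sum.inr (o.own ρ)) (o.own β) (o.own δ)
      * F.K (o.opp β') (o.own ρ) (o.opp δ')) := by
  have hK : ∀ α ρ β β', F.curv X (Sum.inr (o.own α)) (Sum.inr (o.opp ρ)) (o.opp β') (o.opp δ')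
      * F.K (o.own β) (o.opp ρ) (o.own δ) = F.K (o.own β) (o.opp ρ) (o.own δ)
        * F.curv X (Sum.inr (o.own α)) (Sum.inr (o.opp ρ)) (o.opp β') (o.opp δ') :=
    fun α ρ β β' => commute_of_even (deg_of (F.curv_deg X _ _ _ _) (by simp only [par_inr]; decide))
      (F.K_deg _ _ _)
  -- The product form puts the ghost of `K` outermost. The two sums over the own ghost are
  -- interchanged to match the order of the other terms.
  have h1 : ∑ q, K' (o.opp q) (o.own δ) * R' (Sum.inr (o.opp q)) (o.opp δ')
      = ∑ α, x α • ∑ β, x β • ∑ β', y β' • ∑ ρ, F.K (o.own β) (o.opp ρ) (o.own δ)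
        * F.curv X (Sum.inr (o.own α)) (Sum.inr (o.opp ρ)) (o.opp β') (o.opp δ') := by
    simp only [conR_opp, sum_mul_sum_smul]
    simp only [conK_opp_own, sum_sum_smul_mul]
    refine Finset.sum_congr rfl fun α _ => congrArg _ ?_
    simp only [Finset.smul_sum, smul_smul]
    rw [Finset.sum_comm]
    simp only [mul_comm]
  simp only [o.sum_spin, conK_opp_opp, conK_own_own, mul_zero, zero_mul, Finset.sum_const_zero,
    zero_add, h1, conDS_own_opp, add_zero, hK, smul_add, Finset.sum_add_distrib]
  simp only [conR_own, conK_own_opp, sum_sum_smul_mul, sum_mul_sum_smul]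

end components

end Fields
end

/-! ### Equivalence of flat conservation and the constraints -/

section

variable {R T : Type*} [Ring R] [Algebra ℂ R] [SuperCommAlgebra R]
    [Ring T] [Algebra ℂ T] [SuperCommAlgebra T]

namespace Fields

variable {X : GhostExtension R T} {F : Fields R} {o : Orientation} {pO pP : (Fin 16 → ℂ) → Prop}

theorem two_sgn_ne_zero (o : Orientation) : 2 * o.sgn ≠ 0 :=
  mul_ne_zero two_ne_zero o.sgn_ne_zero

theorem conT_deg (X : GhostExtension R T) (F : Fields R) (χ l : Spin → ℂ) (q s : Spin) :
    F.conT X χ l (Sum.inr q) (Sum.inr s) ∈ deg 1 := by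
  have haux : ∀ A B C, F.torsionAux X A B C ∈ deg (par A + par B + par C) := by
    intro A B C
    refine Submodule.sub_mem _ (Submodule.sum_mem _ fun M _ => Submodule.sum_mem _ fun M' _ =>
      deg_of (mul_mem (mul_mem (F.E_deg A M) (X.mpd_derivs.map_deg M (F.E_deg B M')))
        (F.Einv_deg M' C)) ?_) (Submodule.sum_mem _ fun M _ =>
      deg_of (mul_mem (F.E_deg A M) (F.Om_deg M B C)) ?_)
    · simp only [Nat.even_add]
      by_cases hA : Even (par A) <;> by_cases hB : Even (par B) <;> by_cases hC : Even (par C) <;>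
        by_cases hM : Even (par M) <;> by_cases hM' : Even (par M') <;>
          simp [hA, hB, hC, hM, hM', -Nat.not_even_iff_odd]
    · simp only [Nat.even_add]
      by_cases hA : Even (par A) <;> by_cases hB : Even (par B) <;> by_cases hC : Even (par C) <;>
        by_cases hM : Even (par M) <;> simp [hA, hB, hC, hM, -Nat.not_even_iff_odd]
  -- Three spinor labels give degree 3, which has the same parity as 1.
  refine Submodule.sum_mem _ fun r _ => Submodule.smul_mem _ _ (deg_of (i := 3) ?_ (by decide))
  have h3 : ∀ r q, F.torsionAux X (Sum.inr r) (Sum.inr q) (Sum.inr s) ∈ deg 3 :=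
    fun r q => haux (Sum.inr r) (Sum.inr q) (Sum.inr s)
  exact Submodule.sub_mem _ (h3 r q) (Submodule.smul_mem _ _ (h3 q r))

/-- The lower condition between different eigenspaces contains only the flux, so this constraint
follows without information about the other current. It is the first link in the joint argument. -/
theorem H_po_of_flatConserved (hO : Spans pO) (h0 : pP 0)
    (h : ∀ x y, pO x → pP y → F.FlatConserved X o.ind (o.glue x y)) (α β ρ : Fin 16) :
    F.flatH X (Sum.inr (o.own α)) (Sum.inr (o.opp β)) (Sum.inr (o.own ρ)) = 0 := by
  refine hO.eq_zero (fun α => F.flatH X (Sum.inr (o.own α)) (Sum.inr (o.opp β))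
    (Sum.inr (o.own ρ))) (fun x hx => ?_) α
  have := (h x 0 hx h0).dd_ss (o.opp β) (o.own ρ)
  rw [o.chir_own, o.chir_opp, show o.sgn - -o.sgn = 2 * o.sgn by ring,
    smul_eq_zero_iff_right (two_sgn_ne_zero o), conH_glue] at this
  exact this

/-- Isolated from the full list of constraints because it needs only the mixed flux, not the mixed
torsion. In the joint argument it delivers the mixed torsion required by the other orientation. -/
theorem T_po_of_flatConserved (hO : Spans pO) (h0 : pP 0)
    (h : ∀ x y, pO x → pP y → F.FlatConserved X o.ind (o.glue x y))
    (hH : ∀ α β ρ, F.flatH X (Sum.inr (o.own α)) (Sum.inr (o.opp β)) (Sum.inr (o.opp ρ)) = 0)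
    (α β δ : Fin 16) :
    F.tors X (Sum.inr (o.own α)) (Sum.inr (o.opp β)) (Sum.inr (o.own δ)) = 0 := by
  refine hO.eq_zero (fun α => F.tors X (Sum.inr (o.own α)) (Sum.inr (o.opp β))
    (Sum.inr (o.own δ))) (fun x hx => ?_) α
  have := (h x 0 hx h0).du_ss (o.opp β) (o.own δ)
  rw [o.chir_own, o.chir_opp, component_T_po X F o x 0 β δ hH,
    smul_eq_zero_iff_right (two_sgn_ne_zero o)] at this
  exact this

/-- Each ghost occurring linearly is removed by spanning, and a ghost that does not occur is set to
zero, which is pure. Equations quadratic in the own ghost remain contracted with it, since a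
quadratic form vanishing on pure spinors need not vanish. -/
theorem holConstraints_of_flatConserved (hO : Spans pO) (hP : Spans pP) (h0 : pP 0)
    (hH : ∀ α β ρ, F.flatH X (Sum.inr (o.own α)) (Sum.inr (o.opp β)) (Sum.inr (o.opp ρ)) = 0)
    (hT : ∀ α β ρ, F.tors X (Sum.inr (o.own α)) (Sum.inr (o.opp β)) (Sum.inr (o.opp ρ)) = 0)
    (h : ∀ x y, pO x → pP y → F.FlatConserved X o.ind (o.glue x y)) :
    F.HolConstraints X o pO where
  T_symm α b c := by
    refine hO.eq_zero (fun α => F.torsl X (Sum.inr (o.own α)) (vec b) c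
      + F.torsl X (Sum.inr (o.own α)) (vec c) b) (fun x hx => ?_) α
    have := (h x 0 hx h0).dd_vv b c
    simpa only [conTl_glue, smul_add, Finset.sum_add_distrib] using this
  H_vv α b c := by
    refine hO.eq_zero (fun α => F.flatH X (Sum.inr (o.own α)) (vec b) (vec c)) (fun x hx => ?_) α
    have := (h x 0 hx h0).du_vv b c
    simpa only [conH_glue] using this
  H_po := H_po_of_flatConserved hO h0 h
  T_add_H α β c := by
    refine hO.eq_zero (fun α => F.torsl X (Sum.inr (o.own α)) (Sum.inr (o.own β)) c
      + o.sgn • F.flatH X (Sum.inr (o.own α)) (Sum.inr (o.own β)) (vec c)) (fun x hx => ?_) α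
    have := (h x 0 hx h0).dd_sv (o.own β) c
    simpa only [conTl_glue, conH_glue, smul_add, Finset.sum_add_distrib, o.chir_own,
      Finset.smul_sum, smul_comm o.sgn] using this
  T_sub_H α β c := by
    refine hO.eq_zero (fun α => F.torsl X (Sum.inr (o.own α)) (Sum.inr (o.opp β)) c
      - o.sgn • F.flatH X (Sum.inr (o.own α)) (Sum.inr (o.opp β)) (vec c)) (fun x hx => ?_) α
    have := (h x 0 hx h0).dd_sv (o.opp β) c
    simpa only [conTl_glue, conH_glue, smul_add, smul_neg, sub_eq_add_neg,
      Finset.sum_add_distrib, Finset.sum_neg_distrib, o.chir_opp, Finset.smul_sum,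
      smul_comm o.sgn, neg_smul] using this
  T_vo α b δ := hO.eq_zero (fun α => F.tors X (Sum.inr (o.own α)) (vec b) (Sum.inr (o.own δ))
    - ∑ ρ, F.torsl X (Sum.inr (o.own α)) (Sum.inr (o.opp ρ)) b * F.P (o.own δ) (o.opp ρ))
    (fun x hx => (component_T_vo X F o x 0 b δ).symm.trans ((h x 0 hx h0).uu_vs b (o.own δ))) α
  T_vp α b δ := hO.eq_zero (fun α => F.tors X (Sum.inr (o.own α)) (vec b) (Sum.inr (o.opp δ))
    + ∑ ρ, F.torsl X (Sum.inr (o.own α)) (Sum.inr (o.own ρ)) b * F.P (o.own ρ) (o.opp δ))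
    (fun x hx => (component_T_vp X F o x 0 b δ).symm.trans ((h x 0 hx h0).uu_vs b (o.opp δ))) α
  T_op α β δ := by
    refine hO.eq_zero (fun α => F.tors X (Sum.inr (o.own α)) (Sum.inr (o.own β))
        (Sum.inr (o.opp δ)) + (1 / 2 * o.sgn) • ∑ ρ, F.flatH X (Sum.inr (o.own α))
        (Sum.inr (o.own β)) (Sum.inr (o.own ρ)) * F.P (o.own ρ) (o.opp δ)) (fun x hx => ?_) α
    have := (h x 0 hx h0).du_ss (o.own β) (o.opp δ)
    rw [o.chir_own, o.chir_opp, component_T_op X F o x 0 β δ, neg_mul, neg_smul, neg_eq_zero,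
      smul_eq_zero_iff_right (two_sgn_ne_zero o)] at this
    exact this
  T_po := T_po_of_flatConserved hO h0 h hH
  C_eq α β β' := hO.eq_zero (fun α => F.covP X (Sum.inr (o.own α)) (o.own β) (o.opp β')
    + (∑ ρ, F.tors X (Sum.inr (o.own α)) (Sum.inr (o.own ρ)) (Sum.inr (o.own β))
      * F.P (o.own ρ) (o.opp β')) - F.K (o.own α) (o.opp β') (o.own β))
    (fun x hx => (component_C_eq X F o x 0 β β' hT).symm.trans
      ((h x 0 hx h0).uu_ss (o.own β) (o.opp β'))) α
  -- The equation is bilinear in the two ghosts, so spanning is applied once for each kind.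
  Rp_v a β δ σ := by
    refine hP.eq_zero (fun δ => F.curv X (vec a) (Sum.inr (o.own β)) (o.opp δ) (o.opp σ)
      - ∑ ρ, F.torsl X (Sum.inr (o.own β)) (Sum.inr (o.own ρ)) a
        * F.K (o.opp δ) (o.own ρ) (o.opp σ)) (fun y hy => ?_) δ
    refine hO.eq_zero (fun β => ∑ δ, y δ • (F.curv X (vec a) (Sum.inr (o.own β)) (o.opp δ) (o.opp σ)
      - ∑ ρ, F.torsl X (Sum.inr (o.own β)) (Sum.inr (o.own ρ)) a
        * F.K (o.opp δ) (o.own ρ) (o.opp σ))) (fun x hx => ?_) β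
    exact neg_eq_zero.1 ((component_Rp_v X F o x y a σ).symm.trans
      ((h x y hx hy).uu_vg a (o.opp σ)))
  Rp_s α β δ σ := by
    refine hP.eq_zero (fun δ => F.curv X (Sum.inr (o.own α)) (Sum.inr (o.own β)) (o.opp δ)
      (o.opp σ) + (1 / 2 * o.sgn) • ∑ ρ, F.flatH X (Sum.inr (o.own α)) (Sum.inr (o.own β))
      (Sum.inr (o.own ρ)) * F.K (o.opp δ) (o.own ρ) (o.opp σ)) (fun y hy => ?_) δ
    refine hO.eq_zero (fun α => ∑ δ, y δ • (F.curv X (Sum.inr (o.own α)) (Sum.inr (o.own β))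
      (o.opp δ) (o.opp σ) + (1 / 2 * o.sgn) • ∑ ρ, F.flatH X (Sum.inr (o.own α))
      (Sum.inr (o.own β)) (Sum.inr (o.own ρ)) * F.K (o.opp δ) (o.own ρ) (o.opp σ)))
      (fun x hx => ?_) α
    have := (h x y hx hy).du_sg (o.own β) (o.opp σ)
    rw [o.chir_own, o.chir_opp, component_Rp_s X F o x y β σ, neg_mul, neg_smul, neg_eq_zero,
      smul_eq_zero_iff_right (two_sgn_ne_zero o)] at this
    exact this
  S_eq α α' β β' := by
    refine hP.eq_zero (fun α' => F.symS (o.own α) (o.opp α') (o.own β) (o.opp β')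
      + (∑ ρ, F.curv X (Sum.inr (o.own α)) (Sum.inr (o.opp ρ)) (o.opp α') (o.opp β')
        * F.P (o.own β) (o.opp ρ))
      + F.covK X (Sum.inr (o.own α)) (o.opp α') (o.own β) (o.opp β')
      + (∑ ρ, F.tors X (Sum.inr (o.own α)) (Sum.inr (o.own ρ)) (Sum.inr (o.own β))
        * F.K (o.opp α') (o.own ρ) (o.opp β'))) (fun y hy => ?_) α'
    refine hO.eq_zero (fun α => ∑ α', y α' • (F.symS (o.own α) (o.opp α') (o.own β) (o.opp β')
      + (∑ ρ, F.curv X (Sum.inr (o.own α)) (Sum.inr (o.opp ρ)) (o.opp α') (o.opp β')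
        * F.P (o.own β) (o.opp ρ))
      + F.covK X (Sum.inr (o.own α)) (o.opp α') (o.own β) (o.opp β')
      + (∑ ρ, F.tors X (Sum.inr (o.own α)) (Sum.inr (o.own ρ)) (Sum.inr (o.own β))
        * F.K (o.opp α') (o.own ρ) (o.opp β')))) (fun x hx => ?_) α
    exact (component_S_eq X F o x y β β').symm.trans ((h x y hx hy).uu_sg (o.own β) (o.opp β'))
  Ro_v x hx a δ := neg_eq_zero.1 ((component_Ro_v X F o x 0 a δ).symm.trans
    ((h x 0 hx h0).uu_vg a (o.own δ)))
  Ro_p x hx ρ δ := by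
    have := (h x 0 hx h0).du_sg (o.opp ρ) (o.own δ)
    rwa [o.chir_own, o.chir_opp, component_Ro_p X F o x 0 ρ δ hH,
      smul_eq_zero_iff_right (two_sgn_ne_zero o)] at this
  DC_eq x hx δ δ' := (component_DC_eq X F o x 0 δ' δ hT).symm.trans
    ((h x 0 hx h0).uu_sg (o.opp δ') (o.own δ))
  DS_eq x hx β' δ δ' := by
    -- Only the opposite ghost enters linearly. After stripping it, the two own ghosts stay
    -- contracted.
    refine hP.eq_zero (fun β' => ∑ α, x α • ∑ β, x β •
      (F.covSymS X (Sum.inr (o.own α)) (o.own β) (o.opp β') (o.own δ) (o.opp δ')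
      + (∑ ρ, F.curv X (Sum.inr (o.own α)) (Sum.inr (o.opp ρ)) (o.opp β') (o.opp δ')
        * F.K (o.own β) (o.opp ρ) (o.own δ))
      + ∑ ρ, F.curv X (Sum.inr (o.own α)) (Sum.inr (o.own ρ)) (o.own β) (o.own δ)
        * F.K (o.opp β') (o.own ρ) (o.opp δ'))) (fun y hy => ?_) β'
    have hd := (component_DS_eq X F o x y δ δ').symm.trans
      ((h x y hx hy).uu_gg (o.own δ) (o.opp δ'))
    refine Eq.trans ?_ hd
    simp only [Finset.smul_sum, smul_smul]
    rw [Finset.sum_comm]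
    refine Finset.sum_congr rfl fun α _ => ?_
    rw [Finset.sum_comm]
    refine Finset.sum_congr rfl fun β _ => Finset.sum_congr rfl fun γ _ => ?_
    congr 1
    ring

/-- Blocks not listed among the constraints follow from symmetries. Vector rows of the mixed
condition repeat those of the upper one, one order of mixed labels determines the other, and blocks
with two opposite labels cancel by symmetry of the flux. The opposite ghost enters at most linearly
and needs no purity here. -/
theorem flatConserved_of_holConstraints
    (hH : ∀ α β ρ, F.flatH X (Sum.inr (o.own α)) (Sum.inr (o.opp β)) (Sum.inr (o.opp ρ)) = 0)
    (hT : ∀ α β ρ, F.tors X (Sum.inr (o.own α)) (Sum.inr (o.opp β)) (Sum.inr (o.opp ρ)) = 0)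
    (h : F.HolConstraints X o pO) (x y : Fin 16 → ℂ) (hx : pO x) :
    F.FlatConserved X o.ind (o.glue x y) := by
  have h2 : o.sgn - -o.sgn = 2 * o.sgn := by ring
  have hHpo : ∀ β ρ, F.conH X o.ind (o.glue x y) (Sum.inr (o.opp β)) (Sum.inr (o.own ρ)) = 0 :=
    fun β ρ => by simp only [conH_glue, h.H_po, smul_zero, Finset.sum_const_zero]
  have hHop : ∀ β ρ, F.conH X o.ind (o.glue x y) (Sum.inr (o.own β)) (Sum.inr (o.opp ρ)) = 0 :=
    fun β ρ => by rw [conH_spin, hHpo]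
  have hHpp : ∀ β ρ, F.conH X o.ind (o.glue x y) (Sum.inr (o.opp β)) (Sum.inr (o.opp ρ)) = 0 :=
    fun β ρ => by simp only [conH_glue, hH, smul_zero, Finset.sum_const_zero]
  have hTpp : ∀ β ρ, F.conT X o.ind (o.glue x y) (Sum.inr (o.opp β)) (Sum.inr (o.opp ρ)) = 0 :=
    fun β ρ => by simp only [conT_glue, hT, smul_zero, Finset.sum_const_zero]
  have hTpo : ∀ β ρ, F.conT X o.ind (o.glue x y) (Sum.inr (o.opp β)) (Sum.inr (o.own ρ)) = 0 :=
    fun β ρ => by simp only [conT_glue, h.T_po, smul_zero, Finset.sum_const_zero]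
  have hRpo : ∀ β δ, F.conR X o.ind (o.glue x y) (Sum.inr (o.opp β)) (o.own δ) = 0 := fun β δ => by
    have := component_Ro_p X F o x y β δ hH
    rw [h.Ro_p x hx β δ, smul_zero] at this
    simpa only [o.sum_spin, hHpo, hHpp, zero_mul, Finset.sum_const_zero, add_zero, sub_zero, h2,
      smul_eq_zero_iff_right (two_sgn_ne_zero o)] using this
  have hdsv : ∀ r b, F.conTl X o.ind (o.glue x y) (Sum.inr r) b
      + chir r • F.conH X o.ind (o.glue x y) (Sum.inr r) (vec b) = 0 := by
    intro r b
    rcases o.cases r with ⟨β, rfl⟩ | ⟨β, rfl⟩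
    · have : ∑ α, x α • (F.torsl X (Sum.inr (o.own α)) (Sum.inr (o.own β)) b
          + o.sgn • F.flatH X (Sum.inr (o.own α)) (Sum.inr (o.own β)) (vec b)) = 0 := by
        simp only [h.T_add_H, smul_zero, Finset.sum_const_zero]
      simpa only [conTl_glue, conH_glue, smul_add, Finset.sum_add_distrib, o.chir_own,
        Finset.smul_sum, smul_comm o.sgn] using this
    · have : ∑ α, x α • (F.torsl X (Sum.inr (o.own α)) (Sum.inr (o.opp β)) b
          - o.sgn • F.flatH X (Sum.inr (o.own α)) (Sum.inr (o.opp β)) (vec b)) = 0 := by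
        simp only [h.T_sub_H, smul_zero, Finset.sum_const_zero]
      simpa only [conTl_glue, conH_glue, smul_add, smul_neg, sub_eq_add_neg,
        Finset.sum_add_distrib, Finset.sum_neg_distrib, o.chir_opp, Finset.smul_sum,
        smul_comm o.sgn, neg_smul] using this
  -- Flux and torsion with a vector label agree up to the eigenvalue, which makes the vector rows of
  -- the mixed and upper conditions equivalent.
  have hHv : ∀ a r, F.conH X o.ind (o.glue x y) (vec a) (Sum.inr r)
      = chir r • F.conTl X o.ind (o.glue x y) (Sum.inr r) a := by
    intro a r
    have hc : chir r * chir r = 1 := by rcases r with r | r <;> simp [chir]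
    rw [eq_neg_of_add_eq_zero_left (hdsv r a), smul_neg, smul_smul, hc, one_smul, conH_vec, neg_neg]
  have huvs : ∀ a s, F.conT X o.ind (o.glue x y) (vec a) (Sum.inr s)
      + ∑ q, F.conTl X o.ind (o.glue x y) (Sum.inr q) a * F.P q s = 0 := by
    intro a s
    rcases o.cases s with ⟨δ, rfl⟩ | ⟨δ, rfl⟩
    · rw [component_T_vo]
      simp only [h.T_vo, smul_zero, Finset.sum_const_zero]
    · rw [component_T_vp]
      simp only [h.T_vp, smul_zero, Finset.sum_const_zero]
  have huvg : ∀ a g, F.conR X o.ind (o.glue x y) (vec a) g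
      + ∑ q, F.conTl X o.ind (o.glue x y) (Sum.inr q) a * F.conK (o.glue x y) q g = 0 := by
    intro a s
    rcases o.cases s with ⟨δ, rfl⟩ | ⟨δ, rfl⟩
    · rw [component_Ro_v, h.Ro_v x hx, neg_zero]
    · rw [component_Rp_v]
      simp only [h.Rp_v, smul_zero, Finset.sum_const_zero, neg_zero]
  have hTop0 : ∀ β δ, (-o.sgn - o.sgn) •
      F.conT X o.ind (o.glue x y) (Sum.inr (o.own β)) (Sum.inr (o.opp δ))
      - ∑ q, F.conH X o.ind (o.glue x y) (Sum.inr (o.own β)) (Sum.inr q) * F.P q (o.opp δ) = 0 := by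
    intro β δ
    rw [component_T_op]
    simp only [h.T_op, smul_zero, Finset.sum_const_zero]
  have hRop0 : ∀ β δ, (-o.sgn - o.sgn) •
      F.conR X o.ind (o.glue x y) (Sum.inr (o.own β)) (o.opp δ)
      - ∑ q, F.conH X o.ind (o.glue x y) (Sum.inr (o.own β)) (Sum.inr q)
        * F.conK (o.glue x y) q (o.opp δ) = 0 := by
    intro β δ
    rw [component_Rp_s]
    simp only [h.Rp_s, smul_zero, Finset.sum_const_zero]
  have hc0 : (-o.sgn - o.sgn) ≠ 0 := by
    rw [show -o.sgn - o.sgn = -(2 * o.sgn) by ring]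
    exact neg_ne_zero.2 (two_sgn_ne_zero o)
  -- Solving for the torsion presents it as flux times `P`. The same is done for the curvature with
  -- `K`, to be used when both free labels are of the opposite kind.
  have hTop : ∀ β δ, F.conT X o.ind (o.glue x y) (Sum.inr (o.own β)) (Sum.inr (o.opp δ))
      = (-o.sgn - o.sgn)⁻¹ • ∑ ρ, F.conH X o.ind (o.glue x y) (Sum.inr (o.own β))
        (Sum.inr (o.own ρ)) * F.P (o.own ρ) (o.opp δ) := by
    intro β δ
    have := sub_eq_zero.1 (hTop0 β δ)
    simp only [o.sum_spin, P_opp_opp, mul_zero, Finset.sum_const_zero, add_zero] at this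
    rw [← this, inv_smul_smul₀ hc0]
  have hRop : ∀ β δ, F.conR X o.ind (o.glue x y) (Sum.inr (o.own β)) (o.opp δ)
      = (-o.sgn - o.sgn)⁻¹ • ∑ ρ, F.conH X o.ind (o.glue x y) (Sum.inr (o.own β))
        (Sum.inr (o.own ρ)) * F.conK (o.glue x y) (o.own ρ) (o.opp δ) := by
    intro β δ
    have := sub_eq_zero.1 (hRop0 β δ)
    simp only [o.sum_spin, conK_opp_opp, mul_zero, Finset.sum_const_zero, add_zero] at this
    rw [← this, inv_smul_smul₀ hc0]
  have hHs : ∀ i j, F.conH X o.ind (o.glue x y) (Sum.inr (o.own i)) (Sum.inr (o.own j))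
      = F.conH X o.ind (o.glue x y) (Sum.inr (o.own j)) (Sum.inr (o.own i)) :=
    fun i j => F.conH_spin X _ _ _ _
  have hHd : ∀ j k, F.conH X o.ind (o.glue x y) (Sum.inr (o.own j)) (Sum.inr (o.own k)) ∈ deg 1 :=
    fun j k => Submodule.sum_mem _ fun s _ => Submodule.smul_mem _ _
      (deg_of (F.flatH_deg X (Sum.inr s) _ _) (by simp only [par_inr]; decide))
  have hPH : ∀ δ i j k, F.P (o.own i) (o.opp δ)
      * F.conH X o.ind (o.glue x y) (Sum.inr (o.own j)) (Sum.inr (o.own k))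
      = (1 : ℂ) • (F.conH X o.ind (o.glue x y) (Sum.inr (o.own j)) (Sum.inr (o.own k))
        * F.P (o.own i) (o.opp δ)) := fun δ i j k => by
    rw [one_smul]
    exact commute_of_even (F.P_deg _ _) (hHd j k)
  have hKH : ∀ δ i j k, F.conK (o.glue x y) (o.own i) (o.opp δ)
      * F.conH X o.ind (o.glue x y) (Sum.inr (o.own j)) (Sum.inr (o.own k))
      = (-1 : ℂ) • (F.conH X o.ind (o.glue x y) (Sum.inr (o.own j)) (Sum.inr (o.own k))
        * F.conK (o.glue x y) (o.own i) (o.opp δ)) := fun δ i j k => by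
    rw [comm (F.conK_deg _ _ _) (hHd j k)]
    simp
  have hgg : ∀ δ δ', F.conDS X o.ind (o.glue x y) (o.own δ) (o.opp δ')
      + ∑ q, F.conK (o.glue x y) q (o.own δ) * F.conR X o.ind (o.glue x y) (Sum.inr q) (o.opp δ')
      + ∑ q, F.conR X o.ind (o.glue x y) (Sum.inr q) (o.own δ) * F.conK (o.glue x y) q (o.opp δ')
      = 0 := by
    intro δ δ'
    rw [component_DS_eq]
    -- The constraint holds for each label of the opposite ghost separately, so that sum is pulled
    -- to the outside.
    have hc : ∀ f : Fin 16 → Fin 16 → Fin 16 → R, ∑ α, x α • ∑ β, x β • ∑ γ, y γ • f α β γ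
        = ∑ γ, y γ • ∑ α, x α • ∑ β, x β • f α β γ := by
      intro f
      simp only [Finset.smul_sum, smul_smul]
      rw [Finset.sum_comm (γ := Fin 16) (f := fun γ α => ∑ β, (y γ * (x α * x β)) • f α β γ)]
      refine Finset.sum_congr rfl fun α _ => ?_
      rw [Finset.sum_comm]
      refine Finset.sum_congr rfl fun β _ => Finset.sum_congr rfl fun γ _ => ?_
      congr 1
      ring
    rw [hc]
    simp only [h.DS_eq x hx, smul_zero, Finset.sum_const_zero]
  constructor
  · intro a b
    have : ∑ α, x α • (F.torsl X (Sum.inr (o.own α)) (vec a) b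
        + F.torsl X (Sum.inr (o.own α)) (vec b) a) = 0 := by
      simp only [h.T_symm, smul_zero, Finset.sum_const_zero]
    simpa only [conTl_glue, smul_add, Finset.sum_add_distrib] using this
  · exact hdsv
  · intro r s
    rcases o.cases r with ⟨α, rfl⟩ | ⟨α, rfl⟩ <;> rcases o.cases s with ⟨β, rfl⟩ | ⟨β, rfl⟩ <;>
      simp [hHpo, hHop]
  · intro a b
    simp only [conH_glue, h.H_vv, smul_zero, Finset.sum_const_zero]
  · intro a s
    -- Since `P` connects only different kinds, the eigenvalue of the summed label is minus that of
    -- the free one in every nonzero term.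
    have hc : ∀ r, chir r • (F.conTl X o.ind (o.glue x y) (Sum.inr r) a * F.P r s)
        = -(chir s • (F.conTl X o.ind (o.glue x y) (Sum.inr r) a * F.P r s)) := by
      intro r
      rcases o.cases r with ⟨α, rfl⟩ | ⟨α, rfl⟩ <;> rcases o.cases s with ⟨β, rfl⟩ | ⟨β, rfl⟩ <;>
        simp
    simp only [hHv, smul_mul_assoc, hc, Finset.sum_neg_distrib, ← Finset.smul_sum]
    rw [← neg_add, ← smul_add, huvs, smul_zero, neg_zero]
  · intro a s
    have hc : ∀ r, chir r • (F.conTl X o.ind (o.glue x y) (Sum.inr r) a * F.conK (o.glue x y) r s)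
        = -(chir s • (F.conTl X o.ind (o.glue x y) (Sum.inr r) a * F.conK (o.glue x y) r s)) := by
      intro r
      rcases o.cases r with ⟨α, rfl⟩ | ⟨α, rfl⟩ <;> rcases o.cases s with ⟨β, rfl⟩ | ⟨β, rfl⟩ <;>
        simp
    simp only [hHv, smul_mul_assoc, hc, Finset.sum_neg_distrib, ← Finset.smul_sum]
    rw [← neg_add, ← smul_add, huvg, smul_zero, neg_zero]
  · intro r s
    rcases o.cases r with ⟨α, rfl⟩ | ⟨α, rfl⟩ <;> rcases o.cases s with ⟨β, rfl⟩ | ⟨β, rfl⟩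
    · simp [o.sum_spin, -Fintype.sum_sum_type, hHop]
    · rw [o.chir_own, o.chir_opp, hTop0]
    · simp [o.sum_spin, -Fintype.sum_sum_type, hHpo, hHpp, hTpo]
    · simp [o.sum_spin, -Fintype.sum_sum_type, hHpo]
  · intro r s
    rcases o.cases r with ⟨α, rfl⟩ | ⟨α, rfl⟩ <;> rcases o.cases s with ⟨β, rfl⟩ | ⟨β, rfl⟩
    · simp [o.sum_spin, -Fintype.sum_sum_type, hHop]
    · rw [o.chir_own, o.chir_opp, hRop0]
    · simp [o.sum_spin, -Fintype.sum_sum_type, hHpo, hHpp, hRpo]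
    · simp [o.sum_spin, -Fintype.sum_sum_type, hHpo]
  · exact huvs
  · exact huvg
  · have hop : ∀ β β', F.conDP X o.ind (o.glue x y) (o.own β) (o.opp β')
        + ∑ q, F.P (o.own β) q * F.conT X o.ind (o.glue x y) (Sum.inr q) (Sum.inr (o.opp β'))
        + ∑ q, F.conT X o.ind (o.glue x y) (Sum.inr q) (Sum.inr (o.own β)) * F.P q (o.opp β')
        + o.ind (o.opp β') • F.conK (o.glue x y) (o.own β) (o.opp β')
        - o.ind (o.own β) • F.conK (o.glue x y) (o.opp β') (o.own β) = 0 := by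
      intro β β'
      rw [component_C_eq X F o x y β β' hT]
      simp only [h.C_eq, smul_zero, Finset.sum_const_zero]
    intro r s
    rcases o.cases r with ⟨α, rfl⟩ | ⟨α, rfl⟩ <;> rcases o.cases s with ⟨β, rfl⟩ | ⟨β, rfl⟩
    · simp [o.sum_spin, -Fintype.sum_sum_type, hTpo, conDP_glue]
    · exact hop α β
    -- Antisymmetry of `P` makes this block minus the block with labels exchanged, once even and odd
    -- factors are reordered.
    · have hcov : ∀ A, F.covP X A (o.opp α) (o.own β) = -F.covP X A (o.own β) (o.opp α) := by
        intro A
        simp only [covP, F.P_antisymm (o.opp α), F.P_antisymm _ (o.own β), map_neg, mul_neg,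
          Finset.sum_neg_distrib, ← neg_add]
        congr 1
        refine Finset.sum_congr rfl fun M _ => ?_
        congr 1
        abel
      have hD : F.conDP X o.ind (o.glue x y) (o.opp α) (o.own β)
          = -F.conDP X o.ind (o.glue x y) (o.own β) (o.opp α) := by
        simp only [conDP, hcov, smul_neg, Finset.sum_neg_distrib]
      have hcm : ∀ r q s, F.P r q * F.conT X o.ind (o.glue x y) (Sum.inr q) (Sum.inr s)
          = -(F.conT X o.ind (o.glue x y) (Sum.inr q) (Sum.inr s) * F.P q r) := fun r q s => by
        rw [F.P_antisymm r q, neg_mul, commute_of_even (F.P_deg q r) (F.conT_deg X _ _ q s)]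
      have hd := congrArg Neg.neg (hop β α)
      rw [neg_zero] at hd
      rw [← hd, hD]
      simp only [hcm, Finset.sum_neg_distrib]
      abel
    -- Substituting the solved torsion leaves two terms of the form $PHP$. Symmetry of the flux and
    -- antisymmetry of `P` make them cancel.
    · have hs := sum_mul_symm_mul _ _ (fun j => F.P (o.own j) (o.opp β)) 1 hHs (hPH α)
      simp only [o.sum_spin, P_opp_opp, mul_zero, zero_mul, Finset.sum_const_zero, add_zero,
        hTop, P_opp_own, conDP_glue, covP_opp_opp, smul_zero, zero_add, conK_opp_opp, sub_zero,
        neg_mul, Finset.sum_neg_distrib, mul_smul_comm, smul_mul_assoc, ← Finset.smul_sum]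
      rw [hs, one_smul, smul_neg, neg_add_cancel]
  · intro r s
    rcases o.cases r with ⟨α, rfl⟩ | ⟨α, rfl⟩ <;> rcases o.cases s with ⟨β, rfl⟩ | ⟨β, rfl⟩
    · simp [o.sum_spin, -Fintype.sum_sum_type, hTpo, hRpo]
    · rw [component_S_eq]
      simp only [h.S_eq, smul_zero, Finset.sum_const_zero]
    · rw [component_DC_eq X F o x y _ _ hT, h.DC_eq x hx]
    · have hs := sum_mul_symm_mul _ _ (fun j => F.conK (o.glue x y) (o.own j) (o.opp β)) 1 hHs (hPH α)
      simp only [o.sum_spin, P_opp_opp, mul_zero, zero_mul, Finset.sum_const_zero, add_zero,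
        hTop, hRop, P_opp_own, conDK_opp_opp, zero_add, conK_opp_opp, o.ind_opp, zero_smul,
        neg_mul, Finset.sum_neg_distrib, mul_smul_comm, smul_mul_assoc, ← Finset.smul_sum]
      rw [hs, one_smul, smul_neg, neg_add_cancel]
  · intro r s
    rcases o.cases r with ⟨α, rfl⟩ | ⟨α, rfl⟩ <;> rcases o.cases s with ⟨β, rfl⟩ | ⟨β, rfl⟩
    · simp [o.sum_spin, -Fintype.sum_sum_type, hRpo]
    · exact hgg α β
    · have hcomm : ∀ q g g', F.conK (o.glue x y) q g * F.conR X o.ind (o.glue x y) (Sum.inr q) g'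
          = F.conR X o.ind (o.glue x y) (Sum.inr q) g' * F.conK (o.glue x y) q g :=
        fun q g g' => (commute_of_even (Submodule.sum_mem _ fun s _ => Submodule.sum_mem _ fun t _ =>
          Submodule.smul_mem _ _ (deg_of (F.curv_deg X _ _ _ _) (by simp only [par_inr]; decide)))
          (F.conK_deg _ _ _)).symm
      have hd := hgg β α
      rw [conDS_symm] at hd
      rw [← hd]
      simp only [hcomm]
      abel
    -- Here the terms have the form $KHK$. The factor is $-1$ because `K` and the contracted flux
    -- are both odd, and this sign produces the cancellation.
    · have hs := sum_mul_symm_mul _ _ (fun j => F.conK (o.glue x y) (o.own j) (o.opp β)) (-1) hHs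
        (hKH α)
      simp only [o.sum_spin, mul_zero, zero_mul, Finset.sum_const_zero, add_zero,
        hRop, conDS_opp_opp, zero_add, conK_opp_opp,
        mul_smul_comm, smul_mul_assoc, ← Finset.smul_sum]
      rw [hs, neg_one_smul, smul_neg, neg_add_cancel]

end Fields
end

/-! ### Pure spinors span the space of spinors -/

namespace GammaMatrices

open Matrix

/-- Coefficients of null combinations of pairs of gamma matrices. -/
def nullCoeff (i : Fin 5) : ℂ := if i = 0 then 1 else Complex.I

/-- The even labels `2i`. -/
def evenIdx (i : Fin 5) : Fin 10 := ⟨2 * i, by omega⟩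

/-- The odd labels `2i + 1`. -/
def oddIdx (i : Fin 5) : Fin 10 := ⟨2 * i + 1, by omega⟩

/-- The sign of a truth value. -/
def boolSign (s : Bool) : ℂ := if s then 1 else -1

theorem eta_odd_odd (i j : Fin 5) : eta (oddIdx i) (oddIdx j) = if i = j then 1 else 0 := by
  have h : oddIdx i ≠ 0 := fun h => by simpa [oddIdx] using congrArg Fin.val h
  simp only [eta, oddIdx, Fin.mk.injEq]
  congr 1
  simp [Fin.ext_iff]

/-- Rescaling by $\sqrt{-1}$, except for the timelike direction, gives all even directions norm
$-1$. Each then pairs with an odd direction of norm $+1$ to form null combinations. -/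
theorem eta_even_even (i j : Fin 5) :
    nullCoeff i * nullCoeff j * eta (evenIdx i) (evenIdx j) = if i = j then -1 else 0 := by
  by_cases h : i = j
  · subst h
    by_cases h0 : i = 0
    · subst h0
      simp [eta, evenIdx, nullCoeff]
    · have h1 : evenIdx i ≠ 0 := fun h => h0 (by
        have := congrArg Fin.val h
        simp only [evenIdx, Fin.val_zero] at this
        ext
        simp only [Fin.val_zero]
        omega)
      simp [eta, h0, h1, nullCoeff]
  · have h1 : evenIdx i ≠ evenIdx j := fun h' => h (by
      have := congrArg Fin.val h'
      simp only [evenIdx] at this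
      ext
      omega)
    simp [eta, h, h1]

theorem eta_odd_even (i j : Fin 5) : eta (oddIdx i) (evenIdx j) = 0 := by
  have h : oddIdx i ≠ evenIdx j := fun h => by
    have := congrArg Fin.val h
    simp only [oddIdx, evenIdx] at this
    omega
  simp [eta, h]

theorem eta_even_odd (i j : Fin 5) : eta (evenIdx i) (oddIdx j) = 0 := by
  rw [eta_symm, eta_odd_even]

variable (γ : GammaMatrices)

/-- Null combinations of the gamma matrices with lower indices. -/
def nullLower (i : Fin 5) (s : Bool) : Matrix (Fin 16) (Fin 16) ℂ :=
  (1 / 2 : ℂ) • (γ.lower (oddIdx i) + (boolSign s * nullCoeff i) • γ.lower (evenIdx i))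

/-- Null combinations of the gamma matrices with upper indices. -/
def nullUpper (i : Fin 5) (s : Bool) : Matrix (Fin 16) (Fin 16) ℂ :=
  (1 / 2 : ℂ) • (γ.upper (oddIdx i) + (boolSign s * nullCoeff i) • γ.upper (evenIdx i))

/-- The ten directions split into five orthogonal hyperbolic planes. With the normalization $1/2$
the two null vectors of one plane anticommute to the identity, and all other pairs anticommute to
zero. Stated for both orders of chirality at once. -/
theorem null_anticommutator {a b : Fin 10 → Matrix (Fin 16) (Fin 16) ℂ}
    (h : ∀ i j, a i * b j + a j * b i = (2 * eta i j) • 1) (i j : Fin 5) (s t : Bool) :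
    ((1 / 2 : ℂ) • (a (oddIdx i) + (boolSign s * nullCoeff i) • a (evenIdx i)))
        * ((1 / 2 : ℂ) • (b (oddIdx j) + (boolSign t * nullCoeff j) • b (evenIdx j)))
      + ((1 / 2 : ℂ) • (a (oddIdx j) + (boolSign t * nullCoeff j) • a (evenIdx j)))
        * ((1 / 2 : ℂ) • (b (oddIdx i) + (boolSign s * nullCoeff i) • b (evenIdx i)))
      = if i = j ∧ s ≠ t then 1 else 0 := by
  have h1 := h (oddIdx i) (oddIdx j)
  have h2 := h (evenIdx i) (evenIdx j)
  have h3 := h (oddIdx i) (evenIdx j)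
  have h4 := h (evenIdx i) (oddIdx j)
  rw [eta_odd_odd] at h1
  rw [eta_odd_even, mul_zero, zero_smul] at h3
  rw [eta_even_odd, mul_zero, zero_smul] at h4
  have key : ((1 / 2 : ℂ) • (a (oddIdx i) + (boolSign s * nullCoeff i) • a (evenIdx i)))
        * ((1 / 2 : ℂ) • (b (oddIdx j) + (boolSign t * nullCoeff j) • b (evenIdx j)))
      + ((1 / 2 : ℂ) • (a (oddIdx j) + (boolSign t * nullCoeff j) • a (evenIdx j)))
        * ((1 / 2 : ℂ) • (b (oddIdx i) + (boolSign s * nullCoeff i) • b (evenIdx i)))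
      = (1 / 4 : ℂ) • ((a (oddIdx i) * b (oddIdx j) + a (oddIdx j) * b (oddIdx i))
        + (boolSign t * nullCoeff j) •
          (a (oddIdx i) * b (evenIdx j) + a (evenIdx j) * b (oddIdx i))
        + (boolSign s * nullCoeff i) •
          (a (evenIdx i) * b (oddIdx j) + a (oddIdx j) * b (evenIdx i))
        + (boolSign s * nullCoeff i * (boolSign t * nullCoeff j)) •
          (a (evenIdx i) * b (evenIdx j) + a (evenIdx j) * b (evenIdx i))) := by
    simp only [smul_mul_assoc, mul_smul_comm, add_mul, mul_add, smul_add, smul_smul]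
    module
  rw [key, h1, h2, h3, h4, smul_zero, smul_zero, add_zero, add_zero, smul_smul, ← add_smul,
    smul_smul]
  have h5 := eta_even_even i j
  have h6 : (1 / 4 : ℂ) * (2 * (if i = j then 1 else 0) + boolSign s * nullCoeff i
      * (boolSign t * nullCoeff j) * (2 * eta (evenIdx i) (evenIdx j)))
      = if i = j ∧ s ≠ t then 1 else 0 := by
    have h7 : boolSign s * nullCoeff i * (boolSign t * nullCoeff j)
        * (2 * eta (evenIdx i) (evenIdx j)) = 2 * boolSign s * boolSign t
        * (if i = j then -1 else 0) := by rw [← h5]; ring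
    rw [h7]
    by_cases hij : i = j
    · cases s <;> cases t <;> simp [hij, boolSign] <;> norm_num
    · simp [hij]
  rw [h6]
  split_ifs <;> simp

theorem nullLower_mul (i j : Fin 5) (s t : Bool) :
    γ.nullLower i s * γ.nullUpper j t + γ.nullLower j t * γ.nullUpper i s
      = if i = j ∧ s ≠ t then 1 else 0 :=
  null_anticommutator γ.lower_upper i j s t

theorem nullUpper_mul (i j : Fin 5) (s t : Bool) :
    γ.nullUpper i s * γ.nullLower j t + γ.nullUpper j t * γ.nullLower i s
      = if i = j ∧ s ≠ t then 1 else 0 :=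
  null_anticommutator γ.upper_lower i j s t

theorem nullLower_mul_self (i : Fin 5) (s : Bool) : γ.nullLower i s * γ.nullUpper i s = 0 := by
  have h := γ.nullLower_mul i i s s
  simpa [← two_smul ℂ] using h

theorem nullLower_mul_of_ne {i j : Fin 5} (h : i ≠ j) (s t : Bool) :
    γ.nullLower i s * γ.nullUpper j t = -(γ.nullLower j t * γ.nullUpper i s) := by
  have h := γ.nullLower_mul i j s t
  rw [if_neg (by tauto)] at h
  exact eq_neg_of_add_eq_zero_left h

theorem nullUpper_mul_of_ne {i j : Fin 5} (h : i ≠ j) (s t : Bool) :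
    γ.nullUpper i s * γ.nullLower j t = -(γ.nullUpper j t * γ.nullLower i s) := by
  have h := γ.nullUpper_mul i j s t
  rw [if_neg (by tauto)] at h
  exact eq_neg_of_add_eq_zero_left h

theorem null_decomp (i : Fin 5) (s : Bool) (l : Fin 16 → ℂ) :
    (γ.nullUpper i s * γ.nullLower i (!s)) *ᵥ l + (γ.nullUpper i (!s) * γ.nullLower i s) *ᵥ l
      = l := by
  rw [← Matrix.add_mulVec, γ.nullUpper_mul i i s (!s)]
  simp

theorem nullLower_transpose (i : Fin 5) (s : Bool) : (γ.nullLower i s)ᵀ = γ.nullLower i s := by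
  simp [nullLower, Matrix.transpose_smul, Matrix.transpose_add, γ.lower_symm]

/-- A spinor annihilated by a maximal isotropic subspace is pure. The bilinear with an annihilating
null vector vanishes at once. For the complementary one, the spinor is rewritten through another
plane and the two are anticommuted, until an annihilator meets the spinor from the left. These
bilinears span those of all ten gamma matrices. -/
theorem isPure_of_null {l : Fin 16 → ℂ} {σ : Fin 5 → Bool}
    (h : ∀ i, γ.nullLower i (σ i) *ᵥ l = 0) : γ.IsPure l := by
  have hv : ∀ i, l ᵥ* γ.nullLower i (σ i) = 0 := fun i => by
    rw [← γ.nullLower_transpose, Matrix.vecMul_transpose, h]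
  have h1 : ∀ i, l ⬝ᵥ (γ.nullLower i (σ i) *ᵥ l) = 0 := fun i => by rw [h]; simp
  have h2 : ∀ i, l ⬝ᵥ (γ.nullLower i (!σ i) *ᵥ l) = 0 := by
    intro i
    -- A second plane is needed for the anticommutation, so the argument depends on having more than
    -- one pair.
    obtain ⟨j, hj⟩ : ∃ j : Fin 5, i ≠ j := (exists_ne i).imp fun _ h => h.symm
    have hl : l = (γ.nullUpper j (σ j) * γ.nullLower j (!σ j)) *ᵥ l := by
      have := γ.null_decomp j (σ j) l
      rw [← Matrix.mulVec_mulVec _ (γ.nullUpper j (!σ j)), h, Matrix.mulVec_zero, add_zero] at this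
      exact this.symm
    have hc : γ.nullLower i (!σ i) *ᵥ l = -((γ.nullLower j (σ j) * γ.nullUpper i (!σ i)
        * γ.nullLower j (!σ j)) *ᵥ l) := by
      conv_lhs => rw [hl]
      rw [Matrix.mulVec_mulVec, ← mul_assoc, γ.nullLower_mul_of_ne hj, neg_mul, Matrix.neg_mulVec]
    rw [hc, dotProduct_neg, mul_assoc, ← Matrix.mulVec_mulVec, Matrix.dotProduct_mulVec, hv]
    simp
  have h3 : ∀ i s, l ⬝ᵥ (γ.nullLower i s *ᵥ l) = 0 := by
    intro i s
    by_cases hs : s = σ i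
    · rw [hs, h1]
    · rw [show s = !σ i by cases s <;> cases hσ : σ i <;> simp_all, h2]
  have hodd : ∀ i, γ.lower (oddIdx i) = γ.nullLower i true + γ.nullLower i false := by
    intro i
    simp only [nullLower, boolSign, if_true]
    simp only [Bool.false_eq_true, if_false]
    module
  have heven : ∀ i, nullCoeff i • γ.lower (evenIdx i)
      = γ.nullLower i true - γ.nullLower i false := by
    intro i
    simp only [nullLower, boolSign, if_true]
    simp only [Bool.false_eq_true, if_false]
    module
  have hform : ∀ a, (∑ α, ∑ β, l α * γ.lower a α β * l β) = l ⬝ᵥ (γ.lower a *ᵥ l) := by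
    intro a
    simp only [dotProduct, Matrix.mulVec, Finset.mul_sum, mul_assoc]
  intro a
  rw [hform]
  have ha : (∃ i, a = evenIdx i) ∨ ∃ i, a = oddIdx i := by
    rcases Nat.even_or_odd' (a : ℕ) with ⟨k, hk | hk⟩
    · exact Or.inl ⟨⟨k, by omega⟩, Fin.ext hk⟩
    · exact Or.inr ⟨⟨k, by omega⟩, Fin.ext hk⟩
  rcases ha with ⟨i, rfl⟩ | ⟨i, rfl⟩
  · have h4 : l ⬝ᵥ ((nullCoeff i • γ.lower (evenIdx i)) *ᵥ l) = 0 := by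
      rw [heven, Matrix.sub_mulVec, dotProduct_sub, h3, h3, sub_zero]
    rw [Matrix.smul_mulVec, dotProduct_smul, smul_eq_mul, mul_eq_zero] at h4
    refine h4.resolve_left ?_
    rw [nullCoeff]
    split_ifs <;> simp
  · rw [hodd, Matrix.add_mulVec, dotProduct_add, h3, h3, add_zero]

/-- Planes are added one at a time. The anticommutator in the new plane splits a spinor into two
parts, each annihilated by one of its null vectors. Both null vectors anticommute with those of the
earlier planes, so earlier annihilation is preserved. -/
theorem span_null (S : Finset (Fin 5)) :
    Submodule.span ℂ {l | ∃ σ : Fin 5 → Bool, ∀ i ∈ S, γ.nullLower i (σ i) *ᵥ l = 0} = ⊤ := by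
  induction S using Finset.induction with
  | empty => simp
  | insert j S hj ih =>
    rw [eq_top_iff, ← ih, Submodule.span_le]
    rintro l ⟨σ, hσ⟩
    have hmem : ∀ t, (γ.nullUpper j t * γ.nullLower j (!t)) *ᵥ l ∈ Submodule.span ℂ
        {l | ∃ σ : Fin 5 → Bool, ∀ i ∈ insert j S, γ.nullLower i (σ i) *ᵥ l = 0} := by
      intro t
      -- The part beginning with the null vector of sign `t` is annihilated by that same null
      -- vector, which fixes the choice for the new plane.
      refine Submodule.subset_span ⟨Function.update σ j t, fun i hi => ?_⟩
      rw [Finset.mem_insert] at hi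
      rw [Matrix.mulVec_mulVec, ← mul_assoc]
      by_cases hij : i = j
      · subst hij
        rw [Function.update_self, γ.nullLower_mul_self, zero_mul, Matrix.zero_mulVec]
      · rw [Function.update_of_ne hij, γ.nullLower_mul_of_ne hij, neg_mul, mul_assoc,
          γ.nullUpper_mul_of_ne hij, mul_neg, neg_neg, ← mul_assoc, ← Matrix.mulVec_mulVec,
          hσ i (hi.resolve_left hij), Matrix.mulVec_zero]
    rw [← γ.null_decomp j true l]
    exact Submodule.add_mem _ (hmem true) (hmem false)

theorem spans_isPure : Spans γ.IsPure := by
  rw [Spans, eq_top_iff, ← γ.span_null Finset.univ]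
  refine Submodule.span_mono ?_
  rintro l ⟨σ, hσ⟩
  exact γ.isPure_of_null fun i => hσ i (Finset.mem_univ i)

theorem isPure_zero : γ.IsPure 0 := fun a => by simp

end GammaMatrices

section

variable {R T : Type*} [Ring R] [Algebra ℂ R] [SuperCommAlgebra R]
    [Ring T] [Algebra ℂ T] [SuperCommAlgebra T]

namespace Fields

variable (X : GhostExtension R T) (F : Fields R) (χ χ' l : Spin → ℂ)

/-! ### Brackets of the vector fields `χ_s λ^s e_s` -/

/-- The flat components of the bracket of `χ_s λ^s e_s` and `χ'_s λ^s e_s`. -/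
def flatBracket : Coord → T
  | Sum.inl C => ∑ s, χ s • (X.lam s * ∑ t, χ' t • (X.lam t
      * X.up (F.tors X (Sum.inr t) (Sum.inr s) C)))
  | Sum.inr g => ∑ s, χ s • (X.lam s * ∑ t, χ' t • (X.lam t
      * ∑ u, X.lam u * X.up (F.curv X (Sum.inr t) (Sum.inr s) u g)))

theorem flatOm_smul (hχ : ∀ M s t,
      χ s • F.Om M (Sum.inr s) (Sum.inr t) = χ t • F.Om M (Sum.inr s) (Sum.inr t)) (A : Idx)
    (s t : Spin) : χ s • F.flatOm A (Sum.inr s) (Sum.inr t)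
      = χ t • F.flatOm A (Sum.inr s) (Sum.inr t) := by
  simp only [flatOm, Finset.smul_sum, ← mul_smul_comm]
  exact Finset.sum_congr rfl fun M _ => by rw [hχ]

/-- The bracket receives a term from rotating the ghosts in $\chi_s\lambda^s e_s$ and a term from
differentiating the frame. Their connection parts cancel, so only torsion and curvature survive. -/
theorem flatBracket_eq (hχ : ∀ M s t,
      χ s • F.Om M (Sum.inr s) (Sum.inr t) = χ t • F.Om M (Sum.inr s) (Sum.inr t)) (k : Coord) :
    F.flatBracket X χ χ' k = (∑ s, χ s • (if k = mat (Sum.inr s) then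
        act X.pd (F.brstVec X χ') (X.lam s) else 0))
      + ∑ s, χ s • (X.lam s * F.frameDer X χ' (mat (Sum.inr s)) k) := by
  rcases k with (c | r) | g
  · simp [-Fintype.sum_sum_type, flatBracket, frameDer_mat_mat, flatOm, F.Om_vec_right]
  · have h1 : ∑ s, χ s • (if mat (Sum.inr r) = mat (Sum.inr s) then
        act X.pd (F.brstVec X χ') (X.lam s) else 0)
        = -∑ s, χ s • (X.lam s * ∑ t, χ' t • (X.lam t
          * X.up (F.flatOm (Sum.inr t) (Sum.inr s) (Sum.inr r)))) := by
      have hs : ∀ (s t : Spin), χ r • (χ' t • (X.lam t * (X.lam s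
            * X.up (F.flatOm (Sum.inr t) (Sum.inr s) (Sum.inr r)))))
          = χ s • (X.lam s * (χ' t • (X.lam t
            * X.up (F.flatOm (Sum.inr t) (Sum.inr s) (Sum.inr r))))) := by
        intro s t
        rw [mul_smul_comm, ← mul_assoc (X.lam s), X.lam_comm s (X.lam t), mul_assoc]
        have := congrArg (fun z => χ' t • (X.lam t * (X.lam s * X.up z)))
          (F.flatOm_smul χ hχ (Sum.inr t) s r)
        simp only [map_smul, mul_smul_comm] at this
        rw [smul_comm (χ r), smul_comm (χ s), this]
      rw [Finset.sum_eq_single r]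
      · rw [if_pos rfl]
        simp only [act_brstVec, act_frame_lam, mul_neg, smul_neg, Finset.sum_neg_distrib,
          Finset.smul_sum, Finset.mul_sum, hs]
        rw [Finset.sum_comm]
      · intro s _ hs
        rw [if_neg (by simpa using Ne.symm hs), smul_zero]
      · simp
    rw [h1]
    simp only [flatBracket, frameDer_mat_mat, par_inr, pow_one, neg_smul, one_smul,
      map_add, mul_add, smul_add, Finset.sum_add_distrib]
    simp only [neg_add, neg_neg, mul_add, smul_add, Finset.sum_add_distrib]
    abel
  · simp [-Fintype.sum_sum_type, flatBracket, frameDer_mat_gh]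

/-- The bracket of two of the vector fields. -/
theorem bracket_brstVec (hχ : ∀ M s t,
      χ s • F.Om M (Sum.inr s) (Sum.inr t) = χ t • F.Om M (Sum.inr s) (Sum.inr t))
    (hχ' : ∀ M s t,
      χ' s • F.Om M (Sum.inr s) (Sum.inr t) = χ' t • F.Om M (Sum.inr s) (Sum.inr t)) (j : Coord) :
    act X.pd (F.brstVec X χ) (F.brstVec X χ' j) + act X.pd (F.brstVec X χ') (F.brstVec X χ j)
      = ∑ k, F.flatBracket X χ χ' k * F.frame X k j := by
  have hD := act_isOddDerivation X.pd_derivs (F.brstVec_deg X χ')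
  -- The structure equation for row `s`, solved for the derivative of the frame; the sign is that of
  -- an odd row.
  have h1 : ∀ s, act X.pd (F.brstVec X χ') (F.frame X (mat (Sum.inr s)) j)
      = (∑ k, F.frameDer X χ' (mat (Sum.inr s)) k * F.frame X k j)
        - act X.pd (F.frame X (mat (Sum.inr s))) (F.brstVec X χ' j) := by
    intro s
    have h := congrFun (congrFun (F.frameDer_mul_frame X χ' hχ') (mat (Sum.inr s))) j
    rw [Matrix.sub_apply, frame_mul_jac_apply, matDer, Matrix.of_apply, Matrix.mul_apply] at h
    rw [h]
    simp
  have h2 : act X.pd (F.brstVec X χ') (F.brstVec X χ j)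
      = (∑ s, χ s • (act X.pd (F.brstVec X χ') (X.lam s) * F.frame X (mat (Sum.inr s)) j))
        + (∑ s, χ s • (X.lam s * ∑ k, F.frameDer X χ' (mat (Sum.inr s)) k * F.frame X k j))
        - act X.pd (F.brstVec X χ) (F.brstVec X χ' j) := by
    rw [act_brstVec X F χ]
    nth_rewrite 1 [brstVec]
    simp only [map_sum, map_smul]
    rw [← Finset.sum_add_distrib, ← Finset.sum_sub_distrib]
    refine Finset.sum_congr rfl fun s _ => ?_
    rw [hD.leibniz _ (X.lam_deg s), h1, show sg 0 = 1 from pow_zero _, one_smul, mul_sub,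
      smul_add, smul_sub]
    abel
  rw [h2]
  simp only [F.flatBracket_eq X χ χ' hχ, add_mul, Finset.sum_add_distrib, Finset.sum_mul,
    Finset.mul_sum, Finset.smul_sum, smul_mul_assoc, mul_assoc, ite_mul, zero_mul, smul_ite,
    smul_zero]
  rw [Finset.sum_comm (γ := Coord) (α := Spin), Finset.sum_comm (γ := Coord) (α := Spin)]
  simp only [Finset.sum_ite_eq', Finset.mem_univ, if_true]
  abel

theorem ev_flatBracket_mat (C : Idx) : X.ev l (F.flatBracket X χ χ' (mat C))
    = ∑ s, (χ s * l s) • F.conT X χ' l (Sum.inr s) C := by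
  simp only [flatBracket, map_sum, map_smul, ev_lam_mul, X.ev_up, conT, smul_smul]

theorem ev_flatBracket_gh (g : Spin) : X.ev l (F.flatBracket X χ χ' (Sum.inr g))
    = ∑ s, (χ s * l s) • F.conR X χ' l (Sum.inr s) g := by
  simp only [flatBracket, map_sum, map_smul, ev_lam_mul, X.ev_up, conR, Finset.smul_sum, smul_smul,
    mul_assoc]

/-- An invertible frame relates the two sets of components, so they vanish together after
evaluation. -/
theorem sum_mul_map_eq_zero {S : Type*} [Ring S] (φ : T →+* S) {e f : Matrix Coord Coord T}
    (h : e * f = 1) (v : Coord → T) :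
    (∀ j, φ (∑ k, v k * e k j) = 0) ↔ ∀ k, φ (v k) = 0 := by
  constructor
  · intro hv k
    have h1 : v k = ∑ j, (∑ i, v i * e i j) * f j k := by
      simp only [Finset.sum_mul, mul_assoc]
      rw [Finset.sum_comm]
      simp only [← Finset.mul_sum]
      have h2 : ∀ i, ∑ j, e i j * f j k = if i = k then 1 else 0 := fun i => by
        rw [← Matrix.mul_apply, h, Matrix.one_apply]
      simp only [h2, mul_ite, mul_one, mul_zero, Finset.sum_ite_eq', Finset.mem_univ, if_true]
    rw [h1, map_sum]
    simp only [map_mul, hv, zero_mul, Finset.sum_const_zero]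
  · intro hv j
    rw [map_sum]
    simp only [map_mul, hv, zero_mul, Finset.sum_const_zero]

theorem bracket_eq_zero_iff (hχ : ∀ M s t,
      χ s • F.Om M (Sum.inr s) (Sum.inr t) = χ t • F.Om M (Sum.inr s) (Sum.inr t))
    (hχ' : ∀ M s t,
      χ' s • F.Om M (Sum.inr s) (Sum.inr t) = χ' t • F.Om M (Sum.inr s) (Sum.inr t)) :
    (∀ j, X.ev l (act X.pd (F.brstVec X χ) (F.brstVec X χ' j)
        + act X.pd (F.brstVec X χ') (F.brstVec X χ j)) = 0) ↔
      (∀ C, ∑ s, (χ s * l s) • F.conT X χ' l (Sum.inr s) C = 0) ∧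
      ∀ g, ∑ s, (χ s * l s) • F.conR X χ' l (Sum.inr s) g = 0 := by
  simp only [F.bracket_brstVec X χ χ' hχ hχ']
  have h := sum_mul_map_eq_zero (X.ev l : T →+* R) (F.frame_mul_coframe X) (F.flatBracket X χ χ')
  simp only [RingHom.coe_coe] at h
  rw [h]
  simp only [← ev_flatBracket_mat, ← ev_flatBracket_gh]
  constructor
  · exact fun h => ⟨fun C => h _, fun g => h _⟩
  · rintro ⟨h1, h2⟩ (k | k)
    · exact h1 k
    · exact h2 k

/-- Contracting with $V$ amounts to taking the ghost combination of spinor rows of the flattened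
flux. The remaining coframe factor is invertible. -/
theorem flux_eq_zero_iff :
    (∀ k, X.ev l (∑ i, F.brstVec X χ i * F.flux X χ' i k) = 0) ↔
      ∀ B, ∑ s, (χ s * l s) • F.conH X χ' l (Sum.inr s) B = 0 := by
  have hts : st0 cpar (F.coframe X) * st0 cpar (F.frame X) = 1 := by
    rw [← st0_mul (F.frame_isHom X) (F.coframe_isHom X), frame_mul_coframe, st0_one]
  have h1 : F.frame X * F.flux X χ' = F.flatFlux X χ' * st0 cpar (F.coframe X) := by
    rw [← frame_flux, mul_assoc, ← st0_mul (F.coframe_isHom X) (F.frame_isHom X),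
      coframe_mul_frame, st0_one, mul_one]
  have h2 : ∀ k, ∑ i, F.brstVec X χ i * F.flux X χ' i k
      = ∑ j, (∑ s, χ s • (X.lam s * F.flatFlux X χ' (mat (Sum.inr s)) j))
        * st0 cpar (F.coframe X) j k := by
    intro k
    have h3 : ∀ s, ∑ i, F.frame X (mat (Sum.inr s)) i * F.flux X χ' i k
        = ∑ j, F.flatFlux X χ' (mat (Sum.inr s)) j * st0 cpar (F.coframe X) j k := fun s => by
      rw [← Matrix.mul_apply, h1, Matrix.mul_apply]
    simp only [brstVec, Finset.sum_mul, smul_mul_assoc, mul_assoc]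
    rw [Finset.sum_comm]
    simp only [← Finset.smul_sum, ← Finset.mul_sum, h3]
    simp only [Finset.mul_sum, Finset.smul_sum]
    rw [Finset.sum_comm]
  simp only [h2]
  have h := sum_mul_map_eq_zero (X.ev l : T →+* R) hts
    (fun j => ∑ s, χ s • (X.lam s * F.flatFlux X χ' (mat (Sum.inr s)) j))
  simp only [RingHom.coe_coe] at h
  rw [h]
  have h4 : ∀ B, X.ev l (∑ s, χ s • (X.lam s * F.flatFlux X χ' (mat (Sum.inr s)) (mat B)))
      = -∑ s, (χ s * l s) • F.conH X χ' l (Sum.inr s) B := fun B => by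
    simp only [map_sum, map_smul, ev_lam_mul, ev_flatFlux, par_inr, pow_one, neg_smul, one_smul,
      smul_neg, Finset.sum_neg_distrib, smul_smul]
  constructor
  · intro hk B
    rw [← neg_eq_zero, ← h4]
    exact hk _
  · rintro hB (B | g)
    · rw [h4, hB, neg_zero]
    · simp

end Fields

/-- The orientation with the two kinds of spinor labels exchanged. -/
def Orientation.swap (o : Orientation) : Orientation where
  perm := (Equiv.sumComm _ _).trans o.perm
  sgn := -o.sgn
  sgn_sq := by rw [neg_mul_neg, o.sgn_sq]
  chir_inl α := o.chir_inr α
  chir_inr α := by rw [neg_neg]; exact o.chir_inl α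

@[simp] theorem Orientation.swap_own (o : Orientation) (α : Fin 16) : o.swap.own α = o.opp α := rfl
@[simp] theorem Orientation.swap_opp (o : Orientation) (α : Fin 16) : o.swap.opp α = o.own α := rfl
@[simp] theorem Orientation.swap_sgn (o : Orientation) : o.swap.sgn = -o.sgn := rfl

theorem Orientation.swap_glue (o : Orientation) (x y : Fin 16 → ℂ) :
    o.swap.glue y x = o.glue x y := by
  funext s
  rcases o.cases s with ⟨α, rfl⟩ | ⟨α, rfl⟩
  · rw [o.glue_own, ← o.swap_opp, o.swap.glue_opp]
  · rw [o.glue_opp, ← o.swap_own, o.swap.glue_own]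

theorem sum_smul_sum_swap {M : Type*} [AddCommGroup M] [Module ℂ M] (x y : Fin 16 → ℂ)
    (f : Fin 16 → Fin 16 → M) :
    ∑ α, x α • ∑ β, y β • f β α = ∑ β, y β • ∑ α, x α • f β α := by
  simp only [Finset.smul_sum]
  rw [Finset.sum_comm]
  exact Finset.sum_congr rfl fun β _ => Finset.sum_congr rfl fun α _ => smul_comm _ _ _

theorem sum_smul_sum_sum_swap {M : Type*} [AddCommGroup M] [Module ℂ M] (x y z : Fin 16 → ℂ)
    (f : Fin 16 → Fin 16 → Fin 16 → M) :
    ∑ α, x α • ∑ β, y β • ∑ ρ, z ρ • f β α ρ = ∑ β, y β • ∑ α, x α • ∑ ρ, z ρ • f β α ρ :=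
  sum_smul_sum_swap x y fun β α => ∑ ρ, z ρ • f β α ρ

namespace Fields

section orientation

variable (X : GhostExtension R T) (F : Fields R) (o : Orientation) (x y : Fin 16 → ℂ)

theorem sum_ind_glue (f : Spin → R) :
    ∑ s, (o.ind s * o.glue x y s) • f s = ∑ α, x α • f (o.own α) := by
  simp [o.sum_spin, -Fintype.sum_sum_type]

theorem sum_swap_ind_glue (f : Spin → R) :
    ∑ s, (o.swap.ind s * o.glue x y s) • f s = ∑ α, y α • f (o.opp α) := by
  rw [← o.swap_glue, sum_ind_glue]
  simp only [o.swap_own]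

variable {o} {pO pP : (Fin 16 → ℂ) → Prop}

/-- Nilpotency of the BRST operator of the ghosts of one kind. -/
theorem nilpotent_iff (hP : Spans pP) (h0 : pP 0) :
    ((∀ x y, pO x → pP y → ∀ j, X.ev (o.glue x y)
        (act X.pd (F.brstVec X o.ind) (F.brstVec X o.ind j)
          + act X.pd (F.brstVec X o.ind) (F.brstVec X o.ind j)) = 0) ∧
      ∀ x y, pO x → pP y → ∀ k, X.ev (o.glue x y)
        (∑ i, F.brstVec X o.ind i * F.flux X o.ind i k) = 0) ↔
    ∀ x, pO x →
      (∀ C, ∑ α, x α • ∑ β, x β • F.tors X (Sum.inr (o.own α)) (Sum.inr (o.own β)) C = 0) ∧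
      (∀ σ, ∑ α, x α • ∑ β, x β • ∑ ρ, x ρ •
        F.curv X (Sum.inr (o.own α)) (Sum.inr (o.own β)) (o.own ρ) (o.own σ) = 0) ∧
      (∀ ρ σ, ∑ α, x α • ∑ β, x β •
        F.curv X (Sum.inr (o.own α)) (Sum.inr (o.own β)) (o.opp ρ) (o.opp σ) = 0) ∧
      (∀ C, ∑ α, x α • ∑ β, x β • F.flatH X (Sum.inr (o.own α)) (Sum.inr (o.own β)) C = 0) := by
  have hχ := F.ind_smul_Om o
  simp only [F.bracket_eq_zero_iff X _ _ _ hχ hχ, F.flux_eq_zero_iff, sum_ind_glue, conT_glue,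
    conH_glue]
  have eT : ∀ (x : Fin 16 → ℂ) C, ∑ α, x α • ∑ β, x β • F.tors X (Sum.inr (o.own β))
      (Sum.inr (o.own α)) C = ∑ α, x α • ∑ β, x β • F.tors X (Sum.inr (o.own α))
      (Sum.inr (o.own β)) C := fun x C => sum_smul_sum_swap x x _
  have eH : ∀ (x : Fin 16 → ℂ) C, ∑ α, x α • ∑ β, x β • F.flatH X (Sum.inr (o.own β))
      (Sum.inr (o.own α)) C = ∑ α, x α • ∑ β, x β • F.flatH X (Sum.inr (o.own α))
      (Sum.inr (o.own β)) C := fun x C => sum_smul_sum_swap x x _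
  have e1 : ∀ x y σ, ∑ α, x α • F.conR X o.ind (o.glue x y) (Sum.inr (o.own α)) (o.own σ)
      = ∑ α, x α • ∑ β, x β • ∑ ρ, x ρ •
        F.curv X (Sum.inr (o.own α)) (Sum.inr (o.own β)) (o.own ρ) (o.own σ) := fun x y σ => by
    simp only [conR_own]
    rw [sum_smul_sum_sum_swap]
  -- Acting on the opposite ghost, the curvature is linear in it. Moving that ghost outermost allows
  -- it to be removed by spanning.
  have e2 : ∀ x y σ, ∑ α, x α • F.conR X o.ind (o.glue x y) (Sum.inr (o.own α)) (o.opp σ)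
      = ∑ ρ, y ρ • ∑ α, x α • ∑ β, x β •
        F.curv X (Sum.inr (o.own α)) (Sum.inr (o.own β)) (o.opp ρ) (o.opp σ) := fun x y σ => by
    simp only [conR_opp]
    rw [sum_smul_sum_sum_swap, ← sum_smul_sum_swap x y fun ρ α => ∑ β, x β •
      F.curv X (Sum.inr (o.own α)) (Sum.inr (o.own β)) (o.opp ρ) (o.opp σ)]
    exact Finset.sum_congr rfl fun α _ => congrArg (x α • ·) (sum_smul_sum_swap x y fun ρ β =>
      F.curv X (Sum.inr (o.own α)) (Sum.inr (o.own β)) (o.opp ρ) (o.opp σ))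
  simp only [eT, eH]
  constructor
  · rintro ⟨h, h'⟩ x hx
    refine ⟨(h x 0 hx h0).1, fun σ => ?_, fun ρ σ => ?_, h' x 0 hx h0⟩
    · rw [← e1 x 0]
      exact (h x 0 hx h0).2 _
    · exact hP.eq_zero (fun ρ => ∑ α, x α • ∑ β, x β •
        F.curv X (Sum.inr (o.own α)) (Sum.inr (o.own β)) (o.opp ρ) (o.opp σ))
        (fun y hy => by rw [← e2]; exact (h x y hx hy).2 _) ρ
  · intro h
    refine ⟨fun x y hx hy => ⟨(h x hx).1, fun g => ?_⟩, fun x y hx hy => (h x hx).2.2.2⟩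
    rcases o.cases g with ⟨σ, rfl⟩ | ⟨σ, rfl⟩
    · rw [e1]
      exact (h x hx).2.1 σ
    · rw [e2]
      simp only [(h x hx).2.2.1, smul_zero, Finset.sum_const_zero]

/-- Anticommutation of the BRST operators of the ghosts of the two kinds. -/
theorem anticommute_iff (hO : Spans pO) (hP : Spans pP) :
    ((∀ x y, pO x → pP y → ∀ j, X.ev (o.glue x y)
        (act X.pd (F.brstVec X o.ind) (F.brstVec X o.swap.ind j)
          + act X.pd (F.brstVec X o.swap.ind) (F.brstVec X o.ind j)) = 0) ∧
      ∀ x y, pO x → pP y → ∀ k, X.ev (o.glue x y)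
        (∑ i, F.brstVec X o.swap.ind i * F.flux X o.ind i k) = 0) ↔
      (∀ α β C, F.tors X (Sum.inr (o.own α)) (Sum.inr (o.opp β)) C = 0) ∧
      (∀ x, pO x → ∀ β σ, ∑ α, x α • ∑ ρ, x ρ •
        F.curv X (Sum.inr (o.own α)) (Sum.inr (o.opp β)) (o.own ρ) (o.own σ) = 0) ∧
      (∀ y, pP y → ∀ α σ, ∑ β, y β • ∑ ρ, y ρ •
        F.curv X (Sum.inr (o.opp β)) (Sum.inr (o.own α)) (o.opp ρ) (o.opp σ) = 0) ∧
      (∀ α β C, F.flatH X (Sum.inr (o.own α)) (Sum.inr (o.opp β)) C = 0) := by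
  -- The bracket of odd vector fields is symmetric. The order is chosen so that the own label comes
  -- first in torsion and curvature.
  have hb : ∀ l : Spin → ℂ, (∀ j, X.ev l
      (act X.pd (F.brstVec X o.ind) (F.brstVec X o.swap.ind j)
          + act X.pd (F.brstVec X o.swap.ind) (F.brstVec X o.ind j)) = 0) ↔
      (∀ C, ∑ s, (o.swap.ind s * l s) • F.conT X o.ind l (Sum.inr s) C = 0) ∧
      ∀ g, ∑ s, (o.swap.ind s * l s) • F.conR X o.ind l (Sum.inr s) g = 0 := fun l => by
    rw [← F.bracket_eq_zero_iff X _ _ _ (F.ind_smul_Om o.swap) (F.ind_smul_Om o)]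
    simp only [add_comm]
  simp only [hb, F.flux_eq_zero_iff, sum_swap_ind_glue, conT_glue, conH_glue]
  have hc : ∀ A B s t, F.curv X (Sum.inr A) (Sum.inr B) s t = F.curv X (Sum.inr B) (Sum.inr A) s t :=
    fun A B s t => by rw [curv_swap]; simp
  have e1 : ∀ x y σ, ∑ β, y β • F.conR X o.ind (o.glue x y) (Sum.inr (o.opp β)) (o.own σ)
      = ∑ β, y β • ∑ α, x α • ∑ ρ, x ρ •
        F.curv X (Sum.inr (o.own α)) (Sum.inr (o.opp β)) (o.own ρ) (o.own σ) := fun x y σ => by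
    simp only [conR_own]
  have e2 : ∀ x y σ, ∑ β, y β • F.conR X o.ind (o.glue x y) (Sum.inr (o.opp β)) (o.opp σ)
      = ∑ α, x α • ∑ β, y β • ∑ ρ, y ρ •
        F.curv X (Sum.inr (o.opp β)) (Sum.inr (o.own α)) (o.opp ρ) (o.opp σ) := fun x y σ => by
    simp only [conR_opp]
    rw [sum_smul_sum_sum_swap]
    simp only [hc (o.own _)]
  constructor
  · rintro ⟨h, h'⟩
    refine ⟨fun α β C => ?_, fun x hx β σ => ?_, fun y hy α σ => ?_, fun α β C => ?_⟩
    · refine hO.eq_zero (fun α => F.tors X (Sum.inr (o.own α)) (Sum.inr (o.opp β)) C)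
        (fun x hx => ?_) α
      exact hP.eq_zero (fun β => ∑ α, x α • F.tors X (Sum.inr (o.own α)) (Sum.inr (o.opp β)) C)
        (fun y hy => (h x y hx hy).1 C) β
    · exact hP.eq_zero (fun β => ∑ α, x α • ∑ ρ, x ρ •
        F.curv X (Sum.inr (o.own α)) (Sum.inr (o.opp β)) (o.own ρ) (o.own σ))
        (fun y hy => by rw [← e1]; exact (h x y hx hy).2 _) β
    · exact hO.eq_zero (fun α => ∑ β, y β • ∑ ρ, y ρ •
        F.curv X (Sum.inr (o.opp β)) (Sum.inr (o.own α)) (o.opp ρ) (o.opp σ))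
        (fun x hx => by rw [← e2]; exact (h x y hx hy).2 _) α
    · refine hO.eq_zero (fun α => F.flatH X (Sum.inr (o.own α)) (Sum.inr (o.opp β)) C)
        (fun x hx => ?_) α
      exact hP.eq_zero (fun β => ∑ α, x α • F.flatH X (Sum.inr (o.own α)) (Sum.inr (o.opp β)) C)
        (fun y hy => h' x y hx hy C) β
  · rintro ⟨h1, h2, h3, h4⟩
    refine ⟨fun x y hx hy => ⟨fun C => ?_, fun g => ?_⟩, fun x y hx hy C => ?_⟩
    · simp only [h1, smul_zero, Finset.sum_const_zero]
    · rcases o.cases g with ⟨σ, rfl⟩ | ⟨σ, rfl⟩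
      · rw [e1]
        simp only [h2 x hx, smul_zero, Finset.sum_const_zero]
      · rw [e2]
        simp only [h3 y hy, smul_zero, Finset.sum_const_zero]
    · simp only [h4, smul_zero, Finset.sum_const_zero]

end orientation

end Fields
end

/-! ### The concrete ghost extension and the joined background fields -/

section

variable {U : TopologicalSpace.Opens Body} {N : ℕ}

theorem commute_of_tmul_one (g : Ghost) (x : Target U N) :
    ((1 : Matter U N) ⊗ₜ[ℂ] g) * x = x * ((1 : Matter U N) ⊗ₜ[ℂ] g) := by
  induction x using TensorProduct.induction_on with
  | zero => rw [mul_zero, zero_mul]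
  | tmul a b => simp only [Algebra.TensorProduct.tmul_mul_tmul, one_mul, mul_one, mul_comm]
  | add x y hx hy => rw [mul_add, add_mul, hx, hy]

variable (U N) in
/-- The superfunctions on the target space as a ghost extension of the superfields. -/
def ghostExtension : GhostExtension (Matter U N) (Target U N) where
  mpd := Matter.pd
  pd := Target.pd
  up := up
  lam := Sum.elim lam lamh
  ev l := ev (fun α => l (Sum.inl α)) fun α => l (Sum.inr α)
  mpd_derivs := matter_isPartialDerivs
  pd_derivs := target_isPartialDerivs
  up_deg := up_mem_deg
  lam_deg s := by
    rcases s with α | α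
    exacts [lam_mem_deg α, lamh_mem_deg α]
  lam_comm s x := by
    rcases s with α | α
    · exact commute_of_tmul_one _ x
    · exact commute_of_tmul_one _ x
  pd_mat_up M x := pd_mat_up M x
  pd_gh_up s x := pd_gh_up s x
  pd_mat_lam M s := by
    rcases s with α | α
    exacts [pd_mat_lam M α, pd_mat_lamh M α]
  pd_gh_lam s t := by
    rcases s with α | α <;> rcases t with β | β
    · exact (pd_gh_lam α β).trans (by simp only [Sum.inl.injEq])
    · exact (pd_gh_lamh α β).trans (by simp only [reduceCtorEq, if_false])
    · exact (pd_ghh_lam α β).trans (by simp only [reduceCtorEq, if_false])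
    · exact (pd_ghh_lamh α β).trans (by simp only [Sum.inr.injEq])
  ev_up l x := ev_up _ _ x
  ev_lam l s := by
    rcases s with α | α
    exacts [ev_lam _ _ α, ev_lamh _ _ α]

namespace Fields

/-- Both orders of the components `P^{αα̂}`. -/
def joinP {R : Type*} [AddCommGroup R] (P : Fin 16 → Fin 16 → R) : Spin → Spin → R
  | Sum.inl α, Sum.inr β => P α β
  | Sum.inr β, Sum.inl α => -P α β
  | Sum.inl _, Sum.inl _ => 0
  | Sum.inr _, Sum.inr _ => 0

/-- The components `C_α^{ββ̂}` and `Ĉ_α̂^{β̂β}` together. -/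
def joinK {R : Type*} [AddCommGroup R] (C Ch : Fin 16 → Fin 16 → Fin 16 → R) :
    Spin → Spin → Spin → R
  | Sum.inl α, Sum.inr β', Sum.inl β => C α β β'
  | Sum.inr α, Sum.inl β, Sum.inr β' => Ch α β' β
  | Sum.inl _, Sum.inl _, _ => 0
  | Sum.inl _, Sum.inr _, Sum.inr _ => 0
  | Sum.inr _, Sum.inr _, _ => 0
  | Sum.inr _, Sum.inl _, Sum.inl _ => 0

/-- Both orders of the upper indices of `-S_{αα̂}^{ββ̂}`. -/
def joinS {R : Type*} [AddCommGroup R] (S : Fin 16 → Fin 16 → Fin 16 → Fin 16 → R) :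
    Spin → Spin → Spin → Spin → R
  | Sum.inl α, Sum.inr α', Sum.inl β, Sum.inr β' => -S α α' β β'
  | Sum.inl α, Sum.inr α', Sum.inr β', Sum.inl β => -S α α' β β'
  | Sum.inl _, Sum.inr _, Sum.inl _, Sum.inl _ => 0
  | Sum.inl _, Sum.inr _, Sum.inr _, Sum.inr _ => 0
  | Sum.inl _, Sum.inl _, _, _ => 0
  | Sum.inr _, _, _, _ => 0

theorem chir_inl_ne_inr (α β : Fin 16) : chir (Sum.inl α) ≠ chir (Sum.inr β) := by
  simp only [chir, ne_eq]; norm_num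

variable {R : Type*} [AddCommGroup R] [Module ℂ R] (p : ℕ → Submodule ℂ R)

theorem joinP_mem {P : Fin 16 → Fin 16 → R} {V : Submodule ℂ R} (h : ∀ α β, P α β ∈ V)
    (s t : Spin) : joinP P s t ∈ V := by
  rcases s with α | α <;> rcases t with β | β
  exacts [V.zero_mem, h α β, V.neg_mem (h β α), V.zero_mem]

theorem joinP_antisymm (P : Fin 16 → Fin 16 → R) (s t : Spin) : joinP P s t = -joinP P t s := by
  rcases s with α | α <;> rcases t with β | β <;> simp [joinP]

theorem joinP_chir (P : Fin 16 → Fin 16 → R) (s t : Spin) (h : chir s = chir t) :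
    joinP P s t = 0 := by
  rcases s with α | α <;> rcases t with β | β
  exacts [rfl, absurd h (chir_inl_ne_inr _ _), absurd h.symm (chir_inl_ne_inr _ _), rfl]

theorem joinK_mem {C Ch : Fin 16 → Fin 16 → Fin 16 → R} {V : Submodule ℂ R}
    (h : ∀ α β γ, C α β γ ∈ V) (h' : ∀ α β γ, Ch α β γ ∈ V) (t s g : Spin) :
    joinK C Ch t s g ∈ V := by
  rcases t with α | α <;> rcases s with β | β <;> rcases g with δ | δ
  exacts [V.zero_mem, V.zero_mem, h _ _ _, V.zero_mem, V.zero_mem, h' _ _ _, V.zero_mem, V.zero_mem]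

theorem joinK_chir (C Ch : Fin 16 → Fin 16 → Fin 16 → R) (t s g : Spin) (h : chir s = chir g) :
    joinK C Ch t s g = 0 := by
  rcases t with α | α <;> rcases s with β | β <;> rcases g with δ | δ <;>
    first | rfl | exact absurd h (chir_inl_ne_inr _ _) | exact absurd h.symm (chir_inl_ne_inr _ _)

theorem joinK_chir' (C Ch : Fin 16 → Fin 16 → Fin 16 → R) (t s g : Spin) (h : chir t ≠ chir g) :
    joinK C Ch t s g = 0 := by
  rcases t with α | α <;> rcases s with β | β <;> rcases g with δ | δ <;>
    first | rfl | exact absurd rfl h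

theorem joinS_mem {S : Fin 16 → Fin 16 → Fin 16 → Fin 16 → R} {V : Submodule ℂ R}
    (h : ∀ α β γ δ, S α β γ δ ∈ V) (t t' g g' : Spin) : joinS S t t' g g' ∈ V := by
  rcases t with α | α <;> rcases t' with α' | α' <;> rcases g with β | β <;> rcases g' with β' | β' <;>
    first | exact V.zero_mem | exact V.neg_mem (h _ _ _ _)

theorem joinS_symm (S : Fin 16 → Fin 16 → Fin 16 → Fin 16 → R) (t t' g g' : Spin) :
    joinS S t t' g g' = joinS S t t' g' g := by
  rcases t with α | α <;> rcases t' with α' | α' <;> rcases g with β | β <;> rcases g' with β' | β' <;>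
    rfl

theorem joinS_chir (S : Fin 16 → Fin 16 → Fin 16 → Fin 16 → R) (t t' g g' : Spin)
    (h : chir g = chir g') : joinS S t t' g g' = 0 := by
  rcases t with α | α <;> rcases t' with α' | α' <;> rcases g with β | β <;> rcases g' with β' | β' <;>
    first | rfl | exact absurd h (chir_inl_ne_inr _ _) | exact absurd h.symm (chir_inl_ne_inr _ _)

theorem joinS_chir' (S : Fin 16 → Fin 16 → Fin 16 → Fin 16 → R) (t t' g g' : Spin)
    (h : chir t = chir t') : joinS S t t' g g' = 0 := by
  rcases t with α | α <;> rcases t' with α' | α' <;> rcases g with β | β <;> rcases g' with β' | β' <;>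
    first | rfl | exact absurd h (chir_inl_ne_inr _ _)

end Fields

section

variable {R T : Type*} [Ring R] [Algebra ℂ R] [SuperCommAlgebra R]
    [Ring T] [Algebra ℂ T] [SuperCommAlgebra T]

theorem sum_spin {M : Type*} [AddCommMonoid M] (f : Spin → M) :
    ∑ s, f s = ∑ α, f (Sum.inl α) + ∑ α, f (Sum.inr α) := Fintype.sum_sum_type f

namespace Fields

variable (X : GhostExtension R T) (F : Fields R)

theorem metricUp_eq (M M' : Idx) : F.metricUp M M'
    = (∑ a, ∑ b, (sg (par M) * eta a b) • (F.E (vec a) M * F.E (vec b) M'))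
      + ∑ α, ∑ α', (F.E (spi α) M * F.E (hat α') M' * F.P (Sum.inl α) (Sum.inr α')
        - F.E (hat α') M * F.E (spi α) M' * F.P (Sum.inl α) (Sum.inr α')) := by
  have h1 : ∀ α β, F.P (Sum.inl α) (Sum.inl β) = 0 := fun α β => F.P_chir _ _ rfl
  have h2 : ∀ α β, F.P (Sum.inr α) (Sum.inr β) = 0 := fun α β => F.P_chir _ _ rfl
  have h3 : ∀ α β, F.P (Sum.inr α) (Sum.inl β) = -F.P (Sum.inl β) (Sum.inr α) :=
    fun α β => F.P_antisymm _ _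
  simp only [metricUp, sum_spin, h1, h2, h3, mul_zero, Finset.sum_const_zero, zero_add, add_zero,
    mul_neg, Finset.sum_neg_distrib, Finset.sum_sub_distrib]
  rw [Finset.sum_comm (f := fun x y => F.E (Sum.inr (Sum.inr x)) M * _ * _), ← sub_eq_add_neg]

theorem conn_inl (M : Idx) (β : Fin 16) : F.conn X M (Sum.inl β)
    = ∑ α, X.lam (Sum.inl α) * X.up (F.Om M (spi α) (spi β)) := by
  have h : ∀ α, F.Om M (hat α) (spi β) = 0 := fun α =>
    F.Om_chir M (Sum.inr α) (Sum.inl β) (chir_inl_ne_inr _ _).symm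
  simp only [conn, sum_spin, h, map_zero, mul_zero, Finset.sum_const_zero, add_zero]

theorem conn_inr (M : Idx) (β : Fin 16) : F.conn X M (Sum.inr β)
    = ∑ α, X.lam (Sum.inr α) * X.up (F.Om M (hat α) (hat β)) := by
  have h : ∀ α, F.Om M (spi α) (hat β) = 0 := fun α =>
    F.Om_chir M (Sum.inl α) (Sum.inr β) (chir_inl_ne_inr _ _)
  simp only [conn, sum_spin, h, map_zero, mul_zero, Finset.sum_const_zero, zero_add]

theorem lamK_inl (s : Spin) (β : Fin 16) : F.lamK X s (Sum.inl β)
    = ∑ α, X.lam (Sum.inl α) * X.up (F.K (Sum.inl α) s (Sum.inl β)) := by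
  have h : ∀ α, F.K (Sum.inr α) s (Sum.inl β) = 0 := fun α =>
    F.K_chir' _ _ _ (chir_inl_ne_inr _ _).symm
  simp only [lamK, sum_spin, h, map_zero, mul_zero, Finset.sum_const_zero, add_zero]

theorem lamK_inr (s : Spin) (β : Fin 16) : F.lamK X s (Sum.inr β)
    = ∑ α, X.lam (Sum.inr α) * X.up (F.K (Sum.inr α) s (Sum.inr β)) := by
  have h : ∀ α, F.K (Sum.inl α) s (Sum.inr β) = 0 := fun α =>
    F.K_chir' _ _ _ (chir_inl_ne_inr _ _)
  simp only [lamK, sum_spin, h, map_zero, mul_zero, Finset.sum_const_zero, zero_add]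

theorem lamK_chir (s g : Spin) (h : chir s = chir g) : F.lamK X s g = 0 := by
  simp only [lamK, F.K_chir _ s g h, map_zero, mul_zero, Finset.sum_const_zero]

theorem lamS_chir (g g' : Spin) (h : chir g = chir g') : F.lamS X g g' = 0 := by
  simp only [lamS, F.S_chir _ _ g g' h, map_zero, mul_zero, Finset.sum_const_zero]

/-- Only one order of the lower labels is populated in `joinS`, so the sum over both ghosts counts
each product $\lambda\hat\lambda$ once and no factor $1/2$ appears. -/
theorem lamS_inl_inr {S : Fin 16 → Fin 16 → Fin 16 → Fin 16 → R} (hS : F.S = joinS S)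
    (β β' : Fin 16) : F.lamS X (Sum.inl β) (Sum.inr β')
      = -∑ α, ∑ α', X.lam (Sum.inl α) * X.lam (Sum.inr α') * X.up (S α α' β β') := by
  simp only [lamS, sum_spin, hS, joinS, map_zero, mul_zero, Finset.sum_const_zero, zero_add,
    add_zero, map_neg, mul_neg, Finset.sum_neg_distrib]

theorem sum_lamK_inl (f : Spin → T) (β : Fin 16) : ∑ s, F.lamK X s (Sum.inl β) * f s
    = ∑ α, F.lamK X (Sum.inr α) (Sum.inl β) * f (Sum.inr α) := by
  have h : ∀ α, F.lamK X (Sum.inl α) (Sum.inl β) = 0 := fun α => F.lamK_chir X _ _ rfl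
  simp only [sum_spin, h, zero_mul, Finset.sum_const_zero, zero_add]

theorem sum_lamK_inr (f : Spin → T) (β : Fin 16) : ∑ s, F.lamK X s (Sum.inr β) * f s
    = ∑ α, F.lamK X (Sum.inl α) (Sum.inr β) * f (Sum.inl α) := by
  have h : ∀ α, F.lamK X (Sum.inr α) (Sum.inr β) = 0 := fun α => F.lamK_chir X _ _ rfl
  simp only [sum_spin, h, zero_mul, Finset.sum_const_zero, add_zero]

theorem metricUU_gh_mat (M : Idx) (g : Spin) : F.metricUU X (Sum.inr g) (mat M)
    = sg (par M) • F.metricUU X (mat M) (Sum.inr g) := by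
  nth_rewrite 1 [← tuu_metricUU]
  simp [tuu]

theorem metricUU_gh_swap (g g' : Spin) : F.metricUU X (Sum.inr g) (Sum.inr g')
    = F.metricUU X (Sum.inr g') (Sum.inr g) := by
  nth_rewrite 1 [← tuu_metricUU]
  simp [tuu]

theorem metricUU_mat_inl (M : Idx) (β : Fin 16) : F.metricUU X (mat M) (gh β)
    = -(∑ M', X.up (F.metricUp M M') * F.conn X M' (Sum.inl β))
      - sg (par M) • ∑ α, F.lamK X (Sum.inr α) (Sum.inl β) * X.up (F.E (hat α) M) := by
  rw [metricUU_mat_gh, sum_lamK_inl]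

theorem metricUU_mat_inr (M : Idx) (β : Fin 16) : F.metricUU X (mat M) (ghh β)
    = -(∑ M', X.up (F.metricUp M M') * F.conn X M' (Sum.inr β))
      - sg (par M) • ∑ α, F.lamK X (Sum.inl α) (Sum.inr β) * X.up (F.E (spi α) M) := by
  rw [metricUU_mat_gh, sum_lamK_inr]

theorem metricUU_inl_inl (α β : Fin 16) : F.metricUU X (gh α) (gh β)
    = (∑ M, ∑ M', F.conn X M (Sum.inl α) * X.up (F.metricUp M M') * F.conn X M' (Sum.inl β))
      + (∑ δ, ∑ M, F.lamK X (Sum.inr δ) (Sum.inl α) * X.up (F.E (hat δ) M)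
        * F.conn X M (Sum.inl β))
      + ∑ δ, ∑ M, F.lamK X (Sum.inr δ) (Sum.inl β) * X.up (F.E (hat δ) M)
        * F.conn X M (Sum.inl α) := by
  simp only [metricUU_gh_gh, mul_assoc, ← Finset.mul_sum, sum_lamK_inl]
  rw [F.lamS_chir X (Sum.inl α) (Sum.inl β) rfl, add_zero]

theorem metricUU_inr_inr (α β : Fin 16) : F.metricUU X (ghh α) (ghh β)
    = (∑ M, ∑ M', F.conn X M (Sum.inr α) * X.up (F.metricUp M M') * F.conn X M' (Sum.inr β))
      + (∑ δ, ∑ M, F.lamK X (Sum.inl δ) (Sum.inr α) * X.up (F.E (spi δ) M)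
        * F.conn X M (Sum.inr β))
      + ∑ δ, ∑ M, F.lamK X (Sum.inl δ) (Sum.inr β) * X.up (F.E (spi δ) M)
        * F.conn X M (Sum.inr α) := by
  simp only [metricUU_gh_gh, mul_assoc, ← Finset.mul_sum, sum_lamK_inr]
  rw [F.lamS_chir X (Sum.inr α) (Sum.inr β) rfl, add_zero]

theorem metricUU_inl_inr {S : Fin 16 → Fin 16 → Fin 16 → Fin 16 → R} (hS : F.S = joinS S)
    (α β : Fin 16) : F.metricUU X (gh α) (ghh β)
    = (∑ M, ∑ M', F.conn X M (Sum.inl α) * X.up (F.metricUp M M') * F.conn X M' (Sum.inr β))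
      + (∑ δ, ∑ M, F.lamK X (Sum.inr δ) (Sum.inl α) * X.up (F.E (hat δ) M)
        * F.conn X M (Sum.inr β))
      + (∑ δ, ∑ M, F.lamK X (Sum.inl δ) (Sum.inr β) * X.up (F.E (spi δ) M)
        * F.conn X M (Sum.inl α))
      - ∑ δ, ∑ δ', X.lam (Sum.inl δ) * X.lam (Sum.inr δ') * X.up (S δ δ' α β) := by
  simp only [metricUU_gh_gh, mul_assoc, ← Finset.mul_sum, sum_lamK_inr, sum_lamK_inl,
    F.lamS_inl_inr X hS]
  exact (sub_eq_add_neg _ _).symm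

end Fields
end

namespace Background

variable (bg : Background U N)

/-- The background fields with the two kinds of spinor labels combined. -/
def fields : Fields (Matter U N) where
  E := bg.E
  Einv := bg.Einv
  B := bg.B
  Om := bg.Omfull
  P := Fields.joinP bg.P
  K := Fields.joinK bg.C bg.Ch
  S := Fields.joinS bg.S
  E_deg := bg.E_parity
  Einv_deg := bg.Einv_parity
  E_mul_Einv := bg.E_mul_Einv
  Einv_mul_E := bg.Einv_mul_E
  B_deg := bg.B_parity
  B_antisymm := bg.B_antisymm
  Om_deg M A B := by
    rcases A with a | α | α <;> rcases B with b | β | β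
    case inr.inl.inr.inl =>
      exact deg_le (by simp [Nat.even_add, parity_simps]) (bg.Om_parity M α β)
    case inr.inr.inr.inr =>
      exact deg_le (by simp [Nat.even_add, parity_simps]) (bg.Omh_parity M α β)
    all_goals exact Submodule.zero_mem _
  Om_vec_left M a B := by rcases B with b | β | β <;> rfl
  Om_vec_right M A b := by rcases A with a | α | α <;> rfl
  Om_chir M s t h := by
    rcases s with α | α <;> rcases t with β | β
    exacts [absurd rfl h, rfl, rfl, absurd rfl h]
  P_deg := Fields.joinP_mem bg.P_parity
  P_antisymm := Fields.joinP_antisymm bg.P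
  P_chir := Fields.joinP_chir bg.P
  K_deg := Fields.joinK_mem bg.C_parity bg.Ch_parity
  K_chir := Fields.joinK_chir bg.C bg.Ch
  K_chir' := Fields.joinK_chir' bg.C bg.Ch
  S_deg := Fields.joinS_mem bg.S_parity
  S_symm := Fields.joinS_symm bg.S
  S_chir := Fields.joinS_chir bg.S
  S_chir' := Fields.joinS_chir' bg.S

local notation "X" => ghostExtension U N

theorem metricUp_fields (M M' : Idx) : bg.fields.metricUp M M' = bg.Amat M M' :=
  bg.fields.metricUp_eq M M'

theorem conn_inl (M : Idx) (β : Fin 16) : bg.fields.conn X M (Sum.inl β) = bg.lOm M β :=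
  bg.fields.conn_inl X M β

theorem conn_inr (M : Idx) (β : Fin 16) : bg.fields.conn X M (Sum.inr β) = bg.lOmh M β :=
  bg.fields.conn_inr X M β

theorem lamK_inl (β α : Fin 16) :
    bg.fields.lamK X (Sum.inr α) (Sum.inl β) = bg.lC β α :=
  bg.fields.lamK_inl X _ β

theorem lamK_inr (β α : Fin 16) :
    bg.fields.lamK X (Sum.inl α) (Sum.inr β) = bg.lCh β α :=
  bg.fields.lamK_inr X _ β

theorem metricUU_mat_inl (M : Idx) (β : Fin 16) :
    bg.fields.metricUU X (mat M) (gh β) = bg.uuMgh M β := by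
  rw [Fields.metricUU_mat_inl]
  simp only [metricUp_fields, conn_inl, lamK_inl]
  rfl

theorem metricUU_mat_inr (M : Idx) (β : Fin 16) :
    bg.fields.metricUU X (mat M) (ghh β) = bg.uuMghh M β := by
  rw [Fields.metricUU_mat_inr]
  simp only [metricUp_fields, conn_inr, lamK_inr]
  rfl

theorem metricUU_inl_inr (α β : Fin 16) :
    bg.fields.metricUU X (gh α) (ghh β) = bg.uuGhGhh α β := by
  rw [bg.fields.metricUU_inl_inr X rfl]
  simp only [metricUp_fields, conn_inl, conn_inr, lamK_inl, lamK_inr]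
  rfl

/-- The prescribed upper block is a congruence of the flat one by the frame of horizontal lifts. All
connection-dependent terms in its definition come from this congruence. -/
theorem uu_eq : Matrix.of bg.uu = bg.fields.metricUU X := by
  ext i j
  rw [Matrix.of_apply]
  rcases i with M | α | α <;> rcases j with M' | β | β
  · rw [Fields.metricUU_mat_mat, metricUp_fields]
    rfl
  · rw [metricUU_mat_inl]
    rfl
  · rw [metricUU_mat_inr]
    rfl
  · rw [Fields.metricUU_gh_mat, metricUU_mat_inl]
    rfl
  · rw [Fields.metricUU_inl_inl]
    simp only [metricUp_fields, conn_inl, lamK_inl]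
    rfl
  · rw [metricUU_inl_inr]
    rfl
  · rw [Fields.metricUU_gh_mat, metricUU_mat_inr]
    rfl
  · rw [Fields.metricUU_gh_swap, metricUU_inl_inr]
    rfl
  · rw [Fields.metricUU_inr_inr]
    simp only [metricUp_fields, conn_inr, lamK_inr]
    rfl

end Background
end

/-! ### The full generalized metric including the two-form -/

section

variable {R T : Type*} [Ring R] [Algebra ℂ R] [SuperCommAlgebra R]
    [Ring T] [Algebra ℂ T] [SuperCommAlgebra T]

namespace Fields

variable (X : GhostExtension R T) (F : Fields R)

/-- The matrix `𝔸_i^j`. -/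
def fullDU : Matrix Coord Coord T := F.metricDU X - F.Bmat X * F.metricUU X

/-- The matrix `𝔸_{ij}`. -/
def fullDD : Matrix Coord Coord T := F.metricDD X - F.Bmat X * F.metricUU X * F.Bmat X
  + F.metricDU X * F.Bmat X - F.Bmat X * st0 cpar (F.metricDU X)

/-- The matrix `𝔸_M^N`. -/
def matterDU (M M' : Idx) : R := F.metricProj M M' - ∑ Q, F.B M Q * F.metricUp Q M'

theorem up_B_swap (M Q : Idx) : X.up (F.B M Q) = -(sg (par M * par Q) • X.up (F.B Q M)) := by
  rw [F.B_antisymm M Q, map_neg, map_smul]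

/-- Graded antisymmetry reverses the labels of `B`, and moving it past the odd coefficient absorbs
the index sign. This gives the ordering used in the definition of the mixed blocks. -/
theorem B_mul_lamK (M Q : Idx) (s g : Spin) :
    X.up (F.B M Q) * (sg (par Q) • (F.lamK X s g * X.up (F.E (Sum.inr s) Q)))
      = -(F.lamK X s g * X.up (F.E (Sum.inr s) Q) * X.up (F.B Q M)) := by
  rw [up_B_swap, mul_smul_comm, neg_mul, smul_mul_assoc,
    comm (X.up_deg (F.B_deg Q M)) (mul_mem (F.lamK_deg X s g) (X.up_deg (F.E_deg (Sum.inr s) Q))),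
    par_inr, smul_neg, smul_smul, smul_smul, sg_mul, sg_mul, sg_congr (n := 0)]
  simp

theorem metricProj_deg (M M' : Idx) : F.metricProj M M' ∈ deg (par M + par M') :=
  Submodule.sum_mem _ fun s _ => Submodule.smul_mem _ _
    (deg_of (mul_mem (F.Einv_deg M _) (F.E_deg _ M')) (by
      simp only [Nat.even_add, par_inr]
      by_cases hM : Even (par M) <;> by_cases hQ : Even (par M') <;>
        simp [hM, hQ, -Nat.not_even_iff_odd]))

theorem B_mul_metricProj (M Q M' : Idx) :
    X.up (F.B M Q) * (sg (par Q + par Q * par M') • X.up (F.metricProj M' Q))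
      = -(sg (par M * par M') • (X.up (F.metricProj M' Q) * X.up (F.B Q M))) := by
  rw [up_B_swap, mul_smul_comm, neg_mul, smul_mul_assoc,
    comm (X.up_deg (F.B_deg Q M)) (X.up_deg (F.metricProj_deg M' Q)), smul_neg, smul_smul,
    smul_smul, sg_mul, sg_mul]
  congr 2
  refine sg_congr ?_
  simp only [Nat.even_add, Nat.even_mul]
  by_cases hM : Even (par M) <;> by_cases hQ : Even (par Q) <;> by_cases hM' : Even (par M') <;>
    simp [hM, hQ, hM', -Nat.not_even_iff_odd]

theorem fullDU_mat_mat (M M' : Idx) : F.fullDU X (mat M) (mat M') = X.up (F.matterDU M M') := by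
  rw [fullDU, Matrix.sub_apply, Matrix.mul_apply, sum_coord]
  simp only [Bmat_mat_mat, Bmat_mat_gh, metricUU_mat_mat, zero_mul,
    Finset.sum_const_zero, add_zero, metricDU_mat_mat, matterDU, map_sub, map_sum, map_mul]

theorem fullDU_mat_gh (M : Idx) (g : Spin) : F.fullDU X (mat M) (Sum.inr g)
    = chir g • F.conn X M g - (∑ M', X.up (F.matterDU M M') * F.conn X M' g)
      - ∑ s, F.lamK X s g * ∑ Q, X.up (F.E (Sum.inr s) Q) * X.up (F.B Q M) := by
  rw [fullDU, Matrix.sub_apply, metricDU_mat_gh, Matrix.mul_apply, sum_coord]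
  have h1 : ∑ Q, X.up (F.B M Q) * (sg (par Q) • ∑ s, F.lamK X s g * X.up (F.E (Sum.inr s) Q))
      = -∑ s, F.lamK X s g * ∑ Q, X.up (F.E (Sum.inr s) Q) * X.up (F.B Q M) := by
    simp only [Finset.smul_sum, Finset.mul_sum, B_mul_lamK, Finset.sum_neg_distrib, mul_assoc]
    rw [Finset.sum_comm]
  have h2 : ∑ Q, X.up (F.B M Q) * ∑ M', X.up (F.metricUp Q M') * F.conn X M' g
      = ∑ M', (∑ Q, X.up (F.B M Q) * X.up (F.metricUp Q M')) * F.conn X M' g := by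
    simp only [Finset.mul_sum, Finset.sum_mul, mul_assoc]
    rw [Finset.sum_comm]
  simp only [Bmat_mat_mat, Bmat_mat_gh, zero_mul, Finset.sum_const_zero, add_zero,
    metricUU_mat_gh, matterDU, map_sub, map_sum, map_mul, sub_mul, mul_sub, mul_neg,
    Finset.sum_sub_distrib, Finset.sum_neg_distrib, h1, h2]
  abel

theorem fullDU_gh_mat (g : Spin) (M : Idx) : F.fullDU X (Sum.inr g) (mat M) = 0 := by
  simp [fullDU, Matrix.mul_apply, metricDU_gh_mat, -Fintype.sum_sum_type]

theorem fullDU_gh_gh (g g' : Spin) : F.fullDU X (Sum.inr g) (Sum.inr g')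
    = if g = g' then algebraMap ℂ T (chir g) else 0 := by
  simp [fullDU, Matrix.mul_apply, metricDU_gh_gh, -Fintype.sum_sum_type]

theorem fullDD_mat_mat (M M' : Idx) : F.fullDD X (mat M) (mat M')
    = X.up (F.metricG M M' - (∑ L, ∑ Q, F.B M L * F.metricUp L Q * F.B Q M')
      + (∑ Q, F.metricProj M Q * F.B Q M')
      + sg (par M * par M') • ∑ Q, F.metricProj M' Q * F.B Q M) := by
  simp only [fullDD, Matrix.sub_apply, Matrix.add_apply, Matrix.mul_apply, sum_coord, Bmat_gh,
    Bmat_mat_gh, Bmat_mat_mat, metricUU_mat_mat, zero_mul, mul_zero, Finset.sum_const_zero,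
    add_zero, st0, Matrix.of_apply, metricDU_mat_mat, metricDD_mat_mat, cpar_mat,
    B_mul_metricProj, Finset.sum_neg_distrib, sub_neg_eq_add, map_add, map_sub, map_sum, map_mul,
    map_smul, Finset.smul_sum, Finset.sum_mul]
  rw [Finset.sum_comm]

theorem fullDD_mat_gh (M : Idx) (g : Spin) : F.fullDD X (mat M) (Sum.inr g) = 0 := by
  have hB : ∀ i j, F.Bmat X i (Sum.inr j) = 0 := fun i j => by
    rcases i with M | g <;> rfl
  simp [-Fintype.sum_sum_type, fullDD, Matrix.mul_apply, sum_coord, hB, metricDD_mat_gh,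
    metricDU_gh_mat, st0]

theorem fullDD_gh (g : Spin) (j : Coord) : F.fullDD X (Sum.inr g) j = 0 := by
  simp [-Fintype.sum_sum_type, fullDD, Matrix.mul_apply, sum_coord, metricDD_gh, metricDU_gh_mat]

theorem metricProj_eq (M M' : Idx) : F.metricProj M M'
    = (∑ α, F.Einv M (spi α) * F.E (spi α) M') - ∑ α, F.Einv M (hat α) * F.E (hat α) M' := by
  simp [metricProj, sum_spin, chir, sub_eq_add_neg, -Fintype.sum_sum_type]

theorem matterDU_eq (M M' : Idx) : F.matterDU M M'
    = -(∑ Q, F.B M Q * F.metricUp Q M') - (∑ α, F.Einv M (hat α) * F.E (hat α) M')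
      + ∑ α, F.Einv M (spi α) * F.E (spi α) M' := by
  rw [matterDU, metricProj_eq]
  abel

theorem sum_metricProj_mul_B (M M' : Idx) : ∑ Q, F.metricProj M Q * F.B Q M'
    = (∑ α, ∑ Q, F.Einv M (spi α) * F.E (spi α) Q * F.B Q M')
      - ∑ α, ∑ Q, F.Einv M (hat α) * F.E (hat α) Q * F.B Q M' := by
  simp only [metricProj_eq, sub_mul, Finset.sum_sub_distrib, Finset.sum_mul]
  congr 1 <;> exact Finset.sum_comm

theorem fullDD_mat_mat_eq (M M' : Idx) : F.fullDD X (mat M) (mat M')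
    = X.up (F.metricG M M' - (∑ L, ∑ Q, F.B M L * F.metricUp L Q * F.B Q M')
      - ((∑ α, ∑ Q, F.Einv M (hat α) * F.E (hat α) Q * F.B Q M') + sg (par M * par M')
        • ∑ α, ∑ Q, F.Einv M' (hat α) * F.E (hat α) Q * F.B Q M)
      + ((∑ α, ∑ Q, F.Einv M (spi α) * F.E (spi α) Q * F.B Q M') + sg (par M * par M')
        • ∑ α, ∑ Q, F.Einv M' (spi α) * F.E (spi α) Q * F.B Q M)) := by
  rw [fullDD_mat_mat, sum_metricProj_mul_B, sum_metricProj_mul_B, smul_sub]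
  congr 1
  abel

theorem fullDU_mat_inl (M : Idx) (β : Fin 16) : F.fullDU X (mat M) (gh β)
    = (∑ M', ((if M = M' then 1 else 0) - X.up (F.matterDU M M')) * F.conn X M' (Sum.inl β))
      - ∑ α, ∑ Q, F.lamK X (Sum.inr α) (Sum.inl β) * X.up (F.E (hat α) Q) * X.up (F.B Q M) := by
  rw [fullDU_mat_gh, sum_lamK_inl]
  simp only [mul_assoc, Finset.mul_sum, sub_mul, ite_mul, one_mul, zero_mul,
    Finset.sum_sub_distrib, Finset.sum_ite_eq, Finset.mem_univ, if_true, chir, one_smul]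

theorem fullDU_mat_inr (M : Idx) (β : Fin 16) : F.fullDU X (mat M) (ghh β)
    = -(∑ M', ((if M = M' then 1 else 0) + X.up (F.matterDU M M')) * F.conn X M' (Sum.inr β))
      - ∑ α, ∑ Q, F.lamK X (Sum.inl α) (Sum.inr β) * X.up (F.E (spi α) Q) * X.up (F.B Q M) := by
  rw [fullDU_mat_gh, sum_lamK_inr]
  simp only [mul_assoc, Finset.mul_sum, add_mul, ite_mul, one_mul, zero_mul, neg_smul, neg_add,
    Finset.sum_add_distrib, Finset.sum_ite_eq, Finset.mem_univ, if_true, chir, one_smul]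
  abel

end Fields
end

section

variable {U : TopologicalSpace.Opens Body} {N : ℕ}

namespace Background

variable (bg : Background U N)

local notation "X" => ghostExtension U N

theorem matterDU_fields (M M' : Idx) : bg.fields.matterDU M M' = bg.Adu M M' := by
  rw [Fields.matterDU_eq]
  simp only [metricUp_fields]
  rfl

theorem dd_mat_mat (M M' : Idx) : bg.fields.fullDD X (mat M) (mat M') = up (bg.Add M M') := by
  rw [Fields.fullDD_mat_mat_eq]
  simp only [metricUp_fields]
  rfl

theorem dd_eq : Matrix.of bg.dd = bg.fields.fullDD X := by
  ext i j
  rw [Matrix.of_apply]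
  rcases i with M | g
  · rcases j with M' | g'
    · exact (bg.dd_mat_mat M M').symm
    · rw [Fields.fullDD_mat_gh]
      rfl
  · rw [Fields.fullDD_gh]
    rfl

theorem du_gh_gh (g g' : Spin) : bg.du (Sum.inr g) (Sum.inr g')
    = if g = g' then algebraMap ℂ (Target U N) (chir g) else 0 := by
  rcases g with α | α <;> rcases g' with β | β
  · change (if α = β then (1 : Target U N) else 0) = _
    simp only [Sum.inl.injEq, chir, map_one]
  · simp only [reduceCtorEq, if_false]
    rfl
  · simp only [reduceCtorEq, if_false]
    rfl
  · change (if α = β then (-1 : Target U N) else 0) = _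
    simp only [Sum.inr.injEq, chir, map_one, map_neg]

theorem du_eq : Matrix.of bg.du = bg.fields.fullDU X := by
  ext i j
  rw [Matrix.of_apply]
  rcases i with M | g
  · rcases j with M' | β | β
    · rw [Fields.fullDU_mat_mat, matterDU_fields]
      rfl
    · rw [Fields.fullDU_mat_inl]
      simp only [matterDU_fields, conn_inl, lamK_inl]
      rfl
    · rw [Fields.fullDU_mat_inr]
      simp only [matterDU_fields, conn_inr, lamK_inr]
      rfl
  · rcases j with M' | g'
    · rw [Fields.fullDU_gh_mat]
      rcases g with α | α <;> rfl
    · rw [Fields.fullDU_gh_gh, du_gh_gh]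

end Background
end

/-! ### Conservation and commutation in terms of flat data -/

section

variable {R T : Type*} [Ring R] [Algebra ℂ R] [SuperCommAlgebra R]
    [Ring T] [Algebra ℂ T] [SuperCommAlgebra T]

namespace Fields

variable (X : GhostExtension R T) (F : Fields R) (χ χ' l : Spin → ℂ)

theorem fullDU_isHom : IsHom cpar 0 (F.fullDU X) :=
  (F.metricDU_isHom X).sub ((F.Bmat_isHom X).mul (F.metricUU_isHom X))

theorem fullDD_isHom : IsHom cpar 0 (F.fullDD X) :=
  (((F.metricDD_isHom X).sub (((F.Bmat_isHom X).mul (F.metricUU_isHom X)).mul (F.Bmat_isHom X))).add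
    ((F.metricDU_isHom X).mul (F.Bmat_isHom X))).sub
      ((F.Bmat_isHom X).mul (F.metricDU_isHom X).st0)

theorem tdd_metricDD : tdd cpar (F.metricDD X) = F.metricDD X := by
  rw [metricDD, tdd_mul_dd_ud ((F.coframe_isHom X).mul flatDD_isHom) (F.coframe_isHom X).st0,
    st1_st0, tdd_mul_du_dd (F.coframe_isHom X) flatDD_isHom, tdd_flatDD, mul_assoc]

theorem tdd_fullDD : tdd cpar (F.fullDD X) = F.fullDD X :=
  tdd_twist (F.metricDU_isHom X) (F.metricUU_isHom X) (F.tuu_metricUU X) (F.Bmat_isHom X)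
    (F.tdd_Bmat X) (F.tdd_metricDD X)

theorem map_sg_smul_eq_zero {S : Type*} [Ring S] [Algebra ℂ S] (φ : T →ₐ[ℂ] S) (p : Coord → ℕ)
    (Y : Matrix Coord Coord T) : (∀ i j, φ (sg (p i) • Y i j) = 0) ↔ Y.map φ = 0 := by
  rw [← Matrix.ext_iff]
  refine forall_congr' fun i => forall_congr' fun j => ?_
  rw [map_smul, Matrix.map_apply, Matrix.zero_apply, smul_eq_zero_iff_right (by simp)]

/-- The one-form `ι_V B`. -/
def brstForm : Coord → T := lower (F.Bmat X) (F.brstVec X χ)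

/-- The conservation conditions in terms of flat components. -/
theorem conserved_iff (hχ : ∀ M s t,
      χ s • F.Om M (Sum.inr s) (Sum.inr t) = χ t • F.Om M (Sum.inr s) (Sum.inr t)) :
    ((∀ i j, X.ev l ((∑ k, (F.brstVec X χ k * X.pd k (F.fullDD X i j)
          + sg (1 * cpar i) • (X.pd i (F.brstVec X χ k) * F.fullDD X k j)
          + sg (cpar i * cpar j + 1 * cpar j) • (X.pd j (F.brstVec X χ k) * F.fullDD X k i)))
        + ∑ k, (extDeriv cpar X.pd (F.brstForm X χ) i k
            * sg (cpar k + cpar k * cpar j) • F.fullDU X j k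
          + sg (cpar i * cpar j) • (extDeriv cpar X.pd (F.brstForm X χ) j k
            * sg (cpar k + cpar k * cpar i) • F.fullDU X i k))) = 0) ∧
      (∀ i j, X.ev l ((∑ k, (F.brstVec X χ k * X.pd k (F.fullDU X i j)
          - sg (1 * cpar i) • (F.fullDU X i k * X.pd k (F.brstVec X χ j))
          + sg (1 * cpar i) • (X.pd i (F.brstVec X χ k) * F.fullDU X k j)))
        + ∑ k, extDeriv cpar X.pd (F.brstForm X χ) i k * F.metricUU X k j) = 0) ∧
      ∀ i j, X.ev l (∑ k, (F.brstVec X χ k * X.pd k (F.metricUU X i j)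
          - sg (1 * cpar i) • (F.metricUU X i k * X.pd k (F.brstVec X χ j))
          - sg (cpar i + cpar j + cpar i * cpar j + 1 * cpar j)
            • (F.metricUU X j k * X.pd k (F.brstVec X χ i)))) = 0) ↔
    F.FlatConserved X χ l := by
  have hV := F.brstVec_deg X χ
  have hF : ∀ i, F.brstForm X χ i ∈ deg (cpar i + 1) := lower_deg hV (F.Bmat_isHom X)
  have h1 := consDD_coord X.pd_derivs hV (F.fullDD_isHom X) (F.tdd_fullDD X) (F.fullDU_isHom X)
    (extDeriv_isHom X.pd_derivs hF) (tdd_extDeriv (p := cpar) (pd := X.pd) (F.brstForm X χ))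
  have h2 := consDU_coord (p := cpar) (pd := X.pd) (V := F.brstVec X χ) (a := F.fullDU X)
    (u := F.metricUU X) (Φ := extDeriv cpar X.pd (F.brstForm X χ))
  have h3 := consUU_coord X.pd_derivs hV (F.metricUU_isHom X) (F.tuu_metricUU X)
  -- The row signs relating coordinate and matrix conditions are invertible and drop out of the
  -- vanishing statements.
  simp only [h1, h2, h3, map_sg_smul_eq_zero]
  exact (F.cons_iff_flat X χ hχ (X.ev l) rfl rfl
    (extDeriv_lower X.pd_derivs hV (F.Bmat_isHom X) (F.tdd_Bmat X)) rfl rfl rfl rfl).trans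
    (F.flatConserved_iff X χ l hχ)

/-- The components of the bracket of two of the vector fields. -/
def lieVec (i : Coord) : T := act X.pd (F.brstVec X χ) (F.brstVec X χ' i)
  + act X.pd (F.brstVec X χ') (F.brstVec X χ i)

/-- The double contraction of the field strength. -/
def fluxVec (k : Coord) : T := ∑ i, F.brstVec X χ' i * F.flux X χ i k

theorem lieBracket_eq (i : Coord) :
    ∑ j, (F.brstVec X χ j * X.pd j (F.brstVec X χ' i)
      - sg (1 * 1) • (F.brstVec X χ' j * X.pd j (F.brstVec X χ i))) = F.lieVec X χ χ' i := by
  simp only [lieVec, act_apply, ← Finset.sum_add_distrib,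
    show sg (1 * 1) = -1 from pow_one _, neg_smul, one_smul,
    sub_neg_eq_add]

theorem dorfman_form_eq (i : Coord) :
    (∑ j, (F.brstVec X χ j * X.pd j (F.brstForm X χ' i)
        + sg (1 * cpar i + 1 * (cpar i + cpar j)) • (X.pd i (F.brstVec X χ j) * F.brstForm X χ' j)))
      - sg (1 * 1) • ∑ k, sg (1 * cpar k)
        • (F.brstVec X χ' k * extDeriv cpar X.pd (F.brstForm X χ) k i)
      = ∑ k, F.lieVec X χ χ' k * F.Bmat X k i + F.fluxVec X χ χ' i := by
  have h := dorfman_form X.pd_derivs (F.brstVec_deg X χ) (F.brstVec_deg X χ') (F.Bmat_isHom X)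
    (F.tdd_Bmat X) i
  rw [show sg (1 * 1) = -1 from pow_one _, neg_smul, one_smul, sub_neg_eq_add]
  exact h

theorem pairing_eq : ∑ i, sg (1 * cpar i) • (F.brstVec X χ i * F.brstForm X χ' i)
    + sg (1 * 1) • ∑ i, sg (1 * cpar i) • (F.brstVec X χ' i * F.brstForm X χ i) = 0 := by
  rw [show sg (1 * 1) = -1 from pow_one _, neg_smul, one_smul, ← sub_eq_add_neg]
  exact pairing_lower (F.brstVec_deg X χ) (F.brstVec_deg X χ') (F.tdd_Bmat X)

/-- The inner contraction is, up to sign, a row of the flux matrix, and contractions with two odd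
vector fields may be interchanged. The outer minus sign is the one built into `fluxMat`. -/
theorem contract_contract_eq (k : Coord) :
    ∑ i, sg (1 * cpar i) • (F.brstVec X χ i
      * ∑ j, sg (0 * cpar j) • (F.brstVec X χ' j * F.targetH X j i k)) = -F.fluxVec X χ χ' k := by
  rw [fluxVec, flux, contract_contract (F.brstVec_deg X χ') (F.brstVec_deg X χ)
    (F.targetH_swap_left X), ← Finset.sum_neg_distrib]
  refine Finset.sum_congr rfl fun i _ => ?_
  simp only [fluxMat, Matrix.of_apply, mul_neg, neg_neg, mul_smul_comm, zero_mul, pow_zero,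
    one_smul, one_mul]

/-- Once the bracket vanishes its contraction with `B` does too, so the form part of the Dorfman
bracket retains only the flux. -/
theorem commute_iff :
    ((∀ i, X.ev l (F.lieVec X χ χ' i) = 0) ∧
      ∀ i, X.ev l (∑ k, F.lieVec X χ χ' k * F.Bmat X k i + F.fluxVec X χ χ' i) = 0) ↔
    (∀ i, X.ev l (F.lieVec X χ χ' i) = 0) ∧ ∀ i, X.ev l (-F.fluxVec X χ χ' i) = 0 := by
  refine and_congr_right fun h => forall_congr' fun i => ?_
  simp only [map_add, map_sum, map_mul, h, zero_mul, Finset.sum_const_zero, zero_add, map_neg,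
    neg_eq_zero]

end Fields

/-- The orientation of the BRST current of `λ`. -/
def leftOrientation : Orientation where
  perm := Equiv.refl _
  sgn := 1
  sgn_sq := one_mul 1
  chir_inl _ := rfl
  chir_inr _ := rfl

theorem leftOrientation_ind_inl (α : Fin 16) : leftOrientation.ind (Sum.inl α) = 1 :=
  leftOrientation.ind_own α

theorem leftOrientation_ind_inr (α : Fin 16) : leftOrientation.ind (Sum.inr α) = 0 :=
  leftOrientation.ind_opp α

theorem leftOrientation_swap_ind_inl (α : Fin 16) : leftOrientation.swap.ind (Sum.inl α) = 0 :=
  leftOrientation.swap.ind_opp α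

theorem leftOrientation_swap_ind_inr (α : Fin 16) : leftOrientation.swap.ind (Sum.inr α) = 1 :=
  leftOrientation.swap.ind_own α

namespace Fields

variable (X : GhostExtension R T) (F : Fields R)

theorem brstVec_left (M : Idx) : F.brstVec X leftOrientation.ind (mat M)
    = ∑ α, X.lam (Sum.inl α) * X.up (F.E (spi α) M) := by
  simp only [brstVec, sum_spin, leftOrientation_ind_inl, leftOrientation_ind_inr, one_smul,
    zero_smul, Finset.sum_const_zero, add_zero, frame_mat_mat]

theorem brstVec_right (M : Idx) : F.brstVec X leftOrientation.swap.ind (mat M)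
    = ∑ α, X.lam (Sum.inr α) * X.up (F.E (hat α) M) := by
  simp only [brstVec, sum_spin, leftOrientation_swap_ind_inl, leftOrientation_swap_ind_inr,
    one_smul, zero_smul, Finset.sum_const_zero, zero_add, frame_mat_mat]

theorem brstForm_eq (χ : Spin → ℂ) (j : Coord) : F.brstForm X χ j
    = ∑ i, sg (0 * cpar i) • (F.brstVec X χ i * F.Bmat X i j) := by
  simp only [brstForm, lower, zero_mul, pow_zero, one_smul]

end Fields
end

/-! ### The BRST sections as instances of the general construction -/

section

variable {U : TopologicalSpace.Opens Body} {N : ℕ}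

namespace Background

variable (bg : Background U N) (γ γh : GammaMatrices)

local notation "X" => ghostExtension U N

/-- The section with vector part `χ_s λ^s e_s` and form part `ι_V B`. -/
def brstSection (χ : Spin → ℂ) : GenSection U N where
  V := bg.fields.brstVec X χ
  F := bg.fields.brstForm X χ

theorem Bmat_fields : bg.fields.Bmat X = bg.Btarget := by
  funext i j
  rcases i with M | g <;> rcases j with M' | g' <;> rfl

theorem targetH_fields : bg.fields.targetH X = bg.Htarget := by
  funext i j k
  rcases i with M | g
  · rcases j with M' | g'
    · rcases k with M'' | g''
      · exact bg.fields.targetH_mat X M M' M''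
      · exact bg.fields.targetH_gh_right X _ _ g''
    · exact bg.fields.targetH_gh_mid X _ g' k
  · exact bg.fields.targetH_gh_left X g j k

/-- A combination of horizontal lifts is determined by its matter components, because its ghost
components are minus their contraction with the connection. -/
theorem horizontal_eq (χ : Spin → ℂ) {V : Idx → Target U N}
    (hV : ∀ M, bg.fields.brstVec X χ (mat M) = V M) :
    bg.horizontal V = bg.fields.brstVec X χ := by
  funext i
  rcases i with M | α | α
  · exact (hV M).symm
  · rw [Fields.brstVec_gh]
    simp only [conn_inl, hV]
    rfl
  · rw [Fields.brstVec_gh]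
    simp only [conn_inr, hV]
    rfl

theorem brstForm_fields (χ : Spin → ℂ) :
    contract2 0 (bg.fields.brstVec X χ) bg.Btarget = bg.fields.brstForm X χ := by
  funext j
  rw [Fields.brstForm_eq, Bmat_fields]
  rfl

theorem brst_eq : bg.brst = bg.brstSection leftOrientation.ind := by
  have h : bg.horizontal (fun M => ∑ α, lam α * up (bg.E (spi α) M))
      = bg.fields.brstVec X leftOrientation.ind :=
    bg.horizontal_eq _ fun M => bg.fields.brstVec_left X M
  rw [brst, h, brstForm_fields, brstSection]

theorem brsth_eq : bg.brsth = bg.brstSection leftOrientation.swap.ind := by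
  have h : bg.horizontal (fun M => ∑ α, lamh α * up (bg.E (hat α) M))
      = bg.fields.brstVec X leftOrientation.swap.ind :=
    bg.horizontal_eq _ fun M => bg.fields.brstVec_right X M
  rw [brsth, h, brstForm_fields, brstSection]

theorem genMetric_eq : bg.genMetric = ⟨bg.fields.fullDD X, bg.fields.fullDU X,
    fun i j => sg (cpar i + cpar i * cpar j) • bg.fields.fullDU X j i, bg.fields.metricUU X⟩ := by
  rw [← uu_eq, ← du_eq, ← dd_eq]
  rfl

end Background
end

section

variable {U : TopologicalSpace.Opens Body} {N : ℕ}

theorem leftOrientation_glue (x y : Fin 16 → ℂ) : leftOrientation.glue x y = Sum.elim x y := rfl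

theorem leftOrientation_swap_glue (x y : Fin 16 → ℂ) :
    leftOrientation.swap.glue y x = Sum.elim x y := leftOrientation.swap_glue x y

namespace Background

variable (bg : Background U N) (γ γh : GammaMatrices)

local notation "X" => ghostExtension U N

theorem isConserved_iff (o : Orientation) :
    IsConserved γ γh bg.genMetric (bg.brstSection o.ind) ↔
      ∀ x y, γ.IsPure x → γh.IsPure y → bg.fields.FlatConserved X o.ind (Sum.elim x y) := by
  have hχ := bg.fields.ind_smul_Om o
  rw [genMetric_eq]
  constructor
  · intro h x y hx hy
    exact (bg.fields.conserved_iff X o.ind (Sum.elim x y) hχ).1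
      ⟨fun i j => h.1 i j x y hx hy, fun i j => h.2.1 i j x y hx hy,
        fun i j => h.2.2 i j x y hx hy⟩
  · intro h
    have h' := fun x y hx hy =>
      (bg.fields.conserved_iff X o.ind (Sum.elim x y) hχ).2 (h x y hx hy)
    exact ⟨fun i j x y hx hy => (h' x y hx hy).1 i j, fun i j x y hx hy => (h' x y hx hy).2.1 i j,
      fun i j x y hx hy => (h' x y hx hy).2.2 i j⟩

theorem bracketAndFluxVanish_iff (χ χ' : Spin → ℂ) :
    BracketAndFluxVanish γ γh bg (bg.brstSection χ).V (bg.brstSection χ').V ↔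
      (∀ x y, γ.IsPure x → γh.IsPure y → ∀ i,
        (X).ev (Sum.elim x y) (bg.fields.lieVec X χ χ' i) = 0) ∧
      ∀ x y, γ.IsPure x → γh.IsPure y → ∀ k,
        (X).ev (Sum.elim x y) (bg.fields.fluxVec X χ χ' k) = 0 := by
  have h1 : ∀ i, lieBracket 1 1 (bg.brstSection χ).V (bg.brstSection χ').V i
      = bg.fields.lieVec X χ χ' i := bg.fields.lieBracket_eq X χ χ'
  have h2 : ∀ k, contract2 1 (bg.brstSection χ).V
      (contract3 0 (bg.brstSection χ').V bg.Htarget) k = -bg.fields.fluxVec X χ χ' k := by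
    rw [← targetH_fields]
    exact bg.fields.contract_contract_eq X χ χ'
  have h3 : ∀ l (f : Target U N), (X).ev l (-f) = 0 ↔ (X).ev l f = 0 := fun l f => by
    rw [map_neg, neg_eq_zero]
  simp only [BracketAndFluxVanish, h1, h2]
  constructor
  · exact fun h => ⟨fun x y hx hy i => h.1 i x y hx hy,
      fun x y hx hy k => (h3 _ _).1 (h.2 k x y hx hy)⟩
  · exact fun h => ⟨fun i x y hx hy => h.1 x y hx hy i,
      fun k x y hx hy => (h3 (Sum.elim x y) _).2 (h.2 x y hx hy k)⟩

theorem currentsCommute_iff (χ χ' : Spin → ℂ) :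
    CurrentsCommute γ γh (bg.brstSection χ) (bg.brstSection χ') ↔
      BracketAndFluxVanish γ γh bg (bg.brstSection χ).V (bg.brstSection χ').V := by
  have h1 : ∀ i, (dorfman 1 1 (bg.brstSection χ) (bg.brstSection χ')).V i
      = bg.fields.lieVec X χ χ' i := bg.fields.lieBracket_eq X χ χ'
  have h2 : ∀ i, (dorfman 1 1 (bg.brstSection χ) (bg.brstSection χ')).F i
      = ∑ k, bg.fields.lieVec X χ χ' k * bg.fields.Bmat X k i + bg.fields.fluxVec X χ χ' i :=
    bg.fields.dorfman_form_eq X χ χ'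
  have h3 : pairing 1 1 (bg.brstSection χ) (bg.brstSection χ') = 0 :=
    bg.fields.pairing_eq X χ χ'
  have h4 : ∀ l, ((∀ i, (X).ev l (bg.fields.lieVec X χ χ' i) = 0) ∧
      ∀ i, (X).ev l (∑ k, bg.fields.lieVec X χ χ' k * bg.fields.Bmat X k i
        + bg.fields.fluxVec X χ χ' i) = 0) ↔
      (∀ i, (X).ev l (bg.fields.lieVec X χ χ' i) = 0) ∧
        ∀ i, (X).ev l (-bg.fields.fluxVec X χ χ' i) = 0 := bg.fields.commute_iff X χ χ'
  have h5 : ∀ l (f : Target U N), (X).ev l (-f) = 0 ↔ (X).ev l f = 0 := fun l f => by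
    rw [map_neg, neg_eq_zero]
  rw [bracketAndFluxVanish_iff]
  simp only [CurrentsCommute, h1, h2, h3]
  constructor
  · rintro ⟨hV, hF, -⟩
    have h := fun x y hx hy => (h4 (Sum.elim x y)).1
      ⟨fun i => hV i x y hx hy, fun i => hF i x y hx hy⟩
    exact ⟨fun x y hx hy => (h x y hx hy).1, fun x y hx hy i => (h5 _ _).1 ((h x y hx hy).2 i)⟩
  · rintro ⟨hV, hF⟩
    have h := fun x y hx hy => (h4 (Sum.elim x y)).2
      ⟨hV x y hx hy, fun i => (h5 _ _).2 (hF x y hx hy i)⟩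
    exact ⟨fun i x y hx hy => (h x y hx hy).1 i, fun i x y hx hy => (h x y hx hy).2 i,
      fun x y _ _ => map_zero _⟩

/-! ### Torsion, curvature and field strength -/

theorem tors_fields (A B C : Idx) : bg.fields.tors X A B C = bg.T A B C := rfl

theorem flatH_fields (A B C : Idx) : bg.fields.flatH X A B C = bg.Hf A B C := rfl

/-- As $\eta$ is diagonal, lowering a vector label is multiplication by a single entry. -/
theorem torsl_fields (A B : Idx) (c : Fin 10) : bg.fields.torsl X A B c = bg.Tl A B c :=
  (sum_eta_smul' c fun d => bg.T A B (vec d)).symm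

theorem curv_inl (A B : Idx) (α β : Fin 16) :
    bg.fields.curv X A B (Sum.inl α) (Sum.inl β) = bg.R A B α β := by
  have h : ∀ M M', bg.fields.curvAux X M M' (Sum.inl α) (Sum.inl β)
      = curvAux bg.Om M M' α β := fun M M' => by
    have h0 : ∀ ρ, bg.fields.Om M (spi α) (hat ρ) = 0 := fun ρ => rfl
    rw [Fields.curvAux, sum_spin]
    simp only [h0, zero_mul, Finset.sum_const_zero, add_zero]
    rfl
  simp only [Fields.curv, h]
  rfl

theorem curv_inr (A B : Idx) (α β : Fin 16) :
    bg.fields.curv X A B (Sum.inr α) (Sum.inr β) = bg.Rh A B α β := by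
  have h : ∀ M M', bg.fields.curvAux X M M' (Sum.inr α) (Sum.inr β)
      = curvAux bg.Omh M M' α β := fun M M' => by
    have h0 : ∀ ρ, bg.fields.Om M (hat α) (spi ρ) = 0 := fun ρ => rfl
    rw [Fields.curvAux, sum_spin]
    simp only [h0, zero_mul, Finset.sum_const_zero, zero_add]
    rfl
  simp only [Fields.curv, h]
  rfl

end Background
end

theorem leftOrientation_own (α : Fin 16) : leftOrientation.own α = Sum.inl α := rfl
theorem leftOrientation_opp (α : Fin 16) : leftOrientation.opp α = Sum.inr α := rfl
theorem leftOrientation_sgn : leftOrientation.sgn = 1 := rfl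

/-! ### Covariant derivatives split by the kind of spinor -/

section

variable {R T : Type*} [Ring R] [Algebra ℂ R] [SuperCommAlgebra R]
    [Ring T] [Algebra ℂ T] [SuperCommAlgebra T]

namespace Fields

variable (X : GhostExtension R T) (F : Fields R)

theorem sum_Om_inl (M : Idx) (β : Fin 16) (f : Spin → R) :
    ∑ ρ, F.Om M (Sum.inr ρ) (spi β) * f ρ = ∑ ρ, F.Om M (spi ρ) (spi β) * f (Sum.inl ρ) := by
  have h : ∀ α, F.Om M (hat α) (spi β) = 0 := fun α =>
    F.Om_chir M (Sum.inr α) (Sum.inl β) (chir_inl_ne_inr _ _).symm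
  simp only [sum_spin, h, zero_mul, Finset.sum_const_zero, add_zero]

theorem sum_Om_inr (M : Idx) (β : Fin 16) (f : Spin → R) :
    ∑ ρ, F.Om M (Sum.inr ρ) (hat β) * f ρ = ∑ ρ, F.Om M (hat ρ) (hat β) * f (Sum.inr ρ) := by
  have h : ∀ α, F.Om M (spi α) (hat β) = 0 := fun α =>
    F.Om_chir M (Sum.inl α) (Sum.inr β) (chir_inl_ne_inr _ _)
  simp only [sum_spin, h, zero_mul, Finset.sum_const_zero, zero_add]

theorem sum_Om_inl' (M : Idx) (α : Fin 16) (f : Spin → R) :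
    ∑ ρ, F.Om M (spi α) (Sum.inr ρ) * f ρ = ∑ ρ, F.Om M (spi α) (spi ρ) * f (Sum.inl ρ) := by
  have h : ∀ β, F.Om M (spi α) (hat β) = 0 := fun β =>
    F.Om_chir M (Sum.inl α) (Sum.inr β) (chir_inl_ne_inr _ _)
  simp only [sum_spin, h, zero_mul, Finset.sum_const_zero, add_zero]

theorem sum_Om_inr' (M : Idx) (α : Fin 16) (f : Spin → R) :
    ∑ ρ, F.Om M (hat α) (Sum.inr ρ) * f ρ = ∑ ρ, F.Om M (hat α) (hat ρ) * f (Sum.inr ρ) := by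
  have h : ∀ β, F.Om M (hat α) (spi β) = 0 := fun β =>
    F.Om_chir M (Sum.inr α) (Sum.inl β) (chir_inl_ne_inr _ _).symm
  simp only [sum_spin, h, zero_mul, Finset.sum_const_zero, zero_add]

theorem covP_inl_inr (A : Idx) (β β' : Fin 16) : F.covP X A (Sum.inl β) (Sum.inr β')
    = ∑ M, F.E A M * (X.mpd M (F.P (Sum.inl β) (Sum.inr β'))
      + (∑ ρ, F.Om M (spi ρ) (spi β) * F.P (Sum.inl ρ) (Sum.inr β'))
      + ∑ ρ, F.Om M (hat ρ) (hat β') * F.P (Sum.inl β) (Sum.inr ρ)) := by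
  simp only [covP, sum_Om_inl, sum_Om_inr]

theorem covP_swap (A : Idx) (r q : Spin) : F.covP X A r q = -F.covP X A q r := by
  simp only [covP, ← Finset.sum_neg_distrib]
  refine Finset.sum_congr rfl fun M _ => ?_
  rw [← mul_neg]
  refine congrArg _ ?_
  rw [F.P_antisymm r q]
  simp only [F.P_antisymm r, F.P_antisymm _ q, map_neg, mul_neg, Finset.sum_neg_distrib]
  abel

theorem covK_inl_inr_inl (A : Idx) (α β β' : Fin 16) :
    F.covK X A (Sum.inl α) (Sum.inr β') (Sum.inl β)
    = ∑ M, F.E A M * (X.mpd M (F.K (Sum.inl α) (Sum.inr β') (Sum.inl β))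
      + (∑ ρ, F.Om M (spi ρ) (spi β) * F.K (Sum.inl α) (Sum.inr β') (Sum.inl ρ))
      + (∑ ρ, F.Om M (hat ρ) (hat β') * F.K (Sum.inl α) (Sum.inr ρ) (Sum.inl β))
      - ∑ ρ, F.Om M (spi α) (spi ρ) * F.K (Sum.inl ρ) (Sum.inr β') (Sum.inl β)) := by
  simp only [covK, sum_Om_inl, sum_Om_inr, sum_Om_inl']
  refine Finset.sum_congr rfl fun M _ => congrArg _ ?_
  abel

theorem covK_inr_inl_inr (A : Idx) (α β β' : Fin 16) :
    F.covK X A (Sum.inr α) (Sum.inl β) (Sum.inr β')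
    = ∑ M, F.E A M * (X.mpd M (F.K (Sum.inr α) (Sum.inl β) (Sum.inr β'))
      + (∑ ρ, F.Om M (hat ρ) (hat β') * F.K (Sum.inr α) (Sum.inl β) (Sum.inr ρ))
      + (∑ ρ, F.Om M (spi ρ) (spi β) * F.K (Sum.inr α) (Sum.inl ρ) (Sum.inr β'))
      - ∑ ρ, F.Om M (hat α) (hat ρ) * F.K (Sum.inr ρ) (Sum.inl β) (Sum.inr β')) := by
  simp only [covK, sum_Om_inl, sum_Om_inr, sum_Om_inr']
  refine Finset.sum_congr rfl fun M _ => congrArg _ ?_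
  abel

theorem covS_symm (A : Idx) (t t' g g' : Spin) :
    F.covS X A t t' g g' = F.covS X A t t' g' g := by
  simp only [covS]
  refine Finset.sum_congr rfl fun M _ => congrArg _ ?_
  simp only [F.S_symm _ _ g', F.S_symm _ _ _ g]
  abel

theorem symS_swap (t t' g g' : Spin) : F.symS t t' g g' = F.symS t' t g' g := by
  rw [symS, symS, F.S_symm t t', F.S_symm t' t, add_comm]

theorem covSymS_swap (A : Idx) (t t' g g' : Spin) :
    F.covSymS X A t t' g g' = F.covSymS X A t' t g' g := by
  rw [covSymS, covSymS, F.covS_symm X A t t', F.covS_symm X A t' t, add_comm]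

theorem symS_inl_inr {S : Fin 16 → Fin 16 → Fin 16 → Fin 16 → R} (hS : F.S = joinS S)
    (α α' β β' : Fin 16) :
    F.symS (Sum.inl α) (Sum.inr α') (Sum.inl β) (Sum.inr β') = -S α α' β β' := by
  rw [symS, hS]
  exact add_zero _

theorem covSymS_inl_inr {S : Fin 16 → Fin 16 → Fin 16 → Fin 16 → R} (hS : F.S = joinS S)
    (A : Idx) (α α' β β' : Fin 16) :
    F.covSymS X A (Sum.inl α) (Sum.inr α') (Sum.inl β) (Sum.inr β')
    = -∑ M, F.E A M * (X.mpd M (S α α' β β')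
      + (∑ ρ, F.Om M (spi ρ) (spi β) * S α α' ρ β')
      + (∑ ρ, F.Om M (hat ρ) (hat β') * S α α' β ρ)
      - (∑ ρ, F.Om M (spi α) (spi ρ) * S ρ α' β β')
      - ∑ ρ, F.Om M (hat α') (hat ρ) * S α ρ β β') := by
  have h0 : ∀ (t g g' : Spin) (ρ : Fin 16), joinS S (Sum.inr ρ) t g g' = 0 := fun _ _ _ _ => rfl
  have h1 : ∀ α α' β β', joinS S (Sum.inl α) (Sum.inr α') (Sum.inl β) (Sum.inr β')
      = -S α α' β β' := fun _ _ _ _ => rfl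
  have h2 : ∀ (g g' : Spin) (α β : Fin 16), joinS S (Sum.inl α) (Sum.inl β) g g' = 0 :=
    fun _ _ _ _ => rfl
  simp only [covSymS, covS, hS, sum_Om_inl, sum_Om_inr, sum_Om_inl', sum_Om_inr', h0, h1,
    map_zero, mul_zero, Finset.sum_const_zero, add_zero, sub_zero, map_neg, mul_neg,
    ← Finset.sum_neg_distrib]
  refine Finset.sum_congr rfl fun M _ => ?_
  rw [← mul_neg]
  congr 1
  simp only [Finset.sum_neg_distrib]
  abel

end Fields
end

section

variable {M : Type*} [AddCommGroup M] [Module ℂ M] (x : Fin 16 → ℂ)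

theorem sum_mul_smul (f : Fin 16 → Fin 16 → M) :
    ∑ α, ∑ β, (x α * x β) • f α β = ∑ α, x α • ∑ β, x β • f α β := by
  simp only [mul_smul, ← Finset.smul_sum]

theorem sum_mul_mul_smul (f : Fin 16 → Fin 16 → Fin 16 → M) :
    ∑ α, ∑ β, ∑ ρ, (x α * x β * x ρ) • f α β ρ
      = ∑ α, x α • ∑ β, x β • ∑ ρ, x ρ • f α β ρ := by
  simp only [mul_smul, ← Finset.smul_sum]

end

section

variable {U : TopologicalSpace.Opens Body} {N : ℕ}

local notation "X" => ghostExtension U N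

namespace Background

variable (bg : Background U N) (γ γh : GammaMatrices)

/-! ### Nilpotency -/

theorem bracketAndFluxVanish_brst_brst_iff :
    BracketAndFluxVanish γ γh bg bg.brst.V bg.brst.V ↔ bg.SugraNil1 γ := by
  have h := bg.fields.nilpotent_iff X (o := leftOrientation) (pO := γ.IsPure)
    γh.spans_isPure γh.isPure_zero
  simp only [leftOrientation_glue] at h
  rw [bg.brst_eq, bracketAndFluxVanish_iff]
  refine h.trans ?_
  simp only [SugraNil1, sum_mul_smul, sum_mul_mul_smul, leftOrientation_own, leftOrientation_opp,
    tors_fields, curv_inl, curv_inr, flatH_fields]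

theorem bracketAndFluxVanish_brsth_brsth_iff :
    BracketAndFluxVanish γ γh bg bg.brsth.V bg.brsth.V ↔ bg.SugraNil2 γh := by
  have h := bg.fields.nilpotent_iff X (o := leftOrientation.swap) (pO := γh.IsPure)
    γ.spans_isPure γ.isPure_zero
  simp only [leftOrientation_swap_glue] at h
  rw [bg.brsth_eq, bracketAndFluxVanish_iff]
  -- In the swapped orientation the hatted ghost comes first, so the quantifiers over the two ghosts
  -- have to be exchanged.
  refine Iff.trans (and_congr ?_ ?_) (h.trans ?_)
  · exact ⟨fun H y x hy hx => H x y hx hy, fun H x y hx hy => H y x hy hx⟩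
  · exact ⟨fun H y x hy hx => H x y hx hy, fun H x y hx hy => H y x hy hx⟩
  simp only [SugraNil2, sum_mul_smul, sum_mul_mul_smul, Orientation.swap_own,
    Orientation.swap_opp, leftOrientation_own, leftOrientation_opp,
    tors_fields, curv_inl, curv_inr, flatH_fields]
  -- The two curvature conditions appear in opposite order, since own and opposite kinds have traded
  -- places.
  exact ⟨fun H x hx => ⟨(H x hx).1, (H x hx).2.2.1, (H x hx).2.1, (H x hx).2.2.2⟩,
    fun H x hx => ⟨(H x hx).1, (H x hx).2.2.1, (H x hx).2.1, (H x hx).2.2.2⟩⟩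

theorem bracketAndFluxVanish_brst_brsth_iff :
    BracketAndFluxVanish γ γh bg bg.brst.V bg.brsth.V ↔ bg.SugraNil3 γ γh := by
  have h := bg.fields.anticommute_iff X (o := leftOrientation) γ.spans_isPure γh.spans_isPure
  simp only [leftOrientation_glue] at h
  rw [bg.brst_eq, bg.brsth_eq, bracketAndFluxVanish_iff]
  refine h.trans ?_
  simp only [SugraNil3, sum_mul_smul, leftOrientation_own, leftOrientation_opp,
    tors_fields, curv_inl, curv_inr, flatH_fields]

/-! ### Covariant derivatives and background fields -/

theorem covP_inl_inr (A : Idx) (β β' : Fin 16) :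
    bg.fields.covP X A (Sum.inl β) (Sum.inr β') = bg.covP A β β' :=
  bg.fields.covP_inl_inr X A β β'

theorem covP_inr_inl (A : Idx) (β β' : Fin 16) :
    bg.fields.covP X A (Sum.inr β') (Sum.inl β) = -bg.covP A β β' :=
  (bg.fields.covP_swap X A _ _).trans (congrArg _ (bg.covP_inl_inr A β β'))

theorem covK_inl (A : Idx) (α β β' : Fin 16) :
    bg.fields.covK X A (Sum.inl α) (Sum.inr β') (Sum.inl β) = bg.covC A α β β' :=
  bg.fields.covK_inl_inr_inl X A α β β'

theorem covK_inr (A : Idx) (α β β' : Fin 16) :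
    bg.fields.covK X A (Sum.inr α) (Sum.inl β) (Sum.inr β') = bg.covCh A α β' β :=
  bg.fields.covK_inr_inl_inr X A α β β'

theorem symS_inl (α α' β β' : Fin 16) :
    bg.fields.symS (Sum.inl α) (Sum.inr α') (Sum.inl β) (Sum.inr β') = -bg.S α α' β β' :=
  bg.fields.symS_inl_inr rfl α α' β β'

theorem symS_inr (α α' β β' : Fin 16) :
    bg.fields.symS (Sum.inr α') (Sum.inl α) (Sum.inr β') (Sum.inl β) = -bg.S α α' β β' :=
  (bg.fields.symS_swap _ _ _ _).trans (bg.symS_inl α α' β β')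

theorem covSymS_inl (A : Idx) (α α' β β' : Fin 16) :
    bg.fields.covSymS X A (Sum.inl α) (Sum.inr α') (Sum.inl β) (Sum.inr β')
      = -bg.covS A α α' β β' :=
  bg.fields.covSymS_inl_inr X rfl A α α' β β'

theorem covSymS_inr (A : Idx) (α α' β β' : Fin 16) :
    bg.fields.covSymS X A (Sum.inr α') (Sum.inl α) (Sum.inr β') (Sum.inl β)
      = -bg.covS A α α' β β' :=
  (bg.fields.covSymS_swap X A _ _ _ _).trans (bg.covSymS_inl A α α' β β')

theorem P_inl_inr (α β : Fin 16) : bg.fields.P (Sum.inl α) (Sum.inr β) = bg.P α β := rfl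

theorem P_inr_inl (α β : Fin 16) : bg.fields.P (Sum.inr β) (Sum.inl α) = -bg.P α β := rfl

theorem K_inl (α ρ δ : Fin 16) :
    bg.fields.K (Sum.inl α) (Sum.inr ρ) (Sum.inl δ) = bg.C α δ ρ := rfl

theorem K_inr (α ρ δ : Fin 16) :
    bg.fields.K (Sum.inr α) (Sum.inl ρ) (Sum.inr δ) = bg.Ch α δ ρ := rfl

end Background
end

/-! ### Translation between oriented constraints and the supergravity equations -/

section

variable {M : Type*} [AddCommGroup M]

theorem neg_add_neg_sub_eq_zero_iff (a b c : M) : -a + -b + -c = 0 ↔ a + b + c = 0 := by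
  rw [← neg_add, ← neg_add, neg_eq_zero]

/-- The oriented data store $-S$, so the last constraint on $S$ arises with the opposite overall
sign. -/
theorem sum_smul_neg_eq_zero_iff [Module ℂ M] (x : Fin 16 → ℂ) (f g h : Fin 16 → Fin 16 → M) :
    ∑ α, x α • ∑ β, x β • (-f α β + g α β + h α β) = 0 ↔
      ∑ α, x α • ∑ β, x β • (f α β + -g α β + -h α β) = 0 := by
  have e : ∀ α β, -f α β + g α β + h α β = -(f α β + -g α β + -h α β) := fun α β => by abel
  simp only [e, smul_neg, Finset.sum_neg_distrib, neg_eq_zero]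

end

section

variable {U : TopologicalSpace.Opens Body} {N : ℕ}

local notation "X" => ghostExtension U N

namespace Background

variable (bg : Background U N) (γ γh : GammaMatrices)

set_option maxHeartbeats 1000000 in
theorem sugraHol1_of_holConstraints (h : bg.fields.HolConstraints X leftOrientation γ.IsPure) :
    bg.SugraHol1 γ := by
  obtain ⟨h1, h2, h3, h4, h5, h6, h7, h8, h9, h10, h11, h12, h13, h14, h15, h16, h17⟩ := h
  simp only [leftOrientation_own, leftOrientation_opp, leftOrientation_sgn, tors_fields, torsl_fields,
    flatH_fields, curv_inl, curv_inr, covP_inl_inr, covK_inl, covK_inr, symS_inl, covSymS_inl,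
    P_inl_inr, K_inl, K_inr, one_smul, mul_one, sub_eq_add_neg] at h1 h2 h3 h4 h5 h6 h7 h8 h9 h10 h11 h12 h13 h14 h15 h16 h17
  constructor <;> try simp only [sub_eq_add_neg, sum_mul_smul]
  · exact h1
  · exact h2
  · exact h3
  · exact h4
  · exact h5
  · exact h6
  · exact h7
  · exact h8
  · exact h9
  · exact h10
  · exact h11
  · exact h12
  · exact h13
  · exact h14
  · exact h15
  · exact h16
  · exact fun l hl β δ δ' => (sum_smul_neg_eq_zero_iff l _ _ _).1 (h17 l hl β δ δ')

set_option maxHeartbeats 1000000 in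
theorem holConstraints_of_sugraHol1 (h : bg.SugraHol1 γ) :
    bg.fields.HolConstraints X leftOrientation γ.IsPure := by
  obtain ⟨h1, h2, h3, h4, h5, h6, h7, h8, h9, h10, h11, h12, h13, h14, h15, h16, h17⟩ := h
  simp only [sub_eq_add_neg, sum_mul_smul] at h1 h2 h3 h4 h5 h6 h7 h8 h9 h10 h11 h12 h13 h14 h15 h16 h17
  constructor <;> try simp only [leftOrientation_own, leftOrientation_opp, leftOrientation_sgn, tors_fields, torsl_fields,
    flatH_fields, curv_inl, curv_inr, covP_inl_inr, covK_inl, covK_inr, symS_inl, covSymS_inl,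
    P_inl_inr, K_inl, K_inr, one_smul, mul_one, sub_eq_add_neg]
  · exact h1
  · exact h2
  · exact h3
  · exact h4
  · exact h5
  · exact h6
  · exact h7
  · exact h8
  · exact h9
  · exact h10
  · exact h11
  · exact h12
  · exact h13
  · exact h14
  · exact h15
  · exact h16
  · exact fun l hl β δ δ' => (sum_smul_neg_eq_zero_iff l _ _ _).2 (h17 l hl β δ δ')

set_option maxHeartbeats 1000000 in
theorem sugraHol2_of_holConstraints (h : bg.fields.HolConstraints X leftOrientation.swap γh.IsPure) :
    bg.SugraHol2 γh := by
  obtain ⟨h1, h2, h3, h4, h5, h6, h7, h8, h9, h10, h11, h12, h13, h14, h15, h16, h17⟩ := h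
  simp only [Orientation.swap_own, Orientation.swap_opp, Orientation.swap_sgn, leftOrientation_own,
    leftOrientation_opp, leftOrientation_sgn, tors_fields, torsl_fields, flatH_fields, curv_inl,
    curv_inr, covP_inr_inl, covK_inl, covK_inr, symS_inr, covSymS_inr, P_inr_inl, K_inl, K_inr,
    neg_smul, one_smul, mul_one, mul_neg, smul_neg, neg_neg, Finset.sum_neg_distrib,
    sub_eq_add_neg] at h1 h2 h3 h4 h5 h6 h7 h8 h9 h10 h11 h12 h13 h14 h15 h16 h17
  constructor <;> try simp only [sub_eq_add_neg, sum_mul_smul]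
  · exact h1
  · exact h2
  · exact h3
  · exact h4
  · exact h5
  · exact h6
  · exact h7
  · exact h8
  · exact h9
  -- In the swapped orientation `P` and its covariant derivative are read in the reverse order and
  -- change sign, and the coefficient enters with a minus sign as before. All three terms are thus
  -- reversed.
  · exact fun α β β' => (neg_add_neg_sub_eq_zero_iff _ _ _).1 (h10 α β' β)
  · exact h11
  · exact h12
  · exact fun α α' β β' => h13 α' α β' β
  · exact h14
  · exact h15
  · exact h16
  · exact fun l hl β δ δ' => (sum_smul_neg_eq_zero_iff l _ _ _).1 (h17 l hl β δ' δ)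

set_option maxHeartbeats 1000000 in
theorem holConstraints_of_sugraHol2 (h : bg.SugraHol2 γh) :
    bg.fields.HolConstraints X leftOrientation.swap γh.IsPure := by
  obtain ⟨h1, h2, h3, h4, h5, h6, h7, h8, h9, h10, h11, h12, h13, h14, h15, h16, h17⟩ := h
  simp only [sub_eq_add_neg, sum_mul_smul] at h1 h2 h3 h4 h5 h6 h7 h8 h9 h10 h11 h12 h13 h14 h15 h16 h17
  constructor <;> try simp only [Orientation.swap_own, Orientation.swap_opp, Orientation.swap_sgn, leftOrientation_own,
    leftOrientation_opp, leftOrientation_sgn, tors_fields, torsl_fields, flatH_fields, curv_inl,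
    curv_inr, covP_inr_inl, covK_inl, covK_inr, symS_inr, covSymS_inr, P_inr_inl, K_inl, K_inr,
    neg_smul, one_smul, mul_one, mul_neg, smul_neg, neg_neg, Finset.sum_neg_distrib,
    sub_eq_add_neg]
  · exact h1
  · exact h2
  · exact h3
  · exact h4
  · exact h5
  · exact h6
  · exact h7
  · exact h8
  · exact h9
  · exact fun α β β' => (neg_add_neg_sub_eq_zero_iff _ _ _).2 (h10 α β' β)
  · exact h11
  · exact h12
  · exact fun α α' β β' => h13 α' α β' β
  · exact h14
  · exact h15
  · exact h16
  · exact fun l hl β δ δ' => (sum_smul_neg_eq_zero_iff l _ _ _).2 (h17 l hl β δ' δ)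

end Background
end

section

variable {U : TopologicalSpace.Opens Body} {N : ℕ}

namespace Background

variable (bg : Background U N)

/-! ### Relations between the two orientations -/

theorem T_swap_eq_zero {s t : Spin} {C : Idx} (h : bg.T (Sum.inr s) (Sum.inr t) C = 0) :
    bg.T (Sum.inr t) (Sum.inr s) C = 0 := by
  rw [← bg.tors_fields] at h ⊢
  rw [bg.fields.tors_swap (ghostExtension U N), h, smul_zero, neg_zero]

theorem Hf_swap_left_eq_zero {s t : Spin} {C : Idx} (h : bg.Hf (Sum.inr s) (Sum.inr t) C = 0) :
    bg.Hf (Sum.inr t) (Sum.inr s) C = 0 := by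
  rw [← bg.flatH_fields] at h ⊢
  rw [bg.fields.flatH_swap_left (ghostExtension U N), h, smul_zero, neg_zero]

variable (γ γh : GammaMatrices)

/-! ### Conservation and the constraints -/

theorem isConserved_brst_iff : IsConserved γ γh bg.genMetric bg.brst ↔
    ∀ x y, γ.IsPure x → γh.IsPure y →
      bg.fields.FlatConserved (ghostExtension U N) leftOrientation.ind (leftOrientation.glue x y) := by
  rw [bg.brst_eq, bg.isConserved_iff γ γh]
  simp only [leftOrientation_glue]

theorem isConserved_brsth_iff : IsConserved γ γh bg.genMetric bg.brsth ↔
    ∀ y x, γh.IsPure y → γ.IsPure x →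
      bg.fields.FlatConserved (ghostExtension U N) leftOrientation.swap.ind (leftOrientation.swap.glue y x) := by
  rw [bg.brsth_eq, bg.isConserved_iff γ γh]
  simp only [leftOrientation_swap_glue]
  exact ⟨fun h y x hy hx => h x y hx hy, fun h x y hx hy => h y x hy hx⟩

/-- The two hypotheses are the mixed components that this current's equations contain but do not
force to vanish. Granting them, each flat equation isolates one constraint. -/
theorem isConserved_brst_iff_sugraHol1
    (hH : ∀ α β ρ, bg.Hf (spi α) (hat β) (hat ρ) = 0)
    (hT : ∀ α β ρ, bg.T (spi α) (hat β) (hat ρ) = 0) :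
    IsConserved γ γh bg.genMetric bg.brst ↔ bg.SugraHol1 γ := by
  rw [isConserved_brst_iff]
  constructor
  · intro h
    exact bg.sugraHol1_of_holConstraints γ
      (Fields.holConstraints_of_flatConserved (X := ghostExtension U N) (F := bg.fields)
        (o := leftOrientation) γ.spans_isPure γh.spans_isPure γh.isPure_zero hH hT h)
  · intro h x y hx _
    exact Fields.flatConserved_of_holConstraints (X := ghostExtension U N) (F := bg.fields)
        (o := leftOrientation) hH hT (bg.holConstraints_of_sugraHol1 γ h) x y hx

theorem isConserved_brsth_iff_sugraHol2
    (hH : ∀ α β ρ, bg.Hf (hat α) (spi β) (spi ρ) = 0)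
    (hT : ∀ α β ρ, bg.T (hat α) (spi β) (spi ρ) = 0) :
    IsConserved γ γh bg.genMetric bg.brsth ↔ bg.SugraHol2 γh := by
  rw [isConserved_brsth_iff]
  constructor
  · intro h
    exact bg.sugraHol2_of_holConstraints γh
      (Fields.holConstraints_of_flatConserved (X := ghostExtension U N) (F := bg.fields)
        (o := leftOrientation.swap) γh.spans_isPure γ.spans_isPure γ.isPure_zero hH hT h)
  · intro h y x hy _
    exact Fields.flatConserved_of_holConstraints (X := ghostExtension U N) (F := bg.fields)
        (o := leftOrientation.swap) hH hT (bg.holConstraints_of_sugraHol2 γh h) y x hy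

theorem Hf_spi_hat_hat (h : ∀ α β ρ, bg.Hf (hat α) (spi β) (hat ρ) = 0) (α β ρ : Fin 16) :
    bg.Hf (spi α) (hat β) (hat ρ) = 0 :=
  bg.Hf_swap_left_eq_zero (h β α ρ)

theorem Hf_hat_spi_spi (h : ∀ α β ρ, bg.Hf (spi α) (hat β) (spi ρ) = 0) (α β ρ : Fin 16) :
    bg.Hf (hat α) (spi β) (spi ρ) = 0 :=
  bg.Hf_swap_left_eq_zero (h β α ρ)

/-- The missing mixed components come from the other current, and no circularity arises: each
current first yields its mixed flux unconditionally. The flux of one unlocks the mixed torsion of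
the other, and both together unlock the full equivalences. -/
theorem isConserved_both_iff :
    (IsConserved γ γh bg.genMetric bg.brst ∧ IsConserved γ γh bg.genMetric bg.brsth) ↔
      (bg.SugraHol1 γ ∧ bg.SugraHol2 γh) := by
  constructor
  · rintro ⟨h1, h2⟩
    have c1 := (bg.isConserved_brst_iff γ γh).1 h1
    have c2 := (bg.isConserved_brsth_iff γ γh).1 h2
    -- The mixed fluxes need no input from the other current. Exchanging their first two labels
    -- supplies the flux hypotheses used for `T1` and `T2`.
    have H1 : ∀ α β ρ, bg.Hf (spi α) (hat β) (spi ρ) = 0 :=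
      Fields.H_po_of_flatConserved (X := ghostExtension U N) (F := bg.fields)
        (o := leftOrientation) γ.spans_isPure γh.isPure_zero c1
    have H2 : ∀ α β ρ, bg.Hf (hat α) (spi β) (hat ρ) = 0 :=
      Fields.H_po_of_flatConserved (X := ghostExtension U N) (F := bg.fields)
        (o := leftOrientation.swap) γh.spans_isPure γ.isPure_zero c2
    have T1 : ∀ α β ρ, bg.T (spi α) (hat β) (spi ρ) = 0 :=
      Fields.T_po_of_flatConserved (X := ghostExtension U N) (F := bg.fields)
        (o := leftOrientation) γ.spans_isPure γh.isPure_zero c1 (bg.Hf_spi_hat_hat H2)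
    have T2 : ∀ α β ρ, bg.T (hat α) (spi β) (hat ρ) = 0 :=
      Fields.T_po_of_flatConserved (X := ghostExtension U N) (F := bg.fields)
        (o := leftOrientation.swap) γh.spans_isPure γ.isPure_zero c2 (bg.Hf_hat_spi_spi H1)
    exact ⟨(bg.isConserved_brst_iff_sugraHol1 γ γh (bg.Hf_spi_hat_hat H2)
        fun α β ρ => bg.T_swap_eq_zero (T2 β α ρ)).1 h1,
      (bg.isConserved_brsth_iff_sugraHol2 γ γh (bg.Hf_hat_spi_spi H1)
        fun α β ρ => bg.T_swap_eq_zero (T1 β α ρ)).1 h2⟩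
  · rintro ⟨h1, h2⟩
    exact ⟨(bg.isConserved_brst_iff_sugraHol1 γ γh (bg.Hf_spi_hat_hat h2.H_sh)
        fun α β ρ => bg.T_swap_eq_zero (h2.T_sh β α ρ)).2 h1,
      (bg.isConserved_brsth_iff_sugraHol2 γ γh (bg.Hf_hat_spi_spi h1.H_hs)
        fun α β ρ => bg.T_swap_eq_zero (h1.T_hs β α ρ)).2 h2⟩

theorem isConserved_iff_of_sugraNil3 (h : bg.SugraNil3 γ γh) :
    (IsConserved γ γh bg.genMetric bg.brst ↔ bg.SugraHol1 γ) ∧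
      (IsConserved γ γh bg.genMetric bg.brsth ↔ bg.SugraHol2 γh) :=
  ⟨bg.isConserved_brst_iff_sugraHol1 γ γh (fun α β _ => h.2.2.2 α β _) fun α β _ => h.1 α β _,
    bg.isConserved_brsth_iff_sugraHol2 γ γh
      (fun α β _ => bg.Hf_swap_left_eq_zero (h.2.2.2 β α _))
      fun α β _ => bg.T_swap_eq_zero (h.1 β α _)⟩

theorem currentsCommute_brst_iff :
    (CurrentsCommute γ γh bg.brst bg.brst ↔ BracketAndFluxVanish γ γh bg bg.brst.V bg.brst.V) ∧
    (CurrentsCommute γ γh bg.brsth bg.brsth ↔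
      BracketAndFluxVanish γ γh bg bg.brsth.V bg.brsth.V) ∧
    (CurrentsCommute γ γh bg.brst bg.brsth ↔
      BracketAndFluxVanish γ γh bg bg.brst.V bg.brsth.V) := by
  rw [bg.brst_eq, bg.brsth_eq]
  exact ⟨bg.currentsCommute_iff γ γh _ _, bg.currentsCommute_iff γ γh _ _,
    bg.currentsCommute_iff γ γh _ _⟩

end Background
end

end PureSpinor

end

theorem mainTheorem7 (U : TopologicalSpace.Opens PureSpinor.Body) (N : ℕ)
    (γ γh : PureSpinor.GammaMatrices) (bg : PureSpinor.Background U N) :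
    -- nilpotency in terms of Lie brackets and the three-form
    (PureSpinor.CurrentsCommute γ γh bg.brst bg.brst ↔
      PureSpinor.BracketAndFluxVanish γ γh bg bg.brst.V bg.brst.V) ∧
    (PureSpinor.CurrentsCommute γ γh bg.brsth bg.brsth ↔
      PureSpinor.BracketAndFluxVanish γ γh bg bg.brsth.V bg.brsth.V) ∧
    (PureSpinor.CurrentsCommute γ γh bg.brst bg.brsth ↔
      PureSpinor.BracketAndFluxVanish γ γh bg bg.brst.V bg.brsth.V) ∧
    -- nilpotency in terms of torsion, curvature and field strength
    (PureSpinor.BracketAndFluxVanish γ γh bg bg.brst.V bg.brst.V ↔ bg.SugraNil1 γ) ∧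
    (PureSpinor.BracketAndFluxVanish γ γh bg bg.brsth.V bg.brsth.V ↔ bg.SugraNil2 γh) ∧
    (PureSpinor.BracketAndFluxVanish γ γh bg bg.brst.V bg.brsth.V ↔ bg.SugraNil3 γ γh) ∧
    -- holomorphicity and antiholomorphicity
    ((PureSpinor.IsConserved γ γh bg.genMetric bg.brst ∧
        PureSpinor.IsConserved γ γh bg.genMetric bg.brsth) ↔
      (bg.SugraHol1 γ ∧ bg.SugraHol2 γh)) ∧
    (bg.SugraNil3 γ γh →
      ((PureSpinor.IsConserved γ γh bg.genMetric bg.brst ↔ bg.SugraHol1 γ) ∧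
        (PureSpinor.IsConserved γ γh bg.genMetric bg.brsth ↔ bg.SugraHol2 γh))) :=
  ⟨(bg.currentsCommute_brst_iff γ γh).1, (bg.currentsCommute_brst_iff γ γh).2.1,
    (bg.currentsCommute_brst_iff γ γh).2.2, bg.bracketAndFluxVanish_brst_brst_iff γ γh,
    bg.bracketAndFluxVanish_brsth_brsth_iff γ γh, bg.bracketAndFluxVanish_brst_brsth_iff γ γh,
    bg.isConserved_both_iff γ γh, bg.isConserved_iff_of_sugraNil3 γ γh⟩
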